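/- Let $\eta=\mathrm{diag}(-1,1,1,1)$; indices $a,b,\dots,i,j,\dots$ run over $0,\dots,3$, and repeated indices are summed. A *Finsler spacetime* is a four-dimensional, connected, Hausdorff, paracompact, smooth manifold $M$ with a continuous function $L:TM\to\mathbb R$, smooth on $TM\setminus\{0\}$, such that: $L(x,\lambda y)=\lambda^nL(x,y)$ for $\lambda>0$, with a real number $n\ge 2$; $|L(x,-y)|=|L(x,y)|$; the Hessian $g^L_{ab}=\tfrac12\bar\partial_a\bar\partial_bL$ ($\bar\partial_a=\partial/\partial y^a$) is non-degenerate at all non-zero vectors outside a set $X\subset TM$ of measure zero which does not contain the set of the non-zero vectors with $L=0$; and for each $x\in M$ the set $$\Omega_x=\{y\in T_xM : |L(x,y)|=1,\ g^L(x,y)\text{ has signature }(\epsilon,-\epsilon,-\epsilon,-\epsilon),\ \epsilon=L(x,y)/|L(x,y)|\}$$ has a non-empty connected component that is closed in $T_xM$. Put $F=|L|^{1/n}$ and $g^F_{ab}=\tfrac12\bar\partial_a\bar\partial_bF^2$. Let $(M,L,F)$ be a Finsler spacetime that is oriented and time-oriented; the latter means that for every $x$ a non-empty closed connected component $S_x$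 of $\Omega_x$ has been chosen, and that every point of $M$ has a neighbourhood with a continuous vector field whose value at $x$ lies in $S_x$. Let $O=\bigcup_xS_x\subset TM$ be the observer space. Let $P$ be the set of all frames $(x,f_0,\dots,f_3)$ of $M$ that are positively oriented, with $f_0\in S_x$ and $g^F_{ab}(x,f_0)f_i^af_j^b=-\eta_{ij}$; let $\pi:P\to O$, $(x,f)\mapsto(x,f_0)$; and let $K=\mathrm{SO}(3)$ act on $P$ from the right by rotations of $(f_1,f_2,f_3)$. Let $\Lambda\in\mathbb R$, and let $G$ be $\mathrm{SO}_0(4,1)$ if $\Lambda>0$, $\mathrm{ISO}_0(3,1)$ if $\Lambda=0$, $\mathrm{SO}_0(3,2)$ if $\Lambda<0$. Its Lie algebra $\mathfrak g=\mathfrak h\oplus\mathfrak z$, with $\mathfrak h=\mathfrak{so}(3,1)$ and $\mathfrak z\cong\mathbb R^4$, consists of the matrices $$h+z=\begin{pmatrix}h&z\\-\mathrm{sgn}(\Lambda)\,z^{T}\eta&0\end{pmatrix},\qquad h^T\eta+\eta h=0,\quad z\in\mathbb R^4,$$ and $K\subset G$ via $k\mapsto\mathrm{diag}(1,k,1)$.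 In the coordinates $(x^a,y^a)$ on $TM$ and $(x^a,f_i^a)$ on frames induced by a chart of $M$, put $$N^a{}_b=\tfrac14\bar\partial_b\big[g^{F\,ac}(y^d\partial_d\bar\partial_cF^2-\partial_cF^2)\big],\qquad \delta_a=\partial_a-N^b{}_a\bar\partial_b,$$ $$F^a{}_{bc}=\tfrac12g^{F\,ad}(\delta_bg^F_{cd}+\delta_cg^F_{bd}-\delta_dg^F_{bc}),\qquad C^a{}_{bc}=\tfrac12g^{F\,ad}(\bar\partial_bg^F_{cd}+\bar\partial_cg^F_{bd}-\bar\partial_dg^F_{bc})$$ (the Cartan linear connection), and, with these coefficients evaluated at $(x,f_0)$, $$e^i=f^{-1}{}^i_a\,dx^a,\qquad \omega^j{}_i=f^{-1}{}^j_a\,df_i^a+f^{-1}{}^j_af_i^b\big[F^a{}_{bc}dx^c+C^a{}_{bc}(N^c{}_ddx^d+df_0^c)\big].$$ Then: 1. $O$ is a 7-dimensional embedded submanifold of $TM$, $P$ is a 10-dimensional embedded submanifold of the frame bundle of $M$, and $\pi:P\to O$ is a smooth principal $K$-bundle. 2. The formula $A=\omega+e$ defines a smooth $\mathfrak g$-valued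 1-form on $P$ that does not depend on the chart, and $A$ is a Cartan connection modeled on $G/K$: each $A_p:T_pP\to\mathfrak g$ is a linear isomorphism; $(R_k)^*A=\mathrm{Ad}(k^{-1})\circ A$ for all $k\in K$; and $A$ restricts to the Maurer–Cartan form on the vertical vectors, that is, $A(\tfrac{d}{dt}|_0\,p\cdot k(t))=k'(0)$ for curves in $K$ with $k(0)=1$. 3. For $h\in\mathfrak h$ and $z\in\mathfrak z$ the vector field $A^{-1}(h+z)$ on $P$ is $$\big(h^i{}_jf_i^a-h^i{}_0f_i^bf_j^cC^a{}_{bc}\big)\frac{\partial}{\partial f_j^a}+z^if_i^a\Big(\frac{\partial}{\partial x^a}-f_j^bF^c{}_{ab}\frac{\partial}{\partial f_j^c}\Big).$$ -/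

import Mathlib

open Set Filter Topology Manifold Bundle
open scoped ContDiff Matrix

noncomputable section

namespace FinslerCartan

/-- The model space `ℝ⁴` of spacetime. -/
abbrev E4 : Type := EuclideanSpace ℝ (Fin 4)

/-- The standard basis vector `e_a` of `ℝ⁴`. -/
def stdVec (a : Fin 4) : E4 := EuclideanSpace.single a 1

/-- The Minkowski matrix `η = diag(-1, 1, 1, 1)`. -/
def eta : Matrix (Fin 4) (Fin 4) ℝ := Matrix.diagonal ![-1, 1, 1, 1]

/-! ### The model groups -/

/-- Matrices acting on `ℝ⁴ ⊕ ℝ`. -/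
abbrev ModelMat : Type := Matrix (Fin 4 ⊕ Fin 1) (Fin 4 ⊕ Fin 1) ℝ

/-- The special orthogonal group of the bilinear form with matrix `Q`. -/
def specialIsometryGroup (Q : ModelMat) : Subgroup (GL (Fin 4 ⊕ Fin 1) ℝ) where
  carrier := {g | (g : ModelMat)ᵀ * Q * (g : ModelMat) = Q ∧ (g : ModelMat).det = 1}
  one_mem' := by simp
  mul_mem' := by
    rintro a b ⟨ha, ha'⟩ ⟨hb, hb'⟩
    refine ⟨?_, by simp [ha', hb']⟩
    calc ((a * b : GL (Fin 4 ⊕ Fin 1) ℝ) : ModelMat)ᵀ * Q * ((a * b : GL _ ℝ) : ModelMat)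
        = (b : ModelMat)ᵀ * ((a : ModelMat)ᵀ * Q * (a : ModelMat)) * (b : ModelMat) := by
          simp [Matrix.transpose_mul, Matrix.mul_assoc]
      _ = Q := by rw [ha, hb]
  inv_mem' := by
    rintro a ⟨ha, ha'⟩
    have h1 : (a : ModelMat) * ((a⁻¹ : GL (Fin 4 ⊕ Fin 1) ℝ) : ModelMat) = 1 := by
      rw [← Units.val_mul, mul_inv_cancel, Units.val_one]
    have h2 : ((a⁻¹ : GL (Fin 4 ⊕ Fin 1) ℝ) : ModelMat)ᵀ * (a : ModelMat)ᵀ = 1 := by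
      rw [← Matrix.transpose_mul, h1, Matrix.transpose_one]
    refine ⟨?_, ?_⟩
    · calc ((a⁻¹ : GL (Fin 4 ⊕ Fin 1) ℝ) : ModelMat)ᵀ * Q * ((a⁻¹ : GL _ ℝ) : ModelMat)
          = ((a⁻¹ : GL (Fin 4 ⊕ Fin 1) ℝ) : ModelMat)ᵀ *
              ((a : ModelMat)ᵀ * Q * (a : ModelMat)) * ((a⁻¹ : GL _ ℝ) : ModelMat) := by rw [ha]
        _ = (((a⁻¹ : GL (Fin 4 ⊕ Fin 1) ℝ) : ModelMat)ᵀ * (a : ModelMat)ᵀ) * Q *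
              ((a : ModelMat) * ((a⁻¹ : GL _ ℝ) : ModelMat)) := by
            simp only [Matrix.mul_assoc]
        _ = Q := by rw [h1, h2, Matrix.one_mul, Matrix.mul_one]
    · have := congrArg Matrix.det h1
      rwa [Matrix.det_mul, ha', one_mul, Matrix.det_one] at this

/-- The Poincaré group `SO(3,1) ⋉ ℝ⁴`, as the group of the block matrices `(l z; 0 1)` with
`l` in `SO(3,1)`. -/
def poincareGroup : Subgroup (GL (Fin 4 ⊕ Fin 1) ℝ) where
  carrier := {g | ∃ (l : Matrix (Fin 4) (Fin 4) ℝ) (z : Matrix (Fin 4) (Fin 1) ℝ),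
    (g : ModelMat) = Matrix.fromBlocks l z 0 1 ∧ lᵀ * eta * l = eta ∧ l.det = 1}
  one_mem' := ⟨1, 0, by simp, by simp, by simp⟩
  mul_mem' := by
    rintro a b ⟨l, z, ha, hl, hl'⟩ ⟨m, w, hb, hm, hm'⟩
    refine ⟨l * m, l * w + z, ?_, ?_, by simp [hl', hm']⟩
    · rw [Units.val_mul, ha, hb, Matrix.fromBlocks_multiply]
      simp
    · calc (l * m)ᵀ * eta * (l * m) = mᵀ * (lᵀ * eta * l) * m := by
            simp only [Matrix.transpose_mul, Matrix.mul_assoc]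
        _ = eta := by rw [hl, hm]
  inv_mem' := by
    rintro a ⟨l, z, ha, hl, hl'⟩
    have hu : IsUnit l.det := by rw [hl']; exact isUnit_one
    have h1 : l * l⁻¹ = 1 := Matrix.mul_nonsing_inv l hu
    have h2 : (l⁻¹)ᵀ * lᵀ = 1 := by rw [← Matrix.transpose_mul, h1, Matrix.transpose_one]
    refine ⟨l⁻¹, -(l⁻¹ * z), ?_, ?_, ?_⟩
    · have h3 : (a : ModelMat) * Matrix.fromBlocks l⁻¹ (-(l⁻¹ * z)) 0 1 = 1 := by
        rw [ha, Matrix.fromBlocks_multiply]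
        simp [h1, ← Matrix.mul_assoc]
      exact Units.inv_eq_of_mul_eq_one_right h3
    · calc (l⁻¹)ᵀ * eta * l⁻¹ = (l⁻¹)ᵀ * (lᵀ * eta * l) * l⁻¹ := by rw [hl]
        _ = ((l⁻¹)ᵀ * lᵀ) * eta * (l * l⁻¹) := by simp only [Matrix.mul_assoc]
        _ = eta := by rw [h1, h2, Matrix.one_mul, Matrix.mul_one]
    · rw [Matrix.det_nonsing_inv, hl', Ring.inverse_one]

/-- The identity component of a matrix group, again as a matrix group. -/
def identityComponent (H : Subgroup (GL (Fin 4 ⊕ Fin 1) ℝ)) :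
    Subgroup (GL (Fin 4 ⊕ Fin 1) ℝ) :=
  (Subgroup.connectedComponentOfOne H).map H.subtype

/-- The group `G`: it is `SO₀(4,1)` for `Λ > 0`, `ISO₀(3,1)` for `Λ = 0` and `SO₀(3,2)`
for `Λ < 0`. -/
def modelGroup (Λ : ℝ) : Subgroup (GL (Fin 4 ⊕ Fin 1) ℝ) :=
  if 0 < Λ then identityComponent (specialIsometryGroup (Matrix.fromBlocks eta 0 0 1))
  else if Λ = 0 then identityComponent poincareGroup
  else identityComponent (specialIsometryGroup (Matrix.fromBlocks eta 0 0 (-1)))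

/-- The Lie algebra of a matrix group. -/
def lieAlgebraOf {n : Type*} [Fintype n] [DecidableEq n] (G : Subgroup (GL n ℝ)) :
    Set (Matrix n n ℝ) :=
  {X | ∀ t : ℝ, ∃ g ∈ G, (g : Matrix n n ℝ) = NormedSpace.exp (t • X)}

/-- The element `h + z` of `𝔤 = 𝔥 ⊕ 𝔷`, as a matrix. With `h = ½ hⁱⱼ 𝓗ᵢʲ` and `z = zⁱ 𝓩ᵢ` this
realizes `[𝓩ᵢ, 𝓩ⱼ] = sgn Λ ηᵢₖ 𝓗ⱼᵏ` together with the other structure relations. -/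
def algElem (Λ : ℝ) (h : Matrix (Fin 4) (Fin 4) ℝ) (z : Fin 4 → ℝ) : ModelMat :=
  Matrix.fromBlocks h (Matrix.replicateCol (Fin 1) z)
    (Matrix.replicateRow (Fin 1) (-(Real.sign Λ • (eta *ᵥ z)))) 0

/-- The rotation group `K = SO(3)`. -/
abbrev SO3 : Type := Matrix.specialOrthogonalGroup (Fin 3) ℝ

/-- The matrix `diag(1, k)` acting on `ℝ⁴` by the spatial transformation `k`. -/
def spatial (k : Matrix (Fin 3) (Fin 3) ℝ) : Matrix (Fin 4) (Fin 4) ℝ :=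
  Matrix.reindex finSumFinEquiv finSumFinEquiv
    (Matrix.fromBlocks (1 : Matrix (Fin 1) (Fin 1) ℝ) 0 0 k)

theorem spatial_one : spatial 1 = 1 := by
  simp [spatial]

theorem spatial_mul (k l : Matrix (Fin 3) (Fin 3) ℝ) :
    spatial (k * l) = spatial k * spatial l := by
  simp [spatial, Matrix.submatrix_mul_equiv, Matrix.fromBlocks_multiply]

/-- The inclusion `K → G` as matrices: `k ↦ diag(1, k, 1)`. -/
def inclK : SO3 →* ModelMat where
  toFun k := Matrix.fromBlocks (spatial (k : Matrix (Fin 3) (Fin 3) ℝ)) 0 0 1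
  map_one' := by simp [spatial_one]
  map_mul' k l := by simp [spatial_mul, Matrix.fromBlocks_multiply]

/-! ### Principal bundles and Cartan connections -/

section General

variable {EK HK EP HP EB HB : Type*}
  [NormedAddCommGroup EK] [NormedSpace ℝ EK] [TopologicalSpace HK]
  [NormedAddCommGroup EP] [NormedSpace ℝ EP] [TopologicalSpace HP]
  [NormedAddCommGroup EB] [NormedSpace ℝ EB] [TopologicalSpace HB]
  (IK : ModelWithCorners ℝ EK HK) (IP : ModelWithCorners ℝ EP HP) (IB : ModelWithCorners ℝ EB HB)
  {K P B : Type*} [Group K] [TopologicalSpace K] [ChartedSpace HK K]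
  [TopologicalSpace P] [ChartedSpace HP P] [TopologicalSpace B] [ChartedSpace HB B]

/-- `pr : P → B` with the right action `act` of the Lie group `K` is a smooth principal
`K`-bundle: the action is smooth and there are smooth equivariant local trivializations. -/
structure IsPrincipalBundle (pr : P → B) (act : P → K → P) : Prop where
  act_one : ∀ p, act p 1 = p
  act_mul : ∀ p k l, act (act p k) l = act p (k * l)
  contMDiff_act : ContMDiff (IP.prod IK) IP ∞ (fun q : P × K => act q.1 q.2)
  contMDiff_proj : ContMDiff IP IB ∞ pr
  proj_act : ∀ p k, pr (act p k) = pr p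
  exists_trivialization : ∀ b : B, ∃ e : Trivialization K pr, b ∈ e.baseSet ∧
    ContMDiffOn IP (IB.prod IK) ∞ e e.source ∧
    ContMDiffOn (IB.prod IK) IP ∞ e.toOpenPartialHomeomorph.symm e.target ∧
    ∀ p ∈ e.source, ∀ k, e (act p k) = ((e p).1, (e p).2 * k)

/-- `A` is a Cartan connection, modeled on `G/K`, on a manifold `P` with right `K`-action `act`.
Here `G` is a matrix group and `ι` realizes `K` as a closed subgroup of `G`. -/
structure IsCartanConnection {n : Type*} [Fintype n] [DecidableEq n]
    [IsManifold IP ∞ P] (G : Subgroup (GL n ℝ)) (ι : K →* Matrix n n ℝ) (act : P → K → P)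
    (A : ∀ p : P, TangentSpace IP p →L[ℝ] Matrix n n ℝ) : Prop where
  map_mem : ∀ k, ∃ g ∈ G, (g : Matrix n n ℝ) = ι k
  isClosedEmbedding : IsClosedEmbedding ι
  /-- `A` is a smooth form. -/
  contMDiff : ∀ i j, ContMDiff IP.tangent 𝓘(ℝ, ℝ) ∞
    (fun v : TangentBundle IP P => A v.proj v.2 i j)
  /-- `A p` is a linear isomorphism of the tangent space onto the Lie algebra of `G`. -/
  bijOn : ∀ p, BijOn (A p) univ (lieAlgebraOf G)
  /-- `(R_k)^* A = Ad(k⁻¹) ∘ A`. -/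
  equivariant : ∀ k p (v : TangentSpace IP p),
    A (act p k) (mfderiv IP IP (fun q => act q k) p v) = ι k⁻¹ * A p v * ι k
  /-- On vertical vectors, which are the velocities `d/dt (p · k(t))` of the curves in the fiber
  with `k(0) = 1`, `A` is the Maurer-Cartan form `k'(0)`. -/
  maurerCartan : ∀ p (X : TangentSpace IK (1 : K)) (i j : n),
    A (act p 1) (mfderiv IK IP (act p) 1 X) i j = mfderiv IK 𝓘(ℝ, ℝ) (fun k => ι k i j) 1 X

end General

/-! ### The Cartan linear connection in induced coordinates

In this part `Φ` is the coordinate expression of `F²`, a function of the induced coordinates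
`(x, y)` on the tangent bundle. -/

/-- `∂_a`. -/
def pdx (a : Fin 4) (h : E4 × E4 → ℝ) (q : E4 × E4) : ℝ := fderiv ℝ h q (stdVec a, 0)

/-- The fiber derivative `∂̄_a`. -/
def pdy (a : Fin 4) (h : E4 × E4 → ℝ) (q : E4 × E4) : ℝ := fderiv ℝ h q (0, stdVec a)

/-- The Finsler metric `g_ab = ½ ∂̄_a ∂̄_b F²`. -/
def metricCoef (Φ : E4 × E4 → ℝ) (q : E4 × E4) : Matrix (Fin 4) (Fin 4) ℝ :=
  Matrix.of fun a b => (1 / 2) * pdy a (pdy b Φ) q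

/-- The Cartan non-linear connection
`N^a_b = ¼ ∂̄_b [g^ac (y^d ∂_d ∂̄_c F² - ∂_c F²)]`. -/
def nonlinCoef (Φ : E4 × E4 → ℝ) (a b : Fin 4) (q : E4 × E4) : ℝ :=
  (1 / 4) * pdy b (fun r => ∑ c, (metricCoef Φ r)⁻¹ a c *
    ((∑ d, r.2 d * pdx d (pdy c Φ) r) - pdx c Φ r)) q

/-- The horizontal derivative `δ_a = ∂_a - N^b_a ∂̄_b`. -/
def horDeriv (Φ : E4 × E4 → ℝ) (a : Fin 4) (h : E4 × E4 → ℝ) (q : E4 × E4) : ℝ :=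
  pdx a h q - ∑ b, nonlinCoef Φ b a q * pdy b h q

/-- `F^a_bc = ½ g^ad (δ_b g_cd + δ_c g_bd - δ_d g_bc)`. -/
def horCoef (Φ : E4 × E4 → ℝ) (a b c : Fin 4) (q : E4 × E4) : ℝ :=
  (1 / 2) * ∑ d, (metricCoef Φ q)⁻¹ a d *
    (horDeriv Φ b (fun r => metricCoef Φ r c d) q + horDeriv Φ c (fun r => metricCoef Φ r b d) q
      - horDeriv Φ d (fun r => metricCoef Φ r b c) q)

/-- `C^a_bc = ½ g^ad (∂̄_b g_cd + ∂̄_c g_bd - ∂̄_d g_bc)`. -/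
def verCoef (Φ : E4 × E4 → ℝ) (a b c : Fin 4) (q : E4 × E4) : ℝ :=
  (1 / 2) * ∑ d, (metricCoef Φ q)⁻¹ a d *
    (pdy b (fun r => metricCoef Φ r c d) q + pdy c (fun r => metricCoef Φ r b d) q
      - pdy d (fun r => metricCoef Φ r b c) q)

/-- Coordinates `(x, f_0, …, f_3)` of a frame, and of a velocity of frames. -/
abbrev FrameCoord : Type := E4 × (Fin 4 → E4)

/-- The matrix `f_i^a` (row `a`, column `i`). -/
def frameMatrix (s : FrameCoord) : Matrix (Fin 4) (Fin 4) ℝ := Matrix.of fun a i => s.2 i a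

/-- The solder form `e^i = f⁻¹^i_a dx^a` at the frame `s`, evaluated on the velocity `v`. -/
def solderCoord (s v : FrameCoord) (i : Fin 4) : ℝ := ∑ a, (frameMatrix s)⁻¹ i a * v.1 a

/-- The component `(∇_v f_i)^a = df_i^a + f_i^b [F^a_bc dx^c + C^a_bc (N^c_d dx^d + df_0^c)]` of the
covariant derivative of the leg `f_i` with respect to the Cartan linear connection, at the frame
`s` and for the velocity `v`. -/
def covDerivLeg (Φ : E4 × E4 → ℝ) (s v : FrameCoord) (i a : Fin 4) : ℝ :=
  v.2 i a + ∑ b, s.2 i b * ∑ c, (horCoef Φ a b c (s.1, s.2 0) * v.1 c +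
    verCoef Φ a b c (s.1, s.2 0) *
      ((∑ d, nonlinCoef Φ c d (s.1, s.2 0) * v.1 d) + v.2 0 c))

/-- The form `ω^j_i` defined by `f_j ω^j_i(v) = ∇_v f_i`. -/
def connCoord (Φ : E4 × E4 → ℝ) (s v : FrameCoord) : Matrix (Fin 4) (Fin 4) ℝ :=
  Matrix.of fun j i => ∑ a, (frameMatrix s)⁻¹ j a * covDerivLeg Φ s v i a

/-- The form `A = ω + e` in coordinates. -/
def cartanCoord (Λ : ℝ) (Φ : E4 × E4 → ℝ) (s v : FrameCoord) : ModelMat :=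
  algElem Λ (connCoord Φ s v) (solderCoord s v)

/-- The fundamental vector field of `h + z` in coordinates:
`(h^i_j f_i^a - h^i_0 f_i^b f_j^c C^a_bc) ∂̄^j_a + z^i f_i^a (∂_a - f_j^b F^c_ab ∂̄^j_c)`. -/
def fundamentalCoord (Φ : E4 × E4 → ℝ) (s : FrameCoord) (h : Matrix (Fin 4) (Fin 4) ℝ)
    (z : Fin 4 → ℝ) : FrameCoord :=
  (∑ i, z i • s.2 i, fun j => WithLp.toLp 2 fun a =>
    (∑ i, h i j * s.2 i a)
      - (∑ i, ∑ b, ∑ c, h i 0 * s.2 i b * s.2 j c * verCoef Φ a b c (s.1, s.2 0))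
      - ∑ i, ∑ b, ∑ c, z i * s.2 i b * s.2 j c * horCoef Φ a b c (s.1, s.2 0))

/-! ### Finsler spacetimes -/

section Spacetime

variable {M : Type*} [TopologicalSpace M] [ChartedSpace E4 M] [IsManifold (𝓡 4) ∞ M]

/-- Half the Hessian, at `y`, of the restriction of `L` to the tangent space at `x`:
`g(v, w) = ½ ∂²L(x, y + s v + t w) / ∂s ∂t` at `s = t = 0`. -/
def fiberMetric (L : TangentBundle (𝓡 4) M → ℝ) (x : M) (y v w : TangentSpace (𝓡 4) x) : ℝ :=
  (1 / 2) * deriv (fun s : ℝ => deriv (fun t : ℝ => L ⟨x, y + s • v + t • w⟩) 0) 0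

/-- The point of the tangent bundle with coordinates `(x^a, y^a)` induced by the chart `φ`. -/
def inducedPoint (φ : OpenPartialHomeomorph M E4) (q : E4 × E4) : TangentBundle (𝓡 4) M :=
  ⟨φ.symm q.1, mfderiv 𝓘(ℝ, E4) (𝓡 4) φ.symm q.1 q.2⟩

/-- A subset of the tangent bundle has measure zero if it has Lebesgue measure zero in induced
coordinates. -/
def IsNull (X : Set (TangentBundle (𝓡 4) M)) : Prop :=
  ∀ φ ∈ IsManifold.maximalAtlas (𝓡 4) ∞ M,
    MeasureTheory.volume {q : E4 × E4 | q.1 ∈ φ.target ∧ inducedPoint φ q ∈ X} = 0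

/-- The set `Ω_x` of the unit vectors `y` for which the Hessian of `L` has signature
`(ε, -ε, -ε, -ε)` with `ε = L / |L|`. -/
def unitTimelike (L : TangentBundle (𝓡 4) M → ℝ) (x : M) : Set (TangentSpace (𝓡 4) x) :=
  {y | |L ⟨x, y⟩| = 1 ∧ ∃ b : Module.Basis (Fin 4) ℝ (TangentSpace (𝓡 4) x), ∀ i j,
    fiberMetric L x y (b i) (b j) = -(L ⟨x, y⟩ / |L ⟨x, y⟩|) * eta i j}

/-- `S` is a non-empty connected component of `Ω_x` that is closed in the tangent space. -/
def IsClosedComponent (L : TangentBundle (𝓡 4) M → ℝ) (x : M)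
    (S : Set (TangentSpace (𝓡 4) x)) : Prop :=
  IsClosed S ∧ ∃ y ∈ unitTimelike L x, S = connectedComponentIn (unitTimelike L x) y

variable (M) in
/-- A Finsler spacetime structure on a (four-dimensional, connected, Hausdorff, paracompact,
smooth) manifold `M`. -/
structure FinslerSpacetime where
  /-- The fundamental function. -/
  L : TangentBundle (𝓡 4) M → ℝ
  /-- The degree of homogeneity. -/
  n : ℝ
  two_le : 2 ≤ n
  continuous_L : Continuous L
  smooth_L : ContMDiffOn (𝓡 4).tangent 𝓘(ℝ, ℝ) ∞ L {v | v.2 ≠ 0}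
  homogeneous : ∀ (x : M) (y : TangentSpace (𝓡 4) x) (c : ℝ), 0 < c →
    L ⟨x, c • y⟩ = c ^ n * L ⟨x, y⟩
  reversible : ∀ (x : M) (y : TangentSpace (𝓡 4) x), |L ⟨x, -y⟩| = |L ⟨x, y⟩|
  nondegenerate : ∃ X : Set (TangentBundle (𝓡 4) M), IsNull X ∧
    ¬ {v : TangentBundle (𝓡 4) M | v.2 ≠ 0 ∧ L v = 0} ⊆ X ∧
    ∀ v : TangentBundle (𝓡 4) M, v.2 ≠ 0 → v ∉ X → ∀ w : TangentSpace (𝓡 4) v.proj,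
      (∀ u : TangentSpace (𝓡 4) v.proj, fiberMetric L v.proj v.2 w u = 0) → w = 0
  timelike : ∀ x : M, ∃ S, IsClosedComponent L x S

/-- The Finsler function `F = |L|^(1/n)`. -/
def FinslerSpacetime.F (X : FinslerSpacetime M) (v : TangentBundle (𝓡 4) M) : ℝ :=
  |X.L v| ^ (1 / X.n)

/-- The square `F²` of the Finsler function in the coordinates induced by the chart `φ`. -/
def FinslerSpacetime.sqCoord (X : FinslerSpacetime M) (φ : OpenPartialHomeomorph M E4)
    (q : E4 × E4) : ℝ :=
  X.F (inducedPoint φ q) ^ 2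

/-- A time orientation: a choice of a closed component `S_x` of each `Ω_x`, continuous in `x` in
the sense that near every point there is a continuous vector field with values in the `S_x`. -/
structure TimeOrientation (X : FinslerSpacetime M) where
  S : ∀ x : M, Set (TangentSpace (𝓡 4) x)
  isClosedComponent : ∀ x, IsClosedComponent X.L x (S x)
  exists_continuous : ∀ x₀ : M, ∃ U ∈ 𝓝 x₀, ∃ Y : ∀ x : M, TangentSpace (𝓡 4) x,
    ContinuousOn (fun x => (⟨x, Y x⟩ : TangentBundle (𝓡 4) M)) U ∧ ∀ x ∈ U, Y x ∈ S x

variable (M) in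
/-- An orientation of `M`: an orientation of every tangent space, such that near every point there
is a continuous positively oriented frame field. -/
structure ManifoldOrientation where
  orient : ∀ x : M, Orientation ℝ (TangentSpace (𝓡 4) x) (Fin 4)
  exists_continuous : ∀ x₀ : M, ∃ U ∈ 𝓝 x₀,
    ∃ b : ∀ x : M, Module.Basis (Fin 4) ℝ (TangentSpace (𝓡 4) x),
      (∀ i, ContinuousOn (fun x => (⟨x, b x i⟩ : TangentBundle (𝓡 4) M)) U) ∧
      ∀ x ∈ U, (b x).orientation = orient x

/-! ### The observer space and its frame bundle -/

/-- The observer space `O`, the union of the sets `S_x`. -/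
def observerSpace {X : FinslerSpacetime M} (T : TimeOrientation X) :
    Set (TangentBundle (𝓡 4) M) :=
  {v | v.2 ∈ T.S v.proj}

variable (M) in
/-- The bundle of all the linear maps `ℝ⁴ → T_xM`. It is a smooth manifold, and the frame bundle
of `M` is its open subset of isomorphisms; the map `f` stands for the vectors `f_i = f(e_i)`. -/
abbrev FrameSpace : Type _ :=
  TotalSpace (E4 →L[ℝ] E4) (fun x : M => Bundle.Trivial M E4 x →L[ℝ] TangentSpace (𝓡 4) x)

/-- The model with corners of `FrameSpace M`. -/
abbrev frameModel : ModelWithCorners ℝ (E4 × (E4 →L[ℝ] E4)) (ModelProd E4 (E4 →L[ℝ] E4)) :=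
  (𝓡 4).prod 𝓘(ℝ, E4 →L[ℝ] E4)

/-- The leg `f_i` of a frame. -/
def leg (p : FrameSpace M) (i : Fin 4) : TangentSpace (𝓡 4) p.proj := p.2 (stdVec i)

/-- The coordinates `(x^a, f_i^a)` of a frame that are induced by the chart `φ`. -/
def frameCoord (φ : OpenPartialHomeomorph M E4) (p : FrameSpace M) : FrameCoord :=
  (φ p.proj, fun i => mfderiv (𝓡 4) 𝓘(ℝ, E4) φ p.proj (leg p i))

/-- The right action of `k` on frames: `f_0` is kept and `f_α` is replaced by `f_β k^β_α`. -/
def rotateFrame (p : FrameSpace M) (k : SO3) : FrameSpace M :=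
  ⟨p.proj, ContinuousLinearMap.comp (p.2 : E4 →L[ℝ] TangentSpace (𝓡 4) p.proj)
    (Matrix.toEuclideanCLM (𝕜 := ℝ) (spatial (k : Matrix (Fin 3) (Fin 3) ℝ)))⟩

/-- The bundle `P` of the oriented, time-oriented frames with `f_0` in `O` which are orthonormal
with respect to the Finsler metric, `g^F(x, f_0)(f_i, f_j) = -η_ij`. -/
def observerFrames {X : FinslerSpacetime M} (T : TimeOrientation X) (o : ManifoldOrientation M) :
    Set (FrameSpace M) :=
  {p | leg p 0 ∈ T.S p.proj ∧
    (∀ i j, fiberMetric (fun v => X.F v ^ 2) p.proj (leg p 0) (leg p i) (leg p j) = -eta i j) ∧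
    ∃ b : Module.Basis (Fin 4) ℝ (TangentSpace (𝓡 4) p.proj),
      (∀ i, b i = leg p i) ∧ b.orientation = o.orient p.proj}

/-- The projection `π : P → O` that keeps the leg `f_0` only. -/
def toObserver {X : FinslerSpacetime M} (T : TimeOrientation X) (o : ManifoldOrientation M)
    (p : observerFrames T o) : observerSpace T :=
  ⟨⟨p.1.proj, leg p.1 0⟩, p.2.1⟩

/-- The velocity, in the coordinates induced by the chart `φ`, of a tangent vector of `P`. -/
def frameVelocity {X : FinslerSpacetime M} {T : TimeOrientation X} {o : ManifoldOrientation M}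
    [ChartedSpace (EuclideanSpace ℝ (Fin 10)) (observerFrames T o)]
    (φ : OpenPartialHomeomorph M E4) (p : observerFrames T o) (v : TangentSpace (𝓡 10) p) :
    FrameCoord :=
  mfderiv (𝓡 10) 𝓘(ℝ, FrameCoord) (fun q : observerFrames T o => frameCoord φ q.1) p v

end Spacetime

end FinslerCartan

end

/-! The geometry of the observers. Where `L ≠ 0`, the square `F²` is smooth and homogeneous of
degree 2 in `y`. At a timelike unit vector `y` the Hessians of `L` and of `F²` are proportional on
the `g^F`-orthogonal complement of `y` (`gForm_sqFun_neg`), so the signature of `g^L` makes `g^F`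
negative definite there, while `g^F(y, y) = F² = 1`. Hence every observer is the first leg of an
orthonormal frame. The sets `S_x` do not jump as `x` varies: the property of being timelike is open
among unit vectors, each `S_x` is connected, and the continuous vector fields of the time
orientation provide a starting point (`observerCone_mem_nhds`). So `O` is open in `{|L| = 1}`, a
hypersurface met once by each ray with `L ≠ 0`, and it is parametrized by a base point and a
direction: dimension 4 + 3.

The bundle. Positively oriented orthonormal frames over one observer differ by a rotation, because a
Lorentz matrix of positive determinant that fixes the time axis is a rotation. A smooth normal form
for symmetric matrices (`exists_congruence`) spreads one such frame over a neighbourhood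
(`exists_local_frame`, `exists_localSection`). Thus `P` is locally `O × SO(3)`, which gives the
dimension 7 + 3, the embedding and the equivariant trivializations. `SO(3)` itself carries charts by
Cayley transforms.

The connection. Four facts about the Cartan linear connection carry the rest. It is compatible with
the metric (`fderiv_gForm_eq`), so `ω` takes values in `𝔥` on vectors tangent to `P`, along which
`g(f_i, f_j)` is constant. Its coefficients change under `τ` by the usual inhomogeneous terms
(`ChartChange.hVec_eq`, `ChartChange.nMap_eq`, `ChartChange.cVec_eq`), which cancel in `A`. Finally,
homogeneity gives `C(y, ·) = 0` (`cVec_radial`) and `F(y, ·) = N` (`hVec_radial`).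

The last two identities make `A` injective: if `e(v) = 0` then `dx = 0`; then `ω(v) = 0` gives `df_0
= 0`, since the term with `C` drops out for the leg `f_0`; then all `df_i` vanish. As `P` and the
Lie algebra both have dimension 10, `A_p` is an isomorphism. The same identities evaluate `A` on the
proposed fundamental vector fields. Equivariance and the Maurer–Cartan property hold because a
rotation acts linearly on the legs and leaves `f_0`, and with it all the coefficients, unchanged. -/

noncomputable section

namespace FinslerCartan

/-! ### Embedded submanifolds from local parametrizations -/

section SliceChart

variable {F F' E : Type*} [NormedAddCommGroup F] [NormedSpace ℝ F]
  [NormedAddCommGroup F'] [NormedSpace ℝ F'] [NormedAddCommGroup E] [NormedSpace ℝ E]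

/-- A smooth map with invertible derivative restricts to a smooth local diffeomorphism. -/
theorem exists_openPartialHomeomorph_of_hasFDerivAt [CompleteSpace E] {f : E → E} {U : Set E}
    (hU : IsOpen U) (hf : ContDiffOn ℝ ∞ f U) {a : E} (ha : a ∈ U) (e : E ≃L[ℝ] E)
    (he : HasFDerivAt f (e : E →L[ℝ] E) a) :
    ∃ Ξ : OpenPartialHomeomorph E E, a ∈ Ξ.source ∧ Ξ.source ⊆ U ∧ (Ξ : E → E) = f ∧
      ContDiffOn ℝ ∞ Ξ Ξ.source ∧ ContDiffOn ℝ ∞ Ξ.symm Ξ.target := by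
  have hfa : ContDiffAt ℝ ∞ f a := hf.contDiffAt (hU.mem_nhds ha)
  let Ξ₀ := hfa.toOpenPartialHomeomorph f he (by simp)
  have hΞ₀ : (Ξ₀ : E → E) = f := hfa.toOpenPartialHomeomorph_coe he (by simp)
  have hcont : ContinuousOn (fderiv ℝ f) U := hf.continuousOn_fderiv_of_isOpen hU (by simp)
  let R : Set (E →L[ℝ] E) := range ((↑) : (E ≃L[ℝ] E) → E →L[ℝ] E)
  have hR : IsOpen R := ContinuousLinearEquiv.isOpen
  -- The inverse is smooth at the image of each point where the derivative is invertible.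
  -- Restricting to the open set of such points makes it smooth on the whole target.
  have hW : IsOpen (U ∩ fderiv ℝ f ⁻¹' R) := hcont.isOpen_inter_preimage hU hR
  have haW : a ∈ U ∩ fderiv ℝ f ⁻¹' R := ⟨ha, e, he.fderiv.symm⟩
  refine ⟨Ξ₀.restr (U ∩ fderiv ℝ f ⁻¹' R), ?_, ?_, hΞ₀, ?_, ?_⟩
  · rw [Ξ₀.restr_source' _ hW]
    exact ⟨hfa.mem_toOpenPartialHomeomorph_source he (by simp), haW⟩
  · rw [Ξ₀.restr_source' _ hW]
    exact fun x hx => hx.2.1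
  · rw [Ξ₀.restr_source' _ hW]
    change ContDiffOn ℝ ∞ (Ξ₀ : E → E) _
    rw [hΞ₀]
    exact hf.mono fun x hx => hx.2.1
  · intro y hy
    have hy' := (Ξ₀.restr (U ∩ fderiv ℝ f ⁻¹' R)).map_target hy
    rw [Ξ₀.restr_source' _ hW] at hy'
    obtain ⟨e', he'⟩ := hy'.2.2
    have hd : ContDiffAt ℝ ∞ f (Ξ₀.symm y) := hf.contDiffAt (hU.mem_nhds hy'.2.1)
    refine (Ξ₀.contDiffAt_symm (f₀' := e') ?_ ?_ ?_).contDiffWithinAt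
    · exact hy.1
    · rw [he', hΞ₀]
      exact (hd.differentiableAt (by simp)).hasFDerivAt
    · rw [hΞ₀]
      exact hd

/-- A parametrization with a smooth left inverse is flattened by a local diffeomorphism of the
ambient space. -/
theorem exists_slice_chart [FiniteDimensional ℝ F] [FiniteDimensional ℝ F'] [FiniteDimensional ℝ E]
    (hdim : Module.finrank ℝ F + Module.finrank ℝ F' = Module.finrank ℝ E)
    {c : F → E} {r : E → F} {V : Set F} {U : Set E} (hV : IsOpen V) (hU : IsOpen U)
    (hc : ContDiffOn ℝ ∞ c V) (hr : ContDiffOn ℝ ∞ r U) (hcU : MapsTo c V U)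
    (hrc : ∀ u ∈ V, r (c u) = u) {u₀ : F} (hu₀ : u₀ ∈ V) :
    ∃ (equiv : (F × F') ≃L[ℝ] E) (Ξ : OpenPartialHomeomorph E E), c u₀ ∈ Ξ.source ∧
      Ξ.source ⊆ U ∧ ContDiffOn ℝ ∞ Ξ Ξ.source ∧ ContDiffOn ℝ ∞ Ξ.symm Ξ.target ∧
      ∀ u ∈ V, Ξ (c u) = equiv (u, 0) := by
  have : CompleteSpace E := FiniteDimensional.complete ℝ E
  have hcd : HasFDerivAt c (fderiv ℝ c u₀) u₀ :=
    ((hc.contDiffAt (hV.mem_nhds hu₀)).differentiableAt (by simp)).hasFDerivAt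
  have hrd : HasFDerivAt r (fderiv ℝ r (c u₀)) (c u₀) :=
    ((hr.contDiffAt (hU.mem_nhds (hcU hu₀))).differentiableAt (by simp)).hasFDerivAt
  set dc := fderiv ℝ c u₀
  set dr := fderiv ℝ r (c u₀)
  have hright : Function.RightInverse dc dr := by
    have h1 : HasFDerivAt (r ∘ c) (dr.comp dc) u₀ := hrd.comp u₀ hcd
    have h2 : HasFDerivAt (r ∘ c) (ContinuousLinearMap.id ℝ F) u₀ :=
      (hasFDerivAt_id u₀).congr_of_eventuallyEq
        (Filter.eventuallyEq_of_mem (hV.mem_nhds hu₀) hrc)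
    intro v
    exact congrArg (fun l : F →L[ℝ] F => l v) (h1.unique h2)
  -- As `dr ∘ dc = id`, the space splits as the image of `dc` plus the kernel of `dr`; the kernel
  -- has the dimension of `F'` by `hdim`.
  let e₁ := ContinuousLinearEquiv.equivOfRightInverse dr dc hright
  have hker : Module.finrank ℝ (LinearMap.ker (dr : E →ₗ[ℝ] F)) = Module.finrank ℝ F' := by
    have := e₁.toLinearEquiv.finrank_eq
    rw [Module.finrank_prod] at this
    omega
  let e₂ : ↥(LinearMap.ker (dr : E →ₗ[ℝ] F)) ≃L[ℝ] F' := ContinuousLinearEquiv.ofFinrankEq hker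
  let e₃ : E ≃L[ℝ] F × F' :=
    e₁.trans ((ContinuousLinearEquiv.refl ℝ F).prodCongr e₂)
  let pr : E →L[ℝ] F' := (ContinuousLinearMap.snd ℝ F F').comp (e₃ : E →L[ℝ] F × F')
  have he₃ : ∀ z, e₃ z = (dr z, pr (z - dc (dr z))) := by
    intro z
    have h0 : ∀ u, pr (dc u) = 0 := by
      intro u
      change e₂ (e₁ (dc u)).2 = 0
      have : (e₁ (dc u)).2 = 0 := by
        apply Subtype.ext
        rw [ContinuousLinearEquiv.snd_equivOfRightInverse, hright u]
        simp
      rw [this, map_zero]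
    refine Prod.ext ?_ ?_
    · exact ContinuousLinearEquiv.fst_equivOfRightInverse dr dc hright z
    · rw [map_sub, h0, sub_zero]
      rfl
  let W : Set E := U ∩ r ⁻¹' V
  have hW : IsOpen W := hr.continuousOn.isOpen_inter_preimage hU hV
  have hcW : c u₀ ∈ W := ⟨hcU hu₀, by simpa [hrc u₀ hu₀] using hu₀⟩
  -- The second component measures the displacement of `z` from the image of `c`, so it vanishes on
  -- that image. The linear identification `e₃` is undone so that the derivative at `c u₀` is the
  -- identity.
  let f : E → E := fun z => e₃.symm (r z, pr (z - c (r z)))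
  have hf : ContDiffOn ℝ ∞ f W := by
    have h1 : ContDiffOn ℝ ∞ r W := hr.mono inter_subset_left
    have h2 : ContDiffOn ℝ ∞ (fun z => c (r z)) W := hc.comp h1 fun z hz => hz.2
    exact e₃.symm.contDiff.comp_contDiffOn
      (h1.prodMk (pr.contDiff.comp_contDiffOn (contDiffOn_id.sub h2)))
  have hfd : HasFDerivAt f ((ContinuousLinearEquiv.refl ℝ E : E ≃L[ℝ] E) : E →L[ℝ] E) (c u₀) := by
    have h1 : HasFDerivAt (fun z => c (r z)) (dc.comp dr) (c u₀) := by
      refine HasFDerivAt.comp (c u₀) (g := c) ?_ hrd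
      rw [hrc u₀ hu₀]
      exact hcd
    have h2 := (e₃.symm : (F × F') →L[ℝ] E).hasFDerivAt.comp (c u₀)
      (hrd.prodMk (pr.hasFDerivAt.comp (c u₀) ((hasFDerivAt_id (c u₀)).sub h1)))
    refine h2.congr_fderiv ?_
    ext z
    simp only [ContinuousLinearMap.comp_apply, ContinuousLinearMap.prod_apply]
    exact (congrArg e₃.symm (he₃ z)).symm.trans (e₃.symm_apply_apply z)
  obtain ⟨Ξ, h1, h2, h3, h4, h5⟩ := exists_openPartialHomeomorph_of_hasFDerivAt hW hf hcW _ hfd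
  refine ⟨e₃.symm, Ξ, h1, h2.trans inter_subset_left, h4, h5, fun u hu => ?_⟩
  rw [h3]
  simp [f, hrc u hu]

end SliceChart

variable {E G : Type} [NormedAddCommGroup E] [NormedSpace ℝ E] [TopologicalSpace G]
  {J : ModelWithCorners ℝ E G} {F F' : Type} [NormedAddCommGroup F] [NormedSpace ℝ F]
  [NormedAddCommGroup F'] [NormedSpace ℝ F']
  {N S : Type*} [TopologicalSpace N] [ChartedSpace G N] [TopologicalSpace S]

variable (J F) in
/-- A parametrization, near `s`, of the image of `j : S → N` by an open subset of `F`, with a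
smooth left inverse that is defined on an open subset of `N`. -/
structure LocalParam (j : S → N) (s : S) where
  coord : N → F
  param : F → S
  source : Set N
  target : Set F
  isOpen_source : IsOpen source
  isOpen_target : IsOpen target
  mem_source : j s ∈ source
  contMDiffOn_coord : ContMDiffOn J 𝓘(ℝ, F) ∞ coord source
  contMDiffOn_param : ContMDiffOn 𝓘(ℝ, F) J ∞ (j ∘ param) target
  coord_mem : ∀ t, j t ∈ source → coord (j t) ∈ target
  param_mem : ∀ u ∈ target, j (param u) ∈ source
  param_coord : ∀ t, j t ∈ source → param (coord (j t)) = t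
  coord_param : ∀ u ∈ target, coord (j (param u)) = u

namespace LocalParam

variable {j : S → N} {s : S}

/-- The same parametrization by a linearly isomorphic parameter space. -/
def congr (d : LocalParam J F j s) (e : F ≃L[ℝ] F') : LocalParam J F' j s where
  coord z := e (d.coord z)
  param u := d.param (e.symm u)
  source := d.source
  target := e.symm ⁻¹' d.target
  isOpen_source := d.isOpen_source
  isOpen_target := d.isOpen_target.preimage e.symm.continuous
  mem_source := d.mem_source
  contMDiffOn_coord := e.contDiff.contMDiff.comp_contMDiffOn d.contMDiffOn_coord
  contMDiffOn_param :=
    d.contMDiffOn_param.comp e.symm.contDiff.contMDiff.contMDiffOn fun _ hu => hu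
  coord_mem t ht := by simpa using d.coord_mem t ht
  param_mem u hu := d.param_mem _ hu
  param_coord t ht := by simpa using d.param_coord t ht
  coord_param u hu := by simp [d.coord_param _ hu]

/-- The chart of `S` given by a parametrization. -/
def chart (hj : IsEmbedding j) (d : LocalParam J F j s) : OpenPartialHomeomorph S F where
  toFun t := d.coord (j t)
  invFun := d.param
  source := j ⁻¹' d.source
  target := d.target
  map_source' := d.coord_mem
  map_target' := d.param_mem
  left_inv' := d.param_coord
  right_inv' := d.coord_param
  open_source := d.isOpen_source.preimage hj.continuous
  open_target := d.isOpen_target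
  continuousOn_toFun := d.contMDiffOn_coord.continuousOn.comp hj.continuous.continuousOn
    fun _ ht => ht
  continuousOn_invFun := hj.continuousOn_iff.2 d.contMDiffOn_param.continuousOn

/-- The manifold structure given by parametrizations near all points. -/
abbrev chartedSpace (hj : IsEmbedding j) (d : ∀ s, LocalParam J F j s) : ChartedSpace F S where
  atlas := range fun s => (d s).chart hj
  chartAt s := (d s).chart hj
  mem_chart_source s := (d s).mem_source
  chart_mem_atlas s := ⟨s, rfl⟩

/-- A change of charts is `coord` of one parametrization after `j ∘ param` of another. Both are
smooth maps out of or into `N`, so no compatibility between the parametrizations has to be assumed.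
-/
theorem isManifold (hj : IsEmbedding j) (d : ∀ s, LocalParam J F j s) :
    letI := chartedSpace hj d
    IsManifold 𝓘(ℝ, F) ∞ S := by
  let _ := chartedSpace hj d
  refine isManifold_of_contDiffOn _ _ _ ?_
  rintro _ _ ⟨s, rfl⟩ ⟨t, rfl⟩
  have h : ContMDiffOn 𝓘(ℝ, F) 𝓘(ℝ, F) ∞ ((d t).coord ∘ (j ∘ (d s).param))
      ((d s).target ∩ (j ∘ (d s).param) ⁻¹' (d t).source) :=
    (d t).contMDiffOn_coord.comp ((d s).contMDiffOn_param.mono inter_subset_left) fun u hu => hu.2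
  rw [contMDiffOn_iff_contDiffOn] at h
  refine h.mono fun u hu => ?_
  simpa [chart] using hu

/-- The inclusion has injective derivatives. -/
theorem mfderiv_injective (hj : IsEmbedding j) (d : ∀ s, LocalParam J F j s)
    [IsManifold J ∞ N]
    (h : letI := chartedSpace hj d; ContMDiff 𝓘(ℝ, F) J ∞ j) (s : S) :
    letI := chartedSpace hj d
    Function.Injective (mfderiv 𝓘(ℝ, F) J j s) := by
  let _ := chartedSpace hj d
  have := isManifold hj d
  have h1 : MDifferentiableAt J 𝓘(ℝ, F) (d s).coord (j s) :=
    ((d s).contMDiffOn_coord.contMDiffAt ((d s).isOpen_source.mem_nhds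
      (d s).mem_source)).mdifferentiableAt (by simp)
  have h2 : MDifferentiableAt 𝓘(ℝ, F) J j s := (h s).mdifferentiableAt (by simp)
  have h3 := mfderiv_comp s h1 h2
  have h4 : Function.Injective (mfderiv 𝓘(ℝ, F) 𝓘(ℝ, F) (chartAt F s) s) :=
    (mdifferentiable_chart (I := 𝓘(ℝ, F)) s).mfderiv_injective (mem_chart_source F s)
  -- The chart of `S` factors through `j`, and its derivative is injective.
  have h5 : ((d s).coord ∘ j) = (chartAt F s : S → F) := rfl
  rw [h5] at h3
  rw [h3] at h4
  exact Function.Injective.of_comp h4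

/-- In a chart of `N` the map `j ∘ param` has the smooth left inverse `coord`, so
`exists_slice_chart` straightens it to `u ↦ (u, 0)`. The complement is a Euclidean space of the
missing dimension, which is where `hdim` enters. -/
theorem isSmoothEmbedding [FiniteDimensional ℝ F] [FiniteDimensional ℝ E] [J.Boundaryless]
    [IsManifold J ∞ N] (hj : IsEmbedding j) (d : ∀ s, LocalParam J F j s)
    (hdim : Module.finrank ℝ F ≤ Module.finrank ℝ E) :
    letI := chartedSpace hj d
    IsSmoothEmbedding 𝓘(ℝ, F) J ∞ j := by
  let _ := chartedSpace hj d
  have := isManifold hj d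
  refine ⟨?_, hj⟩
  refine IsImmersionOfComplement.isImmersion
    (F := EuclideanSpace ℝ (Fin (Module.finrank ℝ E - Module.finrank ℝ F))) fun s => ?_
  -- the inclusion in the chart of `N` at `j s`
  let κ := chartAt G (j s)
  let D := d s
  have hκ := IsManifold.chart_mem_maximalAtlas (I := J) (n := ∞) (j s)
  let V : Set F := D.target ∩ (j ∘ D.param) ⁻¹' κ.source
  have hV : IsOpen V :=
    D.contMDiffOn_param.continuousOn.isOpen_inter_preimage D.isOpen_target κ.open_source
  let U : Set E := (κ.extend J).target ∩ (κ.extend J).symm ⁻¹' D.source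
  have hU : IsOpen U :=
    (κ.continuousOn_extend_symm (I := J)).isOpen_inter_preimage
      (κ.isOpen_extend_target) D.isOpen_source
  have hc : ContDiffOn ℝ ∞ (fun u => κ.extend J (j (D.param u))) V := by
    rw [← contMDiffOn_iff_contDiffOn]
    exact (κ.contMDiffOn_extend hκ).comp (D.contMDiffOn_param.mono inter_subset_left)
      fun u hu => hu.2
  have hr : ContDiffOn ℝ ∞ (fun z => D.coord ((κ.extend J).symm z)) U := by
    rw [← contMDiffOn_iff_contDiffOn]
    refine D.contMDiffOn_coord.comp ((contMDiffOn_extend_symm hκ).mono ?_) fun z hz => hz.2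
    intro z hz
    have h := hz.1
    simp only [OpenPartialHomeomorph.extend_target, mem_inter_iff, mem_preimage] at h
    exact ⟨J.symm z, h.1, J.right_inv h.2⟩
  have hleft : ∀ u ∈ V, (κ.extend J).symm (κ.extend J (j (D.param u))) = j (D.param u) :=
    fun u hu => κ.extend_left_inv hu.2
  have hcU : MapsTo (fun u => κ.extend J (j (D.param u))) V U := by
    intro u hu
    refine ⟨(κ.extend J).map_source (by simpa using hu.2), ?_⟩
    rw [mem_preimage, hleft u hu]
    exact D.param_mem u hu.1
  have hu₀ : D.coord (j s) ∈ V := by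
    refine ⟨D.coord_mem s D.mem_source, ?_⟩
    simp only [mem_preimage, Function.comp_apply, D.param_coord s D.mem_source]
    exact mem_chart_source G (j s)
  obtain ⟨equiv, Ξ, h1, h2, h3, h4, h5⟩ := exists_slice_chart
    (F' := EuclideanSpace ℝ (Fin (Module.finrank ℝ E - Module.finrank ℝ F))) (by simp; omega)
    hV hU hc hr hcU (fun u hu => by rw [hleft u hu]; exact D.coord_param u hu.1) hu₀
  -- The straightening `Ξ` lives on the model vector space. Without boundary, `J` is a
  -- homeomorphism, so `Ξ` can be carried back to a chart of `N` with values in `G`.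
  let Ξ' : OpenPartialHomeomorph N G :=
    ((κ.trans J.toHomeomorph.toOpenPartialHomeomorph).trans Ξ).trans
      J.toHomeomorph.symm.toOpenPartialHomeomorph
  have hΞ' : Ξ' ∈ IsManifold.maximalAtlas J ∞ N := by
    have hsymm : ContMDiff 𝓘(ℝ, E) J ∞ J.symm := by
      rw [← contMDiffOn_univ, ← J.range_eq_univ]
      exact J.contMDiffOn_symm
    refine OpenPartialHomeomorph.mem_maximalAtlas_of_contMDiffOn Ξ' ?_ ?_
    · have : ContMDiffOn J J ∞ (J.symm ∘ (Ξ ∘ (κ.extend J))) Ξ'.source := by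
        refine hsymm.comp_contMDiffOn (h3.contMDiffOn.comp
          ((κ.contMDiffOn_extend hκ).mono ?_) ?_)
        · intro z hz
          simp [Ξ'] at hz
          exact hz.1
        · intro z hz
          simp [Ξ'] at hz
          exact hz.2
      exact this
    · have : ContMDiffOn J J ∞ (κ.symm ∘ (J.symm ∘ (Ξ.symm ∘ J))) Ξ'.target := by
        refine (contMDiffOn_symm_of_mem_maximalAtlas hκ).comp
          (hsymm.comp_contMDiffOn (h4.contMDiffOn.comp J.contMDiff.contMDiffOn ?_)) ?_
        · intro z hz
          simp [Ξ'] at hz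
          exact hz.1
        · intro z hz
          simp [Ξ'] at hz
          exact hz.2
      exact this
  -- The chart of `S` is shrunk so that its domain is mapped into the domain of `κ`.
  have hdom : (D.chart hj).restr (j ⁻¹' κ.source) ∈ IsManifold.maximalAtlas 𝓘(ℝ, F) ∞ S :=
    restr_mem_maximalAtlas (contDiffGroupoid ∞ 𝓘(ℝ, F))
      (IsManifold.chart_mem_maximalAtlas (I := 𝓘(ℝ, F)) (n := ∞) s)
      (κ.open_source.preimage hj.continuous)
  refine IsImmersionAtOfComplement.mk_of_continuousAt hj.continuous.continuousAt equiv
    ((D.chart hj).restr (j ⁻¹' κ.source)) Ξ' ?_ ?_ hdom hΞ' ?_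
  · rw [OpenPartialHomeomorph.restr_source' _ _ (κ.open_source.preimage hj.continuous)]
    exact ⟨D.mem_source, mem_chart_source G (j s)⟩
  · have : κ.extend J (j (D.param (D.coord (j s)))) ∈ Ξ.source := h1
    rw [D.param_coord s D.mem_source] at this
    simp only [Ξ', OpenPartialHomeomorph.trans_source, OpenPartialHomeomorph.coe_trans]
    simpa [κ] using this
  · intro u hu
    have huV : u ∈ V := by
      simp only [OpenPartialHomeomorph.extend_target] at hu
      have h6 := hu.1
      have h7 := ((D.chart hj).restr (j ⁻¹' κ.source)).map_target h6
      rw [OpenPartialHomeomorph.restr_source' _ _ (κ.open_source.preimage hj.continuous)] at h7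
      exact ⟨h6.1, h7.2⟩
    have := h5 u huV
    simp only [Function.comp_apply]
    rw [← this]
    simpa [Ξ', D, chart] using J.right_inv (by simp [J.range_eq_univ])

end LocalParam

/-! ### Smoothness of matrix operations -/

section MatrixSmooth

variable {Q : Type*} [NormedAddCommGroup Q] [NormedSpace ℝ Q] {n : Type*} [Fintype n]
  {A B : Q → Matrix n n ℝ} {q : Q}

theorem contDiffAt_matrix_mul (hA : ∀ i j, ContDiffAt ℝ ∞ (fun r => A r i j) q)
    (hB : ∀ i j, ContDiffAt ℝ ∞ (fun r => B r i j) q) (i j : n) :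
    ContDiffAt ℝ ∞ (fun r => (A r * B r) i j) q := by
  simp only [Matrix.mul_apply]
  exact ContDiffAt.sum fun k _ => (hA i k).mul (hB k j)

variable [DecidableEq n]

theorem contDiffAt_matrix_det (hA : ∀ i j, ContDiffAt ℝ ∞ (fun r => A r i j) q) :
    ContDiffAt ℝ ∞ (fun r => (A r).det) q := by
  simp only [Matrix.det_apply]
  exact ContDiffAt.sum fun σ _ => (contDiffAt_prod fun k _ => hA (σ k) k).const_smul _

/-- By Cramer's rule the entries of the inverse are polynomials in the entries divided by the
determinant. -/
theorem contDiffAt_matrix_inv (hA : ∀ i j, ContDiffAt ℝ ∞ (fun r => A r i j) q)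
    (h : (A q).det ≠ 0) (i j : n) : ContDiffAt ℝ ∞ (fun r => (A r)⁻¹ i j) q := by
  have h1 : (fun r => (A r)⁻¹ i j) = fun r => (A r).det⁻¹ * (A r).adjugate i j := by
    funext r
    rw [Matrix.inv_def, Ring.inverse_eq_inv', Matrix.smul_apply, smul_eq_mul]
  rw [h1]
  refine ((contDiffAt_matrix_det hA).inv h).mul ?_
  simp only [Matrix.adjugate_apply]
  refine contDiffAt_matrix_det fun k l => ?_
  simp only [Matrix.updateRow_apply]
  split_ifs
  · exact contDiffAt_const
  · exact hA k l

end MatrixSmooth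

/-! ### Normal forms of symmetric matrices near a diagonal one -/

section NormalForm

variable {n : Type*} [Fintype n] [DecidableEq n]

/-- Matrices near `1` have a smooth square root, which is unique near `1`. -/
theorem exists_matrix_sqrt : ∃ (r : (n → n → ℝ) → n → n → ℝ) (Y : Set (n → n → ℝ)),
    IsOpen Y ∧ Matrix.of.symm (1 : Matrix n n ℝ) ∈ Y ∧ r (Matrix.of.symm 1) = Matrix.of.symm 1 ∧
    (∀ S ∈ Y, ContDiffAt ℝ ∞ r S ∧
      Matrix.of (r S) * Matrix.of (r S) = Matrix.of S) ∧
    ∃ Z : Set (n → n → ℝ), IsOpen Z ∧ (∀ S ∈ Y, r S ∈ Z) ∧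
      ∀ X ∈ Z, ∀ X' ∈ Z, Matrix.of X * Matrix.of X = Matrix.of X' * Matrix.of X' → X = X' := by
  let f : (n → n → ℝ) → n → n → ℝ := fun X i j => ∑ k, X i k * X k j
  have hf : ContDiff ℝ ∞ f := by
    refine contDiff_pi.2 fun i => contDiff_pi.2 fun j => ContDiff.sum fun k _ => ?_
    exact (contDiff_apply_apply ℝ ℝ i k).mul (contDiff_apply_apply ℝ ℝ k j)
  -- The derivative of `X ↦ X * X` at `1` is `H ↦ 2H`, which is invertible. The inverse function
  -- theorem yields the root together with its uniqueness, since squaring is injective on the source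
  -- of the local diffeomorphism.
  let e : (n → n → ℝ) ≃L[ℝ] (n → n → ℝ) :=
    ContinuousLinearEquiv.smulLeft (Units.mk0 (2 : ℝ) two_ne_zero)
  let I : n → n → ℝ := Matrix.of.symm 1
  have hI : ∀ a b : n, I a b = if a = b then 1 else 0 := fun a b => Matrix.one_apply
  have he : HasFDerivAt f (e : (n → n → ℝ) →L[ℝ] (n → n → ℝ)) I := by
    rw [hasFDerivAt_pi']
    intro i
    rw [hasFDerivAt_pi']
    intro j
    let pr : n → n → ((n → n → ℝ) →L[ℝ] ℝ) := fun a b =>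
      (ContinuousLinearMap.proj b).comp
        (ContinuousLinearMap.proj (R := ℝ) (φ := fun _ : n => n → ℝ) a)
    have h1 : HasFDerivAt (fun X : n → n → ℝ => ∑ k, pr i k X * pr k j X) _ I :=
      HasFDerivAt.fun_sum (u := Finset.univ) fun k _ =>
        ((pr i k).hasFDerivAt (x := I)).mul (pr k j).hasFDerivAt
    refine h1.congr_fderiv ?_
    ext H
    have hp : ∀ (a b : n) (X : n → n → ℝ), pr a b X = X a b := fun _ _ _ => rfl
    simp only [_root_.sum_apply, _root_.add_apply,
      _root_.smul_apply, hp, smul_eq_mul, Finset.sum_add_distrib, hI]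
    simp [e]
    ring
  obtain ⟨Ξ, h1, -, h3, h4, h5⟩ := exists_openPartialHomeomorph_of_hasFDerivAt
    isOpen_univ hf.contDiffOn (mem_univ _) e he
  have hmul : ∀ X, Matrix.of (f X) = Matrix.of X * Matrix.of X := fun X => by
    ext i j; simp [f, Matrix.mul_apply]
  have hone : f I = I := by
    have := hmul I
    apply Matrix.of.injective
    simpa [I] using this
  refine ⟨Ξ.symm, Ξ.target, Ξ.open_target, ?_, ?_, ?_, Ξ.source, Ξ.open_source,
    fun S hS => Ξ.map_target hS, ?_⟩
  · change I ∈ _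
    rw [← hone, ← h3]; exact Ξ.map_source h1
  · change Ξ.symm I = I
    conv_lhs => rw [← hone, ← h3]
    exact Ξ.left_inv h1
  · intro S hS
    refine ⟨h5.contDiffAt (Ξ.open_target.mem_nhds hS), ?_⟩
    rw [← hmul, ← h3, Ξ.right_inv hS]
  · intro X hX X' hX' h
    refine Ξ.injOn hX hX' ?_
    rw [h3]
    have := (hmul X).trans (h.trans (hmul X').symm)
    exact Matrix.of.injective this

/-- A symmetric matrix near `D`, where `D` is a symmetric involution, is brought to the form `D` by
a congruence that depends smoothly on the matrix. -/
theorem exists_congruence (D : Matrix n n ℝ) (hD : Dᵀ = D) (hDD : D * D = 1) :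
    ∃ r : (n → n → ℝ) → n → n → ℝ, r (Matrix.of.symm D) = Matrix.of.symm 1 ∧
      ∀ᶠ B in 𝓝 (Matrix.of.symm D), ContDiffAt ℝ ∞ r B ∧
        ((Matrix.of B)ᵀ = Matrix.of B →
          (Matrix.of (r B))ᵀ * Matrix.of B * Matrix.of (r B) = D) := by
  obtain ⟨s, Y, hY, h1Y, hs1, hs, Z, hZ, hsZ, hinj⟩ := exists_matrix_sqrt (n := n)
  -- For `B` near `D` the product `D * B` is near `D * D = 1` and has a root `X`. The congruence
  -- will be by `X⁻¹`.
  let m : (n → n → ℝ) → n → n → ℝ := fun B => Matrix.of.symm (D * Matrix.of B)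
  have hm : ContDiff ℝ ∞ m := by
    refine contDiff_pi.2 fun i => contDiff_pi.2 fun j => ?_
    simp only [m, Matrix.of_symm_apply, Matrix.mul_apply]
    exact ContDiff.sum fun k _ => contDiff_const.mul (contDiff_apply_apply ℝ ℝ k j)
  set D' : n → n → ℝ := Matrix.of.symm D with hD'
  have hmD : m D' = Matrix.of.symm 1 := by simp [m, hD', hDD]
  -- This is the adjoint with respect to `D`. For symmetric `B` the adjoint of `X` also squares to
  -- `D * B`, so by uniqueness of the root `D Xᵀ D = X`; therefore `B = D X X = Xᵀ D X`.
  let t : (n → n → ℝ) → n → n → ℝ := fun X => Matrix.of.symm (D * (Matrix.of X)ᵀ * D)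
  have ht : Continuous t := by
    refine continuous_pi fun i => continuous_pi fun j => ?_
    simp only [t, Matrix.of_symm_apply, Matrix.mul_apply, Matrix.transpose_apply, Matrix.of_apply]
    fun_prop
  have hsm : ContDiffAt ℝ ∞ (fun B => s (m B)) D' := by
    refine ContDiffAt.comp D' (g := s) ?_ hm.contDiffAt
    rw [hmD]; exact (hs _ h1Y).1
  have hdet1 : ∀ᶠ B in 𝓝 D', (Matrix.of (s (m B))).det ≠ 0 := by
    have hc : ContinuousAt (fun B => (Matrix.of (s (m B))).det) D' :=
      (contDiffAt_matrix_det fun i j =>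
        contDiffAt_pi.1 (contDiffAt_pi.1 hsm i) j).continuousAt
    refine hc.eventually_ne ?_
    rw [hmD, hs1]
    simp
  have hYe : ∀ᶠ B in 𝓝 D', m B ∈ Y :=
    hm.continuous.continuousAt.eventually_mem (hY.mem_nhds (by rw [hmD]; exact h1Y))
  have hZe : ∀ᶠ B in 𝓝 D', t (s (m B)) ∈ Z := by
    have hc : ContinuousAt (fun B => t (s (m B))) D' :=
      ht.continuousAt.comp hsm.continuousAt
    refine hc.eventually_mem (hZ.mem_nhds ?_)
    have : t (s (m D')) = Matrix.of.symm 1 := by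
      rw [hmD, hs1]
      simp [t, hDD]
    rw [this, ← hs1]
    exact hsZ _ h1Y
  refine ⟨fun B => Matrix.of.symm (Matrix.of (s (m B)))⁻¹, ?_, ?_⟩
  · simp only [hmD, hs1]
    simp
  filter_upwards [hdet1, hYe, hZe] with B hdet hB hBZ
  constructor
  · refine contDiffAt_pi.2 fun i => contDiffAt_pi.2 fun j => ?_
    refine contDiffAt_matrix_inv (A := fun B => Matrix.of (s (m B))) (fun k l => ?_) hdet i j
    have h2 : ContDiffAt ℝ ∞ (fun B => s (m B)) B :=
      ContDiffAt.comp B (g := s) (hs _ hB).1 hm.contDiffAt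
    exact contDiffAt_pi.1 (contDiffAt_pi.1 h2 k) l
  · intro hsymm
    set X : Matrix n n ℝ := Matrix.of (s (m B)) with hX
    have hXX : X * X = D * Matrix.of B := by simpa [m] using (hs _ hB).2
    have hXt : D * Xᵀ * D = X := by
      refine congrArg Matrix.of (hinj _ hBZ _ (hsZ _ hB) ?_)
      change (D * Xᵀ * D) * (D * Xᵀ * D) = X * X
      calc (D * Xᵀ * D) * (D * Xᵀ * D) = D * Xᵀ * (D * D) * Xᵀ * D := by
            simp only [Matrix.mul_assoc]
        _ = D * (X * X)ᵀ * D := by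
            rw [hDD, Matrix.transpose_mul]; simp only [Matrix.mul_assoc, Matrix.one_mul]
        _ = D * Matrix.of B * (D * D) := by
            rw [hXX, Matrix.transpose_mul, hsymm, hD]; simp only [Matrix.mul_assoc]
        _ = X * X := by rw [hDD, Matrix.mul_one, hXX]
    have hu : IsUnit X.det := isUnit_iff_ne_zero.2 hdet
    have hut : IsUnit Xᵀ.det := by rwa [Matrix.det_transpose]
    have hB' : Matrix.of B = Xᵀ * D * X := by
      calc Matrix.of B = D * (D * Matrix.of B) := by rw [← Matrix.mul_assoc, hDD, Matrix.one_mul]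
        _ = D * (X * X) := by rw [hXX]
        _ = D * (D * Xᵀ * D * X) := by rw [hXt]
        _ = (D * D) * Xᵀ * D * X := by simp only [Matrix.mul_assoc]
        _ = Xᵀ * D * X := by rw [hDD, Matrix.one_mul]
    rw [Equiv.apply_symm_apply, hB', Matrix.transpose_nonsing_inv]
    calc Xᵀ⁻¹ * (Xᵀ * D * X) * X⁻¹ = (Xᵀ⁻¹ * Xᵀ) * D * (X * X⁻¹) := by
          simp only [Matrix.mul_assoc]
      _ = D := by
          rw [Matrix.nonsing_inv_mul _ hut, Matrix.mul_nonsing_inv _ hu, Matrix.one_mul,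
            Matrix.mul_one]

end NormalForm

/-! ### The rotation group -/

section Rotations

theorem SO3.transpose_mul_self (k : SO3) : k.1ᵀ * k.1 = 1 := by
  have := (Matrix.mem_specialOrthogonalGroup_iff.1 k.2).1
  exact (Matrix.mem_orthogonalGroup_iff' _ _).1 this

theorem SO3.det_eq_one (k : SO3) : k.1.det = 1 :=
  (Matrix.mem_specialOrthogonalGroup_iff.1 k.2).2

theorem SO3.coe_inv (k : SO3) : (k⁻¹ : SO3).1 = k.1ᵀ := rfl

/-- A rotation from a matrix. -/
def SO3.mk (Q : Matrix (Fin 3) (Fin 3) ℝ) (h : Qᵀ * Q = 1) (h' : Q.det = 1) : SO3 :=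
  ⟨Q, Matrix.mem_specialOrthogonalGroup_iff.2 ⟨(Matrix.mem_orthogonalGroup_iff' _ _).2 h, h'⟩⟩

/-- The skew matrix of a vector. -/
def hat (u : EuclideanSpace ℝ (Fin 3)) : Matrix (Fin 3) (Fin 3) ℝ :=
  !![0, -u 2, u 1; u 2, 0, -u 0; -u 1, u 0, 0]

/-- The vector of a skew matrix. -/
def vee (C : Matrix (Fin 3) (Fin 3) ℝ) : EuclideanSpace ℝ (Fin 3) := !₂[C 2 1, C 0 2, C 1 0]

theorem vee_hat (u : EuclideanSpace ℝ (Fin 3)) : vee (hat u) = u := by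
  ext i; fin_cases i <;> simp [vee, hat]

theorem hat_vee {C : Matrix (Fin 3) (Fin 3) ℝ} (hC : Cᵀ = -C) : hat (vee C) = C := by
  have h : ∀ i j, C j i = -C i j := fun i j => congrFun (congrFun hC i) j
  ext i j
  fin_cases i <;> fin_cases j <;> simp [vee, hat] <;> linarith [h 0 0, h 1 1, h 2 2, h 0 1, h 0 2, h 1 2]

theorem hat_transpose (u : EuclideanSpace ℝ (Fin 3)) : (hat u)ᵀ = -hat u := by
  ext i j; fin_cases i <;> fin_cases j <;> simp [hat]

theorem det_one_sub_hat (u : EuclideanSpace ℝ (Fin 3)) : (1 - hat u).det ≠ 0 := by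
  have : (1 - hat u).det = 1 + u 0 ^ 2 + u 1 ^ 2 + u 2 ^ 2 := by
    rw [Matrix.det_fin_three]; simp [hat]; ring
  rw [this]; positivity

/-- The Cayley transform. -/
def cayley (u : EuclideanSpace ℝ (Fin 3)) : SO3 :=
  SO3.mk ((1 + hat u) * (1 - hat u)⁻¹)
    (by
      have hu : IsUnit (1 - hat u).det := isUnit_iff_ne_zero.2 (det_one_sub_hat u)
      have ht : (1 + hat u)ᵀ = 1 - hat u := by
        rw [Matrix.transpose_add, hat_transpose, Matrix.transpose_one, sub_eq_add_neg]
      have ht' : (1 - hat u)ᵀ = 1 + hat u := by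
        rw [Matrix.transpose_sub, hat_transpose, Matrix.transpose_one, sub_neg_eq_add]
      have hu' : IsUnit (1 + hat u).det := by rwa [← ht', Matrix.det_transpose]
      have hc : (1 - hat u) * (1 + hat u) = (1 + hat u) * (1 - hat u) := by noncomm_ring
      rw [Matrix.transpose_mul, Matrix.transpose_nonsing_inv, ht, ht']
      calc (1 + hat u)⁻¹ * (1 - hat u) * ((1 + hat u) * (1 - hat u)⁻¹)
          = (1 + hat u)⁻¹ * ((1 - hat u) * (1 + hat u)) * (1 - hat u)⁻¹ := by
            simp only [Matrix.mul_assoc]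
        _ = ((1 + hat u)⁻¹ * (1 + hat u)) * ((1 - hat u) * (1 - hat u)⁻¹) := by
            rw [hc]; simp only [Matrix.mul_assoc]
        _ = 1 := by
            rw [Matrix.nonsing_inv_mul _ hu', Matrix.mul_nonsing_inv _ hu, Matrix.one_mul])
    (by
      have ht' : (1 - hat u)ᵀ = 1 + hat u := by
        rw [Matrix.transpose_sub, hat_transpose, Matrix.transpose_one, sub_neg_eq_add]
      rw [Matrix.det_mul, ← ht', Matrix.det_transpose, Matrix.det_nonsing_inv,
        Ring.mul_inverse_cancel _ (isUnit_iff_ne_zero.2 (det_one_sub_hat u))])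

/-- With `cayley_sub_one` this shows that `-1` is not an eigenvalue of a Cayley transform `Q`, and
that `hat u = (Q - 1)(Q + 1)⁻¹` recovers `u`. -/
theorem cayley_add_one (u : EuclideanSpace ℝ (Fin 3)) :
    (cayley u).1 + 1 = (2 : ℝ) • (1 - hat u)⁻¹ := by
  have hu : IsUnit (1 - hat u).det := isUnit_iff_ne_zero.2 (det_one_sub_hat u)
  calc (cayley u).1 + 1 = (1 + hat u) * (1 - hat u)⁻¹ + (1 - hat u) * (1 - hat u)⁻¹ := by
        rw [Matrix.mul_nonsing_inv _ hu]; rfl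
    _ = ((1 + hat u) + (1 - hat u)) * (1 - hat u)⁻¹ := (Matrix.add_mul _ _ _).symm
    _ = (2 : ℝ) • (1 - hat u)⁻¹ := by
        rw [show (1 + hat u) + (1 - hat u) = (2 : ℝ) • 1 by rw [two_smul]; abel,
          Matrix.smul_mul, Matrix.one_mul]

theorem cayley_sub_one (u : EuclideanSpace ℝ (Fin 3)) :
    (cayley u).1 - 1 = hat u * ((cayley u).1 + 1) := by
  have hu : IsUnit (1 - hat u).det := isUnit_iff_ne_zero.2 (det_one_sub_hat u)
  calc (cayley u).1 - 1 = (1 + hat u) * (1 - hat u)⁻¹ - (1 - hat u) * (1 - hat u)⁻¹ := by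
        rw [Matrix.mul_nonsing_inv _ hu]; rfl
    _ = ((1 + hat u) - (1 - hat u)) * (1 - hat u)⁻¹ := (Matrix.sub_mul _ _ _).symm
    _ = hat u * ((cayley u).1 + 1) := by
        rw [cayley_add_one, show (1 + hat u) - (1 - hat u) = (2 : ℝ) • hat u by rw [two_smul]; abel,
          Matrix.smul_mul, Matrix.mul_smul]

theorem det_cayley_add_one (u : EuclideanSpace ℝ (Fin 3)) : ((cayley u).1 + 1).det ≠ 0 := by
  rw [cayley_add_one, Matrix.det_smul, Matrix.det_nonsing_inv, Ring.inverse_eq_inv']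
  exact mul_ne_zero (by positivity) (inv_ne_zero (det_one_sub_hat u))

/-- The inverse Cayley transform. -/
def cayleyInv (Q : Matrix (Fin 3) (Fin 3) ℝ) : EuclideanSpace ℝ (Fin 3) :=
  vee ((Q - 1) * (Q + 1)⁻¹)

theorem cayleyInv_cayley (u : EuclideanSpace ℝ (Fin 3)) : cayleyInv (cayley u).1 = u := by
  have hu : IsUnit ((cayley u).1 + 1).det := isUnit_iff_ne_zero.2 (det_cayley_add_one u)
  rw [cayleyInv, cayley_sub_one, Matrix.mul_assoc, Matrix.mul_nonsing_inv _ hu, Matrix.mul_one,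
    vee_hat]

/-- The matrix `C = (k - 1)(k + 1)⁻¹` is skew because `(k + 1)ᵀ (Cᵀ + C) (k + 1) = 2 (kᵀ k - 1) =
0`. Hence `vee` loses no information, and solving for `k` gives the Cayley transform of `C`. -/
theorem cayley_cayleyInv (k : SO3) (h : (k.1 + 1).det ≠ 0) : cayley (cayleyInv k.1) = k := by
  have hu : IsUnit (k.1 + 1).det := isUnit_iff_ne_zero.2 h
  obtain ⟨C, hC⟩ : ∃ C, C = (k.1 - 1) * (k.1 + 1)⁻¹ := ⟨_, rfl⟩
  have hCk : C * (k.1 + 1) = k.1 - 1 := by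
    rw [hC, Matrix.mul_assoc, Matrix.nonsing_inv_mul _ hu, Matrix.mul_one]
  have hskew : Cᵀ = -C := by
    have hut : IsUnit (k.1 + 1)ᵀ.det := by rwa [Matrix.det_transpose]
    have h1 : (k.1 + 1)ᵀ * (Cᵀ + C) * (k.1 + 1) = 0 := by
      calc (k.1 + 1)ᵀ * (Cᵀ + C) * (k.1 + 1)
          = (C * (k.1 + 1))ᵀ * (k.1 + 1) + (k.1 + 1)ᵀ * (C * (k.1 + 1)) := by
            rw [Matrix.transpose_mul, Matrix.mul_add _ Cᵀ C, Matrix.add_mul]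
            simp only [Matrix.mul_assoc]
        _ = (2 : ℝ) • (k.1ᵀ * k.1 - 1) := by
            rw [hCk, Matrix.transpose_sub, Matrix.transpose_add, Matrix.transpose_one, two_smul]
            noncomm_ring
        _ = 0 := by rw [k.transpose_mul_self]; simp
    have h2 : Cᵀ + C = 0 := by
      calc Cᵀ + C = ((k.1 + 1)ᵀ⁻¹ * (k.1 + 1)ᵀ) * (Cᵀ + C) * ((k.1 + 1) * (k.1 + 1)⁻¹) := by
            rw [Matrix.nonsing_inv_mul _ hut, Matrix.mul_nonsing_inv _ hu, Matrix.one_mul,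
              Matrix.mul_one]
        _ = (k.1 + 1)ᵀ⁻¹ * ((k.1 + 1)ᵀ * (Cᵀ + C) * (k.1 + 1)) * (k.1 + 1)⁻¹ := by
            simp only [Matrix.mul_assoc]
        _ = 0 := by rw [h1]; simp
    exact eq_neg_of_add_eq_zero_left h2
  have hhat : hat (cayleyInv k.1) = C := by
    rw [cayleyInv, ← hC, hat_vee hskew]
  apply Subtype.ext
  change (1 + hat (cayleyInv k.1)) * (1 - hat (cayleyInv k.1))⁻¹ = k.1
  have hu2 : IsUnit (1 - hat (cayleyInv k.1)).det :=
    isUnit_iff_ne_zero.2 (det_one_sub_hat _)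
  have h3 : 1 + hat (cayleyInv k.1) = k.1 * (1 - hat (cayleyInv k.1)) := by
    rw [hhat]
    have h4 : (1 + C) * (k.1 + 1) = k.1 * (1 - C) * (k.1 + 1) := by
      rw [Matrix.mul_assoc, Matrix.add_mul, Matrix.sub_mul, hCk, Matrix.one_mul]
      noncomm_ring
    calc 1 + C = (1 + C) * (k.1 + 1) * (k.1 + 1)⁻¹ := by
          rw [Matrix.mul_assoc, Matrix.mul_nonsing_inv _ hu, Matrix.mul_one]
      _ = k.1 * (1 - C) := by
          rw [h4, Matrix.mul_assoc, Matrix.mul_nonsing_inv _ hu, Matrix.mul_one]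
  rw [h3, Matrix.mul_assoc, Matrix.mul_nonsing_inv _ hu2, Matrix.mul_one]

/-- The entries of a rotation. -/
def SO3.entries (k : SO3) (i j : Fin 3) : ℝ := k.1 i j

theorem SO3.isEmbedding_entries : IsEmbedding SO3.entries := IsEmbedding.subtypeVal

theorem contDiff_hat (i j : Fin 3) : ContDiff ℝ ∞ (fun u => hat u i j) := by
  have h : ∀ k : Fin 3, ContDiff ℝ ∞ (fun u : EuclideanSpace ℝ (Fin 3) => u k) := fun k =>
    (EuclideanSpace.proj (𝕜 := ℝ) k).contDiff
  fin_cases i <;> fin_cases j <;>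
    simp [hat] <;> first | exact contDiff_const | exact h _ | exact (h _).neg

theorem contDiffAt_cayleyInv {Q : Type*} [NormedAddCommGroup Q] [NormedSpace ℝ Q]
    {A : Q → Matrix (Fin 3) (Fin 3) ℝ} {q : Q}
    (hA : ∀ i j, ContDiffAt ℝ ∞ (fun r => A r i j) q) (h : (A q + 1).det ≠ 0) :
    ContDiffAt ℝ ∞ (fun r => cayleyInv (A r)) q := by
  have h1 : ∀ i j, ContDiffAt ℝ ∞ (fun r => ((A r - 1) * (A r + 1)⁻¹) i j) q :=
    contDiffAt_matrix_mul (fun i j => (hA i j).sub contDiffAt_const)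
      (contDiffAt_matrix_inv (fun i j => (hA i j).add contDiffAt_const) h)
  rw [contDiffAt_euclidean]
  intro i
  fin_cases i
  · exact h1 2 1
  · exact h1 0 2
  · exact h1 1 0

/-- The Cayley transform parametrizes a neighbourhood of each rotation. -/
def SO3.localParam (k₀ : SO3) : LocalParam 𝓘(ℝ, Fin 3 → Fin 3 → ℝ) (EuclideanSpace ℝ (Fin 3))
    SO3.entries k₀ where
  coord R := cayleyInv (k₀.1ᵀ * Matrix.of R)
  param u := k₀ * cayley u
  source := {R | (k₀.1ᵀ * Matrix.of R + 1).det ≠ 0}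
  target := univ
  isOpen_source := by
    have : Continuous fun R : Fin 3 → Fin 3 → ℝ => (k₀.1ᵀ * Matrix.of R + 1).det := by
      refine Continuous.matrix_det ?_
      refine ((continuous_const (y := k₀.1ᵀ)).matrix_mul (B := fun R => Matrix.of R) ?_).add continuous_const
      exact (continuous_id : Continuous fun R : Fin 3 → Fin 3 → ℝ => R)
    exact isOpen_ne.preimage this
  isOpen_target := isOpen_univ
  mem_source := by
    change (k₀.1ᵀ * k₀.1 + 1).det ≠ 0
    rw [k₀.transpose_mul_self, ← two_smul ℝ (1 : Matrix (Fin 3) (Fin 3) ℝ), Matrix.det_smul]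
    simp
  contMDiffOn_coord := by
    rw [contMDiffOn_iff_contDiffOn]
    intro R hR
    refine (contDiffAt_cayleyInv (A := fun R : Fin 3 → Fin 3 → ℝ => k₀.1ᵀ * Matrix.of R) (fun i j => ?_) hR).contDiffWithinAt
    simp only [Matrix.mul_apply, Matrix.of_apply]
    exact ContDiffAt.sum fun k _ => contDiffAt_const.mul (contDiff_apply_apply ℝ ℝ k j).contDiffAt
  contMDiffOn_param := by
    rw [contMDiffOn_iff_contDiffOn, contDiffOn_univ]
    refine contDiff_pi.2 fun i => contDiff_pi.2 fun j => contDiff_iff_contDiffAt.2 fun u => ?_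
    refine contDiffAt_matrix_mul (A := fun _ => k₀.1) (B := fun u => (cayley u).1)
      (fun _ _ => contDiffAt_const) ?_ i j
    refine contDiffAt_matrix_mul (A := fun u => 1 + hat u) (B := fun u => (1 - hat u)⁻¹)
      (fun i j => contDiffAt_const.add (contDiff_hat i j).contDiffAt)
      (contDiffAt_matrix_inv (fun i j => contDiffAt_const.sub (contDiff_hat i j).contDiffAt)
        (det_one_sub_hat u))
  coord_mem _ _ := mem_univ _
  param_mem u _ := by
    change (k₀.1ᵀ * (k₀.1 * (cayley u).1) + 1).det ≠ 0
    rw [← Matrix.mul_assoc, k₀.transpose_mul_self, Matrix.one_mul]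
    exact det_cayley_add_one u
  param_coord k hk := by
    change k₀ * cayley (cayleyInv (k₀⁻¹ * k).1) = k
    rw [cayley_cayleyInv (k₀⁻¹ * k) hk, mul_inv_cancel_left]
  coord_param u _ := by
    change cayleyInv (k₀.1ᵀ * (k₀.1 * (cayley u).1)) = u
    rw [← Matrix.mul_assoc, k₀.transpose_mul_self, Matrix.one_mul, cayleyInv_cayley]

/-- The smooth structure of the rotation group. -/
instance SO3.chartedSpace : ChartedSpace (EuclideanSpace ℝ (Fin 3)) SO3 :=
  LocalParam.chartedSpace SO3.isEmbedding_entries SO3.localParam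

instance SO3.isManifold : IsManifold (𝓡 3) ∞ SO3 :=
  LocalParam.isManifold SO3.isEmbedding_entries SO3.localParam

theorem SO3.isSmoothEmbedding_entries :
    IsSmoothEmbedding (𝓡 3) 𝓘(ℝ, Fin 3 → Fin 3 → ℝ) ∞ SO3.entries :=
  LocalParam.isSmoothEmbedding SO3.isEmbedding_entries SO3.localParam
    (by simp [Module.finrank_pi_fintype])

theorem SO3.contMDiff_entry (i j : Fin 3) :
    ContMDiff (𝓡 3) 𝓘(ℝ, ℝ) ∞ (fun k : SO3 => k.1 i j) :=
  (contDiff_apply_apply ℝ ℝ i j).contMDiff.comp SO3.isSmoothEmbedding_entries.contMDiff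

instance SO3.lieGroup : LieGroup (𝓡 3) ∞ SO3 where
  contMDiff_mul := by
    rw [ContMDiff.iff_comp_isImmersion SO3.isSmoothEmbedding_entries.isImmersion]
    refine ⟨continuous_mul, ?_⟩
    rw [contMDiff_pi_space]
    intro i
    rw [contMDiff_pi_space]
    intro j
    have : (fun x : SO3 × SO3 => (SO3.entries ∘ fun p : SO3 × SO3 => p.1 * p.2) x i j) =
        fun x => ∑ k, x.1.1 i k * x.2.1 k j := by
      funext x
      exact Matrix.mul_apply
    rw [this]
    exact contMDiff_finsetSum fun k _ => ((SO3.contMDiff_entry i k).comp contMDiff_fst).mul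
      ((SO3.contMDiff_entry k j).comp contMDiff_snd)
  contMDiff_inv := by
    rw [ContMDiff.iff_comp_isImmersion SO3.isSmoothEmbedding_entries.isImmersion]
    refine ⟨?_, ?_⟩
    · exact SO3.isEmbedding_entries.continuous_iff.2 (continuous_pi fun i => continuous_pi fun j =>
        (SO3.contMDiff_entry j i).continuous)
    rw [contMDiff_pi_space]
    intro i
    rw [contMDiff_pi_space]
    intro j
    exact SO3.contMDiff_entry j i

/-- The adjugate of a rotation is its transpose, so the sum of the principal `2 × 2` minors equals
the trace. The trace therefore decides whether a rotation lies in the range of the Cayley transform.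
-/
theorem SO3.det_add_one (k : SO3) : (k.1 + 1).det = 2 + 2 * k.1.trace := by
  have h1 : k.1.adjugate = k.1ᵀ := by
    calc k.1.adjugate = k.1ᵀ * (k.1 * k.1.adjugate) := by
          rw [← Matrix.mul_assoc, k.transpose_mul_self, Matrix.one_mul]
      _ = k.1ᵀ := by rw [Matrix.mul_adjugate, k.det_eq_one, one_smul, Matrix.mul_one]
  have h2 := k.det_eq_one
  rw [Matrix.adjugate_fin_three] at h1
  have h00 := congrFun (congrFun h1 0) 0
  have h11 := congrFun (congrFun h1 1) 1
  have h22 := congrFun (congrFun h1 2) 2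
  rw [Matrix.det_fin_three] at h2 ⊢
  simp [Matrix.trace_fin_three] at h00 h11 h22 h2 ⊢
  linear_combination h00 + h11 + h22 + h2

/-- Every rotation is a product of two Cayley transforms. -/
theorem SO3.exists_cayley_mul (k : SO3) : ∃ u v, k = cayley u * cayley v := by
  suffices h : ∃ g : SO3, g.1.trace ≠ -1 ∧ (g⁻¹ * k).1.trace ≠ -1 by
    obtain ⟨g, h1, h2⟩ := h
    have hd : ∀ l : SO3, l.1.trace ≠ -1 → (l.1 + 1).det ≠ 0 := by
      intro l hl h0
      rw [l.det_add_one] at h0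
      exact hl (by linarith)
    refine ⟨cayleyInv g.1, cayleyInv (g⁻¹ * k).1, ?_⟩
    rw [cayley_cayleyInv g (hd _ h1), cayley_cayleyInv _ (hd _ h2), mul_inv_cancel_left]
  by_contra! H
  -- Quarter turns about the three axes. If `g⁻¹ k` had trace `-1` for each of them and for their
  -- inverses, adding the two equations for one axis would give the diagonal entry `-1` of `k`. All
  -- three together give `k` the trace `-3`, while `g = 1` gives `-1`.
  let g1 : SO3 := SO3.mk !![0, -1, 0; 1, 0, 0; 0, 0, 1]
    (by ext i j; fin_cases i <;> fin_cases j <;> simp [Matrix.mul_apply, Fin.sum_univ_three])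
    (by simp [Matrix.det_fin_three])
  let g2 : SO3 := SO3.mk !![0, 0, -1; 0, 1, 0; 1, 0, 0]
    (by ext i j; fin_cases i <;> fin_cases j <;> simp [Matrix.mul_apply, Fin.sum_univ_three])
    (by simp [Matrix.det_fin_three])
  let g3 : SO3 := SO3.mk !![1, 0, 0; 0, 0, -1; 0, 1, 0]
    (by ext i j; fin_cases i <;> fin_cases j <;> simp [Matrix.mul_apply, Fin.sum_univ_three])
    (by simp [Matrix.det_fin_three])
  have e1 : g1.1.trace = 1 := by simp [g1, SO3.mk, Matrix.trace_fin_three]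
  have e2 : g2.1.trace = 1 := by simp [g2, SO3.mk, Matrix.trace_fin_three]
  have e3 : g3.1.trace = 1 := by simp [g3, SO3.mk, Matrix.trace_fin_three]
  have e0 : (1 : SO3).1.trace = 3 := by simp [Matrix.trace_one]
  have et : ∀ l : SO3, (l⁻¹).1.trace = l.1.trace := fun l => by
    rw [SO3.coe_inv, Matrix.trace_transpose]
  have f0 := H 1 (by rw [e0]; norm_num)
  have f1 := H g1 (by rw [e1]; norm_num)
  have f1' := H g1⁻¹ (by rw [et, e1]; norm_num)
  have f2 := H g2 (by rw [e2]; norm_num)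
  have f2' := H g2⁻¹ (by rw [et, e2]; norm_num)
  have f3 := H g3 (by rw [e3]; norm_num)
  have f3' := H g3⁻¹ (by rw [et, e3]; norm_num)
  have hval : ∀ l : SO3, (l⁻¹ * k).1 = l.1ᵀ * k.1 := fun l => rfl
  have hval' : ∀ l : SO3, (l⁻¹⁻¹ * k).1 = l.1 * k.1 := fun l => by rw [inv_inv]; rfl
  rw [inv_one, one_mul] at f0
  rw [hval] at f1 f2 f3
  rw [hval'] at f1' f2' f3'
  simp [g1, g2, g3, SO3.mk, Matrix.trace_fin_three, Matrix.mul_apply, Fin.sum_univ_three,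
    Matrix.vecMul, dotProduct]
    at f0 f1 f1' f2 f2' f3 f3'
  linarith

theorem continuous_cayley : Continuous cayley := by
  have h := (SO3.localParam 1).contMDiffOn_param.continuousOn
  rw [← SO3.isEmbedding_entries.continuousOn_iff] at h
  have h2 : (SO3.localParam 1).target = univ := rfl
  rw [h2, continuousOn_univ] at h
  simpa [SO3.localParam] using h

/-- Connectedness is what places the image of `SO(3)` in the identity component of the ambient
matrix group. -/
instance SO3.preconnectedSpace : PreconnectedSpace SO3 := by
  constructor
  have h : (univ : Set SO3) = (fun p : EuclideanSpace ℝ (Fin 3) × EuclideanSpace ℝ (Fin 3) =>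
      cayley p.1 * cayley p.2) '' univ := by
    refine (eq_univ_of_forall fun k => ?_).symm
    obtain ⟨u, v, rfl⟩ := k.exists_cayley_mul
    exact ⟨(u, v), mem_univ _, rfl⟩
  rw [h]
  exact isPreconnected_univ.image _
    ((continuous_cayley.comp continuous_fst).mul (continuous_cayley.comp continuous_snd)).continuousOn

end Rotations

/-! ### Functions that are smooth near a point -/

section SmoothNear

variable {X Y Z : Type*} [NormedAddCommGroup X] [NormedSpace ℝ X] [NormedAddCommGroup Y]
  [NormedSpace ℝ Y] [NormedAddCommGroup Z] [NormedSpace ℝ Z]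

/-- `h` is smooth in a neighbourhood of `q`. -/
def SmoothNear (h : X → Y) (q : X) : Prop := ∀ᶠ r in 𝓝 q, ContDiffAt ℝ ∞ h r

namespace SmoothNear

variable {h k : X → Y} {q : X}

theorem contDiffAt (hh : SmoothNear h q) : ContDiffAt ℝ ∞ h q := hh.self_of_nhds

theorem differentiableAt (hh : SmoothNear h q) : DifferentiableAt ℝ h q :=
  hh.contDiffAt.differentiableAt (by simp)

/-- Smoothness near a point spreads to all nearby points, so pointwise identities proved from it
hold on a neighbourhood and can be differentiated. -/
theorem eventually (hh : SmoothNear h q) : ∀ᶠ r in 𝓝 q, SmoothNear h r :=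
  eventually_eventually_nhds.2 hh

theorem congr (hh : SmoothNear h q) (e : k =ᶠ[𝓝 q] h) : SmoothNear k q := by
  filter_upwards [hh, eventually_eventually_nhds.2 e] with r hr er using hr.congr_of_eventuallyEq er

theorem fderiv (hh : SmoothNear h q) : SmoothNear (fderiv ℝ h) q :=
  hh.mono fun _ hr => hr.fderiv_right (by simp)

theorem comp {g : Z → X} {p : Z} (hh : SmoothNear h (g p)) (hg : SmoothNear g p) :
    SmoothNear (fun z => h (g z)) p := by
  filter_upwards [hg.contDiffAt.continuousAt.eventually hh, hg] with r h1 h2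
  exact ContDiffAt.comp r h1 h2

theorem of_contDiff (hh : ContDiff ℝ ∞ h) : SmoothNear h q :=
  Eventually.of_forall fun _ => hh.contDiffAt

theorem clm_apply {c : X → Y →L[ℝ] Z} {u : X → Y} (hc : SmoothNear c q) (hu : SmoothNear u q) :
    SmoothNear (fun r => c r (u r)) q := by
  filter_upwards [hc, hu] with r h1 h2 using h1.clm_apply h2

theorem const (c : Y) : SmoothNear (fun _ : X => c) q := of_contDiff contDiff_const

theorem dir (hh : SmoothNear h q) (v : X) : SmoothNear (fun r => _root_.fderiv ℝ h r v) q :=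
  hh.fderiv.clm_apply (const v)

theorem prodMk {g : X → Z} (hh : SmoothNear h q) (hg : SmoothNear g q) :
    SmoothNear (fun r => (h r, g r)) q := by
  filter_upwards [hh, hg] with r h1 h2 using h1.prodMk h2

theorem mul {f g : X → ℝ} (hf : SmoothNear f q) (hg : SmoothNear g q) :
    SmoothNear (fun r => f r * g r) q := by
  filter_upwards [hf, hg] with r h1 h2 using h1.mul h2

theorem add {f g : X → Y} (hf : SmoothNear f q) (hg : SmoothNear g q) :
    SmoothNear (fun r => f r + g r) q := by
  filter_upwards [hf, hg] with r h1 h2 using h1.add h2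

theorem sub {f g : X → Y} (hf : SmoothNear f q) (hg : SmoothNear g q) :
    SmoothNear (fun r => f r - g r) q := by
  filter_upwards [hf, hg] with r h1 h2 using h1.sub h2

theorem sum {ι : Type*} [Fintype ι] {f : ι → X → Y} (hf : ∀ i, SmoothNear (f i) q) :
    SmoothNear (fun r => ∑ i, f i r) q := by
  filter_upwards [eventually_all.2 hf] with r h using ContDiffAt.sum fun i _ => h i

theorem matrix_inv {n : Type*} [Fintype n] [DecidableEq n] {A : X → Matrix n n ℝ}
    (hA : ∀ i j, SmoothNear (fun r => A r i j) q) (h : (A q).det ≠ 0) (i j : n) :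
    SmoothNear (fun r => (A r)⁻¹ i j) q := by
  have hd : ∀ᶠ r in 𝓝 q, (A r).det ≠ 0 :=
    (contDiffAt_matrix_det fun i j => (hA i j).contDiffAt).continuousAt.eventually_ne h
  filter_upwards [hd, eventually_all.2 fun i => eventually_all.2 (hA i)] with r h1 h2
  exact contDiffAt_matrix_inv h2 h1 i j

end SmoothNear

variable {h : X → ℝ} {q : X}

theorem fderiv_fderiv_apply (hh : SmoothNear h q) (u v : X) :
    fderiv ℝ (fun r => fderiv ℝ h r v) q u = fderiv ℝ (fderiv ℝ h) q u v := by
  have := (hh.fderiv.differentiableAt.hasFDerivAt.clm_apply (hasFDerivAt_const v q)).fderiv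
  rw [this]; simp

theorem fderiv_fderiv_comm {h : X → Y} (hh : SmoothNear h q) (u v : X) :
    fderiv ℝ (fderiv ℝ h) q u v = fderiv ℝ (fderiv ℝ h) q v u :=
  (hh.contDiffAt.isSymmSndFDerivAt (by simp; exact WithTop.coe_le_coe.2 le_top)).eq u v

theorem dir_comm (hh : SmoothNear h q) (u v : X) :
    fderiv ℝ (fun r => fderiv ℝ h r v) q u = fderiv ℝ (fun r => fderiv ℝ h r u) q v := by
  rw [fderiv_fderiv_apply hh, fderiv_fderiv_apply hh, fderiv_fderiv_comm hh]

end SmoothNear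

/-! ### Homogeneous functions -/

section Homogeneous

/-- `h` is multiplied by `m c` when the fiber coordinate is multiplied by `c > 0`. -/
def FiberHomogeneous (m : ℝ → ℝ) (h : E4 × E4 → ℝ) : Prop :=
  ∀ (x y : E4) (c : ℝ), 0 < c → h (x, c • y) = m c * h (x, y)

/-- Scaling of the fiber coordinate. -/
def fiberScale (c : ℝ) (hc : c ≠ 0) : (E4 × E4) ≃L[ℝ] (E4 × E4) :=
  (ContinuousLinearEquiv.refl ℝ E4).prodCongr (ContinuousLinearEquiv.smulLeft (Units.mk0 c hc))

theorem FiberHomogeneous.congr {m m' : ℝ → ℝ} {h : E4 × E4 → ℝ} (hh : FiberHomogeneous m h)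
    (e : ∀ c, 0 < c → m c = m' c) : FiberHomogeneous m' h := fun x y c hc => by
  rw [hh x y c hc, e c hc]

/-- The homogeneity relation is differentiated. This is valid for every function, since `fderiv`
commutes with precomposition by a linear isomorphism and with multiplication by a real constant. -/
theorem FiberHomogeneous.fderiv_eq {m : ℝ → ℝ} {h : E4 × E4 → ℝ} (hh : FiberHomogeneous m h)
    (x y : E4) {c : ℝ} (hc : 0 < c) (v : E4 × E4) :
    fderiv ℝ h (x, c • y) (v.1, c • v.2) = m c * fderiv ℝ h (x, y) v := by
  have e : h ∘ fiberScale c hc.ne' = fun q => m c * h q := by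
    funext q
    exact hh q.1 q.2 c hc
  have h1 : fderiv ℝ (h ∘ fiberScale c hc.ne') (x, y) =
      (fderiv ℝ h (fiberScale c hc.ne' (x, y))).comp (fiberScale c hc.ne' : _ →L[ℝ] _) :=
    (fiberScale c hc.ne').comp_right_fderiv
  have h2 : fderiv ℝ (fun q => m c * h q) (x, y) = m c • fderiv ℝ h (x, y) :=
    congrFun (fderiv_const_smul_field (𝕜 := ℝ) (m c) (f := h)) (x, y)
  rw [e, h2] at h1
  have := congrArg (fun l : (E4 × E4) →L[ℝ] ℝ => l v) h1
  exact this.symm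

theorem FiberHomogeneous.dir_vertical {m : ℝ → ℝ} {h : E4 × E4 → ℝ} (hh : FiberHomogeneous m h)
    (w : E4) : FiberHomogeneous (fun c => m c / c) (fun q => fderiv ℝ h q (0, w)) := by
  intro x y c hc
  have h1 := hh.fderiv_eq x y hc (0, c⁻¹ • w)
  simp only [smul_smul, mul_inv_cancel₀ hc.ne', one_smul] at h1
  change fderiv ℝ h (x, c • y) (0, w) = m c / c * fderiv ℝ h (x, y) (0, w)
  rw [h1]
  have h2 : ((0 : E4), c⁻¹ • w) = c⁻¹ • ((0 : E4), w) := by simp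
  rw [h2, map_smul, smul_eq_mul]
  ring

theorem FiberHomogeneous.dir_base {m : ℝ → ℝ} {h : E4 × E4 → ℝ} (hh : FiberHomogeneous m h)
    (w : E4) : FiberHomogeneous m (fun q => fderiv ℝ h q (w, 0)) := by
  intro x y c hc
  have h1 := hh.fderiv_eq x y hc (w, 0)
  simpa using h1

/-- Euler's identity. -/
theorem FiberHomogeneous.euler {m : ℝ → ℝ} {h : E4 × E4 → ℝ} (hh : FiberHomogeneous m h)
    {κ : ℝ} (hm : HasDerivAt m κ 1) {q : E4 × E4} (hq : DifferentiableAt ℝ h q) :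
    fderiv ℝ h q (0, q.2) = κ * h q := by
  have h1 : HasDerivAt (fun c : ℝ => (q.1, c • q.2)) (0, q.2) 1 := by
    have := (hasDerivAt_const (1 : ℝ) q.1).prodMk ((hasDerivAt_id (1 : ℝ)).smul_const q.2)
    simpa using this
  have h2 : HasDerivAt (fun c : ℝ => h (q.1, c • q.2)) (fderiv ℝ h q (0, q.2)) 1 := by
    refine HasFDerivAt.comp_hasDerivAt (l := h) (1 : ℝ) ?_ h1
    simpa using hq.hasFDerivAt
  have h3 : HasDerivAt (fun c : ℝ => h (q.1, c • q.2)) (κ * h q) 1 := by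
    refine (hm.mul_const (h q)).congr_of_eventuallyEq ?_
    filter_upwards [lt_mem_nhds (zero_lt_one' ℝ)] with c hc using hh q.1 q.2 c hc
  exact h2.unique h3

end Homogeneous

/-! ### The Finsler metric and the Cartan linear connection without indices -/

section LocalConnection

theorem stdVec_apply (a b : Fin 4) : stdVec a b = if b = a then 1 else 0 := by
  simp [stdVec]

theorem sum_smul_stdVec (u : E4) : ∑ a, u a • stdVec a = u := by
  ext b
  simp [stdVec_apply]

theorem clm_eq_sum {Y : Type*} [NormedAddCommGroup Y] [NormedSpace ℝ Y] (κ : E4 →L[ℝ] Y) (w : E4) :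
    κ w = ∑ a, w a • κ (stdVec a) := by
  conv_lhs => rw [← sum_smul_stdVec w]
  simp

variable {Φ : E4 × E4 → ℝ} {q : E4 × E4}

/-- The Finsler metric as a bilinear form. -/
def gForm (Φ : E4 × E4 → ℝ) (q : E4 × E4) : E4 →L[ℝ] E4 →L[ℝ] ℝ :=
  (1 / 2 : ℝ) • (fderiv ℝ (fderiv ℝ Φ) q).bilinearComp (ContinuousLinearMap.inr ℝ E4 E4)
    (ContinuousLinearMap.inr ℝ E4 E4)

theorem gForm_apply (u v : E4) :
    gForm Φ q u v = (1 / 2) * fderiv ℝ (fderiv ℝ Φ) q (0, u) (0, v) := rfl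

theorem gForm_eq_dir (hΦ : SmoothNear Φ q) (u v : E4) :
    gForm Φ q u v = (1 / 2) * fderiv ℝ (fun r => fderiv ℝ Φ r (0, v)) q (0, u) := by
  rw [fderiv_fderiv_apply hΦ, gForm_apply]

theorem gForm_comm (hΦ : SmoothNear Φ q) (u v : E4) : gForm Φ q u v = gForm Φ q v u := by
  rw [gForm_apply, gForm_apply, fderiv_fderiv_comm hΦ]

theorem metricCoef_eq (hΦ : SmoothNear Φ q) (a b : Fin 4) :
    metricCoef Φ q a b = gForm Φ q (stdVec a) (stdVec b) := by
  rw [gForm_eq_dir hΦ]; rfl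

theorem metricCoef_transpose (hΦ : SmoothNear Φ q) : (metricCoef Φ q)ᵀ = metricCoef Φ q := by
  ext a b
  rw [Matrix.transpose_apply, metricCoef_eq hΦ, metricCoef_eq hΦ, gForm_comm hΦ]

theorem gForm_eq_sum (hΦ : SmoothNear Φ q) (u v : E4) :
    gForm Φ q u v = ∑ a, ∑ b, u a * v b * metricCoef Φ q a b := by
  rw [clm_eq_sum (gForm Φ q) u]
  simp only [_root_.sum_apply, _root_.smul_apply, smul_eq_mul]
  refine Finset.sum_congr rfl fun a _ => ?_
  rw [clm_eq_sum (gForm Φ q (stdVec a)) v, Finset.mul_sum]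
  refine Finset.sum_congr rfl fun b _ => ?_
  rw [metricCoef_eq hΦ, smul_eq_mul, mul_assoc]

/-- Non-degeneracy of the metric. Vectors that are defined by raising an index are compared below by
pairing them with an arbitrary `w`, so inverse matrices need not be manipulated. -/
theorem eq_of_gForm_eq (hΦ : SmoothNear Φ q) (hdet : (metricCoef Φ q).det ≠ 0) {u v : E4}
    (h : ∀ w, gForm Φ q u w = gForm Φ q v w) : u = v := by
  have h1 : (fun a => (u - v) a) ᵥ* metricCoef Φ q = 0 := by
    funext b
    have h2 : gForm Φ q (u - v) (stdVec b) = 0 := by rw [map_sub, _root_.sub_apply, h, sub_self]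
    rw [gForm_eq_sum hΦ] at h2
    simp only [stdVec_apply] at h2
    simpa [Matrix.vecMul, dotProduct] using h2
  have h3 := Matrix.eq_zero_of_vecMul_eq_zero hdet h1
  ext a
  have := congrFun h3 a
  simpa [sub_eq_zero] using this

theorem smoothNear_gForm (hΦ : SmoothNear Φ q) : SmoothNear (gForm Φ) q := by
  have : gForm Φ = fun r => ((1 / 2 : ℝ) • ((ContinuousLinearMap.compL ℝ E4 (E4 × E4) ℝ).flip
      (ContinuousLinearMap.inr ℝ E4 E4)).comp
        ((fderiv ℝ (fderiv ℝ Φ) r).comp (ContinuousLinearMap.inr ℝ E4 E4))) := by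
    funext r
    ext u v
    simp [gForm]
  rw [this]
  filter_upwards [hΦ.fderiv.fderiv] with r hr
  exact (contDiffAt_const.clm_comp (hr.clm_comp contDiffAt_const)).const_smul _

theorem smoothNear_metricCoef (hΦ : SmoothNear Φ q) (a b : Fin 4) :
    SmoothNear (fun r => metricCoef Φ r a b) q := by
  refine ((smoothNear_gForm hΦ).clm_apply (SmoothNear.const (stdVec a))).clm_apply
    (SmoothNear.const (stdVec b)) |>.congr ?_
  filter_upwards [hΦ.eventually] with r hr using metricCoef_eq hr a b

theorem eventually_det_ne_zero (hΦ : SmoothNear Φ q) (hdet : (metricCoef Φ q).det ≠ 0) :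
    ∀ᶠ r in 𝓝 q, (metricCoef Φ r).det ≠ 0 :=
  (contDiffAt_matrix_det fun i j =>
    (smoothNear_metricCoef hΦ i j).contDiffAt).continuousAt.eventually_ne hdet

/-- The vector that corresponds to a covector by means of the metric. -/
def raise (Φ : E4 × E4 → ℝ) (q : E4 × E4) (κ : E4 →L[ℝ] ℝ) : E4 :=
  WithLp.toLp 2 fun a => ∑ d, (metricCoef Φ q)⁻¹ a d * κ (stdVec d)

theorem raise_apply (κ : E4 →L[ℝ] ℝ) (a : Fin 4) :
    raise Φ q κ a = ∑ d, (metricCoef Φ q)⁻¹ a d * κ (stdVec d) := rfl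

theorem gForm_raise (hΦ : SmoothNear Φ q) (hdet : (metricCoef Φ q).det ≠ 0) (κ : E4 →L[ℝ] ℝ)
    (w : E4) : gForm Φ q (raise Φ q κ) w = κ w := by
  set g := metricCoef Φ q with hg
  have hinv : ∀ e d, ∑ a, g⁻¹ a d * g a e = if e = d then 1 else 0 := by
    intro e d
    have h1 : g * g⁻¹ = 1 := Matrix.mul_nonsing_inv _ (isUnit_iff_ne_zero.2 hdet)
    have h2 := congrFun (congrFun h1 e) d
    rw [Matrix.mul_apply, Matrix.one_apply] at h2
    rw [← h2]
    refine Finset.sum_congr rfl fun a _ => ?_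
    have h3 : g a e = g e a := congrFun (congrFun (metricCoef_transpose hΦ) e) a
    rw [h3, mul_comm]
  rw [gForm_eq_sum hΦ, clm_eq_sum κ w]
  rw [Finset.sum_comm]
  refine Finset.sum_congr rfl fun e _ => ?_
  calc ∑ a, raise Φ q κ a * w e * g a e
      = ∑ a, ∑ d, w e * κ (stdVec d) * (g⁻¹ a d * g a e) := by
        refine Finset.sum_congr rfl fun a _ => ?_
        rw [raise_apply, Finset.sum_mul, Finset.sum_mul]
        refine Finset.sum_congr rfl fun d _ => ?_
        rw [← hg]; ring
    _ = ∑ d, w e * κ (stdVec d) * ∑ a, g⁻¹ a d * g a e := by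
        rw [Finset.sum_comm]
        simp only [Finset.mul_sum]
    _ = w e • κ (stdVec e) := by simp [hinv]

/-- The covector `y^d ∂_d ∂̄_c F² - ∂_c F²`. -/
def sprayCovector (Φ : E4 × E4 → ℝ) (q : E4 × E4) : E4 →L[ℝ] ℝ :=
  (fderiv ℝ (fderiv ℝ Φ) q (q.2, 0)).comp (ContinuousLinearMap.inr ℝ E4 E4) -
    (fderiv ℝ Φ q).comp (ContinuousLinearMap.inl ℝ E4 E4)

theorem sprayCovector_apply (w : E4) :
    sprayCovector Φ q w = fderiv ℝ (fderiv ℝ Φ) q (q.2, 0) (0, w) - fderiv ℝ Φ q (w, 0) := rfl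

/-- The spray coefficients `G^a = ¼ g^ac (y^d ∂_d ∂̄_c F² - ∂_c F²)`. -/
def sprayVec (Φ : E4 × E4 → ℝ) (q : E4 × E4) : E4 :=
  (1 / 4 : ℝ) • raise Φ q (sprayCovector Φ q)

theorem gForm_sprayVec (hΦ : SmoothNear Φ q) (hdet : (metricCoef Φ q).det ≠ 0) (w : E4) :
    4 * gForm Φ q (sprayVec Φ q) w =
      fderiv ℝ (fderiv ℝ Φ) q (q.2, 0) (0, w) - fderiv ℝ Φ q (w, 0) := by
  rw [sprayVec, map_smul, _root_.smul_apply, gForm_raise hΦ hdet, sprayCovector_apply, smul_eq_mul]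
  ring

theorem base_eq_sum (y : E4) : ((y, 0) : E4 × E4) = ∑ d, y d • ((stdVec d, 0) : E4 × E4) := by
  conv_lhs => rw [← sum_smul_stdVec y]
  refine Prod.ext ?_ ?_ <;> simp [Prod.fst_sum, Prod.snd_sum]

theorem vertical_eq_sum (y : E4) : ((0, y) : E4 × E4) = ∑ d, y d • ((0, stdVec d) : E4 × E4) := by
  conv_lhs => rw [← sum_smul_stdVec y]
  refine Prod.ext ?_ ?_ <;> simp [Prod.fst_sum, Prod.snd_sum]

theorem sprayVec_apply (hΦ : SmoothNear Φ q) (a : Fin 4) :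
    sprayVec Φ q a = (1 / 4) * ∑ c, (metricCoef Φ q)⁻¹ a c *
      ((∑ d, q.2 d * pdx d (pdy c Φ) q) - pdx c Φ q) := by
  have : ∀ c, sprayCovector Φ q (stdVec c) = (∑ d, q.2 d * pdx d (pdy c Φ) q) - pdx c Φ q := by
    intro c
    rw [sprayCovector_apply, base_eq_sum q.2]
    simp only [map_sum, map_smul, _root_.sum_apply, _root_.smul_apply, smul_eq_mul]
    congr 1
    refine Finset.sum_congr rfl fun d _ => ?_
    rw [← fderiv_fderiv_apply hΦ]; rfl
  simp only [sprayVec, PiLp.smul_apply, raise_apply, this, smul_eq_mul]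

theorem smoothNear_euclidean {f : E4 × E4 → E4} (h : ∀ a, SmoothNear (fun r => f r a) q) :
    SmoothNear f q := by
  filter_upwards [eventually_all.2 h] with r hr using contDiffAt_euclidean.2 hr

theorem smoothNear_raise {κ : E4 × E4 → E4 →L[ℝ] ℝ} (hΦ : SmoothNear Φ q)
    (hdet : (metricCoef Φ q).det ≠ 0) (hκ : SmoothNear κ q) :
    SmoothNear (fun r => raise Φ r (κ r)) q := by
  refine smoothNear_euclidean fun a => ?_
  simp only [raise_apply]
  refine SmoothNear.sum fun d => ?_
  exact (SmoothNear.matrix_inv (smoothNear_metricCoef hΦ) hdet a d).mul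
    (hκ.clm_apply (SmoothNear.const _))

theorem smoothNear_sprayVec (hΦ : SmoothNear Φ q) (hdet : (metricCoef Φ q).det ≠ 0) :
    SmoothNear (sprayVec Φ) q := by
  have h1 : SmoothNear (sprayCovector Φ) q := by
    have h2 := hΦ.fderiv.fderiv
    filter_upwards [h2, hΦ.fderiv] with r h3 h4
    exact ((h3.clm_apply (contDiffAt_snd.prodMk contDiffAt_const)).clm_comp contDiffAt_const).sub
      (h4.clm_comp contDiffAt_const)
  have h5 := smoothNear_raise hΦ hdet h1
  filter_upwards [h5] with r h6 using h6.const_smul _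

/-- The non-linear connection as a linear map. -/
def nMap (Φ : E4 × E4 → ℝ) (q : E4 × E4) : E4 →L[ℝ] E4 :=
  (fderiv ℝ (sprayVec Φ) q).comp (ContinuousLinearMap.inr ℝ E4 E4)

theorem nMap_apply (u : E4) : nMap Φ q u = fderiv ℝ (sprayVec Φ) q (0, u) := rfl

theorem fderiv_coord {f : E4 × E4 → E4} (hf : DifferentiableAt ℝ f q) (v : E4 × E4) (a : Fin 4) :
    fderiv ℝ (fun r => f r a) q v = fderiv ℝ f q v a := by
  have := ((EuclideanSpace.proj (𝕜 := ℝ) a).hasFDerivAt.comp q hf.hasFDerivAt).fderiv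
  exact congrArg (fun l : (E4 × E4) →L[ℝ] ℝ => l v) this

theorem nonlinCoef_eq (hΦ : SmoothNear Φ q) (hdet : (metricCoef Φ q).det ≠ 0) (a b : Fin 4) :
    nonlinCoef Φ a b q = nMap Φ q (stdVec b) a := by
  have h1 := smoothNear_sprayVec hΦ hdet
  rw [nMap_apply, ← fderiv_coord h1.differentiableAt]
  have h2 : (fun r => sprayVec Φ r a) =ᶠ[𝓝 q] fun r => (1 / 4 : ℝ) * ∑ c, (metricCoef Φ r)⁻¹ a c *
      ((∑ d, r.2 d * pdx d (pdy c Φ) r) - pdx c Φ r) := by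
    filter_upwards [hΦ.eventually] with r hr using sprayVec_apply hr a
  rw [h2.fderiv_eq]
  have h3 := congrFun (fderiv_const_smul_field (𝕜 := ℝ) (1 / 4 : ℝ)
    (f := fun r : E4 × E4 => ∑ c, (metricCoef Φ r)⁻¹ a c *
      ((∑ d, r.2 d * pdx d (pdy c Φ) r) - pdx c Φ r))) q
  have h4 := congrArg (fun l : (E4 × E4) →L[ℝ] ℝ => l (0, stdVec b)) h3
  exact h4.symm

theorem sum_nonlinCoef (hΦ : SmoothNear Φ q) (hdet : (metricCoef Φ q).det ≠ 0) (a : Fin 4)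
    (u : E4) : ∑ b, nonlinCoef Φ a b q * u b = nMap Φ q u a := by
  rw [clm_eq_sum (nMap Φ q) u]
  simp [nonlinCoef_eq hΦ hdet, mul_comm]

/-- The lift of a vector that is horizontal for the non-linear connection. -/
def horLift (Φ : E4 × E4 → ℝ) (q : E4 × E4) : E4 →L[ℝ] E4 × E4 :=
  (ContinuousLinearMap.id ℝ E4).prod (-nMap Φ q)

theorem horLift_apply (u : E4) : horLift Φ q u = (u, -nMap Φ q u) := rfl

theorem horDeriv_eq (hΦ : SmoothNear Φ q) (hdet : (metricCoef Φ q).det ≠ 0) (a : Fin 4)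
    (h : E4 × E4 → ℝ) : horDeriv Φ a h q = fderiv ℝ h q (horLift Φ q (stdVec a)) := by
  have h1 : horLift Φ q (stdVec a) = (stdVec a, 0) - (0, nMap Φ q (stdVec a)) := by
    rw [horLift_apply]; simp
  rw [h1, vertical_eq_sum (nMap Φ q (stdVec a)), map_sub, map_sum, horDeriv]
  simp only [map_smul, smul_eq_mul, nonlinCoef_eq hΦ hdet]
  rfl

/-- The derivatives of the metric in the directions given by `V`. -/
def metricDeriv (Φ : E4 × E4 → ℝ) (q : E4 × E4) (V : E4 →L[ℝ] E4 × E4) :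
    E4 →L[ℝ] E4 →L[ℝ] E4 →L[ℝ] ℝ :=
  (fderiv ℝ (gForm Φ) q).comp V

theorem metricDeriv_eq (hΦ : SmoothNear Φ q) (V : E4 →L[ℝ] E4 × E4) (u v w : E4) :
    metricDeriv Φ q V u v w = fderiv ℝ (fun r => gForm Φ r v w) q (V u) := by
  have h1 := (smoothNear_gForm hΦ).differentiableAt.hasFDerivAt
  have h2 := ((h1.clm_apply (hasFDerivAt_const v q)).clm_apply (hasFDerivAt_const w q)).fderiv
  rw [h2]
  simp [metricDeriv]

theorem metricDeriv_comm (hΦ : SmoothNear Φ q) (V : E4 →L[ℝ] E4 × E4) (u v w : E4) :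
    metricDeriv Φ q V u v w = metricDeriv Φ q V u w v := by
  have : (fun r => gForm Φ r v w) =ᶠ[𝓝 q] fun r => gForm Φ r w v := by
    filter_upwards [hΦ.eventually] with r hr using gForm_comm hr v w
  rw [metricDeriv_eq hΦ, metricDeriv_eq hΦ, this.fderiv_eq]

/-- The covector of the Christoffel symbols of the directions given by `V`. -/
def chrCovector (Φ : E4 × E4 → ℝ) (q : E4 × E4) (V : E4 →L[ℝ] E4 × E4) (u v : E4) : E4 →L[ℝ] ℝ :=
  (1 / 2 : ℝ) • (metricDeriv Φ q V u v + metricDeriv Φ q V v u -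
    ((metricDeriv Φ q V).flip u).flip v)

theorem chrCovector_apply (V : E4 →L[ℝ] E4 × E4) (u v w : E4) :
    chrCovector Φ q V u v w = (1 / 2) * (metricDeriv Φ q V u v w + metricDeriv Φ q V v u w -
      metricDeriv Φ q V w u v) := rfl

/-- The Christoffel symbols of the directions given by `V`, applied to two vectors. -/
def chrVec (Φ : E4 × E4 → ℝ) (q : E4 × E4) (V : E4 →L[ℝ] E4 × E4) (u v : E4) : E4 :=
  raise Φ q (chrCovector Φ q V u v)

/-- The Koszul formula. With `V` the horizontal lift it describes the coefficients `F`, and with `V`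
the inclusion of the fiber the coefficients `C`, so both are treated at once. -/
theorem gForm_chrVec (hΦ : SmoothNear Φ q) (hdet : (metricCoef Φ q).det ≠ 0)
    (V : E4 →L[ℝ] E4 × E4) (u v w : E4) :
    gForm Φ q (chrVec Φ q V u v) w = (1 / 2) * (metricDeriv Φ q V u v w + metricDeriv Φ q V v u w -
      metricDeriv Φ q V w u v) := by
  rw [chrVec, gForm_raise hΦ hdet, chrCovector_apply]

theorem chrVec_comm (hΦ : SmoothNear Φ q) (hdet : (metricCoef Φ q).det ≠ 0)
    (V : E4 →L[ℝ] E4 × E4) (u v : E4) : chrVec Φ q V u v = chrVec Φ q V v u := by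
  refine eq_of_gForm_eq hΦ hdet fun w => ?_
  rw [gForm_chrVec hΦ hdet, gForm_chrVec hΦ hdet, metricDeriv_comm hΦ V w u v]
  ring

/-- The Christoffel symbols are compatible with the metric. -/
theorem metricDeriv_eq_chrVec (hΦ : SmoothNear Φ q) (hdet : (metricCoef Φ q).det ≠ 0)
    (V : E4 →L[ℝ] E4 × E4) (u v w : E4) :
    metricDeriv Φ q V u v w = gForm Φ q (chrVec Φ q V v u) w + gForm Φ q v (chrVec Φ q V w u) := by
  -- In the sum of the two Koszul formulas the derivatives in the directions of `v` and `w` cancel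
  -- by the symmetry of the metric.
  rw [gForm_comm hΦ v, gForm_chrVec hΦ hdet, gForm_chrVec hΦ hdet, metricDeriv_comm hΦ V u w v,
    metricDeriv_comm hΦ V w v u, metricDeriv_comm hΦ V v w u]
  ring

set_option synthInstance.maxHeartbeats 100000 in
theorem chrVec_eq_sum (V : E4 →L[ℝ] E4 × E4) (u v : E4) (a : Fin 4) :
    chrVec Φ q V u v a = ∑ b, u b * ∑ c, chrVec Φ q V (stdVec b) (stdVec c) a * v c := by
  have h1 : ∀ w, chrCovector Φ q V u v w =
      ∑ b, ∑ c, u b * v c * chrCovector Φ q V (stdVec b) (stdVec c) w := by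
    intro w
    simp only [chrCovector_apply]
    have e1 : ∀ b, metricDeriv Φ q V (stdVec b) v w =
        ∑ c, v c * metricDeriv Φ q V (stdVec b) (stdVec c) w := fun b => by
      conv_lhs => rw [← sum_smul_stdVec v]
      simp [_root_.sum_apply]
    have e2 : ∀ c, metricDeriv Φ q V (stdVec c) u w =
        ∑ b, u b * metricDeriv Φ q V (stdVec c) (stdVec b) w := fun b => by
      conv_lhs => rw [← sum_smul_stdVec u]
      simp [_root_.sum_apply]
    have e3 : ∀ b, metricDeriv Φ q V w (stdVec b) v =
        ∑ c, v c * metricDeriv Φ q V w (stdVec b) (stdVec c) := fun b => by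
      rw [clm_eq_sum (metricDeriv Φ q V w (stdVec b)) v]; simp
    have e4 : ∀ u v, metricDeriv Φ q V u v w = ∑ b, u b * metricDeriv Φ q V (stdVec b) v w :=
      fun u v => by
        conv_lhs => rw [← sum_smul_stdVec u]
        simp [_root_.sum_apply]
    have e5 : metricDeriv Φ q V w u v = ∑ b, u b * metricDeriv Φ q V w (stdVec b) v := by
      conv_lhs => rw [← sum_smul_stdVec u]
      simp [_root_.sum_apply]
    rw [e4 u v, e4 v u, e5]
    simp only [e1, e2, e3, Finset.mul_sum]
    rw [Finset.sum_comm (f := fun i j => v i * (u j * _)), ← Finset.sum_add_distrib,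
      ← Finset.sum_sub_distrib, Finset.mul_sum]
    refine Finset.sum_congr rfl fun b _ => ?_
    rw [← Finset.sum_add_distrib, ← Finset.sum_sub_distrib, Finset.mul_sum]
    refine Finset.sum_congr rfl fun c _ => ?_
    ring
  simp only [chrVec, raise_apply, h1, Finset.mul_sum, Finset.sum_mul]
  rw [Finset.sum_comm]
  refine Finset.sum_congr rfl fun b _ => ?_
  rw [Finset.sum_comm]
  refine Finset.sum_congr rfl fun c _ => Finset.sum_congr rfl fun d _ => ?_
  ring

theorem horCoef_eq (hΦ : SmoothNear Φ q) (hdet : (metricCoef Φ q).det ≠ 0) (a b c : Fin 4) :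
    horCoef Φ a b c q = chrVec Φ q (horLift Φ q) (stdVec b) (stdVec c) a := by
  have h1 : ∀ i j k, horDeriv Φ i (fun r => metricCoef Φ r j k) q =
      metricDeriv Φ q (horLift Φ q) (stdVec i) (stdVec j) (stdVec k) := by
    intro i j k
    have h2 : (fun r => metricCoef Φ r j k) =ᶠ[𝓝 q] fun r => gForm Φ r (stdVec j) (stdVec k) := by
      filter_upwards [hΦ.eventually] with r hr using metricCoef_eq hr j k
    rw [horDeriv_eq hΦ hdet, h2.fderiv_eq, metricDeriv_eq hΦ]
  simp only [horCoef, h1, chrVec, raise_apply, chrCovector_apply, Finset.mul_sum]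
  refine Finset.sum_congr rfl fun d _ => ?_
  ring

theorem verCoef_eq (hΦ : SmoothNear Φ q) (a b c : Fin 4) :
    verCoef Φ a b c q =
      chrVec Φ q (ContinuousLinearMap.inr ℝ E4 E4) (stdVec b) (stdVec c) a := by
  have h1 : ∀ i j k, pdy i (fun r => metricCoef Φ r j k) q =
      metricDeriv Φ q (ContinuousLinearMap.inr ℝ E4 E4) (stdVec i) (stdVec j) (stdVec k) := by
    intro i j k
    have h2 : (fun r => metricCoef Φ r j k) =ᶠ[𝓝 q] fun r => gForm Φ r (stdVec j) (stdVec k) := by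
      filter_upwards [hΦ.eventually] with r hr using metricCoef_eq hr j k
    rw [pdy, h2.fderiv_eq, metricDeriv_eq hΦ]; rfl
  simp only [verCoef, h1, chrVec, raise_apply, chrCovector_apply, Finset.mul_sum]
  refine Finset.sum_congr rfl fun d _ => ?_
  ring

/-- The horizontal coefficients of the Cartan linear connection, as a vector. -/
def hVec (Φ : E4 × E4 → ℝ) (q : E4 × E4) (u v : E4) : E4 := chrVec Φ q (horLift Φ q) u v

/-- The vertical coefficients of the Cartan linear connection, as a vector. -/
def cVec (Φ : E4 × E4 → ℝ) (q : E4 × E4) (u v : E4) : E4 :=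
  chrVec Φ q (ContinuousLinearMap.inr ℝ E4 E4) u v

theorem hVec_apply (hΦ : SmoothNear Φ q) (hdet : (metricCoef Φ q).det ≠ 0) (u v : E4) (a : Fin 4) :
    hVec Φ q u v a = ∑ b, u b * ∑ c, horCoef Φ a b c q * v c := by
  simp only [horCoef_eq hΦ hdet]
  exact chrVec_eq_sum _ u v a

theorem cVec_apply (hΦ : SmoothNear Φ q) (u v : E4) (a : Fin 4) :
    cVec Φ q u v a = ∑ b, u b * ∑ c, verCoef Φ a b c q * v c := by
  simp only [verCoef_eq hΦ]
  exact chrVec_eq_sum _ u v a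

/-- The covariant derivative of a leg, as a vector. -/
theorem covDerivLeg_eq (s v : FrameCoord) (hΦ : SmoothNear Φ (s.1, s.2 0))
    (hdet : (metricCoef Φ (s.1, s.2 0)).det ≠ 0) (i a : Fin 4) :
    covDerivLeg Φ s v i a = (v.2 i + hVec Φ (s.1, s.2 0) (s.2 i) v.1 +
      cVec Φ (s.1, s.2 0) (s.2 i) (nMap Φ (s.1, s.2 0) v.1 + v.2 0)) a := by
  simp only [covDerivLeg, PiLp.add_apply, hVec_apply hΦ hdet, cVec_apply hΦ,
    sum_nonlinCoef hΦ hdet, Finset.sum_add_distrib, mul_add, add_assoc]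

/-! ### Metric compatibility and homogeneity -/

/-- The Cartan linear connection is compatible with the metric. -/
theorem fderiv_gForm_eq (hΦ : SmoothNear Φ q) (hdet : (metricCoef Φ q).det ≠ 0)
    (dx dy u v : E4) :
    fderiv ℝ (fun r => gForm Φ r u v) q (dx, dy) =
      gForm Φ q (hVec Φ q u dx + cVec Φ q u (nMap Φ q dx + dy)) v +
      gForm Φ q u (hVec Φ q v dx + cVec Φ q v (nMap Φ q dx + dy)) := by
  -- The velocity is split into the horizontal lift of `dx` and a vertical remainder, which is `N dx
  -- + dy`. Each part is covered by one of the two kinds of Christoffel symbols.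
  have h1 : ((dx, dy) : E4 × E4) = horLift Φ q dx +
      ContinuousLinearMap.inr ℝ E4 E4 (nMap Φ q dx + dy) := by
    rw [horLift_apply]; simp
  rw [h1, map_add, ← metricDeriv_eq hΦ (horLift Φ q) dx u v,
    ← metricDeriv_eq hΦ (ContinuousLinearMap.inr ℝ E4 E4) _ u v,
    metricDeriv_eq_chrVec hΦ hdet, metricDeriv_eq_chrVec hΦ hdet]
  simp only [map_add, _root_.add_apply, hVec, cVec]
  ring

section Euler

theorem hom_dir (hom : FiberHomogeneous (fun c => c ^ 2) Φ)
    (w : E4) : FiberHomogeneous (fun c => c) (fun r => fderiv ℝ Φ r (0, w)) :=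
  (hom.dir_vertical w).congr fun c hc => by field_simp

theorem hom_dir_dir (hom : FiberHomogeneous (fun c => c ^ 2) Φ)
    (u w : E4) :
    FiberHomogeneous (fun _ => 1) (fun r => fderiv ℝ (fun s => fderiv ℝ Φ s (0, w)) r (0, u)) :=
  ((hom_dir hom w).dir_vertical u).congr fun c hc => by field_simp

/-- `y^a ∂̄_a g_bc = 0`. -/
theorem fderiv_gForm_radial (hom : FiberHomogeneous (fun c => c ^ 2) Φ)
    (hΦ : SmoothNear Φ q) (u w : E4) :
    fderiv ℝ (fun r => gForm Φ r u w) q (0, q.2) = 0 := by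
  have h1 : (fun r => gForm Φ r u w) =ᶠ[𝓝 q]
      fun r => (1 / 2 : ℝ) • fderiv ℝ (fun s => fderiv ℝ Φ s (0, w)) r (0, u) := by
    filter_upwards [hΦ.eventually] with r hr using gForm_eq_dir hr u w
  have h2 : DifferentiableAt ℝ (fun r => fderiv ℝ (fun s => fderiv ℝ Φ s (0, w)) r (0, u)) q :=
    ((hΦ.dir _).dir _).differentiableAt
  rw [h1.fderiv_eq, fderiv_fun_const_smul h2, _root_.smul_apply,
    (hom_dir_dir hom u w).euler (hasDerivAt_const 1 1) h2]
  simp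

/-- The fiber derivative of the metric is half of the third fiber derivative of `Φ`, hence symmetric
in all its arguments. -/
theorem fderiv_gForm_vertical_symm (hΦ : SmoothNear Φ q) (u v w : E4) :
    fderiv ℝ (fun r => gForm Φ r u w) q (0, v) = fderiv ℝ (fun r => gForm Φ r v w) q (0, u) := by
  have h1 : ∀ u : E4, (fun r => gForm Φ r u w) =ᶠ[𝓝 q]
      fun r => (1 / 2 : ℝ) • fderiv ℝ (fun s => fderiv ℝ Φ s (0, w)) r (0, u) := by
    intro u
    filter_upwards [hΦ.eventually] with r hr using gForm_eq_dir hr u w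
  have h2 : ∀ u : E4,
      DifferentiableAt ℝ (fun r => fderiv ℝ (fun s => fderiv ℝ Φ s (0, w)) r (0, u)) q :=
    fun u => ((hΦ.dir _).dir _).differentiableAt
  rw [(h1 u).fderiv_eq, (h1 v).fderiv_eq, fderiv_fun_const_smul (h2 u), fderiv_fun_const_smul (h2 v),
    _root_.smul_apply, _root_.smul_apply, dir_comm (hΦ.dir (0, w))]

/-- The metric is homogeneous of degree zero, so its derivative along `y` vanishes. By total
symmetry each of the three terms of the Koszul formula contains such a derivative. -/
theorem cVec_radial (hom : FiberHomogeneous (fun c => c ^ 2) Φ)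
    (hΦ : SmoothNear Φ q) (hdet : (metricCoef Φ q).det ≠ 0) (u : E4) :
    cVec Φ q q.2 u = 0 := by
  refine eq_of_gForm_eq hΦ hdet fun w => ?_
  rw [cVec, gForm_chrVec hΦ hdet]
  simp only [metricDeriv_eq hΦ, ContinuousLinearMap.inr_apply]
  have h1 : ∀ u w : E4, fderiv ℝ (fun r => gForm Φ r q.2 w) q (0, u) = 0 := fun u w => by
    rw [fderiv_gForm_vertical_symm hΦ, fderiv_gForm_radial hom hΦ]
  rw [h1, h1, fderiv_gForm_radial hom hΦ]
  simp

theorem sprayVec_homogeneous (hom : FiberHomogeneous (fun c => c ^ 2) Φ)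
    (x y : E4) (c : ℝ) (hc : 0 < c) (hΦ : SmoothNear Φ (x, y))
    (hΦ' : SmoothNear Φ (x, c • y)) :
    sprayVec Φ (x, c • y) = c ^ 2 • sprayVec Φ (x, y) := by
  ext a
  have h1 : metricCoef Φ (x, c • y) = metricCoef Φ (x, y) := by
    ext i j
    have := hom_dir_dir hom (stdVec i) (stdVec j) x y c hc
    simp only [one_mul] at this
    simp only [metricCoef, Matrix.of_apply]
    exact congrArg _ this
  have h2 : ∀ e d, pdx d (pdy e Φ) (x, c • y) = c * pdx d (pdy e Φ) (x, y) := fun e d =>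
    (hom_dir hom (stdVec e)).dir_base (stdVec d) x y c hc
  have h3 : ∀ e, pdx e Φ (x, c • y) = c ^ 2 * pdx e Φ (x, y) := fun e =>
    hom.dir_base (stdVec e) x y c hc
  rw [PiLp.smul_apply, sprayVec_apply hΦ, sprayVec_apply hΦ', h1, smul_eq_mul, mul_left_comm,
    Finset.mul_sum (a := c ^ 2)]
  refine congrArg _ (Finset.sum_congr rfl fun e _ => ?_)
  simp only [h2, h3, PiLp.smul_apply, smul_eq_mul]
  have h4 : ∑ d, c * y d * (c * pdx d (pdy e Φ) (x, y)) =
      c ^ 2 * ∑ d, y d * pdx d (pdy e Φ) (x, y) := by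
    rw [Finset.mul_sum]; exact Finset.sum_congr rfl fun d _ => by ring
  rw [h4]; ring

/-- Euler's identity for the spray, which has degree two. Its homogeneity is available at points
near which `Φ` is smooth; this covers the factors `c` close to `1`, and they suffice for the
derivative at `c = 1`. -/
theorem nMap_radial (hom : FiberHomogeneous (fun c => c ^ 2) Φ)
    (hΦ : SmoothNear Φ q) (hdet : (metricCoef Φ q).det ≠ 0) :
    nMap Φ q q.2 = (2 : ℝ) • sprayVec Φ q := by
  have h1 : HasDerivAt (fun c : ℝ => ((q.1, c • q.2) : E4 × E4)) (0, q.2) 1 := by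
    have := (hasDerivAt_const (1 : ℝ) q.1).prodMk ((hasDerivAt_id (1 : ℝ)).smul_const q.2)
    simpa using this
  have h2 : HasDerivAt (fun c : ℝ => sprayVec Φ (q.1, c • q.2)) (nMap Φ q q.2) 1 := by
    refine HasFDerivAt.comp_hasDerivAt (l := sprayVec Φ) (1 : ℝ) ?_ h1
    simpa using (smoothNear_sprayVec hΦ hdet).differentiableAt.hasFDerivAt
  have h3 : HasDerivAt (fun c : ℝ => sprayVec Φ (q.1, c • q.2)) ((2 : ℝ) • sprayVec Φ q) 1 := by
    have h4 : HasDerivAt (fun c : ℝ => c ^ 2 • sprayVec Φ q) ((2 : ℝ) • sprayVec Φ q) 1 := by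
      simpa using (hasDerivAt_pow 2 (1 : ℝ)).smul_const (sprayVec Φ q)
    refine h4.congr_of_eventuallyEq ?_
    have h5 : ∀ᶠ c in 𝓝 (1 : ℝ), SmoothNear Φ (q.1, c • q.2) := by
      refine h1.continuousAt.eventually ?_
      simpa using hΦ.eventually
    filter_upwards [lt_mem_nhds (zero_lt_one' ℝ), h5] with c hc h6
    exact sprayVec_homogeneous hom q.1 q.2 c hc hΦ h6
  exact h2.unique h3

/-- The linear connection determines the non-linear one: `F^a_bc y^b = N^a_c`. -/
theorem hVec_radial (hom : FiberHomogeneous (fun c => c ^ 2) Φ)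
    (hΦ : SmoothNear Φ q) (hdet : (metricCoef Φ q).det ≠ 0) (u : E4) :
    hVec Φ q q.2 u = nMap Φ q u := by
  refine eq_of_gForm_eq hΦ hdet fun w => ?_
  have hG := (smoothNear_sprayVec hΦ hdet).differentiableAt.hasFDerivAt
  have hg := (smoothNear_gForm hΦ).differentiableAt.hasFDerivAt
  -- the fiber derivative of the equation for the spray
  have key : 4 * (gForm Φ q (nMap Φ q u) w + fderiv ℝ (fun r => gForm Φ r u w) q
      (0, sprayVec Φ q)) =
      fderiv ℝ (fun r => fderiv ℝ Φ r (0, w)) q (u, 0) +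
      fderiv ℝ (fun r => fderiv ℝ (fun s => fderiv ℝ Φ s (0, w)) r (0, u)) q (q.2, 0) -
      fderiv ℝ (fun r => fderiv ℝ Φ r (0, u)) q (w, 0) := by
    have h1 : (fun r => 4 * gForm Φ r (sprayVec Φ r) w) =ᶠ[𝓝 q] fun r =>
        fderiv ℝ (fun s => fderiv ℝ Φ s (0, w)) r (r.2, 0) - fderiv ℝ Φ r (w, 0) := by
      filter_upwards [hΦ.eventually, eventually_det_ne_zero hΦ hdet] with r hr hr'
      rw [gForm_sprayVec hr hr', fderiv_fderiv_apply hr]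
    have h2 : HasFDerivAt (fun r => 4 * gForm Φ r (sprayVec Φ r) w) _ q :=
      ((hg.clm_apply hG).clm_apply (hasFDerivAt_const w q)).const_mul 4
    have hD : SmoothNear (fun s => fderiv ℝ Φ s (0, w)) q := hΦ.dir _
    have h3 : HasFDerivAt (fun r : E4 × E4 => ((r.2, 0) : E4 × E4)) _ q :=
      (hasFDerivAt_snd (𝕜 := ℝ) (p := q)).prodMk (hasFDerivAt_const (0 : E4) q)
    have h4 := (hD.fderiv.differentiableAt.hasFDerivAt.clm_apply h3).sub
      (hΦ.dir (w, 0)).differentiableAt.hasFDerivAt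
    have h5 := congrArg (fun l : (E4 × E4) →L[ℝ] ℝ => l (0, u))
      ((h2.congr_of_eventuallyEq h1.symm).unique h4)
    simp only [_root_.add_apply, _root_.smul_apply, _root_.sub_apply, smul_eq_mul,
      ContinuousLinearMap.comp_apply, ContinuousLinearMap.flip_apply,
      ContinuousLinearMap.prod_apply, ContinuousLinearMap.coe_snd', _root_.zero_apply, map_zero,
      zero_add] at h5
    have e1 : fderiv ℝ (gForm Φ) q (0, u) (sprayVec Φ q) w =
        fderiv ℝ (fun r => gForm Φ r u w) q (0, sprayVec Φ q) := by
      have := metricDeriv_eq hΦ (ContinuousLinearMap.inr ℝ E4 E4) u (sprayVec Φ q) w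
      rw [fderiv_gForm_vertical_symm hΦ]
      exact this
    rw [e1, ← nMap_apply] at h5
    rw [h5, fderiv_fderiv_comm hD (0, u), ← fderiv_fderiv_apply hD, dir_comm hΦ (0, u) (w, 0)]
  have hdu : ∀ a b c : E4 × E4, ∀ u' w' : E4, fderiv ℝ (fun r => gForm Φ r u' w') q a =
      (1 / 2) * fderiv ℝ (fun r => fderiv ℝ (fun s => fderiv ℝ Φ s (0, w')) r (0, u')) q a := by
    intro a _ _ u' w'
    have h1 : (fun r => gForm Φ r u' w') =ᶠ[𝓝 q]
        fun r => (1 / 2 : ℝ) • fderiv ℝ (fun s => fderiv ℝ Φ s (0, w')) r (0, u') := by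
      filter_upwards [hΦ.eventually] with r hr using gForm_eq_dir hr u' w'
    rw [h1.fderiv_eq, fderiv_fun_const_smul ((hΦ.dir _).dir _).differentiableAt]
    rfl
  -- `g(y, ·)` is half of the fiber derivative
  have hy : ∀ u w : E4, metricDeriv Φ q (horLift Φ q) u q.2 w =
      (1 / 2) * fderiv ℝ (fun r => fderiv ℝ Φ r (0, w)) q (u, 0) := by
    intro u w
    have h1 : horLift Φ q u = (u, 0) - (0, nMap Φ q u) := by rw [horLift_apply]; simp
    rw [metricDeriv_eq hΦ, h1, map_sub, fderiv_gForm_vertical_symm hΦ,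
      fderiv_gForm_radial hom hΦ, sub_zero, hdu (u, 0) 0 0]
    congr 1
    have hD : SmoothNear (fun s => fderiv ℝ Φ s (0, w)) q := hΦ.dir _
    rw [dir_comm hD]
    have h2 := ((hom_dir hom w).dir_base u).euler (hasDerivAt_id 1) (hD.dir (u, 0)).differentiableAt
    simpa using h2
  -- The horizontal lift of `y` is the spray direction `(y, -2G)`. With this the Koszul formula for
  -- `F(y, u)` becomes one quarter of the right-hand side of `key`, minus the derivative of `g`
  -- along `G`. That is `g(N u, w)`.
  have h1 : horLift Φ q q.2 = (q.2, 0) - (2 : ℝ) • (0, sprayVec Φ q) := by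
    rw [horLift_apply, nMap_radial hom hΦ hdet]; simp
  rw [hVec, gForm_chrVec hΦ hdet, hy u w, hy w u, metricDeriv_eq hΦ _ q.2, h1, map_sub, map_smul,
    smul_eq_mul, hdu (q.2, 0) 0 0]
  linear_combination (-1 / 4 : ℝ) * key

end Euler

end LocalConnection

/-! ### Change of coordinates -/

section ChangeOfCoordinates

/-- The change of the induced coordinates on the tangent bundle. -/
def tlift (τ : E4 → E4) (q : E4 × E4) : E4 × E4 := (τ q.1, fderiv ℝ τ q.1 q.2)

/-- The derivative of `tlift τ`. -/
def tliftDeriv (τ : E4 → E4) (q : E4 × E4) : E4 × E4 →L[ℝ] E4 × E4 :=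
  ((fderiv ℝ τ q.1).comp (ContinuousLinearMap.fst ℝ E4 E4)).prod
    (((fderiv ℝ (fderiv ℝ τ) q.1).flip q.2).comp (ContinuousLinearMap.fst ℝ E4 E4) +
      (fderiv ℝ τ q.1).comp (ContinuousLinearMap.snd ℝ E4 E4))

variable {τ : E4 → E4} {q : E4 × E4} {Φ Φ' : E4 × E4 → ℝ}

theorem tliftDeriv_apply (v : E4 × E4) :
    tliftDeriv τ q v = (fderiv ℝ τ q.1 v.1,
      fderiv ℝ (fderiv ℝ τ) q.1 v.1 q.2 + fderiv ℝ τ q.1 v.2) := rfl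

theorem smoothNear_comp_fst {Y : Type*} [NormedAddCommGroup Y] [NormedSpace ℝ Y] {h : E4 → Y}
    (hh : SmoothNear h q.1) : SmoothNear (fun r : E4 × E4 => h r.1) q :=
  SmoothNear.comp hh (SmoothNear.of_contDiff contDiff_fst)

theorem smoothNear_tlift (hτ : SmoothNear τ q.1) : SmoothNear (tlift τ) q :=
  (smoothNear_comp_fst hτ).prodMk
    ((smoothNear_comp_fst hτ.fderiv).clm_apply (SmoothNear.of_contDiff contDiff_snd))

theorem hasFDerivAt_jacobian (hτ : SmoothNear τ q.1) :
    HasFDerivAt (fun r : E4 × E4 => fderiv ℝ τ r.1)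
      ((fderiv ℝ (fderiv ℝ τ) q.1).comp (ContinuousLinearMap.fst ℝ E4 E4)) q :=
  hτ.fderiv.differentiableAt.hasFDerivAt.comp q hasFDerivAt_fst

theorem hasFDerivAt_tlift (hτ : SmoothNear τ q.1) :
    HasFDerivAt (tlift τ) (tliftDeriv τ q) q := by
  have h1 : HasFDerivAt (fun r : E4 × E4 => τ r.1) _ q :=
    hτ.differentiableAt.hasFDerivAt.comp q hasFDerivAt_fst
  refine (h1.prodMk ((hasFDerivAt_jacobian hτ).clm_apply hasFDerivAt_snd)).congr_fderiv ?_
  ext v <;> simp [tliftDeriv_apply]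

/-- The coordinate expressions `Φ` and `Φ'` of a function, near `q` and near the point with the
coordinates `tlift τ q`, are related by the change of coordinates `τ`. -/
structure ChartChange (Φ Φ' : E4 × E4 → ℝ) (τ : E4 → E4) (q : E4 × E4) : Prop where
  smooth : SmoothNear τ q.1
  surjective : ∀ᶠ x in 𝓝 q.1, Function.Surjective (fderiv ℝ τ x)
  eq : Φ =ᶠ[𝓝 q] fun r => Φ' (tlift τ r)
  smooth_left : SmoothNear Φ q
  smooth_right : SmoothNear Φ' (tlift τ q)
  det_left : (metricCoef Φ q).det ≠ 0
  det_right : (metricCoef Φ' (tlift τ q)).det ≠ 0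

namespace ChartChange

/-- All the conditions are open. Hence each transformation rule holds near `q` and may be
differentiated to give the next one. -/
theorem eventually (H : ChartChange Φ Φ' τ q) : ∀ᶠ r in 𝓝 q, ChartChange Φ Φ' τ r := by
  have hc : ContinuousAt (tlift τ) q := (smoothNear_tlift H.smooth).contDiffAt.continuousAt
  have hf : Tendsto (fun r : E4 × E4 => r.1) (𝓝 q) (𝓝 q.1) := continuousAt_fst
  filter_upwards [hf.eventually H.smooth.eventually,
    hf.eventually (eventually_eventually_nhds.2 H.surjective),
    eventually_eventually_nhds.2 H.eq, H.smooth_left.eventually,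
    hc.eventually H.smooth_right.eventually, eventually_det_ne_zero H.smooth_left H.det_left,
    hc.eventually (eventually_det_ne_zero H.smooth_right H.det_right)] with r h1 h2 h3 h4 h5 h6 h7
  exact ⟨h1, h2, h3, h4, h5, h6, h7⟩

theorem fderiv_eq (H : ChartChange Φ Φ' τ q) (v : E4 × E4) :
    fderiv ℝ Φ q v = fderiv ℝ Φ' (tlift τ q) (tliftDeriv τ q v) := by
  rw [H.eq.fderiv_eq]
  have := (H.smooth_right.differentiableAt.hasFDerivAt.comp q (hasFDerivAt_tlift H.smooth)).fderiv
  exact congrArg (fun l : (E4 × E4) →L[ℝ] ℝ => l v) this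

/-- The last term arises because the image of a fixed fiber direction varies with the base point. It
vanishes for vertical `v`, which is why the metric is a tensor, and survives for base directions,
which makes the spray inhomogeneous. -/
theorem fderiv_fderiv_eq (H : ChartChange Φ Φ' τ q) (v : E4 × E4) (w : E4) :
    fderiv ℝ (fderiv ℝ Φ) q v (0, w) =
      fderiv ℝ (fderiv ℝ Φ') (tlift τ q) (tliftDeriv τ q v) (0, fderiv ℝ τ q.1 w) +
      fderiv ℝ Φ' (tlift τ q) (0, fderiv ℝ (fderiv ℝ τ) q.1 v.1 w) := by
  rw [← fderiv_fderiv_apply H.smooth_left]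
  have h1 : (fun r => fderiv ℝ Φ r (0, w)) =ᶠ[𝓝 q]
      fun r => fderiv ℝ Φ' (tlift τ r) (0, fderiv ℝ τ r.1 w) := by
    filter_upwards [H.eventually] with r hr
    rw [hr.fderiv_eq, tliftDeriv_apply]; simp
  have h2 : HasFDerivAt (fun r => fderiv ℝ Φ' (tlift τ r)) _ q :=
    H.smooth_right.fderiv.differentiableAt.hasFDerivAt.comp q (hasFDerivAt_tlift H.smooth)
  have h3 : HasFDerivAt (fun r : E4 × E4 => ((0 : E4), fderiv ℝ τ r.1 w)) _ q :=
    (hasFDerivAt_const (0 : E4) q).prodMk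
      ((hasFDerivAt_jacobian H.smooth).clm_apply (hasFDerivAt_const w q))
  rw [h1.fderiv_eq, (h2.clm_apply h3).fderiv]
  simp [add_comm]

theorem gForm_eq (H : ChartChange Φ Φ' τ q) (u v : E4) :
    gForm Φ q u v = gForm Φ' (tlift τ q) (fderiv ℝ τ q.1 u) (fderiv ℝ τ q.1 v) := by
  rw [gForm_apply, gForm_apply, H.fderiv_fderiv_eq, tliftDeriv_apply]
  simp [Prod.mk_zero_zero]

theorem eq_of_gForm (H : ChartChange Φ Φ' τ q) {u v : E4}
    (h : ∀ w, gForm Φ' (tlift τ q) u (fderiv ℝ τ q.1 w) =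
      gForm Φ' (tlift τ q) v (fderiv ℝ τ q.1 w)) : u = v := by
  refine eq_of_gForm_eq H.smooth_right H.det_right fun w => ?_
  obtain ⟨w, rfl⟩ := H.surjective.self_of_nhds w
  exact h w

/-- When the defining equation of the spray is transformed, the terms with the first derivative of
`Φ'` cancel by the symmetry of `D²τ`. The remaining excess in the equation for `4G` is `2 g'(D²τ(y,
y), ·)`, whence the factor `1/2`. -/
theorem sprayVec_eq (H : ChartChange Φ Φ' τ q) :
    fderiv ℝ τ q.1 (sprayVec Φ q) = sprayVec Φ' (tlift τ q) +
      (1 / 2 : ℝ) • fderiv ℝ (fderiv ℝ τ) q.1 q.2 q.2 := by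
  refine H.eq_of_gForm fun w => ?_
  have h1 := gForm_sprayVec H.smooth_left H.det_left w
  rw [H.gForm_eq, H.fderiv_fderiv_eq, H.fderiv_eq, tliftDeriv_apply, tliftDeriv_apply] at h1
  have h2 := gForm_sprayVec H.smooth_right H.det_right (fderiv ℝ τ q.1 w)
  have h3 : (fderiv ℝ τ q.1 q.2, fderiv ℝ (fderiv ℝ τ) q.1 q.2 q.2 + fderiv ℝ τ q.1 0) =
      ((tlift τ q).2, (0 : E4)) + (0, fderiv ℝ (fderiv ℝ τ) q.1 q.2 q.2) := by
    simp [tlift]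
  have h4 : (fderiv ℝ τ q.1 w, fderiv ℝ (fderiv ℝ τ) q.1 w q.2 + fderiv ℝ τ q.1 0) =
      (fderiv ℝ τ q.1 w, (0 : E4)) + (0, fderiv ℝ (fderiv ℝ τ) q.1 q.2 w) := by
    rw [fderiv_fderiv_comm H.smooth w]; simp
  simp only at h1
  rw [h3, h4, map_add, map_add, _root_.add_apply] at h1
  rw [map_add, map_smul, _root_.add_apply, _root_.smul_apply, smul_eq_mul,
    gForm_apply (u := fderiv ℝ (fderiv ℝ τ) q.1 q.2 q.2)]
  linarith

/-- The fiber derivative of the rule for the spray; the quadratic term `½ D²τ(y, y)` becomes `D²τ(u,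
y)`. -/
theorem nMap_eq (H : ChartChange Φ Φ' τ q) (u : E4) :
    fderiv ℝ τ q.1 (nMap Φ q u) = nMap Φ' (tlift τ q) (fderiv ℝ τ q.1 u) +
      fderiv ℝ (fderiv ℝ τ) q.1 u q.2 := by
  have h0 : (fun r : E4 × E4 => fderiv ℝ τ r.1 (sprayVec Φ r)) =ᶠ[𝓝 q] fun r =>
      sprayVec Φ' (tlift τ r) + (1 / 2 : ℝ) • fderiv ℝ (fderiv ℝ τ) r.1 r.2 r.2 := by
    filter_upwards [H.eventually] with r hr using hr.sprayVec_eq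
  have h1 := (hasFDerivAt_jacobian H.smooth).clm_apply
    (smoothNear_sprayVec H.smooth_left H.det_left).differentiableAt.hasFDerivAt
  have h2 := (smoothNear_sprayVec H.smooth_right H.det_right).differentiableAt.hasFDerivAt.comp q
    (hasFDerivAt_tlift H.smooth)
  have h3 : HasFDerivAt (fun r : E4 × E4 => fderiv ℝ (fderiv ℝ τ) r.1) _ q :=
    H.smooth.fderiv.fderiv.differentiableAt.hasFDerivAt.comp q hasFDerivAt_fst
  have h4 := h2.add (((h3.clm_apply hasFDerivAt_snd).clm_apply hasFDerivAt_snd).const_smul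
    (1 / 2 : ℝ))
  have h5 := congrArg (fun l : (E4 × E4) →L[ℝ] E4 => l (0, u))
    ((h1.congr_of_eventuallyEq h0.symm).unique h4)
  simp [tliftDeriv_apply] at h5
  rw [← nMap_apply, ← nMap_apply, fderiv_fderiv_comm H.smooth q.2 u] at h5
  rw [h5, ← add_smul]
  norm_num

/-- The second-order term of the lifted coordinate change cancels the one in the rule for `N`, so
horizontality is independent of the chart. -/
theorem tliftDeriv_horLift (H : ChartChange Φ Φ' τ q) (u : E4) :
    tliftDeriv τ q (horLift Φ q u) = horLift Φ' (tlift τ q) (fderiv ℝ τ q.1 u) := by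
  rw [tliftDeriv_apply, horLift_apply, horLift_apply]
  refine Prod.ext rfl ?_
  simp only [map_neg]
  rw [H.nMap_eq]; abel

set_option synthInstance.maxHeartbeats 100000 in
theorem fderiv_gForm_eq (H : ChartChange Φ Φ' τ q) (e : E4 × E4) (v w : E4) :
    fderiv ℝ (fun r => gForm Φ r v w) q e =
      fderiv ℝ (fun r => gForm Φ' r (fderiv ℝ τ q.1 v) (fderiv ℝ τ q.1 w)) (tlift τ q)
        (tliftDeriv τ q e) +
      gForm Φ' (tlift τ q) (fderiv ℝ (fderiv ℝ τ) q.1 e.1 v) (fderiv ℝ τ q.1 w) +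
      gForm Φ' (tlift τ q) (fderiv ℝ τ q.1 v) (fderiv ℝ (fderiv ℝ τ) q.1 e.1 w) := by
  have h0 : (fun r => gForm Φ r v w) =ᶠ[𝓝 q] fun r =>
      gForm Φ' (tlift τ r) (fderiv ℝ τ r.1 v) (fderiv ℝ τ r.1 w) := by
    filter_upwards [H.eventually] with r hr using hr.gForm_eq v w
  have hg := (smoothNear_gForm H.smooth_right).differentiableAt.hasFDerivAt
  have h1 : HasFDerivAt (fun r => gForm Φ' (tlift τ r)) _ q :=
    hg.comp q (hasFDerivAt_tlift H.smooth)
  have h2 : ∀ v, HasFDerivAt (fun r : E4 × E4 => fderiv ℝ τ r.1 v) _ q := fun v =>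
    (hasFDerivAt_jacobian H.smooth).clm_apply (hasFDerivAt_const v q)
  have h3 := (hg.clm_apply (hasFDerivAt_const (fderiv ℝ τ q.1 v) (tlift τ q))).clm_apply
    (hasFDerivAt_const (fderiv ℝ τ q.1 w) (tlift τ q))
  rw [h0.fderiv_eq, ((h1.clm_apply (h2 v)).clm_apply (h2 w)).fderiv, h3.fderiv]
  simp
  ring

/-- The classical computation for the Levi-Civita connection. Horizontal lifts correspond to each
other, the three derivatives in the Koszul formula contribute six terms with `D²τ`, and all of them
but `g'(D²τ(u, v), ·)` cancel. -/
theorem hVec_eq (H : ChartChange Φ Φ' τ q) (u v : E4) :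
    fderiv ℝ τ q.1 (hVec Φ q u v) =
      hVec Φ' (tlift τ q) (fderiv ℝ τ q.1 u) (fderiv ℝ τ q.1 v) +
      fderiv ℝ (fderiv ℝ τ) q.1 u v := by
  refine H.eq_of_gForm fun w => ?_
  rw [← H.gForm_eq, map_add, _root_.add_apply, hVec, hVec, gForm_chrVec H.smooth_left H.det_left,
    gForm_chrVec H.smooth_right H.det_right]
  simp only [metricDeriv_eq H.smooth_left, metricDeriv_eq H.smooth_right, H.fderiv_gForm_eq,
    H.tliftDeriv_horLift]
  simp only [horLift_apply]
  rw [fderiv_fderiv_comm H.smooth v u, fderiv_fderiv_comm H.smooth w u,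
    fderiv_fderiv_comm H.smooth w v,
    gForm_comm H.smooth_right (fderiv ℝ (fderiv ℝ τ) q.1 u w)]
  ring

/-- Vertical vectors have no base component, so no second derivative of `τ` appears. -/
theorem cVec_eq (H : ChartChange Φ Φ' τ q) (u v : E4) :
    fderiv ℝ τ q.1 (cVec Φ q u v) =
      cVec Φ' (tlift τ q) (fderiv ℝ τ q.1 u) (fderiv ℝ τ q.1 v) := by
  refine H.eq_of_gForm fun w => ?_
  have h1 : ∀ u, tliftDeriv τ q (0, u) = (0, fderiv ℝ τ q.1 u) := fun u => by
    rw [tliftDeriv_apply]; simp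
  rw [← H.gForm_eq, cVec, cVec, gForm_chrVec H.smooth_left H.det_left,
    gForm_chrVec H.smooth_right H.det_right]
  simp only [metricDeriv_eq H.smooth_left, metricDeriv_eq H.smooth_right, H.fderiv_gForm_eq,
    ContinuousLinearMap.inr_apply, h1]
  simp

/-- The coordinates of a frame in the new chart. -/
def frameLift (τ : E4 → E4) (s : FrameCoord) : FrameCoord :=
  (τ s.1, fun i => fderiv ℝ τ s.1 (s.2 i))

/-- The coordinates of a velocity of frames in the new chart. -/
def frameLiftDeriv (τ : E4 → E4) (s v : FrameCoord) : FrameCoord :=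
  (fderiv ℝ τ s.1 v.1, fun i => fderiv ℝ (fderiv ℝ τ) s.1 v.1 (s.2 i) + fderiv ℝ τ s.1 (v.2 i))

/-- The term `D²τ(dx, f_i)` in the new velocity of the leg cancels the one in the rule for `F`.
Likewise `N dx + df_0` transforms as a vector. -/
theorem covDeriv_eq {s : FrameCoord} (H : ChartChange Φ Φ' τ (s.1, s.2 0)) (v : FrameCoord)
    (i a : Fin 4) :
    covDerivLeg Φ' (frameLift τ s) (frameLiftDeriv τ s v) i a =
      fderiv ℝ τ s.1 (WithLp.toLp 2 fun b => covDerivLeg Φ s v i b) a := by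
  have h1 : (WithLp.toLp 2 fun b => covDerivLeg Φ s v i b) =
      v.2 i + hVec Φ (s.1, s.2 0) (s.2 i) v.1 +
      cVec Φ (s.1, s.2 0) (s.2 i) (nMap Φ (s.1, s.2 0) v.1 + v.2 0) := by
    ext b
    exact covDerivLeg_eq s v H.smooth_left H.det_left i b
  have h3 := covDerivLeg_eq (Φ := Φ') (frameLift τ s) (frameLiftDeriv τ s v) H.smooth_right
    H.det_right i a
  rw [h1, h3, map_add, map_add, H.hVec_eq, H.cVec_eq,
    map_add, H.nMap_eq]
  have h2 : ((frameLift τ s).1, (frameLift τ s).2 0) = tlift τ (s.1, s.2 0) := rfl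
  rw [h2]
  simp only [frameLift, frameLiftDeriv]
  rw [fderiv_fderiv_comm H.smooth (s.2 i) v.1,
    add_assoc (nMap Φ' (tlift τ (s.1, s.2 0)) (fderiv ℝ τ s.1 v.1))]
  refine congrArg (fun z : E4 => z a) ?_
  abel

/-- The form `A` does not depend on the coordinates. -/
theorem cartanCoord_eq {s : FrameCoord} (H : ChartChange Φ Φ' τ (s.1, s.2 0))
    (Λ : ℝ) (v : FrameCoord) :
    cartanCoord Λ Φ' (frameLift τ s) (frameLiftDeriv τ s v) = cartanCoord Λ Φ s v := by
  -- Both forms are components of vectors with respect to the frame. The Jacobian multiplies the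
  -- frame as well as the vectors, and cancels.
  let Jm : Matrix (Fin 4) (Fin 4) ℝ := Matrix.of fun a b => fderiv ℝ τ s.1 (stdVec b) a
  have hJ : ∀ (w : E4) (a : Fin 4), fderiv ℝ τ s.1 w a = ∑ b, Jm a b * w b := by
    intro w a
    rw [clm_eq_sum (fderiv ℝ τ s.1) w]
    simp [Jm, mul_comm]
  have hJdet : IsUnit Jm.det := by
    rw [← Matrix.isUnit_iff_isUnit_det, ← Matrix.mulVec_surjective_iff_isUnit]
    intro w
    obtain ⟨u, hu⟩ := H.surjective.self_of_nhds (WithLp.toLp 2 w)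
    refine ⟨u, ?_⟩
    funext a
    have := hJ u a
    rw [hu] at this
    exact this.symm
  have hfm : frameMatrix (frameLift τ s) = Jm * frameMatrix s := by
    ext a i
    simp only [frameMatrix, frameLift, Matrix.of_apply, Matrix.mul_apply, hJ]
  have hinv : (frameMatrix (frameLift τ s))⁻¹ * Jm = (frameMatrix s)⁻¹ := by
    rw [hfm, Matrix.mul_inv_rev, Matrix.mul_assoc, Matrix.nonsing_inv_mul _ hJdet, Matrix.mul_one]
  have key : ∀ (w : Fin 4 → ℝ) (j : Fin 4),
      ∑ a, (frameMatrix (frameLift τ s))⁻¹ j a * (∑ b, Jm a b * w b) =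
        ∑ b, (frameMatrix s)⁻¹ j b * w b := by
    intro w j
    rw [← hinv]
    simp only [Matrix.mul_apply, Finset.sum_mul, Finset.mul_sum]
    rw [Finset.sum_comm]
    exact Finset.sum_congr rfl fun b _ => Finset.sum_congr rfl fun a _ => by ring
  have h1 : connCoord Φ' (frameLift τ s) (frameLiftDeriv τ s v) = connCoord Φ s v := by
    ext j i
    simp only [connCoord, Matrix.of_apply, H.covDeriv_eq, hJ]
    exact key _ j
  have h2 : solderCoord (frameLift τ s) (frameLiftDeriv τ s v) = solderCoord s v := by
    funext j
    simp only [solderCoord, frameLiftDeriv, hJ]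
    exact key _ j
  rw [cartanCoord, cartanCoord, h1, h2]

end ChartChange

end ChangeOfCoordinates

/-! ### The form `A` in coordinates -/

section FormInCoordinates

theorem algElem_injective {Λ : ℝ} {h h' : Matrix (Fin 4) (Fin 4) ℝ} {z z' : Fin 4 → ℝ}
    (e : algElem Λ h z = algElem Λ h' z') : h = h' ∧ z = z' := by
  rw [algElem, algElem, Matrix.fromBlocks_inj] at e
  exact ⟨e.1, Matrix.replicateCol_injective e.2.1⟩

variable {Φ : E4 × E4 → ℝ} {s : FrameCoord}

theorem mulVec_inv_frameMatrix (hs : (frameMatrix s).det ≠ 0) {w w' : Fin 4 → ℝ}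
    (h : ∀ j, ∑ a, (frameMatrix s)⁻¹ j a * w a = ∑ a, (frameMatrix s)⁻¹ j a * w' a) : w = w' := by
  have hu : IsUnit (frameMatrix s).det := isUnit_iff_ne_zero.2 hs
  have h1 : (frameMatrix s)⁻¹ *ᵥ w = (frameMatrix s)⁻¹ *ᵥ w' := funext h
  have h2 := congrArg (fun x => frameMatrix s *ᵥ x) h1
  simpa [Matrix.mulVec_mulVec, Matrix.mul_nonsing_inv _ hu] using h2

theorem sum_inv_frameMatrix_mul (hs : (frameMatrix s).det ≠ 0) (c : Fin 4 → ℝ) (j : Fin 4) :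
    ∑ a, (frameMatrix s)⁻¹ j a * ∑ i, c i * s.2 i a = c j := by
  have hu : IsUnit (frameMatrix s).det := isUnit_iff_ne_zero.2 hs
  have h1 : ((frameMatrix s)⁻¹ *ᵥ (frameMatrix s *ᵥ c)) j = c j := by
    rw [Matrix.mulVec_mulVec, Matrix.nonsing_inv_mul _ hu, Matrix.one_mulVec]
  rw [← h1]
  simp only [Matrix.mulVec, dotProduct, frameMatrix, Matrix.of_apply]
  refine Finset.sum_congr rfl fun a _ => ?_
  congr 1
  exact Finset.sum_congr rfl fun i _ => mul_comm _ _

/-- The form `A` at a frame, as a linear map. -/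
def cartanLin (Λ : ℝ) (Φ : E4 × E4 → ℝ) (s : FrameCoord) : FrameCoord →ₗ[ℝ] ModelMat where
  toFun v := cartanCoord Λ Φ s v
  map_add' v w := by
    have h1 : ∀ i a, covDerivLeg Φ s (v + w) i a = covDerivLeg Φ s v i a + covDerivLeg Φ s w i a := by
      intro i a
      simp only [covDerivLeg, Prod.fst_add, Prod.snd_add, Pi.add_apply, PiLp.add_apply, mul_add,
        Finset.sum_add_distrib]
      ring
    have h2 : connCoord Φ s (v + w) = connCoord Φ s v + connCoord Φ s w := by
      ext j i
      simp [connCoord, h1, mul_add, Finset.sum_add_distrib]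
    have h3 : solderCoord s (v + w) = solderCoord s v + solderCoord s w := by
      funext i
      simp [solderCoord, mul_add, Finset.sum_add_distrib]
    rw [cartanCoord, cartanCoord, cartanCoord, h2, h3, algElem, algElem, algElem,
      Matrix.fromBlocks_add]
    congr 1
    · ext i j
      simp [Matrix.mulVec_add]
      ring
    · simp
  map_smul' c v := by
    have h1 : ∀ i a, covDerivLeg Φ s (c • v) i a = c * covDerivLeg Φ s v i a := by
      intro i a
      simp only [covDerivLeg, Prod.smul_fst, Prod.smul_snd, Pi.smul_apply, PiLp.smul_apply,
        smul_eq_mul, mul_add, Finset.mul_sum, mul_left_comm c]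
    have h2 : connCoord Φ s (c • v) = c • connCoord Φ s v := by
      ext j i
      simp [connCoord, h1, Finset.mul_sum, mul_left_comm c]
    have h3 : solderCoord s (c • v) = c • solderCoord s v := by
      funext i
      simp [solderCoord, Finset.mul_sum, mul_left_comm c]
    rw [RingHom.id_apply, cartanCoord, cartanCoord, h2, h3, algElem, algElem,
      Matrix.fromBlocks_smul]
    congr 1
    · ext i j
      simp [Matrix.mulVec_smul]
      ring
    · simp

theorem cartanLin_apply (Λ : ℝ) (v : FrameCoord) : cartanLin Λ Φ s v = cartanCoord Λ Φ s v := rfl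

/-- If the solder form vanishes, so does `dx`. The vanishing of the covariant derivative of `f_0`
then reads `df_0 + C(f_0, df_0) = 0`, where the second term is zero by `cVec_radial`; with `df_0 =
0` the other legs follow. The velocity `v` is not required to be tangent to `P`, which is used to
identify the fundamental vector fields. -/
theorem cartanCoord_injective (Λ : ℝ) (hom : FiberHomogeneous (fun c => c ^ 2) Φ)
    (hΦ : SmoothNear Φ (s.1, s.2 0)) (hdet : (metricCoef Φ (s.1, s.2 0)).det ≠ 0)
    (hs : (frameMatrix s).det ≠ 0) : Function.Injective (cartanCoord Λ Φ s) := by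
  have key : ∀ v, cartanLin Λ Φ s v = 0 → v = 0 := by
    intro v hv
    have h0 : algElem Λ (connCoord Φ s v) (solderCoord s v) = algElem Λ 0 0 := by
      have : algElem Λ 0 0 = 0 := by
        rw [algElem]
        ext i j
        rcases i with i | i <;> rcases j with j | j <;> simp
      rw [this]; exact hv
    obtain ⟨h1, h2⟩ := algElem_injective h0
    have hx : v.1 = 0 := by
      have := mulVec_inv_frameMatrix hs (w := v.1) (w' := 0) fun j => by
        simpa [solderCoord] using congrFun h2 j
      ext a; exact congrFun this a
    have hc : ∀ i, v.2 i + hVec Φ (s.1, s.2 0) (s.2 i) v.1 +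
        cVec Φ (s.1, s.2 0) (s.2 i) (nMap Φ (s.1, s.2 0) v.1 + v.2 0) = 0 := by
      intro i
      have := mulVec_inv_frameMatrix hs (w := fun a => covDerivLeg Φ s v i a) (w' := 0) fun j => by
        simpa [connCoord] using congrFun (congrFun h1 j) i
      ext a
      rw [← covDerivLeg_eq s v hΦ hdet i a]
      exact congrFun this a
    have hh0 : ∀ u, hVec Φ (s.1, s.2 0) u 0 = 0 := fun u => by
      ext a; simp [hVec_apply hΦ hdet]
    have hc0 : ∀ u, cVec Φ (s.1, s.2 0) u 0 = 0 := fun u => by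
      ext a; simp [cVec_apply hΦ]
    simp only [hx, hh0, map_zero, zero_add, add_zero] at hc
    have hy : v.2 0 = 0 := by
      have h3 := hc 0
      have h4 : cVec Φ (s.1, s.2 0) (s.2 0) (v.2 0) = 0 := cVec_radial hom hΦ hdet _
      rwa [h4, add_zero] at h3
    refine Prod.ext hx (funext fun i => ?_)
    have h3 := hc i
    rw [hy, hc0, add_zero] at h3
    exact h3
  intro v w h
  have : v - w = 0 := key _ (by
    rw [map_sub, cartanLin_apply, cartanLin_apply, h, sub_self])
  exact sub_eq_zero.1 this

/-- The fundamental vector fields are mapped to the constant elements of the Lie algebra. -/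
theorem cartanCoord_fundamentalCoord (Λ : ℝ) (hom : FiberHomogeneous (fun c => c ^ 2) Φ)
    (hΦ : SmoothNear Φ (s.1, s.2 0)) (hdet : (metricCoef Φ (s.1, s.2 0)).det ≠ 0)
    (hs : (frameMatrix s).det ≠ 0) (h : Matrix (Fin 4) (Fin 4) ℝ) (z : Fin 4 → ℝ) :
    cartanCoord Λ Φ s (fundamentalCoord Φ s h z) = algElem Λ h z := by
  set q : E4 × E4 := (s.1, s.2 0) with hq
  let Hv : Fin 4 → E4 := fun j => ∑ i, h i j • s.2 i
  let Zv : E4 := ∑ i, z i • s.2 i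
  have hHv : ∀ j a, Hv j a = ∑ i, h i j * s.2 i a := fun j a => by simp [Hv]
  have hZv : ∀ a, Zv a = ∑ i, z i * s.2 i a := fun a => by simp [Zv]
  have hv1 : (fundamentalCoord Φ s h z).1 = Zv := rfl
  have hv2 : ∀ j, (fundamentalCoord Φ s h z).2 j =
      Hv j - cVec Φ q (s.2 j) (Hv 0) - hVec Φ q (s.2 j) Zv := by
    intro j
    -- The coordinate expression has `f_j` in the second lower slot of the coefficients, whereas the
    -- covariant derivative has it in the first; the coefficients are symmetric.
    rw [cVec, hVec, chrVec_comm hΦ hdet, chrVec_comm hΦ hdet (horLift Φ q), ← cVec, ← hVec]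
    ext a
    simp only [PiLp.sub_apply, cVec_apply hΦ, hVec_apply hΦ hdet, hHv, hZv, fundamentalCoord]
    simp only [Finset.sum_mul, Finset.mul_sum]
    congr 1
    · congr 1
      rw [Finset.sum_comm]
      refine Finset.sum_congr rfl fun b _ => ?_
      rw [Finset.sum_comm]
      exact Finset.sum_congr rfl fun c _ => Finset.sum_congr rfl fun i _ => by ring
    · rw [Finset.sum_comm]
      refine Finset.sum_congr rfl fun b _ => ?_
      rw [Finset.sum_comm]
      exact Finset.sum_congr rfl fun c _ => Finset.sum_congr rfl fun i _ => by ring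
  -- For the leg `f_0` the term with `C` drops and the term with `F` is exactly `N Zv`. So the
  -- vertical part of the velocity is `h^i_0 f_i`, and the corrections in all the other legs cancel.
  have hN : nMap Φ q Zv + (fundamentalCoord Φ s h z).2 0 = Hv 0 := by
    have h1 : cVec Φ q (s.2 0) (Hv 0) = 0 := cVec_radial hom hΦ hdet _
    have h2 : hVec Φ q (s.2 0) Zv = nMap Φ q Zv := hVec_radial hom hΦ hdet _
    rw [hv2, h1, h2]; abel
  have hcov : ∀ i a, covDerivLeg Φ s (fundamentalCoord Φ s h z) i a = ∑ k, h k i * s.2 k a := by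
    intro i a
    rw [covDerivLeg_eq s _ hΦ hdet, hv1, ← hq, hN, hv2, ← hHv]
    refine congrArg (fun w : E4 => w a) ?_
    abel
  have h1 : connCoord Φ s (fundamentalCoord Φ s h z) = h := by
    ext j i
    simp only [connCoord, Matrix.of_apply, hcov]
    exact sum_inv_frameMatrix_mul hs (fun k => h k i) j
  have h2 : solderCoord s (fundamentalCoord Φ s h z) = z := by
    funext j
    simp only [solderCoord, hv1, hZv]
    exact sum_inv_frameMatrix_mul hs z j
  rw [cartanCoord, h1, h2]

/-- On velocities that keep the frame orthonormal, `ω` takes values in `𝔥`. -/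
theorem connCoord_mem (v : FrameCoord)
    (hΦ : SmoothNear Φ (s.1, s.2 0)) (hdet : (metricCoef Φ (s.1, s.2 0)).det ≠ 0)
    (hs : (frameMatrix s).det ≠ 0)
    (ho : ∀ i j, gForm Φ (s.1, s.2 0) (s.2 i) (s.2 j) = -eta i j)
    (hv : ∀ i j, fderiv ℝ (fun r => gForm Φ r (s.2 i) (s.2 j)) (s.1, s.2 0) (v.1, v.2 0) +
      gForm Φ (s.1, s.2 0) (v.2 i) (s.2 j) + gForm Φ (s.1, s.2 0) (s.2 i) (v.2 j) = 0) :
    (connCoord Φ s v)ᵀ * eta + eta * connCoord Φ s v = 0 := by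
  set q : E4 × E4 := (s.1, s.2 0) with hq
  let cov : Fin 4 → E4 := fun i => WithLp.toLp 2 fun a => covDerivLeg Φ s v i a
  have hcov : ∀ i, cov i = v.2 i + hVec Φ q (s.2 i) v.1 +
      cVec Φ q (s.2 i) (nMap Φ q v.1 + v.2 0) := fun i => by
    ext a; exact covDerivLeg_eq s v hΦ hdet i a
  have hω : ∀ i, cov i = ∑ k, connCoord Φ s v k i • s.2 k := by
    intro i
    have := mulVec_inv_frameMatrix hs (w := cov i)
      (w' := fun a => ∑ k, connCoord Φ s v k i * s.2 k a) fun j => by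
        rw [sum_inv_frameMatrix_mul hs (fun k => connCoord Φ s v k i) j]
        rfl
    ext a
    simpa using congrFun this a
  -- Metric compatibility turns the hypothesis that `g(f_i, f_j)` is constant to first order into
  -- the skewness of the covariant derivatives, and `∇f_i = f_k ω^k_i` translates this into
  -- matrices.
  have hsum : ∀ i j, gForm Φ q (cov i) (s.2 j) + gForm Φ q (s.2 i) (cov j) = 0 := by
    intro i j
    have h1 := hv i j
    rw [fderiv_gForm_eq hΦ hdet] at h1
    rw [hcov, hcov, ← h1]
    simp only [map_add, _root_.add_apply]
    ring
  ext i j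
  have h1 := hsum i j
  rw [hω, hω] at h1
  simp only [map_sum, map_smul, _root_.sum_apply, _root_.smul_apply, smul_eq_mul, ho] at h1
  simp only [Matrix.add_apply, Matrix.mul_apply, Matrix.transpose_apply, Matrix.zero_apply]
  simp only [mul_neg, Finset.sum_neg_distrib] at h1
  have h2 : ∑ k, connCoord Φ s v k j * eta i k = ∑ k, eta i k * connCoord Φ s v k j :=
    Finset.sum_congr rfl fun k _ => mul_comm _ _
  rw [h2] at h1
  linarith

theorem smoothNear_pdx {h : E4 × E4 → ℝ} {q : E4 × E4} (hh : SmoothNear h q) (a : Fin 4) :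
    SmoothNear (pdx a h) q := hh.dir _

theorem smoothNear_pdy {h : E4 × E4 → ℝ} {q : E4 × E4} (hh : SmoothNear h q) (a : Fin 4) :
    SmoothNear (pdy a h) q := hh.dir _

section

variable {q : E4 × E4}

theorem smoothNear_nonlinCoef (hΦ : SmoothNear Φ q) (hdet : (metricCoef Φ q).det ≠ 0)
    (a b : Fin 4) : SmoothNear (nonlinCoef Φ a b) q := by
  have hy : ∀ d, SmoothNear (fun r : E4 × E4 => r.2 d) q := fun d =>
    SmoothNear.of_contDiff ((EuclideanSpace.proj (𝕜 := ℝ) d).contDiff.comp contDiff_snd)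
  refine (SmoothNear.const (1 / 4 : ℝ)).mul (smoothNear_pdy (SmoothNear.sum fun c => ?_) b)
  exact (SmoothNear.matrix_inv (smoothNear_metricCoef hΦ) hdet a c).mul
    ((SmoothNear.sum fun d => (hy d).mul (smoothNear_pdx (smoothNear_pdy hΦ c) d)).sub
      (smoothNear_pdx hΦ c))

theorem smoothNear_horDeriv (hΦ : SmoothNear Φ q) (hdet : (metricCoef Φ q).det ≠ 0) (a : Fin 4)
    {h : E4 × E4 → ℝ} (hh : SmoothNear h q) : SmoothNear (horDeriv Φ a h) q :=
  (smoothNear_pdx hh a).sub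
    (SmoothNear.sum fun b => (smoothNear_nonlinCoef hΦ hdet b a).mul (smoothNear_pdy hh b))

theorem smoothNear_horCoef (hΦ : SmoothNear Φ q) (hdet : (metricCoef Φ q).det ≠ 0)
    (a b c : Fin 4) : SmoothNear (horCoef Φ a b c) q := by
  have hg := smoothNear_metricCoef hΦ
  exact (SmoothNear.const (1 / 2 : ℝ)).mul (SmoothNear.sum fun d =>
    (SmoothNear.matrix_inv hg hdet a d).mul
      (((smoothNear_horDeriv hΦ hdet b (hg c d)).add (smoothNear_horDeriv hΦ hdet c (hg b d))).sub
        (smoothNear_horDeriv hΦ hdet d (hg b c))))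

theorem smoothNear_verCoef (hΦ : SmoothNear Φ q) (hdet : (metricCoef Φ q).det ≠ 0)
    (a b c : Fin 4) : SmoothNear (verCoef Φ a b c) q := by
  have hg := smoothNear_metricCoef hΦ
  exact (SmoothNear.const (1 / 2 : ℝ)).mul (SmoothNear.sum fun d =>
    (SmoothNear.matrix_inv hg hdet a d).mul
      (((smoothNear_pdy (hg c d) b).add (smoothNear_pdy (hg b d) c)).sub
        (smoothNear_pdy (hg b c) d)))

end

theorem contDiff_base_coord (a : Fin 4) : ContDiff ℝ ∞ (fun s : FrameCoord => s.1 a) :=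
  (EuclideanSpace.proj (𝕜 := ℝ) a).contDiff.comp contDiff_fst

theorem contDiff_leg_coord (i a : Fin 4) : ContDiff ℝ ∞ (fun s : FrameCoord => s.2 i a) :=
  (EuclideanSpace.proj (𝕜 := ℝ) a).contDiff.comp ((contDiff_apply ℝ E4 i).comp contDiff_snd)

/-- The form `A` depends smoothly on the frame and the velocity. -/
theorem contDiffAt_cartanCoord (Λ : ℝ) (hΦ : SmoothNear Φ (s.1, s.2 0))
    (hdet : (metricCoef Φ (s.1, s.2 0)).det ≠ 0) (hs : (frameMatrix s).det ≠ 0) (v : FrameCoord)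
    (i j : Fin 4 ⊕ Fin 1) :
    ContDiffAt ℝ ∞ (fun p : FrameCoord × FrameCoord => cartanCoord Λ Φ p.1 p.2 i j) (s, v) := by
  have hb : ∀ a, ContDiffAt ℝ ∞ (fun p : FrameCoord × FrameCoord => p.2.1 a) (s, v) := fun a =>
    ((contDiff_base_coord a).comp contDiff_snd).contDiffAt
  have hl : ∀ i a, ContDiffAt ℝ ∞ (fun p : FrameCoord × FrameCoord => p.2.2 i a) (s, v) :=
    fun i a => ((contDiff_leg_coord i a).comp contDiff_snd).contDiffAt
  have hl1 : ∀ i a, ContDiffAt ℝ ∞ (fun p : FrameCoord × FrameCoord => p.1.2 i a) (s, v) :=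
    fun i a => ((contDiff_leg_coord i a).comp contDiff_fst).contDiffAt
  have hinv : ∀ i a, ContDiffAt ℝ ∞
      (fun p : FrameCoord × FrameCoord => (frameMatrix p.1)⁻¹ i a) (s, v) :=
    contDiffAt_matrix_inv (A := fun p : FrameCoord × FrameCoord => frameMatrix p.1)
      (fun a i => hl1 i a) hs
  have hq : ContDiffAt ℝ ∞ (fun p : FrameCoord × FrameCoord => (p.1.1, p.1.2 0)) (s, v) :=
    ((contDiff_fst.comp contDiff_fst).prodMk
      ((contDiff_apply ℝ E4 (0 : Fin 4)).comp (contDiff_snd.comp contDiff_fst))).contDiffAt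
  have hcomp : ∀ f : E4 × E4 → ℝ, SmoothNear f (s.1, s.2 0) →
      ContDiffAt ℝ ∞ (fun p : FrameCoord × FrameCoord => f (p.1.1, p.1.2 0)) (s, v) :=
    fun f hf => ContDiffAt.comp (s, v) hf.contDiffAt hq
  have hsold : ∀ i, ContDiffAt ℝ ∞ (fun p : FrameCoord × FrameCoord => solderCoord p.1 p.2 i)
      (s, v) := fun i => ContDiffAt.sum fun a _ => (hinv i a).mul (hb a)
  have hcov : ∀ i a, ContDiffAt ℝ ∞ (fun p : FrameCoord × FrameCoord =>
      covDerivLeg Φ p.1 p.2 i a) (s, v) := by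
    intro i a
    refine (hl i a).add (ContDiffAt.sum fun b _ => (hl1 i b).mul (ContDiffAt.sum fun c _ => ?_))
    refine ((hcomp _ (smoothNear_horCoef hΦ hdet a b c)).mul (hb c)).add
      ((hcomp _ (smoothNear_verCoef hΦ hdet a b c)).mul (ContDiffAt.add ?_ (hl 0 c)))
    exact ContDiffAt.sum fun d _ => (hcomp _ (smoothNear_nonlinCoef hΦ hdet c d)).mul (hb d)
  have hconn : ∀ j i, ContDiffAt ℝ ∞ (fun p : FrameCoord × FrameCoord =>
      connCoord Φ p.1 p.2 j i) (s, v) := fun j i => by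
    simp only [connCoord, Matrix.of_apply]
    exact ContDiffAt.sum fun a _ => (hinv j a).mul (hcov i a)
  rcases i with i | i <;> rcases j with j | j
  · exact hconn i j
  · exact hsold i
  · have : (fun p : FrameCoord × FrameCoord => cartanCoord Λ Φ p.1 p.2 (Sum.inr i) (Sum.inl j)) =
        fun p => -(Real.sign Λ * ∑ k, eta j k * solderCoord p.1 p.2 k) := rfl
    rw [this]
    exact (contDiffAt_const.mul (ContDiffAt.sum fun k _ => contDiffAt_const.mul (hsold k))).neg
  · exact contDiffAt_const

end FormInCoordinates

/-! ### Induced coordinates on the tangent bundle and on the frames -/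

section InducedCoordinates

variable {M : Type*} [TopologicalSpace M] [ChartedSpace E4 M] [IsManifold (𝓡 4) ∞ M]
  {φ : OpenPartialHomeomorph M E4}
  {E G : Type*} [NormedAddCommGroup E] [NormedSpace ℝ E] [TopologicalSpace G]
  {J : ModelWithCorners ℝ E G} {Q : Type*} [TopologicalSpace Q] [ChartedSpace G Q]

theorem mdifferentiable_of_mem_maximalAtlas (hφ : φ ∈ IsManifold.maximalAtlas (𝓡 4) ∞ M) :
    φ.MDifferentiable (𝓡 4) (𝓡 4) :=
  ⟨(contMDiffOn_of_mem_maximalAtlas hφ).mdifferentiableOn (by simp),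
    (contMDiffOn_symm_of_mem_maximalAtlas hφ).mdifferentiableOn (by simp)⟩

/-- The coordinates `(x^a, y^a)` on the tangent bundle that are induced by the chart `φ`. -/
def tangentCoord (φ : OpenPartialHomeomorph M E4) (v : TangentBundle (𝓡 4) M) : E4 × E4 :=
  (φ v.proj, mfderiv (𝓡 4) 𝓘(ℝ, E4) φ v.proj v.2)

theorem contMDiffOn_tangentCoord (hφ : φ ∈ IsManifold.maximalAtlas (𝓡 4) ∞ M) :
    ContMDiffOn (𝓡 4).tangent 𝓘(ℝ, E4 × E4) ∞ (tangentCoord φ)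
      (TotalSpace.proj ⁻¹' φ.source) := by
  have h1 := (contMDiffOn_of_mem_maximalAtlas hφ).contMDiffOn_tangentMapWithin (m := ∞)
    (by simp) φ.open_source.uniqueMDiffOn
  have h2 : ContMDiffOn (𝓡 4).tangent 𝓘(ℝ, E4 × E4) ∞
      (fun v : TangentBundle (𝓡 4) M => (φ v.proj,
        (tangentMapWithin (𝓡 4) (𝓡 4) φ φ.source v).2))
      (TotalSpace.proj ⁻¹' φ.source) :=
    ((contMDiffOn_of_mem_maximalAtlas hφ).comp
      (contMDiff_proj (TangentSpace (𝓡 4))).contMDiffOn fun v hv => hv).prodMk_space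
      (contMDiff_snd_tangentBundle_modelSpace E4 (𝓡 4) |>.comp_contMDiffOn h1)
  refine h2.congr fun v hv => ?_
  simp only [tangentCoord, tangentMapWithin]
  rw [mfderivWithin_of_isOpen φ.open_source hv]

theorem contMDiffOn_inducedPoint (hφ : φ ∈ IsManifold.maximalAtlas (𝓡 4) ∞ M) :
    ContMDiffOn 𝓘(ℝ, E4 × E4) (𝓡 4).tangent ∞ (inducedPoint φ) (Prod.fst ⁻¹' φ.target) := by
  have h1 := (contMDiffOn_symm_of_mem_maximalAtlas hφ).contMDiffOn_tangentMapWithin (m := ∞)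
    (by simp) φ.open_target.uniqueMDiffOn
  have h2 : ContMDiff 𝓘(ℝ, E4 × E4) (𝓡 4).tangent ∞
      (fun q : E4 × E4 => (⟨q.1, q.2⟩ : TangentBundle (𝓡 4) E4)) := by
    intro q
    rw [contMDiffAt_totalSpace]
    refine ⟨contDiff_fst.contMDiff q, ?_⟩
    simpa using contDiff_snd.contMDiff q
  refine (h1.comp h2.contMDiffOn fun q hq => hq).congr fun q hq => ?_
  simp only [inducedPoint, tangentMapWithin, Function.comp_apply]
  rw [mfderivWithin_of_isOpen φ.open_target hq]

theorem mfderiv_symm_mfderiv (hφ : φ ∈ IsManifold.maximalAtlas (𝓡 4) ∞ M) {x : M}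
    (hx : x ∈ φ.source) (v : TangentSpace (𝓡 4) x) :
    mfderiv (𝓡 4) (𝓡 4) φ.symm (φ x) (mfderiv (𝓡 4) (𝓡 4) φ x v) = v := by
  have := (mdifferentiable_of_mem_maximalAtlas hφ).symm_comp_deriv hx
  exact DFunLike.congr_fun this v

theorem mfderiv_mfderiv_symm (hφ : φ ∈ IsManifold.maximalAtlas (𝓡 4) ∞ M) {x : E4}
    (hx : x ∈ φ.target) (v : E4) :
    mfderiv (𝓡 4) (𝓡 4) φ (φ.symm x) (mfderiv (𝓡 4) (𝓡 4) φ.symm x v) = v := by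
  have := (mdifferentiable_of_mem_maximalAtlas hφ).comp_symm_deriv hx
  exact DFunLike.congr_fun this v

theorem tangentCoord_inducedPoint (hφ : φ ∈ IsManifold.maximalAtlas (𝓡 4) ∞ M) {q : E4 × E4}
    (hq : q.1 ∈ φ.target) : tangentCoord φ (inducedPoint φ q) = q :=
  Prod.ext (φ.right_inv hq) (mfderiv_mfderiv_symm hφ hq q.2)

theorem inducedPoint_tangentCoord (hφ : φ ∈ IsManifold.maximalAtlas (𝓡 4) ∞ M)
    {v : TangentBundle (𝓡 4) M} (hv : v.proj ∈ φ.source) :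
    inducedPoint φ (tangentCoord φ v) = v := by
  obtain ⟨x, v⟩ := v
  have h1 : φ.symm (φ x) = x := φ.left_inv hv
  refine TotalSpace.ext h1 ?_
  exact heq_of_eq (mfderiv_symm_mfderiv hφ hv v)

/-- The linear map with given values on the standard basis. -/
def legMap (f : Fin 4 → E4) : E4 →L[ℝ] E4 :=
  ∑ i, (EuclideanSpace.proj i : E4 →L[ℝ] ℝ).smulRight (f i)

theorem legMap_apply (f : Fin 4 → E4) (w : E4) : legMap f w = ∑ i, w i • f i := by
  simp [legMap]

theorem legMap_stdVec (f : Fin 4 → E4) (i : Fin 4) : legMap f (stdVec i) = f i := by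
  rw [legMap_apply, Finset.sum_eq_single i]
  · simp [stdVec]
  · intro j _ hj; simp [stdVec, hj]
  · simp

theorem clm_eq_legMap (l : E4 →L[ℝ] E4) : l = legMap fun i => l (stdVec i) := by
  ext1 w
  rw [legMap_apply]
  conv_lhs => rw [← sum_smul_stdVec w]
  simp

/-- The frame with the given coordinates. -/
def framePoint (φ : OpenPartialHomeomorph M E4) (s : FrameCoord) : FrameSpace M :=
  ⟨φ.symm s.1, ContinuousLinearMap.comp
    (mfderiv 𝓘(ℝ, E4) (𝓡 4) φ.symm s.1 : E4 →L[ℝ] TangentSpace (𝓡 4) (φ.symm s.1)) (legMap s.2)⟩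

theorem leg_framePoint (s : FrameCoord) (i : Fin 4) :
    leg (framePoint φ s) i = mfderiv 𝓘(ℝ, E4) (𝓡 4) φ.symm s.1 (s.2 i) := by
  change mfderiv 𝓘(ℝ, E4) (𝓡 4) φ.symm s.1 (legMap s.2 (stdVec i)) = _
  rw [legMap_stdVec]

theorem leg_framePoint_eq_inducedPoint (s : FrameCoord) (i : Fin 4) :
    (⟨(framePoint φ s).proj, leg (framePoint φ s) i⟩ : TangentBundle (𝓡 4) M) =
      inducedPoint φ (s.1, s.2 i) := by
  rw [leg_framePoint]; rfl

theorem frameCoord_framePoint (hφ : φ ∈ IsManifold.maximalAtlas (𝓡 4) ∞ M) {s : FrameCoord}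
    (hs : s.1 ∈ φ.target) : frameCoord φ (framePoint φ s) = s := by
  refine Prod.ext (φ.right_inv hs) (funext fun i => ?_)
  simp only [frameCoord]
  rw [leg_framePoint]
  exact mfderiv_mfderiv_symm hφ hs _

theorem frameSpace_ext {p p' : FrameSpace M}
    (h : ∀ i, (⟨p.proj, leg p i⟩ : TangentBundle (𝓡 4) M) = ⟨p'.proj, leg p' i⟩) : p = p' := by
  obtain ⟨x, f⟩ := p
  obtain ⟨x', f'⟩ := p'
  have hx : x = x' := congrArg TotalSpace.proj (h 0)
  subst hx
  congr 1
  change E4 →L[ℝ] E4 at f f'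
  have h1 : ∀ i, f (stdVec i) = f' (stdVec i) := fun i => by
    have := h i
    simp only [TotalSpace.mk.injEq, heq_eq_eq, true_and] at this
    exact this
  rw [clm_eq_legMap f, clm_eq_legMap f']
  exact congrArg legMap (funext h1)

theorem framePoint_frameCoord (hφ : φ ∈ IsManifold.maximalAtlas (𝓡 4) ∞ M) {p : FrameSpace M}
    (hp : p.proj ∈ φ.source) : framePoint φ (frameCoord φ p) = p :=
  frameSpace_ext fun i => by
    rw [leg_framePoint_eq_inducedPoint]
    exact inducedPoint_tangentCoord hφ (v := ⟨p.proj, leg p i⟩) hp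

/-- A map to the bundle of frames is smooth if its legs are. -/
theorem contMDiffWithinAt_frame_iff {f : Q → FrameSpace M} {s : Set Q} {q : Q} :
    ContMDiffWithinAt J frameModel ∞ f s q ↔ ∀ i, ContMDiffWithinAt J (𝓡 4).tangent ∞
      (fun r => (⟨(f r).proj, leg (f r) i⟩ : TangentBundle (𝓡 4) M)) s q := by
  -- Read in the trivializations, the value of the linear map on a basis vector is the trivialized
  -- leg. A linear map on `ℝ⁴` is smooth in a parameter as soon as its four values are, since
  -- `legMap` rebuilds it from them.
  have hco : ∀ (x₀ x : M) (l : E4 →L[ℝ] E4) (w : E4),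
      ContinuousLinearMap.inCoordinates E4 (Bundle.Trivial M E4) E4 (TangentSpace (𝓡 4)) x₀ x x₀ x
        l w = (trivializationAt E4 (TangentSpace (𝓡 4)) x₀ ).continuousLinearMapAt ℝ x (l w) := by
    intro x₀ x l w
    simp [ContinuousLinearMap.inCoordinates]
    rfl
  have hleg : ContDiff ℝ ∞ legMap := by
    unfold legMap
    exact ContDiff.sum fun i _ => contDiff_const.smulRight (contDiff_apply ℝ E4 i)
  rw [contMDiffWithinAt_hom_bundle]
  simp only [contMDiffWithinAt_totalSpace]
  have hcongr : ContMDiffWithinAt J (𝓡 4) ∞ (fun r => (f r).proj) s q → ∀ i,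
      (ContMDiffWithinAt J 𝓘(ℝ, E4) ∞ (fun r =>
        ContinuousLinearMap.inCoordinates E4 (Bundle.Trivial M E4) E4 (TangentSpace (𝓡 4))
          (f q).proj (f r).proj (f q).proj (f r).proj (f r).2 (stdVec i)) s q ↔
      ContMDiffWithinAt J 𝓘(ℝ, E4) ∞ (fun r =>
        (trivializationAt E4 (TangentSpace (𝓡 4)) (f q).proj ⟨(f r).proj, leg (f r) i⟩).2) s q) := by
    intro hb i
    have hmem : ∀ r, (f r).proj ∈ (trivializationAt E4 (TangentSpace (𝓡 4)) (f q).proj).baseSet →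
        ContinuousLinearMap.inCoordinates E4 (Bundle.Trivial M E4) E4 (TangentSpace (𝓡 4))
          (f q).proj (f r).proj (f q).proj (f r).proj (f r).2 (stdVec i) =
        (trivializationAt E4 (TangentSpace (𝓡 4)) (f q).proj ⟨(f r).proj, leg (f r) i⟩).2 := by
      intro r hr
      refine (hco _ _ _ _).trans ?_
      rw [Trivialization.continuousLinearMapAt_apply, Trivialization.coe_linearMapAt_of_mem _ hr]
      rfl
    have hev := hb.continuousWithinAt.preimage_mem_nhdsWithin
      ((trivializationAt E4 (TangentSpace (𝓡 4)) (f q).proj).open_baseSet.mem_nhds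
        (FiberBundle.mem_baseSet_trivializationAt' (f q).proj))
    have hq := hmem q (FiberBundle.mem_baseSet_trivializationAt' (f q).proj)
    exact (EventuallyEq.contMDiffWithinAt_iff (by
      filter_upwards [hev] with r hr using hmem r hr) hq)
  constructor
  · rintro ⟨hb, hl⟩ i
    refine ⟨hb, (hcongr hb i).1 ?_⟩
    exact ((ContinuousLinearMap.apply ℝ E4 (stdVec i)).contDiff.contMDiff.contMDiffAt
      |>.comp_contMDiffWithinAt q hl)
  · intro h
    have hb := (h 0).1
    refine ⟨hb, ?_⟩
    have h1 : ContMDiffWithinAt J 𝓘(ℝ, Fin 4 → E4) ∞ (fun r i =>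
        ContinuousLinearMap.inCoordinates E4 (Bundle.Trivial M E4) E4 (TangentSpace (𝓡 4))
          (f q).proj (f r).proj (f q).proj (f r).proj (f r).2 (stdVec i)) s q :=
      contMDiffWithinAt_pi_space.2 fun i => (hcongr hb i).2 (h i).2
    have h2 := (hleg.contMDiff.contMDiffAt.comp_contMDiffWithinAt q h1)
    refine h2.congr (fun r _ => clm_eq_legMap _) (clm_eq_legMap _)

theorem contMDiff_leg (i : Fin 4) : ContMDiff frameModel (𝓡 4).tangent ∞
    (fun p : FrameSpace M => (⟨p.proj, leg p i⟩ : TangentBundle (𝓡 4) M)) := fun p =>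
  contMDiffWithinAt_frame_iff.1 (contMDiff_id (I := frameModel) p) i

theorem contMDiffOn_frameCoord (hφ : φ ∈ IsManifold.maximalAtlas (𝓡 4) ∞ M) :
    ContMDiffOn frameModel 𝓘(ℝ, FrameCoord) ∞ (frameCoord φ) (TotalSpace.proj ⁻¹' φ.source) := by
  have h : ∀ i, ContMDiffOn frameModel 𝓘(ℝ, E4 × E4) ∞
      (fun p => tangentCoord φ ⟨p.proj, leg p i⟩) (TotalSpace.proj ⁻¹' φ.source) := fun i =>
    (contMDiffOn_tangentCoord hφ).comp (contMDiff_leg i).contMDiffOn fun p hp => hp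
  exact (contDiff_fst.contMDiff.comp_contMDiffOn (h 0)).prodMk_space
    (contMDiffOn_pi_space.2 fun i => contDiff_snd.contMDiff.comp_contMDiffOn (h i))

theorem contMDiffOn_framePoint (hφ : φ ∈ IsManifold.maximalAtlas (𝓡 4) ∞ M) :
    ContMDiffOn 𝓘(ℝ, FrameCoord) frameModel ∞ (framePoint φ) (Prod.fst ⁻¹' φ.target) := by
  intro s hs
  refine contMDiffWithinAt_frame_iff.2 fun i => ?_
  simp only [leg_framePoint_eq_inducedPoint]
  have h : ContDiff ℝ ∞ (fun s : FrameCoord => (s.1, s.2 i)) :=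
    contDiff_fst.prodMk ((contDiff_apply ℝ E4 i).comp contDiff_snd)
  exact ((contMDiffOn_inducedPoint hφ).comp h.contMDiff.contMDiffOn fun s hs => hs) s hs

end InducedCoordinates

/-! ### Orthonormal frames in coordinates -/

section OrthonormalFrames

theorem spatial_zero_zero (k : Matrix (Fin 3) (Fin 3) ℝ) : spatial k 0 0 = 1 := rfl

theorem spatial_zero_succ (k : Matrix (Fin 3) (Fin 3) ℝ) (β : Fin 3) :
    spatial k 0 β.succ = 0 := by fin_cases β <;> rfl

theorem spatial_succ_zero (k : Matrix (Fin 3) (Fin 3) ℝ) (α : Fin 3) :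
    spatial k α.succ 0 = 0 := by fin_cases α <;> rfl

theorem spatial_succ_succ (k : Matrix (Fin 3) (Fin 3) ℝ) (α β : Fin 3) :
    spatial k α.succ β.succ = k α β := by fin_cases α <;> fin_cases β <;> rfl

theorem spatial_transpose (k : Matrix (Fin 3) (Fin 3) ℝ) : (spatial k)ᵀ = spatial kᵀ := by
  ext i j
  refine Fin.cases ?_ (fun α => ?_) i <;> refine Fin.cases ?_ (fun β => ?_) j <;>
    simp [spatial_zero_zero, spatial_zero_succ, spatial_succ_zero, spatial_succ_succ]

theorem spatial_det (k : Matrix (Fin 3) (Fin 3) ℝ) : (spatial k).det = k.det := by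
  rw [spatial, Matrix.reindex_apply, Matrix.det_submatrix_equiv_self,
    Matrix.det_fromBlocks_zero₂₁]
  simp

theorem eta_zero_zero : eta 0 0 = -1 := rfl

theorem eta_zero_succ (β : Fin 3) : eta 0 β.succ = 0 := by fin_cases β <;> rfl

theorem eta_succ_zero (α : Fin 3) : eta α.succ 0 = 0 := by fin_cases α <;> rfl

theorem eta_succ_succ (α β : Fin 3) : eta α.succ β.succ = (1 : Matrix (Fin 3) (Fin 3) ℝ) α β := by
  fin_cases α <;> fin_cases β <;> simp [eta]

theorem eta_transpose : etaᵀ = eta := Matrix.diagonal_transpose _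

theorem eta_mul_eta : eta * eta = 1 := by
  rw [eta, Matrix.diagonal_mul_diagonal, ← Matrix.diagonal_one]
  congr 1
  ext i; fin_cases i <;> simp

theorem spatial_mul_eta (k : Matrix (Fin 3) (Fin 3) ℝ) : spatial k * eta = eta * spatial k := by
  ext i j
  simp only [Matrix.mul_apply, Fin.sum_univ_succ (n := 3)]
  refine Fin.cases ?_ (fun α => ?_) i <;> refine Fin.cases ?_ (fun β => ?_) j <;>
    simp [spatial_zero_zero, spatial_zero_succ, spatial_succ_zero, spatial_succ_succ,
      eta_zero_zero, eta_zero_succ, eta_succ_zero, eta_succ_succ, Matrix.one_apply]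

/-- The spatial block of a matrix. -/
def spatialBlock (l : Matrix (Fin 4) (Fin 4) ℝ) : Matrix (Fin 3) (Fin 3) ℝ :=
  Matrix.of fun α β => l α.succ β.succ

theorem spatialBlock_spatial (k : Matrix (Fin 3) (Fin 3) ℝ) : spatialBlock (spatial k) = k := by
  ext α β; exact spatial_succ_succ k α β

/-- A Lorentz transformation that fixes the time direction is a spatial transformation. -/
theorem eq_spatial_of_fix {l : Matrix (Fin 4) (Fin 4) ℝ} (h : lᵀ * eta * l = eta)
    (h0 : ∀ i, l i 0 = (1 : Matrix (Fin 4) (Fin 4) ℝ) i 0) : l = spatial (spatialBlock l) := by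
  have hrow : ∀ β : Fin 3, l 0 β.succ = 0 := by
    intro β
    have h1 := congrFun (congrFun h 0) β.succ
    simp only [Matrix.mul_apply, Matrix.transpose_apply, h0, Fin.sum_univ_succ (n := 3),
      Matrix.one_apply, eta_zero_zero, eta_zero_succ, eta_succ_zero, eta_succ_succ] at h1
    simpa using h1
  ext i j
  refine Fin.cases ?_ (fun α => ?_) i <;> refine Fin.cases ?_ (fun β => ?_) j <;>
    simp [spatial_zero_zero, spatial_zero_succ, spatial_succ_zero, spatial_succ_succ, hrow, h0,
      spatialBlock]

theorem spatialBlock_orthogonal {l : Matrix (Fin 4) (Fin 4) ℝ} (h : lᵀ * eta * l = eta)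
    (h0 : ∀ i, l i 0 = (1 : Matrix (Fin 4) (Fin 4) ℝ) i 0) :
    (spatialBlock l)ᵀ * spatialBlock l = 1 := by
  have h1 := h
  rw [eq_spatial_of_fix h h0, spatial_transpose, spatial_mul_eta, Matrix.mul_assoc,
    ← spatial_mul] at h1
  have h2 := congrArg (fun m => spatialBlock (eta * m)) h1
  simp only [← Matrix.mul_assoc, eta_mul_eta, Matrix.one_mul, spatialBlock_spatial] at h2
  rw [h2]
  ext α β
  simp [spatialBlock, Matrix.one_apply]

/-- A Lorentz transformation of positive determinant that fixes the time direction is a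
rotation. -/
theorem exists_rotation {l : Matrix (Fin 4) (Fin 4) ℝ} (h : lᵀ * eta * l = eta)
    (h0 : ∀ i, l i 0 = (1 : Matrix (Fin 4) (Fin 4) ℝ) i 0) (hdet : 0 < l.det) :
    ∃ k : SO3, k.1 = spatialBlock l ∧ l = spatial k.1 := by
  have h1 := spatialBlock_orthogonal h h0
  have h2 := eq_spatial_of_fix h h0
  have h3 : 0 < (spatialBlock l).det := by rwa [← spatial_det, ← h2]
  have h4 : (spatialBlock l).det * (spatialBlock l).det = 1 := by
    have := congrArg Matrix.det h1
    rwa [Matrix.det_mul, Matrix.det_transpose, Matrix.det_one] at this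
  exact ⟨SO3.mk _ h1 (by nlinarith), rfl, h2⟩

variable {Φ : E4 × E4 → ℝ} {q : E4 × E4}

theorem gForm_eq_dotProduct (hΦ : SmoothNear Φ q) (u v : E4) :
    gForm Φ q u v = u.ofLp ⬝ᵥ metricCoef Φ q *ᵥ v.ofLp := by
  rw [gForm_eq_sum hΦ]
  simp only [dotProduct, Matrix.mulVec, Finset.mul_sum]
  exact Finset.sum_congr rfl fun a _ => Finset.sum_congr rfl fun b _ => by ring

/-- The Gram matrix of a frame. -/
theorem gram_frameMatrix (hΦ : SmoothNear Φ q) (s : FrameCoord) :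
    (frameMatrix s)ᵀ * metricCoef Φ q * frameMatrix s =
      Matrix.of fun i j => gForm Φ q (s.2 i) (s.2 j) := by
  ext i j
  rw [Matrix.of_apply, gForm_eq_dotProduct hΦ, Matrix.mul_assoc, Matrix.mul_apply]
  simp [dotProduct, Matrix.mulVec, Matrix.mul_apply, frameMatrix]

theorem det_eta : eta.det = -1 := by simp [eta, Matrix.det_diagonal, Fin.prod_univ_succ]

/-- The Gram matrix `-η` has determinant `-1`, so no factor of its determinant can vanish. In
particular one orthonormal frame already forces the metric to be non-degenerate. -/
theorem det_ne_zero_of_orthonormal (hΦ : SmoothNear Φ q) {s : FrameCoord}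
    (h : ∀ i j, gForm Φ q (s.2 i) (s.2 j) = -eta i j) :
    (frameMatrix s).det ≠ 0 ∧ (metricCoef Φ q).det ≠ 0 := by
  have h1 := congrArg Matrix.det (gram_frameMatrix hΦ s)
  have h2 : (Matrix.of fun i j => gForm Φ q (s.2 i) (s.2 j)) = -eta := by
    ext i j; exact h i j
  rw [h2, Matrix.det_mul, Matrix.det_mul, Matrix.det_neg, det_eta] at h1
  constructor <;> intro h3 <;> simp [h3] at h1

/-- Two orthonormal frames with the same first leg and the same orientation differ by a
rotation. -/
theorem exists_rotation_of_orthonormal (hΦ : SmoothNear Φ q) {s t : FrameCoord}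
    (hs : ∀ i j, gForm Φ q (s.2 i) (s.2 j) = -eta i j)
    (ht : ∀ i j, gForm Φ q (t.2 i) (t.2 j) = -eta i j) (h0 : s.2 0 = t.2 0)
    (hdet : 0 < (frameMatrix s).det * (frameMatrix t).det) :
    ∃ k : SO3, k.1 = spatialBlock ((frameMatrix s)⁻¹ * frameMatrix t) ∧
      frameMatrix t = frameMatrix s * spatial k.1 := by
  have hs' := (det_ne_zero_of_orthonormal hΦ hs).1
  have hinv : frameMatrix s * (frameMatrix s)⁻¹ = 1 :=
    Matrix.mul_nonsing_inv _ (isUnit_iff_ne_zero.2 hs')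
  have hinv' : (frameMatrix s)⁻¹ * frameMatrix s = 1 :=
    Matrix.nonsing_inv_mul _ (isUnit_iff_ne_zero.2 hs')
  obtain ⟨l, hl⟩ : ∃ l, l = (frameMatrix s)⁻¹ * frameMatrix t := ⟨_, rfl⟩
  have ht' : frameMatrix t = frameMatrix s * l := by
    rw [hl, ← Matrix.mul_assoc, hinv, Matrix.one_mul]
  have gs : (frameMatrix s)ᵀ * metricCoef Φ q * frameMatrix s = -eta := by
    rw [gram_frameMatrix hΦ]; ext i j; exact hs i j
  have gt : (frameMatrix t)ᵀ * metricCoef Φ q * frameMatrix t = -eta := by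
    rw [gram_frameMatrix hΦ]; ext i j; exact ht i j
  have h1 : lᵀ * eta * l = eta := by
    have : lᵀ * ((frameMatrix s)ᵀ * metricCoef Φ q * frameMatrix s) * l = -eta := by
      rw [← gt, ht', Matrix.transpose_mul]
      simp only [Matrix.mul_assoc]
    rw [gs] at this
    simpa using this
  have h2 : ∀ i, l i 0 = (1 : Matrix (Fin 4) (Fin 4) ℝ) i 0 := by
    intro i
    rw [← hinv', hl, Matrix.mul_apply, Matrix.mul_apply]
    exact Finset.sum_congr rfl fun a _ => by simp [frameMatrix, h0]
  have h3 : 0 < l.det := by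
    rw [ht', Matrix.det_mul, ← mul_assoc] at hdet
    exact pos_of_mul_pos_right hdet (mul_self_nonneg _)
  obtain ⟨k, hk, hk'⟩ := exists_rotation h1 h2 h3
  exact ⟨k, by rw [hk, hl], by rw [ht', ← hk']⟩

/-- Rotations of orthonormal frames are orthonormal. -/
theorem orthonormal_rotate (hΦ : SmoothNear Φ q) {s t : FrameCoord} (k : SO3)
    (hs : ∀ i j, gForm Φ q (s.2 i) (s.2 j) = -eta i j)
    (h : frameMatrix t = frameMatrix s * spatial k.1) (i j : Fin 4) :
    gForm Φ q (t.2 i) (t.2 j) = -eta i j := by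
  have gs : (frameMatrix s)ᵀ * metricCoef Φ q * frameMatrix s = -eta := by
    rw [gram_frameMatrix hΦ]; ext i j; exact hs i j
  have : (frameMatrix t)ᵀ * metricCoef Φ q * frameMatrix t = -eta := by
    rw [h, Matrix.transpose_mul]
    calc (spatial k.1)ᵀ * (frameMatrix s)ᵀ * metricCoef Φ q * (frameMatrix s * spatial k.1)
        = (spatial k.1)ᵀ * ((frameMatrix s)ᵀ * metricCoef Φ q * frameMatrix s) * spatial k.1 := by
          simp only [Matrix.mul_assoc]
      _ = -eta := by
        rw [gs, Matrix.mul_neg, Matrix.neg_mul, Matrix.mul_assoc, ← spatial_mul_eta,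
          ← Matrix.mul_assoc, spatial_transpose, ← spatial_mul, SO3.transpose_mul_self,
          spatial_one, Matrix.one_mul]
  rw [gram_frameMatrix hΦ] at this
  exact congrFun (congrFun this i) j

/-- A vector with `g(y, y) = 1` whose orthogonal complement is negative definite is part of an
orthonormal frame. -/
theorem exists_orthonormal (hΦ : SmoothNear Φ q) {y : E4} (hy : gForm Φ q y y = 1)
    (hneg : ∀ v, v ≠ 0 → gForm Φ q y v = 0 → gForm Φ q v v < 0) :
    ∃ f : Fin 4 → E4, f 0 = y ∧ ∀ i j, gForm Φ q (f i) (f j) = -eta i j := by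
  let κ : E4 →ₗ[ℝ] ℝ := (gForm Φ q y : E4 →L[ℝ] ℝ)
  -- The orthogonal complement of `y` is three-dimensional since `g(y, y) ≠ 0`. An orthogonal basis
  -- of it only needs to be rescaled, because the form is negative on it.
  let W : Submodule ℝ E4 := LinearMap.ker κ
  let b : LinearMap.BilinForm ℝ W := LinearMap.mk₂ ℝ (fun u v => gForm Φ q u v)
    (by simp) (by simp) (by simp) (by simp)
  have hb : LinearMap.IsSymm b := ⟨fun u v => by simpa [b] using gForm_comm hΦ _ _⟩
  have hW : Module.finrank ℝ W = 3 := by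
    have h1 := LinearMap.finrank_range_add_finrank_ker κ
    have h2 : LinearMap.range κ = ⊤ := by
      rw [LinearMap.range_eq_top]
      exact fun c => ⟨c • y, by simp [κ, hy]⟩
    rw [h2] at h1
    simp at h1
    change Module.finrank ℝ (LinearMap.ker κ) = 3
    omega
  obtain ⟨v, hv⟩ := LinearMap.BilinForm.exists_orthogonal_basis hb
  let w : Fin 3 → W := fun α => v (Fin.cast hW.symm α)
  have hw0 : ∀ α, gForm Φ q y (w α) = 0 := fun α => (w α).2
  have hwneg : ∀ α, gForm Φ q (w α) (w α) < 0 := fun α =>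
    hneg _ (by simpa using v.ne_zero _) (hw0 α)
  have hwo : ∀ α β, α ≠ β → gForm Φ q (w α) (w β) = 0 := fun α β hαβ =>
    hv (by simpa using hαβ : Fin.cast hW.symm α ≠ Fin.cast hW.symm β)
  let c : Fin 3 → ℝ := fun α => (Real.sqrt (-gForm Φ q (w α) (w α)))⁻¹
  have hc : ∀ α, c α * (c α * gForm Φ q (w α) (w α)) = -1 := by
    intro α
    have h1 : 0 < -gForm Φ q (w α) (w α) := by linarith [hwneg α]
    have h2 := Real.mul_self_sqrt h1.le
    have h3 : Real.sqrt (-gForm Φ q (w α) (w α)) ≠ 0 := (Real.sqrt_pos.2 h1).ne'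
    simp only [c]
    field_simp
    nlinarith
  refine ⟨Fin.cons y fun α => c α • (w α : E4), rfl, fun i j => ?_⟩
  refine Fin.cases ?_ (fun α => ?_) i <;> refine Fin.cases ?_ (fun β => ?_) j
  · simp [hy, eta_zero_zero]
  · simp [hw0, eta_zero_succ]
  · simp [gForm_comm hΦ _ y, hw0, eta_succ_zero]
  · simp only [Fin.cons_succ, map_smul, _root_.smul_apply, smul_eq_mul, eta_succ_succ,
      Matrix.one_apply]
    rcases eq_or_ne α β with rfl | h
    · simp [hc]
    · simp [h, hwo]

/-- An orthonormal frame extends to a smooth family of orthonormal frames. -/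
theorem exists_local_frame (hΦ : SmoothNear Φ q) {f : Fin 4 → E4} (hf0 : f 0 = q.2)
    (hf : ∀ i j, gForm Φ q (f i) (f j) = -eta i j) :
    ∃ σ : E4 × E4 → Fin 4 → E4, σ q = f ∧ (∀ i, SmoothNear (fun r => σ r i) q) ∧
      (∀ r, σ r 0 = r.2) ∧ ∀ᶠ r in 𝓝 q, gForm Φ r r.2 r.2 = 1 →
        ∀ i j, gForm Φ r (σ r i) (σ r j) = -eta i j := by
  obtain ⟨ρ, hρ1, hρ⟩ := exists_congruence (1 : Matrix (Fin 3) (Fin 3) ℝ) (by simp) (by simp)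
  have hg := smoothNear_gForm hΦ
  have hsnd : SmoothNear (fun r : E4 × E4 => r.2) q := SmoothNear.of_contDiff contDiff_snd
  -- The spatial legs are kept constant up to projection along `y`. The result is orthogonal to `y`
  -- wherever `g(y, y) = 1`.
  let e : E4 × E4 → Fin 3 → E4 := fun r α => f α.succ - gForm Φ r (f α.succ) r.2 • r.2
  have he : ∀ α, SmoothNear (fun r => e r α) q := by
    intro α
    refine (SmoothNear.const _).sub ?_
    have h1 : SmoothNear (fun r => gForm Φ r (f α.succ) r.2) q :=
      (hg.clm_apply (SmoothNear.const (f α.succ))).clm_apply hsnd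
    filter_upwards [h1, hsnd] with r h h' using h.smul h'
  have heq : ∀ α, e q α = f α.succ := by
    intro α
    simp [e, ← hf0, hf, eta_succ_zero]
  -- The negated Gram matrix of the projected legs is `1` at `q`. The smooth congruence `ρ`
  -- normalizes it nearby, in place of the Gram–Schmidt process.
  let H : E4 × E4 → Fin 3 → Fin 3 → ℝ := fun r α β => -gForm Φ r (e r α) (e r β)
  have hH : SmoothNear H q := by
    have : ∀ α β, SmoothNear (fun r => gForm Φ r (e r α) (e r β)) q := fun α β =>
      (hg.clm_apply (he α)).clm_apply (he β)
    have h2 : ∀ᶠ r in 𝓝 q, ∀ α β, ContDiffAt ℝ ∞ (fun r => gForm Φ r (e r α) (e r β)) r :=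
      eventually_all.2 fun α => eventually_all.2 fun β => this α β
    filter_upwards [h2] with r hr
    exact contDiffAt_pi.2 fun α => contDiffAt_pi.2 fun β => (hr α β).neg
  have hHq : H q = Matrix.of.symm 1 := by
    ext α β
    simp [H, heq, hf, eta_succ_succ]
  have hρ' : ∀ᶠ r in 𝓝 q, ContDiffAt ℝ ∞ ρ (H r) ∧ ((Matrix.of (H r))ᵀ = Matrix.of (H r) →
      (Matrix.of (ρ (H r)))ᵀ * Matrix.of (H r) * Matrix.of (ρ (H r)) = 1) := by
    have := hH.contDiffAt.continuousAt.tendsto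
    rw [hHq] at this
    exact this.eventually hρ
  have hR : SmoothNear (fun r => ρ (H r)) q := by
    filter_upwards [hρ', hH] with r h1 h2 using h1.1.comp r h2
  let σ : E4 × E4 → Fin 4 → E4 := fun r => Fin.cons r.2 fun α => ∑ β, ρ (H r) β α • e r β
  refine ⟨σ, ?_, ?_, fun r => rfl, ?_⟩
  · funext i
    refine Fin.cases ?_ (fun α => ?_) i
    · exact hf0.symm
    · simp only [σ, Fin.cons_succ, hHq, hρ1, heq, Matrix.of_symm_apply, Matrix.one_apply]
      simp
  · intro i
    refine Fin.cases ?_ (fun α => ?_) i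
    · exact hsnd
    · simp only [σ, Fin.cons_succ]
      refine SmoothNear.sum fun β => ?_
      have h1 : SmoothNear (fun r => ρ (H r) β α) q := by
        filter_upwards [hR] with r hr using contDiffAt_pi.1 (contDiffAt_pi.1 hr β) α
      filter_upwards [h1, he β] with r h h' using h.smul h'
  · filter_upwards [hρ', hΦ.eventually] with r hr hΦr h1
    have hsymm : (Matrix.of (H r))ᵀ = Matrix.of (H r) := by
      ext α β
      simp only [Matrix.transpose_apply, Matrix.of_apply, H]
      rw [gForm_comm hΦr]
    have h2 := hr.2 hsymm
    have hperp : ∀ α, gForm Φ r r.2 (e r α) = 0 := by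
      intro α
      simp only [e, map_sub, map_smul, smul_eq_mul, h1]
      rw [gForm_comm hΦr]; ring
    have hperp' : ∀ α, gForm Φ r (e r α) r.2 = 0 := fun α => by
      rw [gForm_comm hΦr, hperp]
    intro i j
    refine Fin.cases ?_ (fun α => ?_) i <;> refine Fin.cases ?_ (fun β => ?_) j
    · simp [σ, h1, eta_zero_zero]
    · simp [σ, eta_zero_succ, hperp]
    · simp [σ, eta_succ_zero, hperp', _root_.sum_apply]
    · have h3 := congrFun (congrFun h2 α) β
      simp only [Matrix.mul_apply, Matrix.transpose_apply, Matrix.of_apply, H] at h3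
      simp only [σ, Fin.cons_succ, eta_succ_succ, ← h3, map_sum, map_smul, _root_.sum_apply,
        _root_.smul_apply, smul_eq_mul]
      rw [← Finset.sum_neg_distrib, Finset.sum_congr rfl]
      intro γ _
      rw [Finset.mul_sum, Finset.sum_mul, ← Finset.sum_neg_distrib]
      exact Finset.sum_congr rfl fun δ _ => by simp only [H]; ring

end OrthonormalFrames

/-! ### Timelike vectors of a homogeneous function in coordinates -/

section Timelike

variable {l : E4 × E4 → ℝ} {n : ℝ} {q : E4 × E4}

/-- `|l| = 1`, and the Hessian of `l` has signature `(ε, -ε, -ε, -ε)` with `ε = l`. -/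
def IsTimelikeCoord (l : E4 × E4 → ℝ) (q : E4 × E4) : Prop :=
  |l q| = 1 ∧ ∃ B : Matrix (Fin 4) (Fin 4) ℝ, Bᵀ * metricCoef l q * B = -(l q) • eta

theorem mul_self_of_abs_eq_one {c : ℝ} (h : |c| = 1) : c * c = 1 := by
  rw [← abs_mul_abs_self, h, one_mul]

theorem det_ne_zero_of_congr {B g : Matrix (Fin 4) (Fin 4) ℝ} {c : ℝ} (hc : |c| = 1)
    (h : Bᵀ * g * B = -c • eta) : B.det ≠ 0 := by
  intro h0
  have h1 := congrArg Matrix.det h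
  rw [Matrix.det_mul, h0, mul_zero, Matrix.det_smul, det_eta] at h1
  have h2 : c ≠ 0 := by rintro rfl; simp at hc
  have h3 : (-c) ^ Fintype.card (Fin 4) ≠ 0 := pow_ne_zero _ (neg_ne_zero.2 h2)
  apply h3
  linarith

/-- The property of being timelike is open among the unit vectors. -/
theorem IsTimelikeCoord.eventually (h : IsTimelikeCoord l q) (hl : SmoothNear l q) :
    ∀ᶠ r in 𝓝 q, |l r| = 1 → IsTimelikeCoord l r := by
  obtain ⟨h1, B, hB⟩ := h
  have hcc := mul_self_of_abs_eq_one h1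
  -- As `|l q| = 1`, the normal form `-(l q) η` is a symmetric involution. Hessians near the given
  -- one can therefore be brought to the same normal form.
  obtain ⟨ρ, -, hρ⟩ := exists_congruence (-(l q) • eta)
    (by rw [Matrix.transpose_smul, eta_transpose])
    (by rw [Matrix.smul_mul, Matrix.mul_smul, eta_mul_eta, smul_smul]; simp [hcc])
  let H : E4 × E4 → Fin 4 → Fin 4 → ℝ := fun r => Matrix.of.symm (Bᵀ * metricCoef l r * B)
  have hH : ContinuousAt H q := by
    refine continuousAt_pi.2 fun i => continuousAt_pi.2 fun j => ?_
    refine (contDiffAt_matrix_mul (contDiffAt_matrix_mul (A := fun _ => Bᵀ)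
      (fun _ _ => contDiffAt_const) fun i j => (smoothNear_metricCoef hl i j).contDiffAt)
      (B := fun _ => B) (fun _ _ => contDiffAt_const) i j).continuousAt
  have hHq : H q = Matrix.of.symm (-(l q) • eta) := by simp only [H, hB]
  have hev : ∀ᶠ r in 𝓝 q, (Matrix.of (H r))ᵀ = Matrix.of (H r) →
      (Matrix.of (ρ (H r)))ᵀ * Matrix.of (H r) * Matrix.of (ρ (H r)) = -(l q) • eta := by
    have := hH.tendsto
    rw [hHq] at this
    exact (this.eventually hρ).mono fun r hr => hr.2
  -- Two numbers of absolute value one at distance less than one are equal, so the sign `ε` in the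
  -- definition does not flip.
  have hclose : ∀ᶠ r in 𝓝 q, |l r - l q| < 1 := by
    have : ContinuousAt (fun r => |l r - l q|) q :=
      (hl.contDiffAt.continuousAt.sub continuousAt_const).abs
    exact this.eventually (gt_mem_nhds (by simp))
  filter_upwards [hev, hclose, hl.eventually] with r hr hrc hlr hr1
  have hlr' : l r = l q := by
    rcases (abs_eq zero_le_one).1 hr1 with e | e <;> rcases (abs_eq zero_le_one).1 h1 with e' | e'
    · rw [e, e']
    · rw [e, e'] at hrc; norm_num at hrc
    · rw [e, e'] at hrc; norm_num at hrc
    · rw [e, e']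
  refine ⟨hr1, B * Matrix.of (ρ (H r)), ?_⟩
  rw [hlr', ← hr]
  · simp only [Matrix.transpose_mul, H, Equiv.apply_symm_apply, Matrix.mul_assoc]
  · simp only [H, Equiv.apply_symm_apply, Matrix.transpose_mul, Matrix.transpose_transpose,
      metricCoef_transpose hlr, Matrix.mul_assoc]

/-- In Minkowski space, vectors orthogonal to a timelike vector are spacelike. -/
theorem minkowski_pos {y v : Fin 4 → ℝ} (hy : y ⬝ᵥ eta *ᵥ y < 0) (hyv : y ⬝ᵥ eta *ᵥ v = 0)
    (hv : v ≠ 0) : 0 < v ⬝ᵥ eta *ᵥ v := by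
  have hexp : ∀ u w : Fin 4 → ℝ, u ⬝ᵥ eta *ᵥ w =
      -(u 0 * w 0) + u 1 * w 1 + u 2 * w 2 + u 3 * w 3 := by
    intro u w
    simp [eta, Matrix.mulVec_diagonal, dotProduct, Fin.sum_univ_succ]
    ring
  rw [hexp] at hy hyv ⊢
  set V := v 1 * v 1 + v 2 * v 2 + v 3 * v 3 with hV
  set Y := y 1 * y 1 + y 2 * y 2 + y 3 * y 3 with hY
  -- The Cauchy–Schwarz inequality of the spatial parts, from Lagrange's identity. Orthogonality
  -- replaces the spatial product by `y₀ v₀`, and `y₀²` exceeds the spatial square of `y`.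
  have hcs : (y 1 * v 1 + y 2 * v 2 + y 3 * v 3) ^ 2 ≤ Y * V := by
    have : Y * V - (y 1 * v 1 + y 2 * v 2 + y 3 * v 3) ^ 2 =
      (y 1 * v 2 - y 2 * v 1) ^ 2 + (y 1 * v 3 - y 3 * v 1) ^ 2 + (y 2 * v 3 - y 3 * v 2) ^ 2 := by
      rw [hV, hY]; ring
    nlinarith [sq_nonneg (y 1 * v 2 - y 2 * v 1), sq_nonneg (y 1 * v 3 - y 3 * v 1),
      sq_nonneg (y 2 * v 3 - y 3 * v 2)]
  have hyv' : y 1 * v 1 + y 2 * v 2 + y 3 * v 3 = y 0 * v 0 := by linarith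
  rw [hyv'] at hcs
  have hY0 : 0 ≤ Y := add_nonneg (add_nonneg (mul_self_nonneg _) (mul_self_nonneg _))
    (mul_self_nonneg _)
  have hy0 : Y < y 0 * y 0 := by linarith
  have hV0 : 0 ≤ V := add_nonneg (add_nonneg (mul_self_nonneg _) (mul_self_nonneg _))
    (mul_self_nonneg _)
  rcases hV0.eq_or_lt with h0 | h0
  · exfalso
    apply hv
    have h1 : v 1 = 0 := by
      nlinarith [mul_self_nonneg (v 1), mul_self_nonneg (v 2), mul_self_nonneg (v 3)]
    have h2 : v 2 = 0 := by
      nlinarith [mul_self_nonneg (v 1), mul_self_nonneg (v 2), mul_self_nonneg (v 3)]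
    have h3 : v 3 = 0 := by
      nlinarith [mul_self_nonneg (v 1), mul_self_nonneg (v 2), mul_self_nonneg (v 3)]
    have h4 : v 0 = 0 := by
      have : (y 0 * v 0) ^ 2 ≤ 0 := by rw [← h0] at hcs; linarith
      have h5 : y 0 * v 0 = 0 := by nlinarith
      rcases mul_eq_zero.1 h5 with h | h
      · rw [h] at hy0; linarith
      · exact h
    funext i; fin_cases i <;> simp [h1, h2, h3, h4]
  · have h1 : Y * V < y 0 * y 0 * V := mul_lt_mul_of_pos_right hy0 h0
    have h2 : y 0 * y 0 * (v 0 * v 0) < y 0 * y 0 * V := by nlinarith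
    have h3 := lt_of_mul_lt_mul_left h2 (mul_self_nonneg _)
    linarith

/-- For a timelike `y`, the Hessian is definite on the orthogonal complement of `y`. -/
theorem IsTimelikeCoord.neg (h : IsTimelikeCoord l q) (hl : SmoothNear l q) {y v : E4}
    (hy : 0 < l q * gForm l q y y) (hyv : gForm l q y v = 0) (hv : v ≠ 0) :
    l q * gForm l q v v < 0 := by
  obtain ⟨h1, B, hB⟩ := h
  have hcc := mul_self_of_abs_eq_one h1
  have hdet := det_ne_zero_of_congr h1 hB
  have hinv : B * B⁻¹ = 1 := Matrix.mul_nonsing_inv _ (isUnit_iff_ne_zero.2 hdet)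
  -- The matrix `B⁻¹` carries `l q * g` to the negative of the Minkowski form; here `(l q)² = 1` is
  -- used.
  have hform : ∀ u w : E4, l q * gForm l q u w =
      -((B⁻¹ *ᵥ u.ofLp) ⬝ᵥ eta *ᵥ (B⁻¹ *ᵥ w.ofLp)) := by
    intro u w
    have h2 : ∀ z : E4, z.ofLp = B *ᵥ (B⁻¹ *ᵥ z.ofLp) := fun z => by
      rw [Matrix.mulVec_mulVec, hinv, Matrix.one_mulVec]
    have h3 : gForm l q u w = (B⁻¹ *ᵥ u.ofLp) ⬝ᵥ (Bᵀ * metricCoef l q * B) *ᵥ (B⁻¹ *ᵥ w.ofLp) := by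
      rw [gForm_eq_dotProduct hl]
      conv_lhs => rw [h2 u, h2 w]
      rw [Matrix.mul_assoc, ← Matrix.mulVec_mulVec, Matrix.dotProduct_mulVec _ Bᵀ,
        Matrix.vecMul_transpose, ← Matrix.mulVec_mulVec]
    rw [h3, hB, Matrix.smul_mulVec, dotProduct_smul, smul_eq_mul]
    linear_combination (-((B⁻¹ *ᵥ u.ofLp) ⬝ᵥ eta *ᵥ (B⁻¹ *ᵥ w.ofLp))) * hcc
  rw [hform] at hy ⊢
  have hyv' := hform y v
  rw [hyv, mul_zero] at hyv'
  have hv' : B⁻¹ *ᵥ v.ofLp ≠ 0 := by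
    intro h0
    apply hv
    have : v.ofLp = B *ᵥ (B⁻¹ *ᵥ v.ofLp) := by
      rw [Matrix.mulVec_mulVec, hinv, Matrix.one_mulVec]
    rw [h0, Matrix.mulVec_zero] at this
    ext a; exact congrFun this a
  have := minkowski_pos (by linarith) (by linarith) hv'
  linarith

/-- The square `F² = |l|^(2/n)`. -/
def sqFun (l : E4 × E4 → ℝ) (n : ℝ) (q : E4 × E4) : ℝ := (|l q| ^ (1 / n)) ^ 2

theorem sqFun_eq (l : E4 × E4 → ℝ) (n : ℝ) (q : E4 × E4) : sqFun l n q = |l q| ^ (2 / n) := by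
  rw [sqFun, ← Real.rpow_natCast, ← Real.rpow_mul (abs_nonneg _)]
  congr 1; push_cast; ring

theorem sqFun_homogeneous (hn : 2 ≤ n) (hom : FiberHomogeneous (fun c => c ^ n) l) :
    FiberHomogeneous (fun c => c ^ 2) (sqFun l n) := by
  intro x y c hc
  simp only [sqFun]
  have h1 := hom x y c hc
  simp only at h1
  rw [h1, abs_mul, abs_of_pos (Real.rpow_pos_of_pos hc _),
    Real.mul_rpow (Real.rpow_nonneg hc.le _) (abs_nonneg _), ← Real.rpow_mul hc.le,
    mul_one_div_cancel (by linarith), Real.rpow_one, mul_pow]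

/-- The sign of `l` is locally constant where `l ≠ 0`. So `|l|` is locally a constant multiple of
`l`, and the fractional power has a positive base and is smooth. -/
theorem sqFun_eventuallyEq (hl : SmoothNear l q) (h0 : l q ≠ 0) (n : ℝ) :
    ∀ᶠ r in 𝓝 q, 0 < SignType.sign (l q) * l r ∧
      sqFun l n r = (SignType.sign (l q) * l r) ^ (2 / n) := by
  have h1 : ∀ᶠ r in 𝓝 q, 0 < (SignType.sign (l q) : ℝ) * l r := by
    have : ContinuousAt (fun r => (SignType.sign (l q) : ℝ) * l r) q :=
      continuousAt_const.mul hl.contDiffAt.continuousAt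
    refine this.eventually (lt_mem_nhds ?_)
    change 0 < (SignType.sign (l q) : ℝ) * l q
    rw [sign_mul_self]
    exact abs_pos.2 h0
  filter_upwards [h1] with r hr
  refine ⟨hr, ?_⟩
  rw [sqFun_eq]
  congr 1
  rw [← abs_of_pos hr, abs_mul]
  rcases lt_or_gt_of_ne h0 with h | h <;> simp [h]

theorem smoothNear_sqFun (hl : SmoothNear l q) (h0 : l q ≠ 0) (n : ℝ) :
    SmoothNear (sqFun l n) q := by
  refine SmoothNear.congr (h := fun r => ((SignType.sign (l q) : ℝ) * l r) ^ (2 / n)) ?_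
    ((sqFun_eventuallyEq hl h0 n).mono fun r hr => hr.2)
  filter_upwards [hl, sqFun_eventuallyEq hl h0 n] with r h1 h2
  exact (contDiffAt_const.mul h1).rpow_const_of_ne h2.1.ne'

theorem fderiv_sqFun (hl : SmoothNear l q) (h0 : l q ≠ 0) (n : ℝ) :
    ∀ᶠ r in 𝓝 q, ∀ w, fderiv ℝ (sqFun l n) r w =
      (2 / n * (SignType.sign (l q) * l r) ^ (2 / n - 1) * SignType.sign (l q)) *
        fderiv ℝ l r w := by
  filter_upwards [hl.eventually, (sqFun_eventuallyEq hl h0 n).eventually_nhds] with r h1 h2 w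
  have h3 : sqFun l n =ᶠ[𝓝 r] fun r => ((SignType.sign (l q) : ℝ) * l r) ^ (2 / n) :=
    h2.mono fun r hr => hr.2
  rw [h3.fderiv_eq]
  have h4 : HasFDerivAt (fun r => (SignType.sign (l q) : ℝ) * l r)
      ((SignType.sign (l q) : ℝ) • fderiv ℝ l r) r :=
    h1.differentiableAt.hasFDerivAt.const_mul _
  rw [(h4.rpow_const (Or.inl h2.self_of_nhds.1.ne')).fderiv]
  simp only [_root_.smul_apply, smul_eq_mul]
  ring

section Homogeneous

variable {Φ : E4 × E4 → ℝ}

theorem gForm_radial (hom : FiberHomogeneous (fun c => c ^ 2) Φ) (hΦ : SmoothNear Φ q) (v : E4) :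
    gForm Φ q q.2 v = (1 / 2) * fderiv ℝ Φ q (0, v) := by
  rw [gForm_eq_dir hΦ, (hom_dir hom v).euler (hasDerivAt_id 1) (hΦ.dir _).differentiableAt, one_mul]

theorem gForm_radial_radial (hom : FiberHomogeneous (fun c => c ^ 2) Φ) (hΦ : SmoothNear Φ q) :
    gForm Φ q q.2 q.2 = Φ q := by
  rw [gForm_radial hom hΦ, hom.euler (κ := 2) (by simpa using hasDerivAt_pow 2 (1 : ℝ))
    hΦ.differentiableAt]
  ring

end Homogeneous

theorem gForm_radial_rpow (hom : FiberHomogeneous (fun c => c ^ n) l) (hl : SmoothNear l q)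
    (v : E4) : gForm l q q.2 v = (1 / 2) * ((n - 1) * fderiv ℝ l q (0, v)) := by
  have h1 : FiberHomogeneous (fun c => c ^ (n - 1)) (fun r => fderiv ℝ l r (0, v)) :=
    (hom.dir_vertical v).congr fun c hc => by rw [Real.rpow_sub_one hc.ne']
  rw [gForm_eq_dir hl, h1.euler (κ := n - 1) ?_ (hl.dir _).differentiableAt]
  simpa using Real.hasDerivAt_rpow_const (x := 1) (p := n - 1) (Or.inl one_ne_zero)

theorem gForm_radial_radial_rpow (hom : FiberHomogeneous (fun c => c ^ n) l)
    (hl : SmoothNear l q) : gForm l q q.2 q.2 = (1 / 2) * ((n - 1) * (n * l q)) := by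
  rw [gForm_radial_rpow hom hl, hom.euler (κ := n) ?_ hl.differentiableAt]
  simpa using Real.hasDerivAt_rpow_const (x := 1) (p := n) (Or.inl one_ne_zero)

theorem sqFun_eq_one (h : |l q| = 1) : sqFun l n q = 1 := by simp [sqFun, h]

/-- At a timelike unit vector `y`, the Finsler metric is negative definite on the orthogonal
complement of `y`. -/
theorem gForm_sqFun_neg (hn : 2 ≤ n) (hom : FiberHomogeneous (fun c => c ^ n) l)
    (hl : SmoothNear l q) (h : IsTimelikeCoord l q) {v : E4} (hv : v ≠ 0)
    (hyv : gForm (sqFun l n) q q.2 v = 0) : gForm (sqFun l n) q v v < 0 := by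
  have hcc := mul_self_of_abs_eq_one h.1
  have h0 : l q ≠ 0 := by rintro h0; rw [h0] at hcc; simp at hcc
  have hΦ := smoothNear_sqFun hl h0 n
  have hsign : (SignType.sign (l q) : ℝ) = l q := by
    rcases (abs_eq zero_le_one).1 h.1 with e | e <;> simp [e]
  have hfd := fderiv_sqFun hl h0 n
  rw [hsign] at hfd
  -- By Euler's identity `g^F(y, v)` is half of the derivative of `F²` along `v`, a non-zero
  -- multiple of that of `l`.
  have hdl : fderiv ℝ l q (0, v) = 0 := by
    rw [gForm_radial (sqFun_homogeneous hn hom) hΦ, hfd.self_of_nhds, hcc, Real.one_rpow] at hyv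
    have : 2 / n ≠ 0 := by positivity
    simpa [this, h0] using hyv
  -- Since the derivative of `l` along `v` vanishes, the term in which the outer power is
  -- differentiated twice drops out, and the two Hessians are proportional on `v`. Moreover `v` is
  -- also `g^L`-orthogonal to `y`, for which `l * g^L(y, y) = n(n - 1)/2 > 0`.
  have h1 : gForm (sqFun l n) q v v = 2 / n * (l q * gForm l q v v) := by
    rw [gForm_eq_dir hΦ, gForm_eq_dir hl]
    have h2 : (fun r => fderiv ℝ (sqFun l n) r (0, v)) =ᶠ[𝓝 q] fun r =>
        (2 / n * (l q * l r) ^ (2 / n - 1) * l q) * fderiv ℝ l r (0, v) :=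
      hfd.mono fun r hr => hr _
    rw [h2.fderiv_eq]
    have h3 : DifferentiableAt ℝ (fun r => 2 / n * (l q * l r) ^ (2 / n - 1) * l q) q := by
      have : DifferentiableAt ℝ (fun r => (l q * l r) ^ (2 / n - 1)) q :=
        (hl.differentiableAt.const_mul _).rpow_const (Or.inl (by rw [hcc]; exact one_ne_zero))
      exact (this.const_mul _).mul_const _
    rw [fderiv_fun_mul h3 (hl.dir _).differentiableAt]
    simp only [_root_.add_apply, _root_.smul_apply, smul_eq_mul, hdl, zero_mul, add_zero, hcc,
      Real.one_rpow]
    ring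
  rw [h1]
  have h4 : l q * gForm l q v v < 0 := by
    refine h.neg hl (y := q.2) ?_ ?_ hv
    · rw [gForm_radial_radial_rpow hom hl]
      have : l q * (1 / 2 * ((n - 1) * (n * l q))) = (1 / 2) * ((n - 1) * n) * (l q * l q) := by ring
      rw [this, hcc]
      have : 0 < (n - 1) * n := by nlinarith
      linarith
    · rw [gForm_radial_rpow hom hl, hdl]; ring
  have : 0 < 2 / n := by positivity
  nlinarith

end Timelike

/-! ### Finsler spacetimes in induced coordinates -/

section FinslerCoordinates

variable {M : Type*} [TopologicalSpace M] [ChartedSpace E4 M] [IsManifold (𝓡 4) ∞ M]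
  {φ : OpenPartialHomeomorph M E4}

/-- The isomorphism of `ℝ⁴` with a tangent space given by a chart. -/
def chartEquiv (hφ : φ ∈ IsManifold.maximalAtlas (𝓡 4) ∞ M) {x : E4} (hx : x ∈ φ.target) :
    E4 ≃L[ℝ] TangentSpace (𝓡 4) (φ.symm x) :=
  (mdifferentiable_of_mem_maximalAtlas hφ).symm.mfderiv hx

theorem inducedPoint_eq_chartEquiv (hφ : φ ∈ IsManifold.maximalAtlas (𝓡 4) ∞ M) {x : E4}
    (hx : x ∈ φ.target) (y : E4) : inducedPoint φ (x, y) = ⟨φ.symm x, chartEquiv hφ hx y⟩ := rfl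

theorem leg_framePoint_eq_chartEquiv (hφ : φ ∈ IsManifold.maximalAtlas (𝓡 4) ∞ M) {s : FrameCoord}
    (hs : s.1 ∈ φ.target) (i : Fin 4) :
    leg (framePoint φ s) i = chartEquiv hφ hs (s.2 i) := leg_framePoint s i

/-- The invariant Hessian is an iterated derivative in one real variable. Smoothness near the point
identifies the inner derivative with a directional derivative for all small `s`, as is needed before
the outer one can be taken. -/
theorem fiberMetric_chartEquiv {L : TangentBundle (𝓡 4) M → ℝ}
    (hφ : φ ∈ IsManifold.maximalAtlas (𝓡 4) ∞ M) {x y : E4} (hx : x ∈ φ.target)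
    (hL : SmoothNear (fun q => L (inducedPoint φ q)) (x, y)) (v w : E4) :
    fiberMetric L (φ.symm x) (chartEquiv hφ hx y) (chartEquiv hφ hx v) (chartEquiv hφ hx w) =
      gForm (fun q => L (inducedPoint φ q)) (x, y) v w := by
  set h : E4 × E4 → ℝ := fun q => L (inducedPoint φ q) with hh
  have h1 : ∀ s t : ℝ, L ⟨φ.symm x, chartEquiv hφ hx y + s • chartEquiv hφ hx v +
      t • chartEquiv hφ hx w⟩ = h ((x, y + s • v) + t • (0, w)) := by
    intro s t
    simp only [hh, Prod.smul_mk, Prod.mk_add_mk, smul_zero, add_zero]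
    rw [inducedPoint_eq_chartEquiv hφ hx]
    simp only [map_add, map_smul]
  have hcurve : HasDerivAt (fun s : ℝ => ((x, y + s • v) : E4 × E4)) (0, v) 0 := by
    have h2 : HasDerivAt (fun s : ℝ => y + s • v) v 0 := by
      simpa using ((hasDerivAt_id (0 : ℝ)).smul_const v).const_add y
    exact (hasDerivAt_const _ _).prodMk h2
  have hcurve0 : ((x, y + (0 : ℝ) • v) : E4 × E4) = (x, y) := by simp
  have h2 : (fun s : ℝ => deriv (fun t : ℝ => L ⟨φ.symm x, chartEquiv hφ hx y +
      s • chartEquiv hφ hx v + t • chartEquiv hφ hx w⟩) 0) =ᶠ[𝓝 0]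
      fun s => fderiv ℝ h (x, y + s • v) (0, w) := by
    have h3 : ∀ᶠ s : ℝ in 𝓝 0, SmoothNear h (x, y + s • v) := by
      have := hcurve.continuousAt.tendsto
      rw [hcurve0] at this
      exact this.eventually hL.eventually
    filter_upwards [h3] with s hs
    simp only [h1]
    have h4 : HasDerivAt (fun t : ℝ => ((x, y + s • v) : E4 × E4) + t • ((0, w) : E4 × E4))
        (0, w) 0 := by
      simpa using ((hasDerivAt_id (0 : ℝ)).smul_const ((0, w) : E4 × E4)).const_add (x, y + s • v)
    have h5 : HasFDerivAt h (fderiv ℝ h (x, y + s • v))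
        ((x, y + s • v) + (0 : ℝ) • ((0, w) : E4 × E4)) := by
      simpa using hs.differentiableAt.hasFDerivAt
    exact (h5.comp_hasDerivAt (0 : ℝ) h4).deriv
  rw [fiberMetric, h2.deriv_eq, gForm_eq_dir hL]
  congr 1
  have h6 : HasFDerivAt (fun r => fderiv ℝ h r (0, w))
      (fderiv ℝ (fun r => fderiv ℝ h r (0, w)) (x, y)) (x, y + (0 : ℝ) • v) := by
    rw [hcurve0]
    exact (hL.dir (0, w)).differentiableAt.hasFDerivAt
  exact (h6.comp_hasDerivAt (0 : ℝ) hcurve).deriv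

theorem exists_basis_of_det_ne_zero {s : FrameCoord} (h : (frameMatrix s).det ≠ 0) :
    ∃ b : Module.Basis (Fin 4) ℝ E4, ∀ i, b i = s.2 i := by
  let e : Module.Basis (Fin 4) ℝ E4 := (EuclideanSpace.basisFun (Fin 4) ℝ).toBasis
  have h1 : e.toMatrix s.2 = frameMatrix s := by
    ext a i
    simp [e, Module.Basis.toMatrix_apply, frameMatrix]
  have h2 := (Module.Basis.is_basis_iff_det e (v := s.2)).2
    (by rw [Module.Basis.det_apply, h1]; exact isUnit_iff_ne_zero.2 h)
  exact ⟨Module.Basis.mk h2.1 h2.2.ge, fun i => by simp⟩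

namespace FinslerSpacetime

variable (X : FinslerSpacetime M)

/-- The function `L` in induced coordinates. -/
def lCoord (φ : OpenPartialHomeomorph M E4) (q : E4 × E4) : ℝ := X.L (inducedPoint φ q)

theorem sqCoord_eq_sqFun : X.sqCoord φ = sqFun (X.lCoord φ) X.n := rfl

theorem lCoord_homogeneous : FiberHomogeneous (fun c => c ^ X.n) (X.lCoord φ) := by
  intro x y c hc
  have h : inducedPoint φ (x, c • y) =
      ⟨φ.symm x, c • mfderiv 𝓘(ℝ, E4) (𝓡 4) φ.symm x y⟩ :=
    congrArg (TotalSpace.mk (φ.symm x))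
      (ContinuousLinearMap.map_smul (mfderiv 𝓘(ℝ, E4) (𝓡 4) φ.symm x) c y)
  simp only [lCoord, h]
  exact X.homogeneous _ _ c hc

theorem sqCoord_homogeneous : FiberHomogeneous (fun c => c ^ 2) (X.sqCoord φ) :=
  sqFun_homogeneous X.two_le X.lCoord_homogeneous

/-- Homogeneity with the factor `2`. Consequently vectors with `L ≠ 0` are non-zero and lie where
`L` is smooth. -/
theorem L_zero (x : M) : X.L ⟨x, 0⟩ = 0 := by
  have h1 := X.homogeneous x 0 2 two_pos
  rw [smul_zero] at h1
  have h2 : (1 : ℝ) < 2 ^ X.n := Real.one_lt_rpow one_lt_two (by linarith [X.two_le])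
  have h3 : X.L ⟨x, 0⟩ * (2 ^ X.n - 1) = 0 := by linarith
  rcases mul_eq_zero.1 h3 with h | h
  · exact h
  · linarith

theorem ne_zero_of_lCoord_ne_zero {q : E4 × E4} (h : X.lCoord φ q ≠ 0) : q.2 ≠ 0 := by
  rintro h0
  apply h
  have : inducedPoint φ q = ⟨φ.symm q.1, 0⟩ := by
    simp only [inducedPoint, h0]
    exact congrArg (TotalSpace.mk (φ.symm q.1))
      (ContinuousLinearMap.map_zero (mfderiv 𝓘(ℝ, E4) (𝓡 4) φ.symm q.1))
  rw [lCoord, this, X.L_zero]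

theorem continuousOn_lCoord (hφ : φ ∈ IsManifold.maximalAtlas (𝓡 4) ∞ M) :
    ContinuousOn (X.lCoord φ) (Prod.fst ⁻¹' φ.target) :=
  X.continuous_L.comp_continuousOn (contMDiffOn_inducedPoint hφ).continuousOn

theorem smoothNear_lCoord (hφ : φ ∈ IsManifold.maximalAtlas (𝓡 4) ∞ M) {q : E4 × E4}
    (hq : q.1 ∈ φ.target) (h : X.lCoord φ q ≠ 0) : SmoothNear (X.lCoord φ) q := by
  have hU : IsOpen ({r : E4 × E4 | r.1 ∈ φ.target ∧ r.2 ≠ 0}) :=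
    (φ.open_target.preimage continuous_fst).inter (isOpen_ne.preimage continuous_snd)
  have h1 : ContMDiffOn 𝓘(ℝ, E4 × E4) 𝓘(ℝ, ℝ) ∞ (X.lCoord φ)
      {r : E4 × E4 | r.1 ∈ φ.target ∧ r.2 ≠ 0} := by
    refine X.smooth_L.comp ((contMDiffOn_inducedPoint hφ).mono fun r hr => hr.1) ?_
    rintro ⟨x, y⟩ ⟨hx, hy⟩
    rw [mem_preimage, inducedPoint_eq_chartEquiv hφ hx]
    exact fun h0 => hy ((chartEquiv hφ hx).map_eq_zero_iff.1 h0)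
  rw [contMDiffOn_iff_contDiffOn] at h1
  filter_upwards [hU.mem_nhds ⟨hq, X.ne_zero_of_lCoord_ne_zero h⟩] with r hr
  exact h1.contDiffAt (hU.mem_nhds hr)

theorem smoothNear_sqCoord (hφ : φ ∈ IsManifold.maximalAtlas (𝓡 4) ∞ M) {q : E4 × E4}
    (hq : q.1 ∈ φ.target) (h : X.lCoord φ q ≠ 0) : SmoothNear (X.sqCoord φ) q :=
  smoothNear_sqFun (X.smoothNear_lCoord hφ hq h) h _

theorem lCoord_ne_zero_of_abs {q : E4 × E4} (h : |X.lCoord φ q| = 1) : X.lCoord φ q ≠ 0 := by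
  rintro h0
  simp [h0] at h

/-- Timelike unit vectors in induced coordinates. -/
theorem mem_unitTimelike_iff (hφ : φ ∈ IsManifold.maximalAtlas (𝓡 4) ∞ M) {x : E4}
    (hx : x ∈ φ.target) (y : E4) :
    chartEquiv hφ hx y ∈ unitTimelike X.L (φ.symm x) ↔ IsTimelikeCoord (X.lCoord φ) (x, y) := by
  have hL : X.L ⟨φ.symm x, chartEquiv hφ hx y⟩ = X.lCoord φ (x, y) := rfl
  simp only [unitTimelike, IsTimelikeCoord, mem_ofPred_eq, hL]
  refine and_congr_right fun h1 => ?_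
  have hs := X.smoothNear_lCoord hφ (q := (x, y)) hx (X.lCoord_ne_zero_of_abs h1)
  rw [h1, div_one]
  constructor
  · rintro ⟨b, hb⟩
    let s : FrameCoord := (x, fun i => (chartEquiv hφ hx).symm (b i))
    refine ⟨frameMatrix s, ?_⟩
    rw [gram_frameMatrix hs]
    ext i j
    have := hb i j
    rw [← (chartEquiv hφ hx).apply_symm_apply (b i), ← (chartEquiv hφ hx).apply_symm_apply (b j),
      fiberMetric_chartEquiv hφ hx hs] at this
    exact this
  · rintro ⟨B, hB⟩
    let s : FrameCoord := (x, fun i => WithLp.toLp 2 fun a => B a i)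
    have hsB : frameMatrix s = B := rfl
    obtain ⟨b, hb⟩ := exists_basis_of_det_ne_zero (s := s)
      (by rw [hsB]; exact det_ne_zero_of_congr h1 hB)
    refine ⟨b.map (chartEquiv hφ hx).toLinearEquiv, fun i j => ?_⟩
    rw [← hsB, gram_frameMatrix hs] at hB
    have := congrFun (congrFun hB i) j
    simp only [Matrix.of_apply, ← hb] at this
    simp only [Module.Basis.map_apply]
    refine (fiberMetric_chartEquiv hφ hx hs _ _).trans ?_
    exact this

/-- The Finsler metric in induced coordinates. -/
theorem fiberMetric_sq (hφ : φ ∈ IsManifold.maximalAtlas (𝓡 4) ∞ M) {x y : E4}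
    (hx : x ∈ φ.target) (h : X.lCoord φ (x, y) ≠ 0) (v w : E4) :
    fiberMetric (fun v => X.F v ^ 2) (φ.symm x) (chartEquiv hφ hx y) (chartEquiv hφ hx v)
      (chartEquiv hφ hx w) = gForm (X.sqCoord φ) (x, y) v w :=
  fiberMetric_chartEquiv hφ hx (X.smoothNear_sqCoord hφ (q := (x, y)) hx h) v w

end FinslerSpacetime

/-- The orientation of frames near a point is the sign of the determinant in coordinates, up to
a constant. -/
theorem ManifoldOrientation.exists_sign (o : ManifoldOrientation M)
    (hφ : φ ∈ IsManifold.maximalAtlas (𝓡 4) ∞ M) {x₀ : E4} (hx₀ : x₀ ∈ φ.target) :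
    ∃ ε : ℝ, ε ≠ 0 ∧ ∀ᶠ x in 𝓝 x₀, ∀ f : Fin 4 → E4,
      (∃ b : Module.Basis (Fin 4) ℝ (TangentSpace (𝓡 4) (framePoint φ (x, f)).proj),
        (∀ i, b i = leg (framePoint φ (x, f)) i) ∧
        b.orientation = o.orient (framePoint φ (x, f)).proj) ↔
      0 < ε * (frameMatrix (x, f)).det := by
  obtain ⟨U, hU, b, hb, hbo⟩ := o.exists_continuous (φ.symm x₀)
  -- the given frame field in coordinates
  let B : E4 → FrameCoord := fun x =>
    (x, fun i => (tangentCoord φ ⟨φ.symm x, b (φ.symm x) i⟩).2)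
  have hBcont : ContinuousAt (fun x => (frameMatrix (B x)).det) x₀ := by
    have h1 : ContinuousAt φ.symm x₀ := φ.continuousAt_symm hx₀
    have h2 : ∀ i, ContinuousAt (fun x => (tangentCoord φ ⟨φ.symm x, b (φ.symm x) i⟩).2) x₀ := by
      intro i
      have h3 : ContinuousAt (fun x => (⟨x, b x i⟩ : TangentBundle (𝓡 4) M)) (φ.symm x₀) :=
        (hb i).continuousAt hU
      have h4 : ContinuousAt (tangentCoord φ) ⟨φ.symm x₀, b (φ.symm x₀) i⟩ :=
        (contMDiffOn_tangentCoord hφ).continuousOn.continuousAt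
          ((φ.open_source.preimage (FiberBundle.continuous_proj E4 (TangentSpace (𝓡 4)))).mem_nhds
            (φ.map_target hx₀))
      exact (ContinuousAt.comp (f := φ.symm) (x := x₀)
        (g := fun x => tangentCoord φ ⟨x, b x i⟩) (ContinuousAt.comp (x := φ.symm x₀)
          (f := fun x => (⟨x, b x i⟩ : TangentBundle (𝓡 4) M)) h4 h3) h1).snd
    have h5 : ContinuousAt (fun x => frameMatrix (B x)) x₀ := by
      refine continuousAt_pi.2 fun a => continuousAt_pi.2 fun i => ?_
      exact (EuclideanSpace.proj (𝕜 := ℝ) a).continuous.continuousAt.comp (h2 i)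
    exact (continuous_id.matrix_det.continuousAt).comp h5
  -- determinants with respect to the frame field
  have hmat : ∀ x (hx : x ∈ φ.target) (f : Fin 4 → E4), (frameMatrix (x, f)).det =
      (frameMatrix (B x)).det * (b (φ.symm x)).det fun i => chartEquiv hφ hx (f i) := by
    intro x hx f
    have hB : ∀ i, chartEquiv hφ hx ((B x).2 i) = b (φ.symm x) i := by
      intro i
      have h1 := inducedPoint_tangentCoord hφ (v := ⟨φ.symm x, b (φ.symm x) i⟩) (φ.map_target hx)
      have h2 : tangentCoord φ ⟨φ.symm x, b (φ.symm x) i⟩ = (x, (B x).2 i) :=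
        Prod.ext (φ.right_inv hx) rfl
      rw [h2, inducedPoint_eq_chartEquiv hφ hx] at h1
      simpa using h1
    rw [Module.Basis.det_apply, ← Matrix.det_mul]
    congr 1
    ext a i
    have h1 : f i = ∑ j, (b (φ.symm x)).repr (chartEquiv hφ hx (f i)) j • (B x).2 j := by
      apply (chartEquiv hφ hx).injective
      rw [map_sum]
      simp only [map_smul, hB]
      exact ((b (φ.symm x)).sum_repr _).symm
    simp only [frameMatrix, Matrix.of_apply, Matrix.mul_apply, Module.Basis.toMatrix_apply]
    conv_lhs => rw [h1]
    simp only [WithLp.ofLp_sum, Finset.sum_apply, PiLp.smul_apply, smul_eq_mul]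
    exact Finset.sum_congr rfl fun j _ => mul_comm _ _
  have hB0 : ∀ x ∈ φ.target, (frameMatrix (B x)).det ≠ 0 := by
    intro x hx h0
    have h1 := hmat x hx stdVec
    rw [h0, zero_mul] at h1
    have h2 : frameMatrix (x, stdVec) = 1 := by
      ext a i
      simp [frameMatrix, stdVec_apply, Matrix.one_apply]
    rw [h2] at h1
    simp at h1
  -- The constant is the coordinate determinant of the given positively oriented frame field at
  -- `x₀`; by continuity the determinant keeps its sign nearby.
  refine ⟨(frameMatrix (B x₀)).det, hB0 x₀ hx₀, ?_⟩
  have hsign : ∀ᶠ x in 𝓝 x₀, 0 < (frameMatrix (B x₀)).det * (frameMatrix (B x)).det := by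
    refine (continuousAt_const.mul hBcont).eventually (lt_mem_nhds ?_)
    exact mul_self_pos.2 (hB0 x₀ hx₀)
  filter_upwards [hsign, φ.open_target.mem_nhds hx₀, (φ.continuousAt_symm hx₀) hU]
    with x hx hxt hxU f
  rw [hmat x hxt f, ← mul_assoc, mul_pos_iff_of_pos_left hx]
  have hleg : ∀ i, leg (framePoint φ (x, f)) i = chartEquiv hφ hxt (f i) :=
    fun i => leg_framePoint_eq_chartEquiv hφ (s := (x, f)) hxt i
  simp only [hleg]
  change (∃ b' : Module.Basis (Fin 4) ℝ (TangentSpace (𝓡 4) (φ.symm x)),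
    (∀ i, b' i = chartEquiv hφ hxt (f i)) ∧ b'.orientation = o.orient (φ.symm x)) ↔ _
  rw [← hbo _ hxU]
  constructor
  · rintro ⟨b', hb', hbo'⟩
    have h1 := ((b (φ.symm x)).orientation_eq_iff_det_pos b').1 hbo'.symm
    rwa [funext hb'] at h1
  · intro h
    have h2 := (Module.Basis.is_basis_iff_det (b (φ.symm x))
      (v := fun i => chartEquiv hφ hxt (f i))).2 (isUnit_iff_ne_zero.2 h.ne')
    refine ⟨Module.Basis.mk h2.1 h2.2.ge, fun i => by simp, ?_⟩
    refine (((b (φ.symm x)).orientation_eq_iff_det_pos _).2 ?_).symm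
    simpa using h

end FinslerCoordinates

/-! ### The observer space -/

section ObserverSpace

variable {M : Type*} [TopologicalSpace M] [ChartedSpace E4 M] [IsManifold (𝓡 4) ∞ M]
  {φ : OpenPartialHomeomorph M E4} {X : FinslerSpacetime M} {T : TimeOrientation X}

/-- The observer space in induced coordinates. -/
def observerCoord (T : TimeOrientation X) (φ : OpenPartialHomeomorph M E4) : Set (E4 × E4) :=
  {q | q.1 ∈ φ.target ∧ inducedPoint φ q ∈ observerSpace T}

theorem mem_observerCoord_iff (hφ : φ ∈ IsManifold.maximalAtlas (𝓡 4) ∞ M) {x : E4}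
    (hx : x ∈ φ.target) {y : E4} :
    (x, y) ∈ observerCoord T φ ↔ chartEquiv hφ hx y ∈ T.S (φ.symm x) :=
  ⟨fun h => h.2, fun h => ⟨hx, h⟩⟩

theorem isTimelikeCoord_of_mem (hφ : φ ∈ IsManifold.maximalAtlas (𝓡 4) ∞ M) {q : E4 × E4}
    (hq : q ∈ observerCoord T φ) : IsTimelikeCoord (X.lCoord φ) q := by
  obtain ⟨x, y⟩ := q
  rw [← X.mem_unitTimelike_iff hφ hq.1]
  obtain ⟨-, z, -, hz⟩ := T.isClosedComponent (φ.symm x)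
  have := (mem_observerCoord_iff hφ hq.1).1 hq
  rw [hz] at this
  exact connectedComponentIn_subset _ _ this

theorem isPreconnected_observerCoord (hφ : φ ∈ IsManifold.maximalAtlas (𝓡 4) ∞ M) {x : E4}
    (hx : x ∈ φ.target) : IsPreconnected {y | (x, y) ∈ observerCoord T φ} := by
  obtain ⟨-, z, -, hz⟩ := T.isClosedComponent (φ.symm x)
  have h1 : {y | (x, y) ∈ observerCoord T φ} =
      (chartEquiv hφ hx).symm '' T.S (φ.symm x) := by
    ext y
    simp only [mem_ofPred_eq, mem_observerCoord_iff hφ hx, mem_image]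
    exact ⟨fun h => ⟨_, h, by simp⟩, by rintro ⟨w, hw, rfl⟩; simpa using hw⟩
  rw [h1, hz]
  exact isPreconnected_connectedComponentIn.image _ (chartEquiv hφ hx).symm.continuous.continuousOn

/-- A connected set of timelike unit vectors that meets the component `S_x` is contained in it. -/
theorem subset_observerCoord (hφ : φ ∈ IsManifold.maximalAtlas (𝓡 4) ∞ M) {x : E4}
    (hx : x ∈ φ.target) {Y : Set E4} (hY : IsPreconnected Y)
    (htime : ∀ y ∈ Y, IsTimelikeCoord (X.lCoord φ) (x, y)) {y₁ : E4} (hy₁ : y₁ ∈ Y)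
    (h₁ : (x, y₁) ∈ observerCoord T φ) {y : E4} (hy : y ∈ Y) : (x, y) ∈ observerCoord T φ := by
  obtain ⟨-, z, hz', hz⟩ := T.isClosedComponent (φ.symm x)
  rw [mem_observerCoord_iff hφ hx] at h₁ ⊢
  rw [hz] at h₁ ⊢
  rw [connectedComponentIn_eq h₁]
  refine (hY.image (chartEquiv hφ hx) (chartEquiv hφ hx).continuous.continuousOn
    ).subset_connectedComponentIn ⟨y₁, hy₁, rfl⟩ ?_ ⟨y, hy, rfl⟩
  rintro _ ⟨w, hw, rfl⟩
  exact (X.mem_unitTimelike_iff hφ hx w).2 (htime w hw)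

/-- The Finsler function in coordinates. -/
def finslerCoord (X : FinslerSpacetime M) (φ : OpenPartialHomeomorph M E4) (q : E4 × E4) : ℝ := |X.lCoord φ q| ^ (1 / X.n)

/-- The unit vector in the direction of a given vector. -/
def unitCoord (X : FinslerSpacetime M) (φ : OpenPartialHomeomorph M E4) (q : E4 × E4) :
    E4 × E4 := (q.1, (finslerCoord X φ q)⁻¹ • q.2)

theorem finslerCoord_pos {q : E4 × E4} (h : X.lCoord φ q ≠ 0) : 0 < finslerCoord X φ q :=
  Real.rpow_pos_of_pos (abs_pos.2 h) _

theorem finslerCoord_smul (x y : E4) {c : ℝ} (hc : 0 < c) :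
    finslerCoord X φ (x, c • y) = c * finslerCoord X φ (x, y) := by
  have hn : X.n ≠ 0 := by linarith [X.two_le]
  have h1 := X.lCoord_homogeneous (φ := φ) x y c hc
  simp only at h1
  rw [finslerCoord, h1, abs_mul, abs_of_pos (Real.rpow_pos_of_pos hc _),
    Real.mul_rpow (Real.rpow_nonneg hc.le _) (abs_nonneg _), ← Real.rpow_mul hc.le,
    mul_one_div_cancel hn, Real.rpow_one]
  rfl

theorem finslerCoord_eq_one_iff {q : E4 × E4} : finslerCoord X φ q = 1 ↔ |X.lCoord φ q| = 1 := by
  have hn : X.n ≠ 0 := by linarith [X.two_le]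
  rw [finslerCoord]
  constructor
  · intro h
    have := congrArg (fun c : ℝ => c ^ X.n) h
    simpa [← Real.rpow_mul (abs_nonneg _), hn] using this
  · intro h; rw [h, Real.one_rpow]

theorem abs_lCoord_unitCoord {q : E4 × E4} (h : X.lCoord φ q ≠ 0) :
    |X.lCoord φ (unitCoord X φ q)| = 1 := by
  rw [← finslerCoord_eq_one_iff, unitCoord, finslerCoord_smul _ _ (inv_pos.2 (finslerCoord_pos h))]
  exact inv_mul_cancel₀ (finslerCoord_pos h).ne'

theorem unitCoord_eq_self {q : E4 × E4} (h : |X.lCoord φ q| = 1) : unitCoord X φ q = q := by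
  rw [unitCoord, finslerCoord_eq_one_iff.2 h, inv_one, one_smul]

theorem smoothNear_unitCoord (hφ : φ ∈ IsManifold.maximalAtlas (𝓡 4) ∞ M) {q : E4 × E4}
    (hq : q.1 ∈ φ.target) (h : X.lCoord φ q ≠ 0) : SmoothNear (unitCoord X φ) q := by
  have hl := X.smoothNear_lCoord hφ hq h
  have hne : ∀ᶠ r in 𝓝 q, X.lCoord φ r ≠ 0 := hl.contDiffAt.continuousAt.eventually_ne h
  filter_upwards [hl, hne] with r h1 h2
  have h3 : ContDiffAt ℝ ∞ (finslerCoord X φ) r :=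
    (h1.abs h2).rpow_const_of_ne (abs_ne_zero.2 h2)
  exact contDiffAt_fst.prodMk ((h3.inv (finslerCoord_pos h2).ne').smul contDiffAt_snd)

/-- The cone over the observer space. -/
def observerCone (T : TimeOrientation X) (φ : OpenPartialHomeomorph M E4) : Set (E4 × E4) :=
  {q | q.1 ∈ φ.target ∧ X.lCoord φ q ≠ 0 ∧ unitCoord X φ q ∈ observerCoord T φ}

theorem mem_observerCone_of_mem (hφ : φ ∈ IsManifold.maximalAtlas (𝓡 4) ∞ M) {q : E4 × E4}
    (hq : q ∈ observerCoord T φ) : q ∈ observerCone T φ := by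
  have h1 := (isTimelikeCoord_of_mem hφ hq).1
  exact ⟨hq.1, X.lCoord_ne_zero_of_abs h1, by rwa [unitCoord_eq_self h1]⟩

/-- If near `q₁ = (x₁, y₁)` in the observer space all the fibers meet the cone near `y₁`, then the
cone is a neighbourhood of `q₁`. -/
theorem exists_nhds_observerCone (hφ : φ ∈ IsManifold.maximalAtlas (𝓡 4) ∞ M) {q₁ : E4 × E4}
    (hq₁ : q₁ ∈ observerCoord T φ) : ∃ B ∈ 𝓝 q₁.2,
      ((∀ᶠ x in 𝓝 q₁.1, ∃ y ∈ B, (x, y) ∈ observerCone T φ) → observerCone T φ ∈ 𝓝 q₁) := by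
  have htime := isTimelikeCoord_of_mem hφ hq₁
  have h0 := X.lCoord_ne_zero_of_abs htime.1
  have hl := X.smoothNear_lCoord hφ hq₁.1 h0
  have hν := smoothNear_unitCoord hφ hq₁.1 h0
  have hev : ∀ᶠ r in 𝓝 q₁, r.1 ∈ φ.target ∧ X.lCoord φ r ≠ 0 ∧
      ContinuousAt (unitCoord X φ) r ∧ IsTimelikeCoord (X.lCoord φ) (unitCoord X φ r) := by
    have h1 : Tendsto (unitCoord X φ) (𝓝 q₁) (𝓝 q₁) := by
      have := hν.contDiffAt.continuousAt.tendsto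
      rwa [unitCoord_eq_self htime.1] at this
    filter_upwards [(φ.open_target.preimage continuous_fst).mem_nhds hq₁.1,
      hl.contDiffAt.continuousAt.eventually_ne h0, hν,
      h1.eventually (htime.eventually hl)] with r h2 h3 h4 h5
    exact ⟨h2, h3, h4.continuousAt, h5 (abs_lCoord_unitCoord h3)⟩
  rw [nhds_prod_eq, eventually_prod_iff] at hev
  obtain ⟨pa, ha, pb, hb, hab⟩ := hev
  obtain ⟨ε, hε, hball⟩ := Metric.eventually_nhds_iff_ball.1 hb
  -- The radius `ε` serves all base points near `q₁.1` simultaneously, because the conditions in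
  -- `hev` hold on a product neighbourhood.
  refine ⟨Metric.ball q₁.2 ε, Metric.ball_mem_nhds _ hε, fun hmeet => ?_⟩
  rw [← Prod.mk.eta (p := q₁), nhds_prod_eq]
  refine mem_of_superset (prod_mem_prod (inter_mem ha hmeet) (Metric.ball_mem_nhds q₁.2 hε)) ?_
  rintro ⟨x, y⟩ ⟨⟨hxa, y', hy', hx'⟩, hy⟩
  obtain ⟨hx, hne, -, -⟩ := hab hxa (hball y hy)
  refine ⟨hx, hne, ?_⟩
  -- The ball is convex, so the unit vectors in its directions form a connected set of timelike
  -- vectors over `x`. It meets `S_x` in the direction of `y'`, hence it is contained in `S_x`.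
  have hconn : IsPreconnected ((fun z => (unitCoord X φ (x, z)).2) '' Metric.ball q₁.2 ε) := by
    refine (convex_ball q₁.2 ε).isPreconnected.image _ fun z hz => ?_
    have h1 := (hab hxa (hball z hz)).2.2.1
    exact ((ContinuousAt.comp (f := fun z => (x, z)) h1
      (by fun_prop)).snd).continuousWithinAt
  refine subset_observerCoord hφ hx hconn ?_ (y₁ := (unitCoord X φ (x, y')).2) ⟨y', hy', rfl⟩
    hx'.2.2 ⟨y, hy, rfl⟩
  rintro _ ⟨z, hz, rfl⟩
  exact (hab hxa (hball z hz)).2.2.2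

/-- The cone over the observer space is a neighbourhood of the observer space. -/
theorem observerCone_mem_nhds (hφ : φ ∈ IsManifold.maximalAtlas (𝓡 4) ∞ M) {q : E4 × E4}
    (hq : q ∈ observerCoord T φ) : observerCone T φ ∈ 𝓝 q := by
  obtain ⟨x₀, y₀⟩ := q
  let u : Set E4 := {y | observerCone T φ ∈ 𝓝 (x₀, y)}
  have hu : IsOpen u := by
    have : u = (fun y => (x₀, y)) ⁻¹' interior (observerCone T φ) := by
      ext y; simp [u, mem_interior_iff_mem_nhds]
    rw [this]
    exact isOpen_interior.preimage (by fun_prop)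
  suffices h : {y | (x₀, y) ∈ observerCoord T φ} ⊆ u from h hq
  -- The fiber over `x₀` is connected, so it is enough that the open set `u` meets it and is
  -- relatively closed in it. The vector field of the time orientation supplies the first point.
  refine (isPreconnected_observerCoord hφ hq.1).subset_of_closure_inter_subset hu ?_ ?_
  · -- the given vector field
    obtain ⟨U, hU, Y, hY, hYS⟩ := T.exists_continuous (φ.symm x₀)
    let y : E4 → E4 := fun x => (tangentCoord φ ⟨φ.symm x, Y (φ.symm x)⟩).2
    have hy : ∀ x ∈ φ.target, φ.symm x ∈ U → (x, y x) ∈ observerCoord T φ := by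
      intro x hx hxU
      have h1 : tangentCoord φ ⟨φ.symm x, Y (φ.symm x)⟩ = (x, y x) :=
        Prod.ext (φ.right_inv hx) rfl
      refine ⟨hx, ?_⟩
      rw [← h1, inducedPoint_tangentCoord hφ (φ.map_target hx)]
      exact hYS _ hxU
    have hcont : ContinuousAt y x₀ := by
      have h3 : ContinuousAt (fun x => (⟨x, Y x⟩ : TangentBundle (𝓡 4) M)) (φ.symm x₀) :=
        hY.continuousAt hU
      have h4 : ContinuousAt (tangentCoord φ) ⟨φ.symm x₀, Y (φ.symm x₀)⟩ :=
        (contMDiffOn_tangentCoord hφ).continuousOn.continuousAt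
          ((φ.open_source.preimage (FiberBundle.continuous_proj E4 (TangentSpace (𝓡 4)))).mem_nhds
            (φ.map_target hq.1))
      exact (ContinuousAt.comp (f := φ.symm) (x := x₀)
        (g := fun x => tangentCoord φ ⟨x, Y x⟩) (ContinuousAt.comp (x := φ.symm x₀)
          (f := fun x => (⟨x, Y x⟩ : TangentBundle (𝓡 4) M)) h4 h3)
        (φ.continuousAt_symm hq.1)).snd
    have h₀ := hy x₀ hq.1 (mem_of_mem_nhds hU)
    obtain ⟨B, hB, h⟩ := exists_nhds_observerCone hφ h₀
    refine ⟨y x₀, h₀, h ?_⟩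
    filter_upwards [φ.open_target.mem_nhds hq.1, (φ.continuousAt_symm hq.1) hU, hcont hB]
      with x hx hxU hxB
    exact ⟨y x, hxB, mem_observerCone_of_mem hφ (hy x hx hxU)⟩
  · rintro y ⟨hyu, hyS⟩
    obtain ⟨B, hB, h⟩ := exists_nhds_observerCone hφ hyS
    obtain ⟨y', hy', hyB⟩ := mem_closure_iff_nhds.1 hyu B hB
    refine h ?_
    -- A vector `y'` of `u` inside `B` belongs to the cone over all base points near `x₀`. Thus the
    -- nearby fibers meet `B`, and the neighbourhood property passes to the limit `y`.
    have h1 : Tendsto (fun x => (x, y')) (𝓝 x₀) (𝓝 (x₀, y')) :=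
      (Continuous.tendsto (by fun_prop) x₀)
    filter_upwards [h1 hyB] with x hx
    exact ⟨y', hy', hx⟩

/-- The observer space is open among the unit vectors. -/
theorem eventually_mem_observerCoord (hφ : φ ∈ IsManifold.maximalAtlas (𝓡 4) ∞ M) {q : E4 × E4}
    (hq : q ∈ observerCoord T φ) :
    ∀ᶠ r in 𝓝 q, |X.lCoord φ r| = 1 → r ∈ observerCoord T φ := by
  filter_upwards [observerCone_mem_nhds hφ hq] with r hr h1
  have := hr.2.2
  rwa [unitCoord_eq_self h1] at this

end ObserverSpace

/-! ### The manifold structure of the observer space. -/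

section ObserverManifold

variable {M : Type*} [TopologicalSpace M] [ChartedSpace E4 M] [IsManifold (𝓡 4) ∞ M]
  {φ : OpenPartialHomeomorph M E4} {X : FinslerSpacetime M} {T : TimeOrientation X}

theorem tangentCoord_mem_observerCoord (hφ : φ ∈ IsManifold.maximalAtlas (𝓡 4) ∞ M)
    {v : TangentBundle (𝓡 4) M} (hv : v ∈ observerSpace T) (hx : v.proj ∈ φ.source) :
    tangentCoord φ v ∈ observerCoord T φ :=
  ⟨φ.map_source hx, by rwa [inducedPoint_tangentCoord hφ hx]⟩

theorem isOpen_tangentCoord_preimage (hφ : φ ∈ IsManifold.maximalAtlas (𝓡 4) ∞ M)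
    {N : Set (E4 × E4)} (hN : IsOpen N) :
    IsOpen {v : TangentBundle (𝓡 4) M | v.proj ∈ φ.source ∧ tangentCoord φ v ∈ N} :=
  (contMDiffOn_tangentCoord hφ).continuousOn.isOpen_inter_preimage
    (φ.open_source.preimage (FiberBundle.continuous_proj E4 (TangentSpace (𝓡 4)))) hN

/-- The observer space is parametrized by the points of `M` and a hyperplane of directions. -/
theorem exists_observer_localParam (hφ : φ ∈ IsManifold.maximalAtlas (𝓡 4) ∞ M)
    (v₀ : observerSpace T) (hv₀ : v₀.1.proj ∈ φ.source) :
    Nonempty (LocalParam (𝓡 4).tangent (EuclideanSpace ℝ (Fin 7))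
      (Subtype.val : observerSpace T → TangentBundle (𝓡 4) M) v₀) := by
  obtain ⟨q₀, hq₀⟩ : ∃ q, q = tangentCoord φ v₀.1 := ⟨_, rfl⟩
  have hq₀O : q₀ ∈ observerCoord T φ := hq₀ ▸ tangentCoord_mem_observerCoord hφ v₀.2 hv₀
  have hy₀ : q₀.2 ≠ 0 := X.ne_zero_of_lCoord_ne_zero
    (X.lCoord_ne_zero_of_abs (isTimelikeCoord_of_mem hφ hq₀O).1)
  -- a hyperplane transversal to `y₀`
  let ℓ : E4 →L[ℝ] ℝ := (‖q₀.2‖ ^ 2)⁻¹ • innerSL ℝ q₀.2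
  have hℓ : ℓ q₀.2 = 1 := by
    have : ‖q₀.2‖ ≠ 0 := norm_ne_zero_iff.2 hy₀
    simp [ℓ, this]
  let W : Submodule ℝ E4 := LinearMap.ker (ℓ : E4 →ₗ[ℝ] ℝ)
  have hWmem : ∀ w : W, ℓ w = 0 := fun w => w.2
  let pr : E4 →L[ℝ] W := (ContinuousLinearMap.id ℝ E4 - ℓ.smulRight q₀.2).codRestrict W fun u => by
    simp [W, hℓ]
  have hpr : ∀ w : W, pr (q₀.2 + w) = w := by
    intro w
    ext1
    simp [pr, hℓ, hWmem]
  have hpr' : ∀ u, ℓ u = 1 → q₀.2 + (pr u : E4) = u := by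
    intro u hu
    simp [pr, hu]
  -- a neighbourhood on which unit vectors are observers
  have hev : ∀ᶠ q in 𝓝 q₀, q.1 ∈ φ.target ∧ 0 < ℓ q.2 ∧
      (|X.lCoord φ q| = 1 → q ∈ observerCoord T φ) := by
    have h1 : ContinuousAt (fun q : E4 × E4 => ℓ q.2) q₀ := by fun_prop
    filter_upwards [(φ.open_target.preimage continuous_fst).mem_nhds hq₀O.1,
      h1.eventually (lt_mem_nhds (show (0 : ℝ) < ℓ q₀.2 by rw [hℓ]; exact one_pos)),
      eventually_mem_observerCoord hφ hq₀O] with q h2 h3 h4 using ⟨h2, h3, h4⟩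
  obtain ⟨N, hN, hNo, hq₀N⟩ := eventually_nhds_iff.1 hev
  -- Directions near `y₀` are represented by points of the affine hyperplane `y₀ + ker ℓ`. Scaling
  -- by `F` leads from there to the observers, and scaling by `ℓ` leads back.
  let ι : E4 × W → E4 × E4 := fun u => (u.1, q₀.2 + u.2)
  have hι : ContDiff ℝ ∞ ι :=
    contDiff_fst.prodMk (contDiff_const.add (W.subtypeL.contDiff.comp contDiff_snd))
  let V : Set (E4 × W) := {u | u.1 ∈ φ.target ∧ X.lCoord φ (ι u) ≠ 0}
  have hV : IsOpen V := by
    have h1 : IsOpen {q : E4 × E4 | q.1 ∈ φ.target ∧ X.lCoord φ q ≠ 0} :=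
      (X.continuousOn_lCoord hφ).isOpen_inter_preimage (φ.open_target.preimage continuous_fst)
        isOpen_ne
    exact h1.preimage hι.continuous
  have hVs : ContDiffOn ℝ ∞ (fun u => unitCoord X φ (ι u)) V := fun u hu =>
    ((smoothNear_unitCoord hφ (q := ι u) hu.1 hu.2).contDiffAt.comp u
      hι.contDiffAt).contDiffWithinAt
  have hmem : ∀ u ∈ V, unitCoord X φ (ι u) ∈ N →
      inducedPoint φ (unitCoord X φ (ι u)) ∈ observerSpace T := fun u hu huN =>
    ((hN _ huN).2.2 (abs_lCoord_unitCoord hu.2)).2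
  -- the directions of observers
  have hdir : ∀ v ∈ observerSpace T, v.proj ∈ φ.source → tangentCoord φ v ∈ N →
      ((tangentCoord φ v).1, pr ((ℓ (tangentCoord φ v).2)⁻¹ • (tangentCoord φ v).2)) ∈ V ∧
      unitCoord X φ (ι ((tangentCoord φ v).1,
        pr ((ℓ (tangentCoord φ v).2)⁻¹ • (tangentCoord φ v).2))) = tangentCoord φ v := by
    intro v hv hvs hvN
    obtain ⟨q, hq⟩ : ∃ q, q = tangentCoord φ v := ⟨_, rfl⟩
    have hqO : q ∈ observerCoord T φ := hq ▸ tangentCoord_mem_observerCoord hφ hv hvs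
    rw [← hq] at hvN ⊢
    have hpos := (hN q hvN).2.1
    have h1 : ι (q.1, pr ((ℓ q.2)⁻¹ • q.2)) = (q.1, (ℓ q.2)⁻¹ • q.2) :=
      Prod.ext rfl (hpr' _ (by simp [hpos.ne']))
    have h2 : finslerCoord X φ q = 1 :=
      finslerCoord_eq_one_iff.2 (isTimelikeCoord_of_mem hφ hqO).1
    have h3 : finslerCoord X φ (q.1, (ℓ q.2)⁻¹ • q.2) = (ℓ q.2)⁻¹ := by
      rw [finslerCoord_smul _ _ (inv_pos.2 hpos), Prod.mk.eta, h2, mul_one]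
    refine ⟨⟨hqO.1, ?_⟩, ?_⟩
    · rw [h1]
      intro h0
      have hn : X.n ≠ 0 := by linarith [X.two_le]
      rw [finslerCoord, h0, abs_zero, Real.zero_rpow (by simpa using hn)] at h3
      exact (inv_pos.2 hpos).ne h3
    · rw [h1, unitCoord, h3, inv_inv, smul_smul, mul_inv_cancel₀ hpos.ne', one_smul]
  have hdim : Module.finrank ℝ (E4 × W) = 7 := by
    have h1 := LinearMap.finrank_range_add_finrank_ker (ℓ : E4 →ₗ[ℝ] ℝ)
    have h2 : LinearMap.range (ℓ : E4 →ₗ[ℝ] ℝ) = ⊤ := by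
      rw [LinearMap.range_eq_top]
      exact fun c => ⟨c • q₀.2, by simp [hℓ]⟩
    rw [h2] at h1
    simp at h1
    have h3 : Module.finrank ℝ W = 3 := by
      change Module.finrank ℝ (LinearMap.ker (ℓ : E4 →ₗ[ℝ] ℝ)) = 3
      omega
    simp [h3]
  classical
  refine ⟨LocalParam.congr (F := E4 × W) (F' := EuclideanSpace ℝ (Fin 7))
    { coord := fun v => ((tangentCoord φ v).1,
        pr ((ℓ (tangentCoord φ v).2)⁻¹ • (tangentCoord φ v).2))
      param := fun u => if h : inducedPoint φ (unitCoord X φ (ι u)) ∈ observerSpace T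
        then ⟨_, h⟩ else v₀
      source := {v | v.proj ∈ φ.source ∧ tangentCoord φ v ∈ N}
      target := {u | u ∈ V ∧ unitCoord X φ (ι u) ∈ N}
      isOpen_source := isOpen_tangentCoord_preimage hφ hNo
      isOpen_target := hVs.continuousOn.isOpen_inter_preimage hV hNo
      mem_source := ⟨hv₀, hq₀ ▸ hq₀N⟩
      contMDiffOn_coord := ?_
      contMDiffOn_param := ?_
      coord_mem := ?_
      param_mem := ?_
      param_coord := ?_
      coord_param := ?_ } (ContinuousLinearEquiv.ofFinrankEq (by rw [hdim]; simp))⟩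
  · have h1 : ContMDiffOn (𝓡 4).tangent 𝓘(ℝ, E4 × E4) ∞ (tangentCoord φ)
        {v : TangentBundle (𝓡 4) M | v.proj ∈ φ.source ∧ tangentCoord φ v ∈ N} :=
      (contMDiffOn_tangentCoord hφ).mono fun v hv => hv.1
    have h2 : ContDiffOn ℝ ∞ (fun q : E4 × E4 => (q.1, pr ((ℓ q.2)⁻¹ • q.2))) N := by
      refine contDiffOn_fst.prodMk (pr.contDiff.comp_contDiffOn ?_)
      exact ((ℓ.contDiff.comp_contDiffOn contDiffOn_snd).inv fun q hq => (hN q hq).2.1.ne').smul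
        contDiffOn_snd
    exact h2.contMDiffOn.comp h1 fun v hv => hv.2
  · have h1 : ContMDiffOn 𝓘(ℝ, E4 × W) (𝓡 4).tangent ∞
        (fun u => inducedPoint φ (unitCoord X φ (ι u)))
        {u | u ∈ V ∧ unitCoord X φ (ι u) ∈ N} :=
      (contMDiffOn_inducedPoint hφ).comp (hVs.contMDiffOn.mono fun u hu => hu.1)
        fun u hu => hu.1.1
    refine h1.congr fun u hu => ?_
    simp only [Function.comp_apply]
    rw [dif_pos (hmem u hu.1 hu.2)]
  · rintro ⟨v, hv⟩ ⟨h1, h2⟩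
    obtain ⟨h3, h4⟩ := hdir v hv h1 h2
    exact ⟨h3, h4.symm ▸ h2⟩
  · rintro u ⟨h1, h2⟩
    rw [dif_pos (hmem u h1 h2)]
    refine ⟨φ.map_target h1.1, ?_⟩
    rwa [tangentCoord_inducedPoint hφ h1.1]
  · rintro ⟨v, hv⟩ ⟨h1, h2⟩
    obtain ⟨h3, h4⟩ := hdir v hv h1 h2
    have h5 := hmem _ h3 (by rw [h4]; exact h2)
    simp only
    rw [dif_pos h5]
    ext1
    simp only [h4]
    exact inducedPoint_tangentCoord hφ h1
  · rintro u ⟨h1, h2⟩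
    rw [dif_pos (hmem u h1 h2)]
    simp only
    rw [tangentCoord_inducedPoint hφ h1.1]
    have h3 := finslerCoord_pos h1.2
    have h4 : ℓ (unitCoord X φ (ι u)).2 = (finslerCoord X φ (ι u))⁻¹ := by
      simp [unitCoord, ι, hℓ, hWmem]
    refine Prod.ext rfl ?_
    simp only
    rw [h4, inv_inv, unitCoord, smul_smul, mul_inv_cancel₀ h3.ne', one_smul]
    exact hpr u.2

end ObserverManifold

/-! ### Local sections of the bundle of observer frames -/

section LocalSections

variable {M : Type*} [TopologicalSpace M] [ChartedSpace E4 M] [IsManifold (𝓡 4) ∞ M]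
  {φ : OpenPartialHomeomorph M E4} {X : FinslerSpacetime M} {T : TimeOrientation X}
  {o : ManifoldOrientation M}

theorem framePoint_mem_observerFrames_iff (hφ : φ ∈ IsManifold.maximalAtlas (𝓡 4) ∞ M)
    {s : FrameCoord} (hs : s.1 ∈ φ.target) : framePoint φ s ∈ observerFrames T o ↔
      (s.1, s.2 0) ∈ observerCoord T φ ∧
      (∀ i j, gForm (X.sqCoord φ) (s.1, s.2 0) (s.2 i) (s.2 j) = -eta i j) ∧
      ∃ b : Module.Basis (Fin 4) ℝ (TangentSpace (𝓡 4) (framePoint φ s).proj),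
        (∀ i, b i = leg (framePoint φ s) i) ∧ b.orientation = o.orient (framePoint φ s).proj := by
  have h1 : leg (framePoint φ s) 0 ∈ T.S (framePoint φ s).proj ↔
      (s.1, s.2 0) ∈ observerCoord T φ := by
    rw [mem_observerCoord_iff hφ hs, leg_framePoint_eq_chartEquiv hφ hs]; rfl
  rw [observerFrames, mem_ofPred_eq, h1]
  refine and_congr_right fun h2 => and_congr_left fun _ => ?_
  refine forall_congr' fun i => forall_congr' fun j => ?_
  rw [leg_framePoint_eq_chartEquiv hφ hs, leg_framePoint_eq_chartEquiv hφ hs,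
    leg_framePoint_eq_chartEquiv hφ hs, ← X.fiberMetric_sq hφ hs
      (X.lCoord_ne_zero_of_abs (isTimelikeCoord_of_mem hφ h2).1)]
  rfl

theorem leg_rotateFrame (p : FrameSpace M) (k : SO3) (i : Fin 4) :
    leg (rotateFrame p k) i = ∑ a, spatial k.1 a i • leg p a := by
  change (p.2 : E4 →L[ℝ] E4) (Matrix.toEuclideanCLM (𝕜 := ℝ) (spatial k.1) (stdVec i)) =
    ∑ a, spatial k.1 a i • (p.2 : E4 →L[ℝ] E4) (stdVec a)
  have h1 : Matrix.toEuclideanCLM (𝕜 := ℝ) (spatial k.1) (stdVec i) =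
      ∑ a, spatial k.1 a i • stdVec a := by
    ext b
    simp [stdVec, Matrix.ofLp_toEuclideanCLM, Pi.single_apply]
  rw [h1, map_sum]
  simp

theorem frameCoord_rotateFrame (p : FrameSpace M) (k : SO3) (i : Fin 4) :
    (frameCoord φ (rotateFrame p k)).2 i = ∑ a, spatial k.1 a i • (frameCoord φ p).2 a := by
  simp only [frameCoord, leg_rotateFrame]
  change mfderiv (𝓡 4) 𝓘(ℝ, E4) φ p.proj (∑ a, spatial k.1 a i • leg p a) = _
  rw [map_sum]
  simp only [map_smul]
  rfl

theorem frameMatrix_rotateFrame (p : FrameSpace M) (k : SO3) :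
    frameMatrix (frameCoord φ (rotateFrame p k)) = frameMatrix (frameCoord φ p) * spatial k.1 := by
  ext a i
  simp only [frameMatrix, Matrix.of_apply, Matrix.mul_apply, frameCoord_rotateFrame,
    WithLp.ofLp_sum, Finset.sum_apply, PiLp.smul_apply, smul_eq_mul]
  exact Finset.sum_congr rfl fun b _ => mul_comm _ _

/-- The observer of a frame. -/
def baseLeg (p : FrameSpace M) : TangentBundle (𝓡 4) M := ⟨p.proj, leg p 0⟩

theorem baseLeg_framePoint (s : FrameCoord) :
    baseLeg (framePoint φ s) = inducedPoint φ (s.1, s.2 0) := leg_framePoint_eq_inducedPoint s 0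

/-- A smooth local section of the bundle of observer frames, in induced coordinates. -/
structure LocalSection (T : TimeOrientation X) (φ : OpenPartialHomeomorph M E4)
    (o : ManifoldOrientation M) where
  domain : Set (E4 × E4)
  frame : E4 × E4 → Fin 4 → E4
  isOpen_domain : IsOpen domain
  contDiffOn_frame : ContDiffOn ℝ ∞ frame domain
  frame_zero : ∀ q, frame q 0 = q.2
  det_ne_zero : ∀ q ∈ domain, (frameMatrix (q.1, frame q)).det ≠ 0
  mem_iff : ∀ q ∈ domain, q ∈ observerCoord T φ → ∀ f : Fin 4 → E4,
    (framePoint φ (q.1, f) ∈ observerFrames T o ∧ f 0 = q.2) ↔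
      ∃ k : SO3, frameMatrix (q.1, f) = frameMatrix (q.1, frame q) * spatial k.1

/-- The signature yields an orthonormal frame at `q₀`, which is oriented if necessary and then
spread smoothly. Frames over the same observer differ by a rotation, so the section describes entire
fibers of `P`. -/
theorem exists_localSection (hφ : φ ∈ IsManifold.maximalAtlas (𝓡 4) ∞ M) {q₀ : E4 × E4}
    (hq₀ : q₀ ∈ observerCoord T φ) : ∃ D : LocalSection T φ o, q₀ ∈ D.domain := by
  have htime := isTimelikeCoord_of_mem hφ hq₀
  have h0 := X.lCoord_ne_zero_of_abs htime.1
  have hl := X.smoothNear_lCoord hφ hq₀.1 h0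
  have hΦ := X.smoothNear_sqCoord hφ hq₀.1 h0
  obtain ⟨ε, hε, hor⟩ := o.exists_sign hφ hq₀.1
  have hunit : ∀ q, SmoothNear (X.sqCoord φ) q → |X.lCoord φ q| = 1 →
      gForm (X.sqCoord φ) q q.2 q.2 = 1 := by
    intro q hq h1
    rw [gForm_radial_radial X.sqCoord_homogeneous hq, X.sqCoord_eq_sqFun, sqFun_eq_one h1]
  -- a positively oriented orthonormal frame
  obtain ⟨f, hf0, hf, hfε⟩ : ∃ f : Fin 4 → E4, f 0 = q₀.2 ∧
      (∀ i j, gForm (X.sqCoord φ) q₀ (f i) (f j) = -eta i j) ∧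
      0 < ε * (frameMatrix (q₀.1, f)).det := by
    obtain ⟨f, hf0, hf⟩ := exists_orthonormal hΦ (hunit q₀ hΦ htime.1)
      fun v hv hyv => gForm_sqFun_neg X.two_le X.lCoord_homogeneous hl htime hv hyv
    have hdet := (det_ne_zero_of_orthonormal hΦ (s := (q₀.1, f)) hf).1
    rcases lt_or_gt_of_ne (mul_ne_zero hε hdet) with h | h
    -- Reversing the three spatial legs changes the orientation and preserves both `f_0` and
    -- orthonormality.
    · let c : Fin 4 → ℝ := ![1, -1, -1, -1]
      refine ⟨fun i => c i • f i, by simpa [c] using hf0, fun i j => ?_, ?_⟩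
      · simp only [map_smul, _root_.smul_apply, smul_eq_mul, hf]
        rcases eq_or_ne i j with rfl | hij
        · have : c i * c i = 1 := by fin_cases i <;> simp [c]
          linear_combination (-eta i i) * this
        · simp [eta, hij]
      · have h1 : frameMatrix (q₀.1, fun i => c i • f i) =
            frameMatrix (q₀.1, f) * Matrix.diagonal c := by
          ext a i
          simp [frameMatrix, Matrix.mul_diagonal, mul_comm]
        have h2 : (Matrix.diagonal c).det = -1 := by
          simp [c, Matrix.det_diagonal, Fin.prod_univ_succ]
        rw [h1, Matrix.det_mul, h2]
        linarith
    · exact ⟨f, hf0, hf, h⟩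
  obtain ⟨σ, hσ0, hσs, hσy, hσo⟩ := exists_local_frame hΦ hf0 hf
  have hσ : ∀ᶠ q in 𝓝 q₀, ContDiffAt ℝ ∞ σ q := by
    filter_upwards [eventually_all.2 hσs] with q hq using contDiffAt_pi.2 hq
  have hσε : ∀ᶠ q in 𝓝 q₀, 0 < ε * (frameMatrix (q.1, σ q)).det := by
    have h1 : ContDiffAt ℝ ∞ (fun q : E4 × E4 => (frameMatrix (q.1, σ q)).det) q₀ := by
      refine contDiffAt_matrix_det fun a i => ?_
      exact (EuclideanSpace.proj (𝕜 := ℝ) a).contDiff.contDiffAt.comp q₀ (hσs i).contDiffAt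
    refine (continuousAt_const.mul h1.continuousAt).eventually (lt_mem_nhds ?_)
    change 0 < ε * (frameMatrix (q₀.1, σ q₀)).det
    rwa [hσ0]
  have hall : ∀ᶠ q in 𝓝 q₀, q.1 ∈ φ.target ∧ ContDiffAt ℝ ∞ σ q ∧
      0 < ε * (frameMatrix (q.1, σ q)).det ∧ (q ∈ observerCoord T φ → ∀ f : Fin 4 → E4,
        (framePoint φ (q.1, f) ∈ observerFrames T o ∧ f 0 = q.2) ↔
          ∃ k : SO3, frameMatrix (q.1, f) = frameMatrix (q.1, σ q) * spatial k.1) := by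
    filter_upwards [(φ.open_target.preimage continuous_fst).mem_nhds hq₀.1, hσ, hσε,
      hσo, hΦ.eventually, continuous_fst.continuousAt.eventually hor] with q h1 h2 h3 h4 h5 h6
    refine ⟨h1, h2, h3, fun hqO f => ?_⟩
    have h7 := h4 (hunit q h5 (isTimelikeCoord_of_mem hφ hqO).1)
    rw [framePoint_mem_observerFrames_iff hφ (s := (q.1, f)) h1, h6 f]
    constructor
    · rintro ⟨⟨-, hfo, hfd⟩, hf0⟩
      have hq : ((q.1, f 0) : E4 × E4) = q := by rw [hf0]
      simp only [hq] at hfo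
      obtain ⟨k, -, hk⟩ := exists_rotation_of_orthonormal h5 (s := (q.1, σ q)) (t := (q.1, f))
        h7 hfo ((hσy q).trans hf0.symm) (by
          have := mul_pos h3 hfd
          have h8 : 0 < (ε * ε) * ((frameMatrix (q.1, σ q)).det * (frameMatrix (q.1, f)).det) := by
            linarith
          exact pos_of_mul_pos_right h8 (mul_self_nonneg _))
      exact ⟨k, hk⟩
    · rintro ⟨k, hk⟩
      have hf0 : f 0 = q.2 := by
        rw [← hσy q]
        ext a
        have h8 := congrFun (congrFun hk a) 0
        simp only [frameMatrix, Matrix.of_apply, Matrix.mul_apply,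
          Fin.sum_univ_succ (n := 3), spatial_zero_zero, spatial_succ_zero] at h8
        simpa using h8
      have hq : ((q.1, f 0) : E4 × E4) = q := by rw [hf0]
      refine ⟨⟨?_, ?_, ?_⟩, hf0⟩
      · simpa only [hq] using hqO
      · simp only [hq]
        exact orthonormal_rotate h5 (s := (q.1, σ q)) (t := (q.1, f)) k h7 hk
      · rw [hk, Matrix.det_mul, spatial_det, SO3.det_eq_one, mul_one]
        exact h3
  obtain ⟨N, hN, hNo, hq₀N⟩ := eventually_nhds_iff.1 hall
  exact ⟨{ domain := N
           frame := σ
           isOpen_domain := hNo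
           contDiffOn_frame := fun q hq => (hN q hq).2.1.contDiffWithinAt
           frame_zero := hσy
           det_ne_zero := fun q hq h => by
            have := (hN q hq).2.2.1
            rw [h, mul_zero] at this
            exact this.false
           mem_iff := fun q hq => (hN q hq).2.2.2 }, hq₀N⟩

namespace LocalSection

variable (D : LocalSection T φ o)

/-- The observers over which the section is defined. -/
def base : Set (TangentBundle (𝓡 4) M) := {v | v.proj ∈ φ.source ∧ tangentCoord φ v ∈ D.domain}

theorem isOpen_base (hφ : φ ∈ IsManifold.maximalAtlas (𝓡 4) ∞ M) : IsOpen D.base :=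
  isOpen_tangentCoord_preimage hφ D.isOpen_domain

/-- The matrix of the section. -/
def mat (v : TangentBundle (𝓡 4) M) : Matrix (Fin 4) (Fin 4) ℝ :=
  frameMatrix ((tangentCoord φ v).1, D.frame (tangentCoord φ v))

/-- The frame obtained from the section by a spatial transformation. -/
def transform (v : TangentBundle (𝓡 4) M) (R : Fin 3 → Fin 3 → ℝ) : FrameSpace M :=
  framePoint φ ((tangentCoord φ v).1,
    fun i => WithLp.toLp 2 fun a => (D.mat v * spatial (Matrix.of R)) a i)

/-- The spatial transformation from the section to a frame. -/
def rotation (p : FrameSpace M) : Fin 3 → Fin 3 → ℝ :=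
  Matrix.of.symm (spatialBlock ((D.mat (baseLeg p))⁻¹ * frameMatrix (frameCoord φ p)))

theorem mat_contMDiffOn (hφ : φ ∈ IsManifold.maximalAtlas (𝓡 4) ∞ M) (a i : Fin 4) :
    ContMDiffOn (𝓡 4).tangent 𝓘(ℝ, ℝ) ∞ (fun v => D.mat v a i) D.base := by
  have h1 : ContDiffOn ℝ ∞ (fun q => D.frame q i a) D.domain :=
    (EuclideanSpace.proj (𝕜 := ℝ) a).contDiff.comp_contDiffOn
      (contDiffOn_pi.1 D.contDiffOn_frame i)
  exact h1.contMDiffOn.comp ((contMDiffOn_tangentCoord hφ).mono fun v hv => hv.1) fun v hv => hv.2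

theorem isUnit_det_mat {v : TangentBundle (𝓡 4) M} (hv : v ∈ D.base) : IsUnit (D.mat v).det :=
  isUnit_iff_ne_zero.2 (D.det_ne_zero _ hv.2)

/-- Arbitrary `3 × 3` matrices and tangent vectors over `base` are admitted, so that smoothness is
checked on open subsets of ambient manifolds. Restriction to observers and rotations comes
afterwards; `contMDiffOn_rotation` treats the inverse direction in the same way. -/
theorem contMDiffOn_transform (hφ : φ ∈ IsManifold.maximalAtlas (𝓡 4) ∞ M) :
    ContMDiffOn ((𝓡 4).tangent.prod 𝓘(ℝ, Fin 3 → Fin 3 → ℝ)) frameModel ∞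
      (fun r : TangentBundle (𝓡 4) M × (Fin 3 → Fin 3 → ℝ) => D.transform r.1 r.2)
      (D.base ×ˢ univ) := by
  have hspatial : ∀ i j, ContDiff ℝ ∞ (fun R : Fin 3 → Fin 3 → ℝ => spatial (Matrix.of R) i j) := by
    intro i j
    refine Fin.cases ?_ (fun α => ?_) i <;> refine Fin.cases ?_ (fun β => ?_) j
    · exact contDiff_const
    · simp only [spatial_zero_succ]; exact contDiff_const
    · simp only [spatial_succ_zero]; exact contDiff_const
    · simp only [spatial_succ_succ, Matrix.of_apply]
      exact (contDiff_apply ℝ ℝ β).comp (contDiff_apply ℝ (Fin 3 → ℝ) α)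
  have h1 : ∀ a i, ContMDiffOn ((𝓡 4).tangent.prod 𝓘(ℝ, Fin 3 → Fin 3 → ℝ)) 𝓘(ℝ, ℝ) ∞
      (fun r : TangentBundle (𝓡 4) M × (Fin 3 → Fin 3 → ℝ) =>
        (D.mat r.1 * spatial (Matrix.of r.2)) a i) (D.base ×ˢ univ) := by
    intro a i
    simp only [Matrix.mul_apply]
    refine contMDiffOn_finsetSum fun b _ => ContMDiffOn.mul ?_ ?_
    · exact (D.mat_contMDiffOn hφ a b).comp contMDiffOn_fst fun r hr => hr.1
    · exact (hspatial b i).contMDiff.comp_contMDiffOn contMDiffOn_snd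
  have h2 : ContMDiffOn ((𝓡 4).tangent.prod 𝓘(ℝ, Fin 3 → Fin 3 → ℝ)) 𝓘(ℝ, FrameCoord) ∞
      (fun r : TangentBundle (𝓡 4) M × (Fin 3 → Fin 3 → ℝ) => ((tangentCoord φ r.1).1,
        fun i => (WithLp.toLp 2 fun a => (D.mat r.1 * spatial (Matrix.of r.2)) a i : E4)))
      (D.base ×ˢ univ) := by
    refine ContMDiffOn.prodMk_space ?_ (contMDiffOn_pi_space.2 fun i => ?_)
    · exact contDiff_fst.contMDiff.comp_contMDiffOn
        ((contMDiffOn_tangentCoord hφ).comp contMDiffOn_fst fun r hr => hr.1.1)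
    · exact (PiLp.continuousLinearEquiv 2 ℝ fun _ : Fin 4 => ℝ).symm.contDiff.contMDiff
        |>.comp_contMDiffOn (contMDiffOn_pi_space.2 fun a => h1 a i)
  exact (contMDiffOn_framePoint hφ).comp h2 fun r hr => φ.map_source hr.1.1

theorem contMDiffOn_rotation (hφ : φ ∈ IsManifold.maximalAtlas (𝓡 4) ∞ M) :
    ContMDiffOn frameModel 𝓘(ℝ, Fin 3 → Fin 3 → ℝ) ∞ D.rotation (baseLeg ⁻¹' D.base) := by
  have h1 : ContMDiffOn frameModel 𝓘(ℝ, FrameCoord) ∞ (frameCoord φ) (baseLeg ⁻¹' D.base) :=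
    (contMDiffOn_frameCoord hφ).mono fun p hp => hp.1
  let g : FrameCoord → Fin 3 → Fin 3 → ℝ := fun s => Matrix.of.symm (spatialBlock
    ((frameMatrix (s.1, D.frame (s.1, s.2 0)))⁻¹ * frameMatrix s))
  have hg : ∀ s : FrameCoord, (s.1, s.2 0) ∈ D.domain → ContDiffAt ℝ ∞ g s := by
    intro s hs
    have h2 : ContDiffAt ℝ ∞ (fun s : FrameCoord => D.frame (s.1, s.2 0)) s :=
      (D.contDiffOn_frame.contDiffAt (D.isOpen_domain.mem_nhds hs)).comp s
        (contDiff_fst.prodMk ((contDiff_apply ℝ E4 (0 : Fin 4)).comp contDiff_snd)).contDiffAt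
    refine contDiffAt_pi.2 fun α => contDiffAt_pi.2 fun β => ?_
    refine contDiffAt_matrix_mul (A := fun s : FrameCoord =>
      (frameMatrix (s.1, D.frame (s.1, s.2 0)))⁻¹) (B := fun s : FrameCoord => frameMatrix s)
      (contDiffAt_matrix_inv (A := fun s : FrameCoord => frameMatrix (s.1, D.frame (s.1, s.2 0)))
        (fun a i => ?_) (D.det_ne_zero _ hs)) (fun a i => ?_) α.succ β.succ
    · exact (EuclideanSpace.proj (𝕜 := ℝ) a).contDiff.contDiffAt.comp s (contDiffAt_pi.1 h2 i)
    · exact (contDiff_leg_coord i a).contDiffAt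
  intro p hp
  exact (hg (frameCoord φ p) hp.2).contMDiffAt.comp_contMDiffWithinAt p (h1 p hp)

theorem baseLeg_transform (hφ : φ ∈ IsManifold.maximalAtlas (𝓡 4) ∞ M)
    {v : TangentBundle (𝓡 4) M} (hv : v ∈ D.base) (R : Fin 3 → Fin 3 → ℝ) :
    baseLeg (D.transform v R) = v := by
  rw [transform, baseLeg_framePoint]
  conv_rhs => rw [← inducedPoint_tangentCoord hφ hv.1]
  congr 1
  refine Prod.ext rfl ?_
  rw [← D.frame_zero (tangentCoord φ v)]
  ext a
  simp [mat, Matrix.mul_apply, Fin.sum_univ_succ (n := 3), spatial_zero_zero, spatial_succ_zero,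
    frameMatrix]

theorem rotation_transform (hφ : φ ∈ IsManifold.maximalAtlas (𝓡 4) ∞ M)
    {v : TangentBundle (𝓡 4) M} (hv : v ∈ D.base) (R : Fin 3 → Fin 3 → ℝ) :
    D.rotation (D.transform v R) = R := by
  have h1 : frameMatrix (frameCoord φ (D.transform v R)) = D.mat v * spatial (Matrix.of R) := by
    rw [transform, frameCoord_framePoint hφ (φ.map_source hv.1)]
    rfl
  rw [rotation, D.baseLeg_transform hφ hv, h1, ← Matrix.mul_assoc,
    Matrix.nonsing_inv_mul _ (D.isUnit_det_mat hv), Matrix.one_mul, spatialBlock_spatial]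
  rfl

theorem transform_mem (hφ : φ ∈ IsManifold.maximalAtlas (𝓡 4) ∞ M)
    {v : TangentBundle (𝓡 4) M} (hv : v ∈ D.base) (hvO : v ∈ observerSpace T) (k : SO3) :
    D.transform v (SO3.entries k) ∈ observerFrames T o :=
  ((D.mem_iff _ hv.2 (tangentCoord_mem_observerCoord hφ hvO hv.1) _).2 ⟨k, rfl⟩).1

theorem exists_transform_eq (hφ : φ ∈ IsManifold.maximalAtlas (𝓡 4) ∞ M) {p : FrameSpace M}
    (hp : p ∈ observerFrames T o) (hb : baseLeg p ∈ D.base) :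
    ∃ k : SO3, SO3.entries k = D.rotation p ∧ D.transform (baseLeg p) (SO3.entries k) = p := by
  have hps : p.proj ∈ φ.source := hb.1
  have h1 : framePoint φ ((tangentCoord φ (baseLeg p)).1, (frameCoord φ p).2) = p :=
    framePoint_frameCoord hφ hps
  obtain ⟨k, hk⟩ := (D.mem_iff _ hb.2 (tangentCoord_mem_observerCoord hφ
    (v := baseLeg p) hp.1 hps) (frameCoord φ p).2).1 ⟨by rwa [h1], rfl⟩
  have h2 : D.transform (baseLeg p) (SO3.entries k) = p := by
    conv_rhs => rw [← h1]
    refine congrArg (framePoint φ) (Prod.ext rfl (funext fun i => ?_))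
    ext a
    exact (congrFun (congrFun hk a) i).symm
  refine ⟨k, ?_, h2⟩
  conv_rhs => rw [← h2]
  rw [D.rotation_transform hφ hb]

theorem rotation_rotateFrame (p : FrameSpace M) (k : SO3) :
    D.rotation (rotateFrame p k) = Matrix.of.symm (Matrix.of (D.rotation p) * k.1) := by
  have h1 : baseLeg (rotateFrame p k) = baseLeg p := by
    refine congrArg (TotalSpace.mk p.proj) ?_
    rw [leg_rotateFrame, Fin.sum_univ_succ]
    simp [spatial_zero_zero, spatial_succ_zero]
  rw [rotation, h1, frameMatrix_rotateFrame, ← Matrix.mul_assoc]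
  ext α β
  simp only [Matrix.of_symm_apply, spatialBlock, Matrix.of_apply]
  rw [Matrix.mul_apply, Fin.sum_univ_succ]
  simp [spatial_zero_succ, spatial_succ_succ, Matrix.mul_apply, rotation, spatialBlock]

end LocalSection

end LocalSections

/-! ### Smooth maps into embedded submanifolds. -/

section Embedding

variable {E H : Type*} [NormedAddCommGroup E] [NormedSpace ℝ E] [TopologicalSpace H]
  {I : ModelWithCorners ℝ E H} {E' H' : Type*} [NormedAddCommGroup E'] [NormedSpace ℝ E']
  [TopologicalSpace H'] {I' : ModelWithCorners ℝ E' H'} {E'' H'' : Type*} [NormedAddCommGroup E'']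
  [NormedSpace ℝ E''] [TopologicalSpace H''] {I'' : ModelWithCorners ℝ E'' H''}
  {Q S N : Type*} [TopologicalSpace Q] [ChartedSpace H Q] [TopologicalSpace S]
  [ChartedSpace H' S] [TopologicalSpace N] [ChartedSpace H'' N]

/-- A map to an embedded submanifold is smooth if it is smooth as a map to the ambient
manifold. -/
theorem contMDiffOn_of_comp_isSmoothEmbedding [IsManifold I ∞ Q] [IsManifold I' ∞ S]
    [IsManifold I'' ∞ N] {j : S → N} (hj : IsSmoothEmbedding I' I'' ∞ j) {f : Q → S} {U : Set Q}
    (hU : IsOpen U) (hf : ContMDiffOn I I'' ∞ (j ∘ f) U) : ContMDiffOn I I' ∞ f U := by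
  intro q hq
  have h1 : ContMDiffAt I I'' ∞ (j ∘ f) q := hf.contMDiffAt (hU.mem_nhds hq)
  refine ContMDiffAt.contMDiffWithinAt ?_
  rw [ContMDiffAt.iff_comp_isImmersionAt (hj.isImmersion.isImmersionAt (f q))]
  exact ⟨hj.isEmbedding.continuousAt_iff.2 h1.continuousAt, h1⟩

end Embedding

/-! ### The smooth structures of `O` and `P`, and the principal bundle. -/

section PrincipalBundle

variable {M : Type*} [TopologicalSpace M] [ChartedSpace E4 M] [IsManifold (𝓡 4) ∞ M]
  {X : FinslerSpacetime M}

/-- The parametrizations of the observer space. -/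
def observerParam (T : TimeOrientation X) (v : observerSpace T) :
    LocalParam (𝓡 4).tangent (EuclideanSpace ℝ (Fin 7))
      (Subtype.val : observerSpace T → TangentBundle (𝓡 4) M) v :=
  Classical.choice (exists_observer_localParam
    (IsManifold.chart_mem_maximalAtlas v.1.proj) v (mem_chart_source E4 v.1.proj))

instance observerChartedSpace (T : TimeOrientation X) :
    ChartedSpace (EuclideanSpace ℝ (Fin 7)) (observerSpace T) :=
  LocalParam.chartedSpace IsEmbedding.subtypeVal (observerParam T)

instance observerIsManifold (T : TimeOrientation X) : IsManifold (𝓡 7) ∞ (observerSpace T) :=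
  LocalParam.isManifold IsEmbedding.subtypeVal (observerParam T)

theorem isSmoothEmbedding_observerSpace (T : TimeOrientation X) :
    IsSmoothEmbedding (𝓡 7) (𝓡 4).tangent ∞
      (Subtype.val : observerSpace T → TangentBundle (𝓡 4) M) :=
  LocalParam.isSmoothEmbedding IsEmbedding.subtypeVal (observerParam T) (by simp)

variable {T : TimeOrientation X} {o : ManifoldOrientation M}

theorem continuous_baseLeg : Continuous (baseLeg : FrameSpace M → TangentBundle (𝓡 4) M) :=
  (contMDiff_leg 0).continuous

/-- The bundle of observer frames is parametrized by the observer space and the rotations. -/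
theorem exists_frame_localParam (p₀ : observerFrames T o) :
    Nonempty (LocalParam frameModel (EuclideanSpace ℝ (Fin 10))
      (Subtype.val : observerFrames T o → FrameSpace M) p₀) := by
  obtain ⟨φ, hφ, hp₀⟩ : ∃ φ ∈ IsManifold.maximalAtlas (𝓡 4) ∞ M, p₀.1.proj ∈ φ.source :=
    ⟨_, IsManifold.chart_mem_maximalAtlas p₀.1.proj, mem_chart_source E4 p₀.1.proj⟩
  obtain ⟨D, hD⟩ := exists_localSection (o := o) hφ
    (tangentCoord_mem_observerCoord hφ (v := baseLeg p₀.1) p₀.2.1 hp₀)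
  have hb₀ : baseLeg p₀.1 ∈ D.base := ⟨hp₀, hD⟩
  obtain ⟨k₀, hk₀, -⟩ := D.exists_transform_eq hφ p₀.2 hb₀
  -- The section identifies frames near `p₀` with pairs of an observer and a rotation. The
  -- parameters are those of the two factors, of dimensions 7 and 3.
  let dO := observerParam T (toObserver T o p₀)
  let dK := SO3.localParam k₀
  classical
  have hopen : IsOpen (baseLeg ⁻¹' (D.base ∩ dO.source) : Set (FrameSpace M)) :=
    ((D.isOpen_base hφ).inter dO.isOpen_source).preimage continuous_baseLeg
  have hdim : Module.finrank ℝ (EuclideanSpace ℝ (Fin 7) × EuclideanSpace ℝ (Fin 3)) = 10 := by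
    simp
  have hmem : ∀ u : EuclideanSpace ℝ (Fin 7) × EuclideanSpace ℝ (Fin 3),
      (dO.param u.1).1 ∈ D.base →
      D.transform (dO.param u.1).1 (SO3.entries (dK.param u.2)) ∈ observerFrames T o :=
    fun u hu => D.transform_mem hφ hu (dO.param u.1).2 _
  refine ⟨LocalParam.congr (F := EuclideanSpace ℝ (Fin 7) × EuclideanSpace ℝ (Fin 3))
    (F' := EuclideanSpace ℝ (Fin 10))
    { coord := fun p => (dO.coord (baseLeg p), dK.coord (D.rotation p))
      param := fun u => if h : D.transform (dO.param u.1).1 (SO3.entries (dK.param u.2)) ∈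
        observerFrames T o then ⟨_, h⟩ else p₀
      source := {p | baseLeg p ∈ D.base ∩ dO.source ∧ D.rotation p ∈ dK.source}
      target := {u | u.1 ∈ dO.target ∧ (dO.param u.1).1 ∈ D.base} ∩ {u | u.2 ∈ dK.target}
      isOpen_source := ((D.contMDiffOn_rotation hφ).continuousOn.mono
        fun p hp => hp.1).isOpen_inter_preimage hopen dK.isOpen_source
      isOpen_target := ((dO.contMDiffOn_param.continuousOn.isOpen_inter_preimage
        dO.isOpen_target (D.isOpen_base hφ)).preimage continuous_fst).inter
          (dK.isOpen_target.preimage continuous_snd)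
      mem_source := ⟨⟨hb₀, dO.mem_source⟩, hk₀ ▸ dK.mem_source⟩
      contMDiffOn_coord := ?_
      contMDiffOn_param := ?_
      coord_mem := ?_
      param_mem := ?_
      param_coord := ?_
      coord_param := ?_ } (ContinuousLinearEquiv.ofFinrankEq (by rw [hdim]; simp))⟩
  · refine ContMDiffOn.prodMk_space ?_ ?_
    · exact dO.contMDiffOn_coord.comp (contMDiff_leg 0).contMDiffOn fun p hp => hp.1.2
    · exact dK.contMDiffOn_coord.comp ((D.contMDiffOn_rotation hφ).mono fun p hp => hp.1.1)
        fun p hp => hp.2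
  · have h1 : ContMDiffOn 𝓘(ℝ, EuclideanSpace ℝ (Fin 7) × EuclideanSpace ℝ (Fin 3))
        ((𝓡 4).tangent.prod 𝓘(ℝ, Fin 3 → Fin 3 → ℝ)) ∞
        (fun u : EuclideanSpace ℝ (Fin 7) × EuclideanSpace ℝ (Fin 3) =>
          ((dO.param u.1).1, SO3.entries (dK.param u.2)))
        ({u | u.1 ∈ dO.target ∧ (dO.param u.1).1 ∈ D.base} ∩ {u | u.2 ∈ dK.target}) :=
      (dO.contMDiffOn_param.comp contDiff_fst.contMDiff.contMDiffOn fun u hu => hu.1.1).prodMk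
        (dK.contMDiffOn_param.comp contDiff_snd.contMDiff.contMDiffOn fun u hu => hu.2)
    refine ((D.contMDiffOn_transform hφ).comp h1 fun u hu => ⟨hu.1.2, mem_univ _⟩).congr
      fun u hu => ?_
    simp only [Function.comp_apply]
    rw [dif_pos (hmem u hu.1.2)]
  · rintro ⟨p, hp⟩ ⟨⟨h1, h2⟩, h3⟩
    obtain ⟨k, hk, -⟩ := D.exists_transform_eq hφ hp h1
    have h4 := dO.param_coord (toObserver T o ⟨p, hp⟩) h2
    refine ⟨⟨dO.coord_mem (toObserver T o ⟨p, hp⟩) h2, ?_⟩, ?_⟩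
    · change (dO.param (dO.coord (toObserver T o ⟨p, hp⟩).1)).1 ∈ D.base
      rw [h4]
      exact h1
    · change dK.coord (D.rotation p) ∈ dK.target
      rw [← hk]
      exact dK.coord_mem k (hk ▸ h3)
  · rintro u ⟨⟨h1, h2⟩, h3⟩
    rw [dif_pos (hmem u h2)]
    refine ⟨?_, ?_⟩
    · simp only
      rw [D.baseLeg_transform hφ h2]
      exact ⟨h2, dO.param_mem _ h1⟩
    · simp only
      rw [D.rotation_transform hφ h2]
      exact dK.param_mem _ h3
  · rintro ⟨p, hp⟩ ⟨⟨h1, h2⟩, h3⟩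
    obtain ⟨k, hk, hkp⟩ := D.exists_transform_eq hφ hp h1
    have h4 : dO.param (dO.coord (baseLeg p)) = toObserver T o ⟨p, hp⟩ :=
      dO.param_coord (toObserver T o ⟨p, hp⟩) h2
    have h5 : dK.param (dK.coord (D.rotation p)) = k := by
      rw [← hk]; exact dK.param_coord k (hk ▸ h3)
    have h6 : D.transform (dO.param (dO.coord (baseLeg p))).1
        (SO3.entries (dK.param (dK.coord (D.rotation p)))) = p := by
      rw [h4, h5]; exact hkp
    simp only
    rw [dif_pos (h6.symm ▸ hp)]
    exact Subtype.ext h6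
  · rintro u ⟨⟨h1, h2⟩, h3⟩
    rw [dif_pos (hmem u h2)]
    simp only
    rw [D.baseLeg_transform hφ h2, D.rotation_transform hφ h2]
    exact Prod.ext (dO.coord_param _ h1) (dK.coord_param _ h3)

/-- The parametrizations of the bundle of observer frames. -/
def frameParam (T : TimeOrientation X) (o : ManifoldOrientation M) (p : observerFrames T o) :
    LocalParam frameModel (EuclideanSpace ℝ (Fin 10))
      (Subtype.val : observerFrames T o → FrameSpace M) p :=
  Classical.choice (exists_frame_localParam p)

instance framesChartedSpace (T : TimeOrientation X) (o : ManifoldOrientation M) :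
    ChartedSpace (EuclideanSpace ℝ (Fin 10)) (observerFrames T o) :=
  LocalParam.chartedSpace IsEmbedding.subtypeVal (frameParam T o)

instance framesIsManifold (T : TimeOrientation X) (o : ManifoldOrientation M) :
    IsManifold (𝓡 10) ∞ (observerFrames T o) :=
  LocalParam.isManifold IsEmbedding.subtypeVal (frameParam T o)

theorem isSmoothEmbedding_observerFrames (T : TimeOrientation X) (o : ManifoldOrientation M) :
    IsSmoothEmbedding (𝓡 10) frameModel ∞
      (Subtype.val : observerFrames T o → FrameSpace M) :=
  LocalParam.isSmoothEmbedding IsEmbedding.subtypeVal (frameParam T o) (by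
    have h : Module.finrank ℝ (E4 →L[ℝ] E4) = 16 := by
      rw [(LinearMap.toContinuousLinearMap (𝕜 := ℝ) (E := E4) (F' := E4)).symm.finrank_eq,
        Module.finrank_linearMap]
      simp
    rw [Module.finrank_prod, h]
    simp)

theorem mfderiv_val_injective (p : observerFrames T o) :
    Function.Injective (mfderiv (𝓡 10) frameModel
      (Subtype.val : observerFrames T o → FrameSpace M) p) :=
  LocalParam.mfderiv_injective IsEmbedding.subtypeVal (frameParam T o)
    (isSmoothEmbedding_observerFrames T o).contMDiff p

/-- By `mem_iff` of a local section the frames of `P` over an observer are precisely the rotations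
of the section, and these are stable under further rotation. -/
theorem rotateFrame_mem (p : observerFrames T o) (k : SO3) :
    rotateFrame p.1 k ∈ observerFrames T o := by
  obtain ⟨φ, hφ, hp⟩ : ∃ φ ∈ IsManifold.maximalAtlas (𝓡 4) ∞ M, p.1.proj ∈ φ.source :=
    ⟨_, IsManifold.chart_mem_maximalAtlas p.1.proj, mem_chart_source E4 p.1.proj⟩
  have hO := tangentCoord_mem_observerCoord hφ (v := baseLeg p.1) p.2.1 hp
  obtain ⟨D, hD⟩ := exists_localSection (o := o) hφ hO
  obtain ⟨k', hk'⟩ := (D.mem_iff _ hD hO (frameCoord φ p.1).2).1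
    ⟨by
      have h1 : framePoint φ ((tangentCoord φ (baseLeg p.1)).1, (frameCoord φ p.1).2) = p.1 :=
        framePoint_frameCoord hφ hp
      rw [h1]
      exact p.2, rfl⟩
  have h2 := ((D.mem_iff _ hD hO (frameCoord φ (rotateFrame p.1 k)).2).2 ⟨k' * k, by
    refine (frameMatrix_rotateFrame p.1 k).trans ?_
    have h3 : frameMatrix (frameCoord φ p.1) = _ := hk'
    rw [h3, Matrix.mul_assoc, ← spatial_mul]
    rfl⟩).1
  have h4 : framePoint φ ((tangentCoord φ (baseLeg p.1)).1,
      (frameCoord φ (rotateFrame p.1 k)).2) = rotateFrame p.1 k :=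
    framePoint_frameCoord hφ (p := rotateFrame p.1 k) hp
  rwa [h4] at h2

variable (T o) in
/-- The right action of the rotations on the observer frames. -/
def frameAction (p : observerFrames T o) (k : SO3) : observerFrames T o :=
  ⟨rotateFrame p.1 k, rotateFrame_mem p k⟩

theorem rotateFrame_one (p : FrameSpace M) : rotateFrame p 1 = p := by
  refine congrArg (TotalSpace.mk p.proj) ?_
  rw [show ((1 : SO3) : Matrix (Fin 3) (Fin 3) ℝ) = 1 from rfl, spatial_one, map_one]
  rfl

theorem sum_smul_sum_smul (A B : Matrix (Fin 4) (Fin 4) ℝ) (f : Fin 4 → E4) (i : Fin 4) :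
    ∑ b, B b i • ∑ a, A a b • f a = ∑ a, (A * B) a i • f a := by
  simp only [Finset.smul_sum, smul_smul, Matrix.mul_apply, Finset.sum_smul]
  rw [Finset.sum_comm]
  exact Finset.sum_congr rfl fun a _ => Finset.sum_congr rfl fun b _ => by rw [mul_comm]

theorem rotateFrame_mul (p : FrameSpace M) (k l : SO3) :
    rotateFrame (rotateFrame p k) l = rotateFrame p (k * l) := by
  refine frameSpace_ext fun i => congrArg (TotalSpace.mk p.proj) ?_
  refine (leg_rotateFrame (rotateFrame p k) l i).trans (Eq.trans ?_
    (leg_rotateFrame p (k * l) i).symm)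
  simp only [leg_rotateFrame p k]
  refine (sum_smul_sum_smul (spatial k.1) (spatial l.1) (leg p) i).trans ?_
  rw [← spatial_mul]
  rfl

theorem contMDiff_spatial_entry (i j : Fin 4) :
    ContMDiff (𝓡 3) 𝓘(ℝ, ℝ) ∞ (fun k : SO3 => spatial k.1 i j) := by
  refine Fin.cases ?_ (fun α => ?_) i <;> refine Fin.cases ?_ (fun β => ?_) j
  · exact contMDiff_const
  · simp only [spatial_zero_succ]; exact contMDiff_const
  · simp only [spatial_succ_zero]; exact contMDiff_const
  · simp only [spatial_succ_succ]; exact SO3.contMDiff_entry α β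

theorem contMDiff_rotateFrame : ContMDiff (frameModel.prod (𝓡 3)) frameModel ∞
    (fun r : FrameSpace M × SO3 => rotateFrame r.1 r.2) := by
  intro r₀
  obtain ⟨φ, hφ, hp⟩ : ∃ φ ∈ IsManifold.maximalAtlas (𝓡 4) ∞ M, r₀.1.proj ∈ φ.source :=
    ⟨_, IsManifold.chart_mem_maximalAtlas r₀.1.proj, mem_chart_source E4 r₀.1.proj⟩
  let U : Set (FrameSpace M × SO3) := {r | r.1.proj ∈ φ.source}
  have hU : IsOpen U := (φ.open_source.preimage
    (FiberBundle.continuous_proj (E4 →L[ℝ] E4)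
      (fun x : M => Bundle.Trivial M E4 x →L[ℝ] TangentSpace (𝓡 4) x))).preimage continuous_fst
  have hc : ContMDiffOn (frameModel.prod (𝓡 3)) 𝓘(ℝ, FrameCoord) ∞
      (fun r : FrameSpace M × SO3 => frameCoord φ r.1) U :=
    (contMDiffOn_frameCoord hφ).comp contMDiffOn_fst fun r hr => hr
  have h1 : ContMDiffOn (frameModel.prod (𝓡 3)) 𝓘(ℝ, FrameCoord) ∞
      (fun r : FrameSpace M × SO3 => frameCoord φ (rotateFrame r.1 r.2)) U := by
    have h2 : ∀ i, ContMDiffOn (frameModel.prod (𝓡 3)) 𝓘(ℝ, E4) ∞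
        (fun r : FrameSpace M × SO3 => (frameCoord φ (rotateFrame r.1 r.2)).2 i) U := by
      intro i
      simp only [frameCoord_rotateFrame]
      refine contMDiffOn_finsetSum fun a _ => ?_
      have h3 : ContMDiffOn (frameModel.prod (𝓡 3)) 𝓘(ℝ, ℝ) ∞
          (fun r : FrameSpace M × SO3 => spatial r.2.1 a i) U :=
        (contMDiff_spatial_entry a i).comp_contMDiffOn contMDiffOn_snd
      exact h3.smul (((contDiff_apply ℝ E4 a).comp contDiff_snd).contMDiff.comp_contMDiffOn hc)
    exact ContMDiffOn.prodMk_space (contDiff_fst.contMDiff.comp_contMDiffOn hc)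
      (contMDiffOn_pi_space.2 h2)
  have h2 : ContMDiffOn (frameModel.prod (𝓡 3)) frameModel ∞
      (fun r : FrameSpace M × SO3 => rotateFrame r.1 r.2) U := by
    refine ((contMDiffOn_framePoint hφ).comp h1 fun r hr => φ.map_source hr).congr fun r hr => ?_
    exact (framePoint_frameCoord hφ (p := rotateFrame r.1 r.2) hr).symm
  exact h2.contMDiffAt (hU.mem_nhds hp)

theorem contMDiff_frameAction : ContMDiff ((𝓡 10).prod (𝓡 3)) (𝓡 10) ∞
    (fun r : observerFrames T o × SO3 => frameAction T o r.1 r.2) := by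
  rw [← contMDiffOn_univ]
  refine contMDiffOn_of_comp_isSmoothEmbedding (isSmoothEmbedding_observerFrames T o) isOpen_univ ?_
  rw [contMDiffOn_univ]
  exact contMDiff_rotateFrame.comp
    (((isSmoothEmbedding_observerFrames T o).contMDiff.comp contMDiff_fst).prodMk contMDiff_snd)

theorem contMDiff_toObserver : ContMDiff (𝓡 10) (𝓡 7) ∞ (toObserver T o) := by
  rw [← contMDiffOn_univ]
  refine contMDiffOn_of_comp_isSmoothEmbedding (isSmoothEmbedding_observerSpace T) isOpen_univ ?_
  rw [contMDiffOn_univ]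
  exact (contMDiff_leg 0).comp (isSmoothEmbedding_observerFrames T o).contMDiff

theorem baseLeg_rotateFrame (p : FrameSpace M) (k : SO3) :
    baseLeg (rotateFrame p k) = baseLeg p := by
  refine congrArg (TotalSpace.mk p.proj) ?_
  rw [leg_rotateFrame, Fin.sum_univ_succ]
  simp [spatial_zero_zero, spatial_succ_zero]

/-- The bundle of observer frames has smooth equivariant local trivializations. -/
theorem exists_frame_trivialization (b : observerSpace T) :
    ∃ e : Trivialization SO3 (toObserver T o), b ∈ e.baseSet ∧
      ContMDiffOn (𝓡 10) ((𝓡 7).prod (𝓡 3)) ∞ e e.source ∧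
      ContMDiffOn ((𝓡 7).prod (𝓡 3)) (𝓡 10) ∞ e.toOpenPartialHomeomorph.symm e.target ∧
      ∀ p ∈ e.source, ∀ k, e (frameAction T o p k) = ((e p).1, (e p).2 * k) := by
  obtain ⟨φ, hφ, hb⟩ : ∃ φ ∈ IsManifold.maximalAtlas (𝓡 4) ∞ M, b.1.proj ∈ φ.source :=
    ⟨_, IsManifold.chart_mem_maximalAtlas b.1.proj, mem_chart_source E4 b.1.proj⟩
  obtain ⟨D, hD⟩ := exists_localSection (o := o) hφ
    (tangentCoord_mem_observerCoord hφ b.2 hb)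
  have hbD : b.1 ∈ D.base := ⟨hb, hD⟩
  classical
  let V : Set (observerSpace T) := Subtype.val ⁻¹' D.base
  have hV : IsOpen V := (D.isOpen_base hφ).preimage continuous_subtype_val
  let rot : observerFrames T o → SO3 := fun p =>
    if h : ∃ k : SO3, SO3.entries k = D.rotation p.1 then h.choose else 1
  have hrot : ∀ p : observerFrames T o, toObserver T o p ∈ V →
      SO3.entries (rot p) = D.rotation p.1 ∧
        D.transform (toObserver T o p).1 (SO3.entries (rot p)) = p.1 := by
    intro p hp
    obtain ⟨k, hk, hk'⟩ := D.exists_transform_eq hφ p.2 hp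
    have h1 : SO3.entries (rot p) = D.rotation p.1 := by
      simp only [rot]
      rw [dif_pos ⟨k, hk⟩]
      exact (⟨k, hk⟩ : ∃ k : SO3, SO3.entries k = D.rotation p.1).choose_spec
    refine ⟨h1, ?_⟩
    rw [h1, ← hk]
    exact hk'
  let inv : observerSpace T × SO3 → observerFrames T o := fun r =>
    if h : D.transform r.1.1 (SO3.entries r.2) ∈ observerFrames T o then ⟨_, h⟩
    else ⟨_, D.transform_mem hφ hbD b.2 1⟩
  have hinv : ∀ r : observerSpace T × SO3, r.1 ∈ V →
      (inv r).1 = D.transform r.1.1 (SO3.entries r.2) := by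
    intro r hr
    simp only [inv]
    rw [dif_pos (D.transform_mem hφ hr r.1.2 r.2)]
  have hproj : ∀ r : observerSpace T × SO3, r.1 ∈ V → toObserver T o (inv r) = r.1 := by
    intro r hr
    apply Subtype.ext
    change baseLeg (inv r).1 = r.1.1
    rw [hinv r hr, D.baseLeg_transform hφ hr]
  have hrotinv : ∀ r : observerSpace T × SO3, r.1 ∈ V → rot (inv r) = r.2 := by
    intro r hr
    apply SO3.isEmbedding_entries.injective
    rw [(hrot (inv r) (by rw [hproj r hr]; exact hr)).1, hinv r hr, D.rotation_transform hφ hr]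
  have hsrc : IsOpen (toObserver T o ⁻¹' V) := hV.preimage contMDiff_toObserver.continuous
  have hval := (isSmoothEmbedding_observerFrames T o).contMDiff
  have hsmooth : ContMDiffOn (𝓡 10) ((𝓡 7).prod (𝓡 3)) ∞
      (fun p => (toObserver T o p, rot p)) (toObserver T o ⁻¹' V) := by
    refine contMDiff_toObserver.contMDiffOn.prodMk ?_
    refine contMDiffOn_of_comp_isSmoothEmbedding SO3.isSmoothEmbedding_entries hsrc ?_
    exact ((D.contMDiffOn_rotation hφ).comp hval.contMDiffOn fun p hp => hp).congr
      fun p hp => (hrot p hp).1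
  have hsmooth' : ContMDiffOn ((𝓡 7).prod (𝓡 3)) (𝓡 10) ∞ inv (V ×ˢ univ) := by
    refine contMDiffOn_of_comp_isSmoothEmbedding (isSmoothEmbedding_observerFrames T o)
      (hV.prod isOpen_univ) ?_
    have h1 : ContMDiff ((𝓡 7).prod (𝓡 3)) ((𝓡 4).tangent.prod 𝓘(ℝ, Fin 3 → Fin 3 → ℝ)) ∞
        (fun r : observerSpace T × SO3 => (r.1.1, SO3.entries r.2)) :=
      ((isSmoothEmbedding_observerSpace T).contMDiff.comp contMDiff_fst).prodMk
        (SO3.isSmoothEmbedding_entries.contMDiff.comp contMDiff_snd)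
    exact ((D.contMDiffOn_transform hφ).comp h1.contMDiffOn fun r hr => ⟨hr.1, mem_univ _⟩).congr
      fun r hr => hinv r hr.1
  let e : Trivialization SO3 (toObserver T o) :=
    { toFun := fun p => (toObserver T o p, rot p)
      invFun := inv
      source := toObserver T o ⁻¹' V
      target := V ×ˢ univ
      map_source' := fun p hp => ⟨hp, mem_univ _⟩
      map_target' := fun r hr => by
        rw [mem_preimage, hproj r hr.1]
        exact hr.1
      left_inv' := fun p hp => Subtype.ext (by
        rw [hinv _ (show (toObserver T o p, rot p).1 ∈ V from hp)]
        exact (hrot p hp).2)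
      right_inv' := fun r hr => Prod.ext (hproj r hr.1) (hrotinv r hr.1)
      open_source := hsrc
      open_target := hV.prod isOpen_univ
      continuousOn_toFun := hsmooth.continuousOn
      continuousOn_invFun := hsmooth'.continuousOn
      baseSet := V
      open_baseSet := hV
      source_eq := rfl
      target_eq := rfl
      proj_toFun := fun p _ => rfl }
  refine ⟨e, hbD, hsmooth, hsmooth', fun p hp k => ?_⟩
  have hpr : toObserver T o (frameAction T o p k) = toObserver T o p :=
    Subtype.ext (baseLeg_rotateFrame p.1 k)
  refine Prod.ext hpr ?_
  apply SO3.isEmbedding_entries.injective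
  change SO3.entries (rot (frameAction T o p k)) = SO3.entries (rot p * k)
  rw [(hrot (frameAction T o p k) (by rw [hpr]; exact hp)).1]
  change D.rotation (rotateFrame p.1 k) = _
  rw [D.rotation_rotateFrame, ← (hrot p hp).1]
  rfl

variable (T o) in
theorem isPrincipalBundle_frames :
    IsPrincipalBundle (𝓡 3) (𝓡 10) (𝓡 7) (toObserver T o) (frameAction T o) where
  act_one p := Subtype.ext (rotateFrame_one p.1)
  act_mul p k l := Subtype.ext (rotateFrame_mul p.1 k l)
  contMDiff_act := contMDiff_frameAction
  contMDiff_proj := contMDiff_toObserver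
  proj_act p k := Subtype.ext (baseLeg_rotateFrame p.1 k)
  exists_trivialization := exists_frame_trivialization

end PrincipalBundle

/-! ### The Lie algebra of the model group -/

section Exponential

variable {n : Type*} [Fintype n] [DecidableEq n]

attribute [local instance] Matrix.linftyOpNormedRing Matrix.linftyOpNormedAlgebra

theorem continuous_exp_smul (X : Matrix n n ℝ) :
    Continuous fun t : ℝ => NormedSpace.exp (t • X) :=
  continuous_iff_continuousAt.2 fun t => (hasDerivAt_exp_smul_const X t).continuousAt

/-- One curve covers all the conditions on one-parameter groups that occur: preserving a form (`A =
Xᵀ`, `B = X`), preserving a form on the dual space (`A = X`, `B = Xᵀ`) and fixing a row (`A = 0`).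
It is constant exactly if `A * C + C * B = 0`. -/
theorem hasDerivAt_exp_mul_exp (A B C : Matrix n n ℝ) (t : ℝ) :
    HasDerivAt (fun t : ℝ => NormedSpace.exp (t • A) * C * NormedSpace.exp (t • B))
      (NormedSpace.exp (t • A) * (A * C + C * B) * NormedSpace.exp (t • B)) t := by
  have h := ((hasDerivAt_exp_smul_const A t).mul_const C).mul (hasDerivAt_exp_smul_const' B t)
  rw [show NormedSpace.exp (t • A) * (A * C + C * B) * NormedSpace.exp (t • B) =
    NormedSpace.exp (t • A) * A * C * NormedSpace.exp (t • B) +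
      NormedSpace.exp (t • A) * C * (B * NormedSpace.exp (t • B)) by
    simp only [Matrix.mul_add, Matrix.add_mul, Matrix.mul_assoc]]
  exact h

theorem exp_mul_mul_exp {A B C : Matrix n n ℝ} (h : A * C + C * B = 0) (t : ℝ) :
    NormedSpace.exp (t • A) * C * NormedSpace.exp (t • B) = C := by
  have hd := fun t => hasDerivAt_exp_mul_exp A B C t
  simp only [h, mul_zero, zero_mul] at hd
  have := is_const_of_deriv_eq_zero (fun t => (hd t).differentiableAt) (fun t => (hd t).deriv) t 0
  simpa using this

theorem add_eq_zero_of_exp_mul_mul_exp {A B C : Matrix n n ℝ}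
    (h : ∀ t : ℝ, NormedSpace.exp (t • A) * C * NormedSpace.exp (t • B) = C) :
    A * C + C * B = 0 := by
  have h1 := hasDerivAt_exp_mul_exp A B C 0
  have h2 : (fun t : ℝ => NormedSpace.exp (t • A) * C * NormedSpace.exp (t • B)) = fun _ => C :=
    funext h
  rw [h2] at h1
  have := h1.unique (hasDerivAt_const 0 C)
  simpa using this

theorem exp_smul_add (X : Matrix n n ℝ) (s t : ℝ) :
    NormedSpace.exp ((s + t) • X) = NormedSpace.exp (s • X) * NormedSpace.exp (t • X) := by
  rw [add_smul]
  exact Matrix.exp_add_of_commute _ _ (((Commute.refl X).smul_left s).smul_right t)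

theorem exp_smul_transpose (X : Matrix n n ℝ) (t : ℝ) :
    NormedSpace.exp (t • Xᵀ) = (NormedSpace.exp (t • X))ᵀ := by
  rw [← Matrix.transpose_smul, Matrix.exp_transpose]

/-- The one-parameter group generated by `X`. -/
def expUnit (X : Matrix n n ℝ) (t : ℝ) : GL n ℝ where
  val := NormedSpace.exp (t • X)
  inv := NormedSpace.exp (-t • X)
  val_inv := by rw [← exp_smul_add]; simp
  inv_val := by rw [← exp_smul_add]; simp

theorem continuous_expUnit (X : Matrix n n ℝ) : Continuous (expUnit X) :=
  Units.continuous_iff.2 ⟨continuous_exp_smul X, (continuous_exp_smul X).comp continuous_neg⟩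

theorem mem_lieAlgebraOf_iff {H : Subgroup (GL n ℝ)} {X : Matrix n n ℝ} :
    X ∈ lieAlgebraOf H ↔ ∀ t, expUnit X t ∈ H := by
  refine ⟨fun h t => ?_, fun h t => ⟨_, h t, rfl⟩⟩
  obtain ⟨g, hg, e⟩ := h t
  rwa [show expUnit X t = g from Units.ext e.symm]

end Exponential

/-- The range of a continuous map from a connected space that passes through `1` stays in the
component of `1`. This is applied to one-parameter groups and to the inclusion of `SO(3)`. -/
theorem mem_identityComponent {Y : Type*} [TopologicalSpace Y] [PreconnectedSpace Y]
    {H : Subgroup (GL (Fin 4 ⊕ Fin 1) ℝ)} {f : Y → GL (Fin 4 ⊕ Fin 1) ℝ} (hf : Continuous f)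
    (hH : ∀ y, f y ∈ H) {y₀ : Y} (h₀ : f y₀ = 1) (y : Y) : f y ∈ identityComponent H := by
  let g : Y → H := fun y => ⟨f y, hH y⟩
  have hg : Continuous g := hf.subtype_mk _
  have h1 : (1 : H) ∈ range g := ⟨y₀, Subtype.ext h₀⟩
  exact ⟨g y, (isPreconnected_range hg).subset_connectedComponent h1 ⟨y, rfl⟩, rfl⟩

theorem lieAlgebraOf_identityComponent (H : Subgroup (GL (Fin 4 ⊕ Fin 1) ℝ)) :
    lieAlgebraOf (identityComponent H) = lieAlgebraOf H := by
  ext X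
  rw [mem_lieAlgebraOf_iff, mem_lieAlgebraOf_iff]
  refine ⟨fun h t => ?_, fun h t => ?_⟩
  · obtain ⟨g, -, e⟩ := h t
    exact e ▸ g.2
  · exact mem_identityComponent (continuous_expUnit X) h (y₀ := 0)
      (Units.ext (by simp [expUnit])) t

theorem mem_lieAlgebraOf_specialIsometryGroup {Q : ModelMat} (hQ : Q.det ≠ 0) {X : ModelMat} :
    X ∈ lieAlgebraOf (specialIsometryGroup Q) ↔ Xᵀ * Q + Q * X = 0 := by
  rw [mem_lieAlgebraOf_iff]
  constructor
  · intro h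
    refine add_eq_zero_of_exp_mul_mul_exp fun t => ?_
    rw [exp_smul_transpose]
    exact (h t).1
  · intro h
    have h1 : ∀ t : ℝ, (NormedSpace.exp (t • X))ᵀ * Q * NormedSpace.exp (t • X) = Q := fun t => by
      rw [← exp_smul_transpose]; exact exp_mul_mul_exp h t
    refine fun t => ⟨h1 t, ?_⟩
    change (NormedSpace.exp (t • X)).det = 1
    -- Preserving `Q` gives only that the squared determinant is `1`. Writing the exponential at `t`
    -- as the square of the one at `t / 2` shows that the determinant itself is `1`.
    have h2 := congrArg Matrix.det (h1 (t / 2))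
    rw [Matrix.det_mul, Matrix.det_mul, Matrix.det_transpose] at h2
    rw [← add_halves t, exp_smul_add, Matrix.det_mul]
    exact mul_right_cancel₀ hQ (by linear_combination h2)

/-- Since `η² = 1`, each relation says that `η lᵀ η` is a one-sided inverse of `l`, and one-sided
inverses of square matrices are two-sided. The form with the transpose on the right arises from the
action of Poincaré matrices on the dual space. -/
theorem mul_eta_transpose {l : Matrix (Fin 4) (Fin 4) ℝ} : l * eta * lᵀ = eta ↔
    lᵀ * eta * l = eta := by
  constructor
  · intro h
    have h1 : l * (eta * lᵀ * eta) = 1 := by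
      rw [← eta_mul_eta]; nth_rw 3 [← h]; simp only [Matrix.mul_assoc]
    have h2 := mul_eq_one_comm.1 h1
    calc lᵀ * eta * l = eta * (eta * lᵀ * eta * l) := by
          simp only [← Matrix.mul_assoc, eta_mul_eta, Matrix.one_mul]
      _ = eta := by rw [h2, Matrix.mul_one]
  · intro h
    have h1 : (eta * lᵀ * eta) * l = 1 := by
      rw [← eta_mul_eta]; nth_rw 4 [← h]; simp only [Matrix.mul_assoc]
    have h2 := mul_eq_one_comm.1 h1
    calc l * eta * lᵀ = l * (eta * lᵀ * eta) * eta := by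
          simp only [Matrix.mul_assoc, eta_mul_eta, Matrix.mul_one]
      _ = eta := by rw [h2, Matrix.one_mul]

/-- Apart from the determinant, the group is cut out by two linear-type relations for `g`: its last
row is `(0, 1)`, and `g diag(η, 0) gᵀ = diag(η, 0)`, in which the translation part does not appear.
Each of them passes to the Lie algebra and back by the lemmas on exponentials. -/
theorem mem_lieAlgebraOf_poincareGroup {X : ModelMat} : X ∈ lieAlgebraOf poincareGroup ↔
    ∃ (h : Matrix (Fin 4) (Fin 4) ℝ) (w : Matrix (Fin 4) (Fin 1) ℝ),
      X = Matrix.fromBlocks h w 0 0 ∧ hᵀ * eta + eta * h = 0 := by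
  have hE : ∀ l w m c, (Matrix.fromBlocks 0 0 0 1 : ModelMat) * Matrix.fromBlocks l w m c =
      Matrix.fromBlocks 0 0 m c := fun l w m c => by simp [Matrix.fromBlocks_multiply]
  have hQ : ∀ (l : Matrix (Fin 4) (Fin 4) ℝ) (w : Matrix (Fin 4) (Fin 1) ℝ),
      (Matrix.fromBlocks l w 0 1 : ModelMat) * Matrix.fromBlocks eta 0 0 0 *
      (Matrix.fromBlocks l w 0 1 : ModelMat)ᵀ = Matrix.fromBlocks (l * eta * lᵀ) 0 0 0 := fun l w => by
    simp [Matrix.fromBlocks_multiply, Matrix.fromBlocks_transpose]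
  rw [mem_lieAlgebraOf_iff]
  constructor
  · intro H
    have h1 : (0 : ModelMat) * Matrix.fromBlocks 0 0 0 1 + Matrix.fromBlocks 0 0 0 1 * X = 0 := by
      refine add_eq_zero_of_exp_mul_mul_exp fun t => ?_
      obtain ⟨l, w, e, -⟩ := H t
      change NormedSpace.exp (t • X) = _ at e
      rw [e, smul_zero, NormedSpace.exp_zero, Matrix.one_mul, hE]
    have h2 : X * Matrix.fromBlocks eta 0 0 0 + Matrix.fromBlocks eta 0 0 0 * Xᵀ = 0 := by
      refine add_eq_zero_of_exp_mul_mul_exp fun t => ?_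
      obtain ⟨l, w, e, hl, -⟩ := H t
      change NormedSpace.exp (t • X) = _ at e
      rw [exp_smul_transpose, e, hQ, mul_eta_transpose.2 hl]
    rw [← Matrix.fromBlocks_toBlocks X] at h1 h2 ⊢
    rw [zero_mul, zero_add, hE, ← Matrix.fromBlocks_zero, Matrix.fromBlocks_inj] at h1
    obtain ⟨-, -, h3, h4⟩ := h1
    rw [h3, h4] at h2 ⊢
    refine ⟨_, _, rfl, ?_⟩
    rw [Matrix.fromBlocks_transpose, Matrix.fromBlocks_multiply, Matrix.fromBlocks_multiply,
      Matrix.fromBlocks_add, ← Matrix.fromBlocks_zero, Matrix.fromBlocks_inj] at h2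
    have h5 := h2.1
    simp only [Matrix.mul_zero, Matrix.zero_mul, add_zero] at h5
    have h6 := congrArg (fun A => eta * A * eta) h5
    simp only [Matrix.mul_add, Matrix.add_mul, Matrix.mul_zero, Matrix.zero_mul] at h6
    rw [← h6, add_comm]
    congr 1
    · rw [Matrix.mul_assoc, Matrix.mul_assoc, eta_mul_eta, Matrix.mul_one]
    · rw [← Matrix.mul_assoc, eta_mul_eta, Matrix.one_mul]
  · rintro ⟨h, w, rfl, hh⟩
    set X : ModelMat := Matrix.fromBlocks h w 0 0
    have h1 : ∀ t : ℝ, (Matrix.fromBlocks 0 0 0 1 : ModelMat) * NormedSpace.exp (t • X) =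
        Matrix.fromBlocks 0 0 0 1 := by
      intro t
      have := exp_mul_mul_exp (A := 0) (B := X) (C := Matrix.fromBlocks 0 0 0 1)
        (by rw [zero_mul, zero_add, hE, Matrix.fromBlocks_zero]) t
      rwa [smul_zero, NormedSpace.exp_zero, Matrix.one_mul] at this
    have h2 : X * Matrix.fromBlocks eta 0 0 0 + Matrix.fromBlocks eta 0 0 0 * Xᵀ = 0 := by
      have h6 := congrArg (fun A => eta * A * eta) hh
      simp only [Matrix.mul_add, Matrix.add_mul, Matrix.mul_zero, Matrix.zero_mul] at h6
      rw [Matrix.mul_assoc, Matrix.mul_assoc, eta_mul_eta, Matrix.mul_one, ← Matrix.mul_assoc,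
        eta_mul_eta, Matrix.one_mul, add_comm] at h6
      simp [X, Matrix.fromBlocks_multiply, Matrix.fromBlocks_transpose, Matrix.fromBlocks_add, h6]
    have h3 : ∀ t : ℝ, ∃ l w, NormedSpace.exp (t • X) = Matrix.fromBlocks l w 0 1 ∧
        lᵀ * eta * l = eta := by
      intro t
      have h4 := h1 t
      have h5 := exp_mul_mul_exp h2 t
      rw [exp_smul_transpose] at h5
      have e := (Matrix.fromBlocks_toBlocks (NormedSpace.exp (t • X))).symm
      rw [e, hE, Matrix.fromBlocks_inj] at h4
      rw [h4.2.2.1, h4.2.2.2] at e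
      rw [e, hQ, Matrix.fromBlocks_inj] at h5
      exact ⟨_, _, e, mul_eta_transpose.1 h5.1⟩
    intro t
    obtain ⟨l, w', e, hl⟩ := h3 t
    obtain ⟨m, u, e', hm⟩ := h3 (t / 2)
    refine ⟨l, w', e, hl, ?_⟩
    have h4 := exp_smul_add X (t / 2) (t / 2)
    rw [add_halves, e, e', Matrix.fromBlocks_multiply, Matrix.fromBlocks_inj] at h4
    have h5 := congrArg Matrix.det hm
    rw [Matrix.det_mul, Matrix.det_mul, Matrix.det_transpose] at h5
    rw [h4.1, Matrix.mul_zero, add_zero, Matrix.det_mul]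
    have h6 : eta.det ≠ 0 := by rw [det_eta]; norm_num
    exact mul_right_cancel₀ h6 (by linear_combination h5)

/-- The off-diagonal blocks give `ε mᵀ = -η w` for the lower row `m` and the column `w`; with `ε² =
1` this is solved for `m`. The values `ε = 1` and `ε = -1` belong to the two signs of `Λ`. -/
theorem transpose_mul_add_mul_iff {ε : ℝ} (hε : ε * ε = 1) {X : ModelMat} :
    Xᵀ * Matrix.fromBlocks eta 0 0 (ε • 1) +
      Matrix.fromBlocks eta 0 0 (ε • 1) * X = 0 ↔
    ∃ (h : Matrix (Fin 4) (Fin 4) ℝ) (z : Fin 4 → ℝ), hᵀ * eta + eta * h = 0 ∧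
      X = Matrix.fromBlocks h (Matrix.replicateCol (Fin 1) z)
        (Matrix.replicateRow (Fin 1) (-(ε • (eta *ᵥ z)))) 0 := by
  have key : ∀ h w m c, (Matrix.fromBlocks h w m c : ModelMat)ᵀ *
        Matrix.fromBlocks eta 0 0 (ε • 1) +
      Matrix.fromBlocks eta 0 0 (ε • 1) * (Matrix.fromBlocks h w m c : ModelMat) =
      Matrix.fromBlocks (hᵀ * eta + eta * h) (ε • mᵀ + eta * w) (wᵀ * eta + ε • m)
        (ε • cᵀ + ε • c) := by
    intro h w m c
    simp [Matrix.fromBlocks_multiply, Matrix.fromBlocks_transpose, Matrix.fromBlocks_add]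
  have hε0 : ε ≠ 0 := fun h => by simp [h] at hε
  constructor
  · intro H
    rw [← Matrix.fromBlocks_toBlocks X] at H ⊢
    rw [key, ← Matrix.fromBlocks_zero, Matrix.fromBlocks_inj] at H
    obtain ⟨h1, h2, -, h4⟩ := H
    refine ⟨X.toBlocks₁₁, fun i => X.toBlocks₁₂ i 0, h1, ?_⟩
    congr 1
    · ext i j
      rw [Subsingleton.elim j 0]; rfl
    · ext i j
      rw [Subsingleton.elim i 0]
      have h5 := congrFun (congrFun h2 j) 0
      simp [Matrix.mul_apply] at h5
      simp [Matrix.mulVec, dotProduct]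
      linear_combination ε * h5 - X.toBlocks₂₁ 0 j * hε
    · ext i j
      rw [Subsingleton.elim i 0, Subsingleton.elim j 0]
      have h5 := congrFun (congrFun h4 0) 0
      simpa [hε0] using h5
  · rintro ⟨h, z, hh, rfl⟩
    rw [key, hh, ← Matrix.fromBlocks_zero]
    congr 1
    · ext i j
      simp [Matrix.mul_apply, Matrix.mulVec, dotProduct]
      linear_combination (-∑ x, eta i x * z x) * hε
    · ext i j
      simp [Matrix.mul_apply, Matrix.mulVec, dotProduct]
      have : ∑ x, z x * eta x j = ∑ x, eta j x * z x :=
        Finset.sum_congr rfl fun x _ => by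
          rw [mul_comm, ← Matrix.transpose_apply eta, eta_transpose]
      rw [this]
      linear_combination (-∑ x, eta j x * z x) * hε
    · simp

/-- The Lie algebra of the model group consists of the matrices `h + z`. -/
theorem mem_lieAlgebraOf_modelGroup {Λ : ℝ} {X : ModelMat} : X ∈ lieAlgebraOf (modelGroup Λ) ↔
    ∃ (h : Matrix (Fin 4) (Fin 4) ℝ) (z : Fin 4 → ℝ),
      hᵀ * eta + eta * h = 0 ∧ X = algElem Λ h z := by
  rw [modelGroup]
  split_ifs with h1 h2
  · rw [lieAlgebraOf_identityComponent, mem_lieAlgebraOf_specialIsometryGroup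
      (by rw [Matrix.det_fromBlocks_zero₂₁, det_eta]; simp), ← one_smul ℝ (1 : Matrix (Fin 1) (Fin 1) ℝ),
      transpose_mul_add_mul_iff (by norm_num)]
    simp only [algElem, Real.sign_of_pos h1]
  · rw [lieAlgebraOf_identityComponent, mem_lieAlgebraOf_poincareGroup]
    simp only [algElem, h2, Real.sign_zero, zero_smul, neg_zero]
    constructor
    · rintro ⟨h, w, e, hh⟩
      refine ⟨h, fun i => w i 0, hh, ?_⟩
      rw [e]
      congr 1
      ext i j
      rw [Subsingleton.elim j 0]; rfl
    · rintro ⟨h, z, hh, e⟩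
      exact ⟨h, _, e, hh⟩
  · have h3 : Λ < 0 := lt_of_le_of_ne (not_lt.1 h1) h2
    rw [lieAlgebraOf_identityComponent, mem_lieAlgebraOf_specialIsometryGroup
      (by rw [Matrix.det_fromBlocks_zero₂₁, det_eta]; simp), show (-1 : Matrix (Fin 1) (Fin 1) ℝ) = (-1 : ℝ) • 1 by simp,
      transpose_mul_add_mul_iff (by norm_num)]
    simp only [algElem, Real.sign_of_neg h3]

/-! ### The inclusion of the rotation group -/

theorem spatial_transpose_mul_eta_mul (k : SO3) : (spatial k.1)ᵀ * eta * spatial k.1 = eta := by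
  rw [Matrix.mul_assoc, ← spatial_mul_eta, ← Matrix.mul_assoc, spatial_transpose, ← spatial_mul,
    k.transpose_mul_self, spatial_one, Matrix.one_mul]

theorem continuous_spatial : Continuous fun k : SO3 => spatial k.1 :=
  (Continuous.matrix_fromBlocks continuous_const continuous_const continuous_const
    continuous_subtype_val).matrix_submatrix _ _

theorem continuous_inclK : Continuous inclK :=
  Continuous.matrix_fromBlocks continuous_spatial continuous_const continuous_const
    continuous_const

theorem inclK_transpose_mul_mul (k : SO3) (c : Matrix (Fin 1) (Fin 1) ℝ) :
    (inclK k)ᵀ * Matrix.fromBlocks eta 0 0 c * inclK k = Matrix.fromBlocks eta 0 0 c := by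
  change (Matrix.fromBlocks (spatial k.1) 0 0 1)ᵀ * _ * Matrix.fromBlocks (spatial k.1) 0 0 1 = _
  simp [Matrix.fromBlocks_multiply, Matrix.fromBlocks_transpose, spatial_transpose_mul_eta_mul]

theorem det_inclK (k : SO3) : (inclK k).det = 1 := by
  change (Matrix.fromBlocks (spatial k.1) 0 0 1 : ModelMat).det = 1
  rw [Matrix.det_fromBlocks_zero₂₁, spatial_det, k.det_eq_one, Matrix.det_one, mul_one]

/-- Each `diag(1, k, 1)` satisfies the defining equations of the full group, and the connectedness
of `SO(3)` brings it into the identity component. -/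
theorem inclK_mem_modelGroup (Λ : ℝ) (k : SO3) : ∃ g ∈ modelGroup Λ, (g : ModelMat) = inclK k := by
  let u : SO3 →* GL (Fin 4 ⊕ Fin 1) ℝ := inclK.toHomUnits
  have hu : Continuous u := Units.continuous_iff.2 ⟨continuous_inclK,
    by
      have : (fun x => (((u x)⁻¹ : GL (Fin 4 ⊕ Fin 1) ℝ) : ModelMat)) = fun x => inclK x⁻¹ := by
        funext x; rw [← map_inv]; rfl
      rw [this]
      exact continuous_inclK.comp
        (continuous_subtype_val.matrix_transpose.subtype_mk fun k : SO3 => (k⁻¹).2)⟩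
  refine ⟨u k, ?_, rfl⟩
  rw [modelGroup]
  split_ifs
  · exact mem_identityComponent (H := specialIsometryGroup _) hu (fun k => ⟨inclK_transpose_mul_mul k _, det_inclK k⟩)
      (map_one u) k
  · exact mem_identityComponent (H := poincareGroup) hu (fun k => ⟨spatial k.1, 0, rfl, spatial_transpose_mul_eta_mul k,
      by rw [spatial_det, k.det_eq_one]⟩) (map_one u) k
  · exact mem_identityComponent (H := specialIsometryGroup _) hu (fun k => ⟨inclK_transpose_mul_mul k _, det_inclK k⟩)
      (map_one u) k

/-- The rotations are cut out of the `3 × 3` matrices by closed conditions, and `k ↦ diag(1, k, 1)`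
has the continuous left inverse that extracts the spatial block. -/
theorem isClosedEmbedding_inclK : IsClosedEmbedding inclK := by
  have h1 : IsClosedEmbedding (Subtype.val : SO3 → Matrix (Fin 3) (Fin 3) ℝ) := by
    refine IsClosed.isClosedEmbedding_subtypeVal ?_
    have : {Q : Matrix (Fin 3) (Fin 3) ℝ | Q ∈ Matrix.specialOrthogonalGroup (Fin 3) ℝ} =
        {Q | Qᵀ * Q = 1 ∧ Q.det = 1} := by
      ext Q
      exact ⟨fun h => ⟨SO3.transpose_mul_self ⟨Q, h⟩, SO3.det_eq_one ⟨Q, h⟩⟩,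
        fun h => (SO3.mk Q h.1 h.2).2⟩
    change IsClosed {Q : Matrix (Fin 3) (Fin 3) ℝ | Q ∈ Matrix.specialOrthogonalGroup (Fin 3) ℝ}
    rw [this]
    exact (isClosed_eq (by fun_prop) continuous_const).inter
      (isClosed_eq (by fun_prop) continuous_const)
  let j : Matrix (Fin 3) (Fin 3) ℝ → ModelMat := fun Q => Matrix.fromBlocks (spatial Q) 0 0 1
  let r : ModelMat → Matrix (Fin 3) (Fin 3) ℝ := fun Y => spatialBlock Y.toBlocks₁₁
  have hj : Continuous j := Continuous.matrix_fromBlocks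
    ((Continuous.matrix_fromBlocks continuous_const continuous_const continuous_const
      continuous_id).matrix_submatrix _ _) continuous_const continuous_const continuous_const
  have hr : Continuous r := continuous_matrix fun a b =>
    continuous_id.matrix_elem (Sum.inl a.succ) (Sum.inl b.succ)
  have hrj : Function.LeftInverse r j := fun Q => by
    ext a b
    exact spatial_succ_succ Q a b
  exact (hrj.isClosedEmbedding hr hj).comp h1

/-! ### Behaviour of the form `A` under rotations, in coordinates -/

section Rotations

variable {Φ : E4 × E4 → ℝ} {s : FrameCoord}

/-- The action of a rotation on coordinates of frames. -/
def rotateCoord (k : SO3) : FrameCoord →L[ℝ] FrameCoord :=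
  (ContinuousLinearMap.fst ℝ E4 (Fin 4 → E4)).prod (ContinuousLinearMap.pi fun i =>
    ∑ a, spatial k.1 a i • (ContinuousLinearMap.proj (R := ℝ) (φ := fun _ : Fin 4 => E4) a).comp
      (ContinuousLinearMap.snd ℝ E4 (Fin 4 → E4)))

theorem rotateCoord_fst (k : SO3) (s : FrameCoord) : (rotateCoord k s).1 = s.1 := rfl

theorem rotateCoord_snd (k : SO3) (s : FrameCoord) (i : Fin 4) :
    (rotateCoord k s).2 i = ∑ a, spatial k.1 a i • s.2 a := by
  simp [rotateCoord]

theorem rotateCoord_snd_apply (k : SO3) (s : FrameCoord) (i b : Fin 4) :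
    (rotateCoord k s).2 i b = ∑ a, spatial k.1 a i * s.2 a b := by
  simp [rotateCoord_snd]

theorem rotateCoord_zero (k : SO3) (s : FrameCoord) : (rotateCoord k s).2 0 = s.2 0 := by
  rw [rotateCoord_snd, Fin.sum_univ_succ]
  simp [spatial_zero_zero, spatial_succ_zero]

theorem frameMatrix_rotateCoord (k : SO3) (s : FrameCoord) :
    frameMatrix (rotateCoord k s) = frameMatrix s * spatial k.1 := by
  ext a i
  simp only [frameMatrix, Matrix.of_apply, Matrix.mul_apply, rotateCoord_snd_apply]
  exact Finset.sum_congr rfl fun b _ => mul_comm _ _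

theorem inv_frameMatrix_rotateCoord (k : SO3) (s : FrameCoord) :
    (frameMatrix (rotateCoord k s))⁻¹ = spatial k.1ᵀ * (frameMatrix s)⁻¹ := by
  rw [frameMatrix_rotateCoord, Matrix.mul_inv_rev]
  congr 1
  refine Matrix.inv_eq_left_inv ?_
  rw [← spatial_mul, k.transpose_mul_self, spatial_one]

/-- A rotation leaves `f_0` and `df_0` unchanged, hence also the coefficients and their arguments.
What remains is linear in the leg. -/
theorem covDerivLeg_rotateCoord (k : SO3) (s v : FrameCoord) (i b : Fin 4) :
    covDerivLeg Φ (rotateCoord k s) (rotateCoord k v) i b =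
      ∑ a, spatial k.1 a i * covDerivLeg Φ s v a b := by
  simp only [covDerivLeg, rotateCoord_fst, rotateCoord_zero, rotateCoord_snd_apply]
  let G : Fin 4 → ℝ := fun x => ∑ c, (horCoef Φ b x c (s.1, s.2 0) * v.1 c +
    verCoef Φ b x c (s.1, s.2 0) * ((∑ d, nonlinCoef Φ c d (s.1, s.2 0) * v.1 d) + v.2 0 c))
  change ∑ a, spatial k.1 a i * v.2 a b + ∑ x, (∑ a, spatial k.1 a i * s.2 a x) * G x =
    ∑ a, spatial k.1 a i * (v.2 a b + ∑ x, s.2 a x * G x)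
  simp only [mul_add, Finset.sum_add_distrib, Finset.sum_mul, Finset.mul_sum]
  rw [Finset.sum_comm]
  simp only [mul_assoc]

theorem connCoord_rotateCoord (k : SO3) (s v : FrameCoord) :
    connCoord Φ (rotateCoord k s) (rotateCoord k v) =
      spatial k.1ᵀ * connCoord Φ s v * spatial k.1 := by
  have h1 : ∀ s v, connCoord Φ s v =
      (frameMatrix s)⁻¹ * Matrix.of fun a i => covDerivLeg Φ s v i a := fun s v => by
    ext j i; simp [connCoord, Matrix.mul_apply]
  have h2 : (Matrix.of fun a i => covDerivLeg Φ (rotateCoord k s) (rotateCoord k v) i a) =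
      (Matrix.of fun a i => covDerivLeg Φ s v i a) * spatial k.1 := by
    ext a i
    simp only [Matrix.of_apply, Matrix.mul_apply, covDerivLeg_rotateCoord]
    exact Finset.sum_congr rfl fun b _ => mul_comm _ _
  rw [h1, h1, h2, inv_frameMatrix_rotateCoord]
  simp only [Matrix.mul_assoc]

theorem solderCoord_rotateCoord (k : SO3) (s v : FrameCoord) :
    solderCoord (rotateCoord k s) (rotateCoord k v) = spatial k.1ᵀ *ᵥ solderCoord s v := by
  have h1 : ∀ s v, solderCoord s v = (frameMatrix s)⁻¹ *ᵥ (v.1 : Fin 4 → ℝ) := fun s v => rfl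
  rw [h1, h1, inv_frameMatrix_rotateCoord, Matrix.mulVec_mulVec, rotateCoord_fst]

theorem algElem_conj (Λ : ℝ) (k : SO3) (h : Matrix (Fin 4) (Fin 4) ℝ) (z : Fin 4 → ℝ) :
    algElem Λ (spatial k.1ᵀ * h * spatial k.1) (spatial k.1ᵀ *ᵥ z) =
      inclK k⁻¹ * algElem Λ h z * inclK k := by
  change _ = Matrix.fromBlocks (spatial k.1ᵀ) 0 0 1 * _ * Matrix.fromBlocks (spatial k.1) 0 0 1
  rw [algElem, algElem, Matrix.fromBlocks_multiply, Matrix.fromBlocks_multiply]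
  congr 1
  · simp
  · ext i j
    simp [Matrix.mul_apply, Matrix.mulVec, dotProduct]
  · have h1 : eta *ᵥ (spatial k.1ᵀ *ᵥ z) = (eta *ᵥ z) ᵥ* spatial k.1 := by
      rw [Matrix.mulVec_mulVec, ← Matrix.mulVec_transpose, Matrix.mulVec_mulVec,
        spatial_transpose, spatial_mul_eta]
    rw [h1]
    ext i j
    simp [Matrix.mul_apply, Matrix.vecMul, dotProduct, Finset.mul_sum, mul_assoc]
  · simp

theorem cartanCoord_rotateCoord (Λ : ℝ) (k : SO3) (s v : FrameCoord) :
    cartanCoord Λ Φ (rotateCoord k s) (rotateCoord k v) =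
      inclK k⁻¹ * cartanCoord Λ Φ s v * inclK k := by
  rw [cartanCoord, cartanCoord, connCoord_rotateCoord, solderCoord_rotateCoord, algElem_conj]

/-- The form `A` on vertical velocities. -/
theorem cartanCoord_vertical (Λ : ℝ) (hs : (frameMatrix s).det ≠ 0)
    {κ : Matrix (Fin 4) (Fin 4) ℝ} (h0 : ∀ i, κ i 0 = 0) :
    cartanCoord Λ Φ s (0, fun i => ∑ a, κ a i • s.2 a) = algElem Λ κ 0 := by
  rw [cartanCoord]
  congr 1
  · ext j i
    -- The first column of `κ` vanishes, so `df_0 = 0`; as also `dx = 0`, all the connection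
    -- coefficients drop out.
    have h1 : ∀ a, covDerivLeg Φ s (0, fun i => ∑ a, κ a i • s.2 a) i a =
        ∑ b, κ b i * s.2 b a := fun a => by simp [covDerivLeg, h0]
    simp only [connCoord, Matrix.of_apply, h1]
    exact sum_inv_frameMatrix_mul hs (fun b => κ b i) j
  · funext i
    simp [solderCoord]

end Rotations

/-! ### Coordinates on the Lie algebra -/

/-- The positions of ten matrix entries that determine an element of the Lie algebra. -/
def algIndex : Fin 10 → (Fin 4 ⊕ Fin 1) × (Fin 4 ⊕ Fin 1) :=
  ![(.inl 0, .inr 0), (.inl 1, .inr 0), (.inl 2, .inr 0), (.inl 3, .inr 0),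
    (.inl 0, .inl 1), (.inl 0, .inl 2), (.inl 0, .inl 3),
    (.inl 1, .inl 2), (.inl 1, .inl 3), (.inl 2, .inl 3)]

/-- Ten coordinates on the Lie algebra. -/
def algCoord : ModelMat →ₗ[ℝ] Fin 10 → ℝ :=
  LinearMap.pi fun k => LinearMap.proj (algIndex k).2 ∘ₗ LinearMap.proj (algIndex k).1

theorem algCoord_apply (Y : ModelMat) (k : Fin 10) :
    algCoord Y k = Y (algIndex k).1 (algIndex k).2 := rfl

theorem eta_mul_apply (h : Matrix (Fin 4) (Fin 4) ℝ) (i j : Fin 4) :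
    (hᵀ * eta + eta * h) i j = h j i * eta j j + eta i i * h i j := by
  rw [eta, Matrix.add_apply, Matrix.mul_diagonal, Matrix.diagonal_mul, Matrix.diagonal_apply_eq,
    Matrix.diagonal_apply_eq, Matrix.transpose_apply]

/-- The ten entries are `z` and the part of `h` above the diagonal. The relation `hᵀ η + η h = 0`
forces the diagonal to vanish and determines the part below. -/
theorem algCoord_injOn (Λ : ℝ) : InjOn algCoord (lieAlgebraOf (modelGroup Λ)) := by
  intro Y hY Y' hY' e
  obtain ⟨h, z, hh, rfl⟩ := mem_lieAlgebraOf_modelGroup.1 hY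
  obtain ⟨h', z', hh', rfl⟩ := mem_lieAlgebraOf_modelGroup.1 hY'
  have hc := fun k => congrFun e k
  simp only [algCoord_apply] at hc
  have hz : z = z' := by
    funext i
    fin_cases i
    exacts [hc 0, hc 1, hc 2, hc 3]
  have e1 : h 0 1 = h' 0 1 := hc 4
  have e2 : h 0 2 = h' 0 2 := hc 5
  have e3 : h 0 3 = h' 0 3 := hc 6
  have e4 : h 1 2 = h' 1 2 := hc 7
  have e5 : h 1 3 = h' 1 3 := hc 8
  have e6 : h 2 3 = h' 2 3 := hc 9
  have hd : ∀ i j, (h j i - h' j i) * eta j j + eta i i * (h i j - h' i j) = 0 := by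
    intro i j
    have a1 := congrFun (congrFun hh i) j
    have a2 := congrFun (congrFun hh' i) j
    rw [eta_mul_apply, Matrix.zero_apply] at a1 a2
    linear_combination a1 - a2
  have hn : ∀ i, eta i i ≠ 0 := fun i => by fin_cases i <;> simp [eta]
  have hsymm : ∀ i j, h i j = h' i j → h j i = h' j i := by
    intro i j eij
    have := hd i j
    rw [eij, sub_self, mul_zero, add_zero] at this
    exact sub_eq_zero.1 ((mul_eq_zero.1 this).resolve_right (hn j))
  have hdiag : ∀ i, h i i = h' i i := by
    intro i
    have a1 := hd i i
    have : (h i i - h' i i) * eta i i = 0 := by linear_combination a1 / 2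
    exact sub_eq_zero.1 ((mul_eq_zero.1 this).resolve_right (hn i))
  have hh : h = h' := by
    ext i j
    fin_cases i <;> fin_cases j
    exacts [hdiag 0, e1, e2, e3, hsymm _ _ e1, hdiag 1, e4, e5, hsymm _ _ e2, hsymm _ _ e4,
      hdiag 2, e6, hsymm _ _ e3, hsymm _ _ e5, hsymm _ _ e6, hdiag 3]
  rw [hz, hh]

/-- An injective linear map from a ten-dimensional space to the Lie algebra is bijective. -/
theorem bijOn_lieAlgebraOf {V : Type*} [AddCommGroup V] [Module ℝ V] [FiniteDimensional ℝ V]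
    (hV : Module.finrank ℝ V = 10) {Λ : ℝ} (f : V →ₗ[ℝ] ModelMat) (hf : Function.Injective f)
    (hm : ∀ v, f v ∈ lieAlgebraOf (modelGroup Λ)) :
    BijOn f univ (lieAlgebraOf (modelGroup Λ)) := by
  refine ⟨fun v _ => hm v, hf.injOn, fun Y hY => ?_⟩
  -- Read in the ten coordinates, `f` is an injective linear map between spaces of dimension 10,
  -- hence surjective.
  have h1 : Function.Injective (algCoord ∘ₗ f) := fun v w e =>
    hf (algCoord_injOn Λ (hm v) (hm w) e)
  obtain ⟨v, hv⟩ := (LinearMap.injective_iff_surjective_of_finrank_eq_finrank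
    (by rw [hV]; simp)).1 h1 (algCoord Y)
  exact ⟨v, mem_univ v, algCoord_injOn Λ (hm v) hY hv⟩

/-! ### Changes of charts -/

section Transition

variable {M : Type*} [TopologicalSpace M] [ChartedSpace E4 M] [IsManifold (𝓡 4) ∞ M]
  {φ φ' : OpenPartialHomeomorph M E4}

theorem fderiv_transition (hφ : φ ∈ IsManifold.maximalAtlas (𝓡 4) ∞ M)
    (hφ' : φ' ∈ IsManifold.maximalAtlas (𝓡 4) ∞ M) {x : M} (hx : x ∈ φ.source)
    (hx' : x ∈ φ'.source) (w : TangentSpace (𝓡 4) x) :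
    fderiv ℝ (φ' ∘ φ.symm) (φ x) (mfderiv (𝓡 4) 𝓘(ℝ, E4) φ x w) =
      mfderiv (𝓡 4) 𝓘(ℝ, E4) φ' x w := by
  have h1 : MDifferentiableAt (𝓡 4) (𝓡 4) φ.symm (φ x) :=
    (mdifferentiable_of_mem_maximalAtlas hφ).mdifferentiableAt_symm (φ.map_source hx)
  have e : φ.symm (φ x) = x := φ.left_inv hx
  have h2 : MDifferentiableAt (𝓡 4) (𝓡 4) φ' (φ.symm (φ x)) := by
    rw [e]
    exact (mdifferentiable_of_mem_maximalAtlas hφ').mdifferentiableAt hx'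
  have h3 := mfderiv_comp (φ x) h2 h1
  rw [← mfderiv_eq_fderiv]
  refine (DFunLike.congr_fun h3 (mfderiv (𝓡 4) 𝓘(ℝ, E4) φ x w)).trans ?_
  change mfderiv (𝓡 4) (𝓡 4) φ' (φ.symm (φ x))
    (mfderiv (𝓡 4) (𝓡 4) φ.symm (φ x) (mfderiv (𝓡 4) (𝓡 4) φ x w)) = _
  rw [mfderiv_symm_mfderiv hφ hx]
  -- The points `φ.symm (φ x)` and `x` are equal but not by definition. All the tangent spaces are
  -- `E4`, so the two derivatives are compared as maps of `E4`.
  have key : ∀ y, y = x → ∀ w : E4, (mfderiv (𝓡 4) (𝓡 4) φ' y : E4 →L[ℝ] E4) w =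
      (mfderiv (𝓡 4) (𝓡 4) φ' x : E4 →L[ℝ] E4) w := by
    rintro y rfl w; rfl
  exact key _ e w

theorem tlift_transition (hφ : φ ∈ IsManifold.maximalAtlas (𝓡 4) ∞ M)
    (hφ' : φ' ∈ IsManifold.maximalAtlas (𝓡 4) ∞ M) {v : TangentBundle (𝓡 4) M}
    (hv : v.proj ∈ φ.source) (hv' : v.proj ∈ φ'.source) :
    tlift (φ' ∘ φ.symm) (tangentCoord φ v) = tangentCoord φ' v :=
  Prod.ext (congrArg φ' (φ.left_inv hv)) (fderiv_transition hφ hφ' hv hv' v.2)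

theorem frameLift_transition (hφ : φ ∈ IsManifold.maximalAtlas (𝓡 4) ∞ M)
    (hφ' : φ' ∈ IsManifold.maximalAtlas (𝓡 4) ∞ M) {p : FrameSpace M}
    (hp : p.proj ∈ φ.source) (hp' : p.proj ∈ φ'.source) :
    ChartChange.frameLift (φ' ∘ φ.symm) (frameCoord φ p) = frameCoord φ' p :=
  Prod.ext (congrArg φ' (φ.left_inv hp))
    (funext fun i => fderiv_transition hφ hφ' hp hp' (leg p i))

theorem smoothNear_transition (hφ : φ ∈ IsManifold.maximalAtlas (𝓡 4) ∞ M)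
    (hφ' : φ' ∈ IsManifold.maximalAtlas (𝓡 4) ∞ M) {x : M} (hx : x ∈ φ.source)
    (hx' : x ∈ φ'.source) : SmoothNear (φ' ∘ φ.symm) (φ x) := by
  have hopen : IsOpen (φ.target ∩ φ.symm ⁻¹' φ'.source) :=
    φ.symm.isOpen_inter_preimage φ'.open_source
  have hmem : φ x ∈ φ.target ∩ φ.symm ⁻¹' φ'.source :=
    ⟨φ.map_source hx, by rw [mem_preimage, φ.left_inv hx]; exact hx'⟩
  have h1 : ContMDiffOn (𝓡 4) (𝓡 4) ∞ (φ' ∘ φ.symm) (φ.target ∩ φ.symm ⁻¹' φ'.source) :=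
    (contMDiffOn_of_mem_maximalAtlas hφ').comp
      ((contMDiffOn_symm_of_mem_maximalAtlas hφ).mono inter_subset_left) fun y hy => hy.2
  filter_upwards [hopen.mem_nhds hmem] with y hy
  exact (contMDiffOn_iff_contDiffOn.1 h1).contDiffAt (hopen.mem_nhds hy)

theorem eventually_transition {x : M} (hx : x ∈ φ.source) (hx' : x ∈ φ'.source) :
    ∀ᶠ y in 𝓝 (φ x), y ∈ φ.target ∧ φ.symm y ∈ φ'.source :=
  (φ.symm.isOpen_inter_preimage φ'.open_source).mem_nhds
    ⟨φ.map_source hx, by rw [mem_preimage, φ.left_inv hx]; exact hx'⟩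

theorem surjective_fderiv_transition (hφ : φ ∈ IsManifold.maximalAtlas (𝓡 4) ∞ M)
    (hφ' : φ' ∈ IsManifold.maximalAtlas (𝓡 4) ∞ M) {y : E4} (hy : y ∈ φ.target)
    (hy' : φ.symm y ∈ φ'.source) : Function.Surjective (fderiv ℝ (φ' ∘ φ.symm) y) := by
  intro w
  have h1 := fderiv_transition hφ hφ' (φ.map_target hy) hy'
    (mfderiv (𝓡 4) (𝓡 4) φ'.symm (φ' (φ.symm y)) w)
  rw [φ.right_inv hy] at h1
  refine ⟨_, h1.trans ?_⟩
  obtain ⟨x, hx⟩ : ∃ x, x = φ.symm y := ⟨_, rfl⟩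
  rw [← hx] at hy' ⊢
  have h2 := mfderiv_mfderiv_symm hφ' (φ'.map_source hy') w
  have key : ∀ z, z = x → ∀ w : E4, (mfderiv (𝓡 4) (𝓡 4) φ' z : E4 →L[ℝ] E4) w =
      (mfderiv (𝓡 4) (𝓡 4) φ' x : E4 →L[ℝ] E4) w := by
    rintro y rfl w; rfl
  exact (key _ (φ'.left_inv hy') _).symm.trans h2

theorem hasFDerivAt_frameLift {τ : E4 → E4} {s : FrameCoord} (hτ : SmoothNear τ s.1)
    (v : FrameCoord) : DifferentiableAt ℝ (ChartChange.frameLift τ) s ∧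
      fderiv ℝ (ChartChange.frameLift τ) s v = ChartChange.frameLiftDeriv τ s v := by
  have h1 : HasFDerivAt (fun r : FrameCoord => τ r.1) _ s :=
    hτ.differentiableAt.hasFDerivAt.comp s hasFDerivAt_fst
  have h2 : HasFDerivAt (fun r : FrameCoord => fderiv ℝ τ r.1) _ s :=
    hτ.fderiv.differentiableAt.hasFDerivAt.comp s hasFDerivAt_fst
  have h3 : ∀ i, HasFDerivAt (fun r : FrameCoord => r.2 i)
      ((ContinuousLinearMap.proj (R := ℝ) (φ := fun _ : Fin 4 => E4) i).comp
        (ContinuousLinearMap.snd ℝ E4 (Fin 4 → E4))) s := fun i =>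
    ((ContinuousLinearMap.proj (R := ℝ) (φ := fun _ : Fin 4 => E4) i).comp
        (ContinuousLinearMap.snd ℝ E4 (Fin 4 → E4))).hasFDerivAt
  have h4 : HasFDerivAt (ChartChange.frameLift τ) _ s :=
    h1.prodMk (hasFDerivAt_pi.2 fun i => h2.clm_apply (h3 i))
  refine ⟨h4.differentiableAt, ?_⟩
  rw [h4.fderiv]
  refine Prod.ext (by simp [ChartChange.frameLiftDeriv]) (funext fun i => ?_)
  simp [ChartChange.frameLiftDeriv, add_comm]

theorem sqCoord_transition (X : FinslerSpacetime M) (hφ : φ ∈ IsManifold.maximalAtlas (𝓡 4) ∞ M)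
    (hφ' : φ' ∈ IsManifold.maximalAtlas (𝓡 4) ∞ M) {r : E4 × E4} (hr : r.1 ∈ φ.target)
    (hr' : φ.symm r.1 ∈ φ'.source) :
    X.sqCoord φ r = X.sqCoord φ' (tlift (φ' ∘ φ.symm) r) := by
  have h1 := tlift_transition (v := inducedPoint φ r) hφ hφ' (φ.map_target hr) hr'
  rw [tangentCoord_inducedPoint hφ hr] at h1
  rw [FinslerSpacetime.sqCoord, FinslerSpacetime.sqCoord, h1, inducedPoint_tangentCoord hφ' hr']

end Transition

/-! ### The Cartan connection -/

section CartanForm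

variable {M : Type*} [TopologicalSpace M] [ChartedSpace E4 M] [IsManifold (𝓡 4) ∞ M]
  {φ φ' : OpenPartialHomeomorph M E4} {X : FinslerSpacetime M} {T : TimeOrientation X}
  {o : ManifoldOrientation M} {p : observerFrames T o}

theorem smoothNear_sqCoord_frameCoord (hφ : φ ∈ IsManifold.maximalAtlas (𝓡 4) ∞ M)
    (hp : p.1.proj ∈ φ.source) :
    SmoothNear (X.sqCoord φ) ((frameCoord φ p.1).1, (frameCoord φ p.1).2 0) :=
  X.smoothNear_sqCoord hφ (φ.map_source hp) (X.lCoord_ne_zero_of_abs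
    (isTimelikeCoord_of_mem hφ
      (tangentCoord_mem_observerCoord hφ (v := baseLeg p.1) p.2.1 hp)).1)

theorem orthonormal_frameCoord (hφ : φ ∈ IsManifold.maximalAtlas (𝓡 4) ∞ M)
    (hp : p.1.proj ∈ φ.source) (i j : Fin 4) :
    gForm (X.sqCoord φ) ((frameCoord φ p.1).1, (frameCoord φ p.1).2 0) ((frameCoord φ p.1).2 i)
      ((frameCoord φ p.1).2 j) = -eta i j := by
  have h := framePoint_mem_observerFrames_iff (T := T) (o := o) hφ (s := frameCoord φ p.1)
    (φ.map_source hp)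
  rw [framePoint_frameCoord hφ hp] at h
  exact (h.1 p.2).2.1 i j

theorem det_metricCoef_ne_zero (hφ : φ ∈ IsManifold.maximalAtlas (𝓡 4) ∞ M)
    (hp : p.1.proj ∈ φ.source) :
    (metricCoef (X.sqCoord φ) ((frameCoord φ p.1).1, (frameCoord φ p.1).2 0)).det ≠ 0 :=
  (det_ne_zero_of_orthonormal (smoothNear_sqCoord_frameCoord hφ hp)
    (orthonormal_frameCoord hφ hp)).2

theorem det_frameMatrix_ne_zero (hφ : φ ∈ IsManifold.maximalAtlas (𝓡 4) ∞ M)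
    (hp : p.1.proj ∈ φ.source) : (frameMatrix (frameCoord φ p.1)).det ≠ 0 :=
  (det_ne_zero_of_orthonormal (smoothNear_sqCoord_frameCoord hφ hp)
    (orthonormal_frameCoord hφ hp)).1

variable (T o) in
theorem isOpen_frameDomain (φ : OpenPartialHomeomorph M E4) :
    IsOpen {q : observerFrames T o | q.1.proj ∈ φ.source} :=
  (φ.open_source.preimage (FiberBundle.continuous_proj (E4 →L[ℝ] E4)
      (fun x : M => Bundle.Trivial M E4 x →L[ℝ] TangentSpace (𝓡 4) x))).preimage
    continuous_subtype_val

variable (T o) in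
theorem contMDiffOn_frameCoord_val (hφ : φ ∈ IsManifold.maximalAtlas (𝓡 4) ∞ M) :
    ContMDiffOn (𝓡 10) 𝓘(ℝ, FrameCoord) ∞ (fun q : observerFrames T o => frameCoord φ q.1)
      {q | q.1.proj ∈ φ.source} :=
  (contMDiffOn_frameCoord hφ).comp (isSmoothEmbedding_observerFrames T o).contMDiff.contMDiffOn
    fun _ hq => hq

theorem mdifferentiableAt_frameCoord_val (hφ : φ ∈ IsManifold.maximalAtlas (𝓡 4) ∞ M)
    (hp : p.1.proj ∈ φ.source) : MDifferentiableAt (𝓡 10) 𝓘(ℝ, FrameCoord)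
      (fun q : observerFrames T o => frameCoord φ q.1) p :=
  ((contMDiffOn_frameCoord_val T o hφ).contMDiffAt
    ((isOpen_frameDomain T o φ).mem_nhds hp)).mdifferentiableAt (by simp)

/-- Near `p` the map `framePoint φ` recovers the frame from its coordinates. So the injective
derivative of the inclusion of `P` factors through the velocity in coordinates. -/
theorem frameVelocity_injective (hφ : φ ∈ IsManifold.maximalAtlas (𝓡 4) ∞ M)
    (hp : p.1.proj ∈ φ.source) : Function.Injective (frameVelocity φ p) := by
  have h1 : MDifferentiableAt 𝓘(ℝ, FrameCoord) frameModel (framePoint φ) (frameCoord φ p.1) :=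
    ((contMDiffOn_framePoint hφ).contMDiffAt ((φ.open_target.preimage continuous_fst).mem_nhds
      (φ.map_source hp))).mdifferentiableAt (by simp)
  have h2 := mfderiv_comp p h1 (mdifferentiableAt_frameCoord_val hφ hp)
  have h3 : (framePoint φ ∘ fun q : observerFrames T o => frameCoord φ q.1) =ᶠ[𝓝 p]
      Subtype.val := by
    filter_upwards [(isOpen_frameDomain T o φ).mem_nhds hp] with q hq
    exact framePoint_frameCoord hφ hq
  have h4 := h3.mfderiv_eq (I := 𝓡 10) (I' := frameModel)
  intro v w e
  refine mfderiv_val_injective p ?_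
  have h5 := fun u => DFunLike.congr_fun (h4.symm.trans h2) u
  have e' : mfderiv (𝓡 10) 𝓘(ℝ, FrameCoord) (fun q : observerFrames T o => frameCoord φ q.1) p v =
    mfderiv (𝓡 10) 𝓘(ℝ, FrameCoord) (fun q : observerFrames T o => frameCoord φ q.1) p w := e
  refine (h5 v).trans (Eq.trans ?_ (h5 w).symm)
  exact congrArg (mfderiv 𝓘(ℝ, FrameCoord) frameModel (framePoint φ) (frameCoord φ p.1)) e'

end CartanForm

section CartanForm

variable {M : Type*} [TopologicalSpace M] [ChartedSpace E4 M] [IsManifold (𝓡 4) ∞ M]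
  {φ φ' : OpenPartialHomeomorph M E4} {X : FinslerSpacetime M} {T : TimeOrientation X}
  {o : ManifoldOrientation M} {p : observerFrames T o}

theorem hasFDerivAt_comp_clm_apply {S A Y Z : Type*} [NormedAddCommGroup S] [NormedSpace ℝ S]
    [NormedAddCommGroup A] [NormedSpace ℝ A] [NormedAddCommGroup Y] [NormedSpace ℝ Y]
    [NormedAddCommGroup Z] [NormedSpace ℝ Z] {g : A → Y →L[ℝ] Z} {g' : A →L[ℝ] Y →L[ℝ] Z}
    (a : S →L[ℝ] A) (u : S →L[ℝ] Y) {s : S} (hg : HasFDerivAt g g' (a s)) :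
    HasFDerivAt (fun r => g (a r) (u r))
      ((g (a s)).comp u + (g'.comp a).flip (u s)) s :=
  (hg.comp s a.hasFDerivAt).clm_apply u.hasFDerivAt

theorem fderiv_clm_apply_apply {S A Y : Type*} [NormedAddCommGroup S] [NormedSpace ℝ S]
    [NormedAddCommGroup A] [NormedSpace ℝ A] [NormedAddCommGroup Y] [NormedSpace ℝ Y]
    {g : A → Y →L[ℝ] Y →L[ℝ] ℝ} (a : S →L[ℝ] A) (u w : S →L[ℝ] Y) {s : S}
    (hg : DifferentiableAt ℝ g (a s)) (v : S) :
    DifferentiableAt ℝ (fun r => g (a r) (u r) (w r)) s ∧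
    fderiv ℝ (fun r => g (a r) (u r) (w r)) s v =
      fderiv ℝ (fun r => g r (u s) (w s)) (a s) (a v) + g (a s) (u v) (w s) +
        g (a s) (u s) (w v) := by
  have h2 := (hasFDerivAt_comp_clm_apply a u hg.hasFDerivAt).clm_apply w.hasFDerivAt
  have h3 := (hg.hasFDerivAt.clm_apply (hasFDerivAt_const (u s) _)).clm_apply
    (hasFDerivAt_const (w s) _)
  refine ⟨h2.differentiableAt, ?_⟩
  rw [h2.fderiv, h3.fderiv]
  simp
  ring

theorem fderiv_gForm_legs {Φ : E4 × E4 → ℝ} {s : FrameCoord}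
    (hΦ : SmoothNear Φ (s.1, s.2 0)) (i j : Fin 4) (v : FrameCoord) :
    DifferentiableAt ℝ (fun r : FrameCoord => gForm Φ (r.1, r.2 0) (r.2 i) (r.2 j)) s ∧
    fderiv ℝ (fun r : FrameCoord => gForm Φ (r.1, r.2 0) (r.2 i) (r.2 j)) s v =
      fderiv ℝ (fun r => gForm Φ r (s.2 i) (s.2 j)) (s.1, s.2 0) (v.1, v.2 0) +
      gForm Φ (s.1, s.2 0) (v.2 i) (s.2 j) + gForm Φ (s.1, s.2 0) (s.2 i) (v.2 j) := by
  let pr : Fin 4 → FrameCoord →L[ℝ] E4 := fun i =>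
    (ContinuousLinearMap.proj (R := ℝ) (φ := fun _ : Fin 4 => E4) i).comp
      (ContinuousLinearMap.snd ℝ E4 (Fin 4 → E4))
  exact fderiv_clm_apply_apply ((ContinuousLinearMap.fst ℝ E4 (Fin 4 → E4)).prod (pr 0)) (pr i)
    (pr j) (smoothNear_gForm hΦ).differentiableAt v

/-- Along `P` the functions `g(f_i, f_j)` are constant, so their derivatives on tangent vectors of
`P` vanish. This is the infinitesimal condition required by `connCoord_mem`. -/
theorem connCoord_frameVelocity_mem (hφ : φ ∈ IsManifold.maximalAtlas (𝓡 4) ∞ M)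
    (hp : p.1.proj ∈ φ.source) (v : TangentSpace (𝓡 10) p) :
    (connCoord (X.sqCoord φ) (frameCoord φ p.1) (frameVelocity φ p v))ᵀ * eta +
      eta * connCoord (X.sqCoord φ) (frameCoord φ p.1) (frameVelocity φ p v) = 0 := by
  refine connCoord_mem _ (smoothNear_sqCoord_frameCoord hφ hp) (det_metricCoef_ne_zero hφ hp)
    (det_frameMatrix_ne_zero hφ hp) (orthonormal_frameCoord hφ hp) fun i j => ?_
  obtain ⟨h1, h2⟩ := fderiv_gForm_legs (smoothNear_sqCoord_frameCoord hφ hp) i j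
    (frameVelocity φ p v)
  rw [← h2]
  have h3 := mfderiv_comp p h1.mdifferentiableAt (mdifferentiableAt_frameCoord_val hφ hp)
  have h4 : ((fun r : FrameCoord => gForm (X.sqCoord φ) (r.1, r.2 0) (r.2 i) (r.2 j)) ∘
      fun q : observerFrames T o => frameCoord φ q.1) =ᶠ[𝓝 p] fun _ => -eta i j := by
    filter_upwards [(isOpen_frameDomain T o φ).mem_nhds hp] with q hq
    exact orthonormal_frameCoord hφ hq i j
  have h5 := h4.mfderiv_eq (I := 𝓡 10) (I' := 𝓘(ℝ, ℝ))
  rw [mfderiv_const] at h5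
  have h6 := DFunLike.congr_fun (h5.symm.trans h3) v
  rw [mfderiv_eq_fderiv] at h6
  exact h6.symm

theorem chartChange_transition (hφ : φ ∈ IsManifold.maximalAtlas (𝓡 4) ∞ M)
    (hφ' : φ' ∈ IsManifold.maximalAtlas (𝓡 4) ∞ M) (hp : p.1.proj ∈ φ.source)
    (hp' : p.1.proj ∈ φ'.source) : ChartChange (X.sqCoord φ) (X.sqCoord φ') (φ' ∘ φ.symm)
      ((frameCoord φ p.1).1, (frameCoord φ p.1).2 0) := by
  have hq : tlift (φ' ∘ φ.symm) ((frameCoord φ p.1).1, (frameCoord φ p.1).2 0) =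
      ((frameCoord φ' p.1).1, (frameCoord φ' p.1).2 0) :=
    tlift_transition hφ hφ' (v := baseLeg p.1) hp hp'
  have hev := eventually_transition (φ := φ) (φ' := φ') hp hp'
  refine ⟨smoothNear_transition hφ hφ' hp hp', ?_, ?_, smoothNear_sqCoord_frameCoord hφ hp, ?_,
    det_metricCoef_ne_zero hφ hp, ?_⟩
  · filter_upwards [hev] with y hy using surjective_fderiv_transition hφ hφ' hy.1 hy.2
  · filter_upwards [continuous_fst.continuousAt.eventually hev] with r hr
    exact sqCoord_transition X hφ hφ' hr.1 hr.2
  · rw [hq]; exact smoothNear_sqCoord_frameCoord hφ' hp'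
  · rw [hq]; exact det_metricCoef_ne_zero hφ' hp'

theorem frameVelocity_transition (hφ : φ ∈ IsManifold.maximalAtlas (𝓡 4) ∞ M)
    (hφ' : φ' ∈ IsManifold.maximalAtlas (𝓡 4) ∞ M) (hp : p.1.proj ∈ φ.source)
    (hp' : p.1.proj ∈ φ'.source) (v : TangentSpace (𝓡 10) p) :
    frameVelocity φ' p v = ChartChange.frameLiftDeriv (φ' ∘ φ.symm) (frameCoord φ p.1)
      (frameVelocity φ p v) := by
  obtain ⟨h1, h2⟩ := hasFDerivAt_frameLift (s := frameCoord φ p.1)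
    (smoothNear_transition hφ hφ' hp hp') (frameVelocity φ p v)
  rw [← h2]
  have h3 := mfderiv_comp p h1.mdifferentiableAt (mdifferentiableAt_frameCoord_val hφ hp)
  have h4 : (ChartChange.frameLift (φ' ∘ φ.symm) ∘
      fun q : observerFrames T o => frameCoord φ q.1) =ᶠ[𝓝 p] fun q => frameCoord φ' q.1 := by
    filter_upwards [(isOpen_frameDomain T o φ).mem_nhds hp,
      (isOpen_frameDomain T o φ').mem_nhds hp'] with q hq hq'
    exact frameLift_transition hφ hφ' hq hq'
  have h5 := h4.mfderiv_eq (I := 𝓡 10) (I' := 𝓘(ℝ, FrameCoord))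
  have h6 := DFunLike.congr_fun (h5.symm.trans h3) v
  rw [mfderiv_eq_fderiv] at h6
  exact h6

/-- The form `A = ω + e` on the bundle of observer frames. -/
def cartanForm (T : TimeOrientation X) (o : ManifoldOrientation M) (Λ : ℝ)
    (p : observerFrames T o) : TangentSpace (𝓡 10) p →L[ℝ] ModelMat :=
  (LinearMap.toContinuousLinearMap (cartanLin Λ (X.sqCoord (chartAt E4 p.1.proj))
    (frameCoord (chartAt E4 p.1.proj) p.1))).comp
    (mfderiv (𝓡 10) 𝓘(ℝ, FrameCoord)
      (fun q : observerFrames T o => frameCoord (chartAt E4 p.1.proj) q.1) p)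

/-- The form is defined with the preferred chart at the base point of each frame, which varies with
the frame. The transformation rules allow any chart instead, in particular one fixed chart near a
given point. -/
theorem cartanForm_eq (Λ : ℝ) (hφ : φ ∈ IsManifold.maximalAtlas (𝓡 4) ∞ M)
    (hp : p.1.proj ∈ φ.source) (v : TangentSpace (𝓡 10) p) :
    cartanForm T o Λ p v =
      cartanCoord Λ (X.sqCoord φ) (frameCoord φ p.1) (frameVelocity φ p v) := by
  have hχ := IsManifold.chart_mem_maximalAtlas (I := 𝓡 4) (n := ∞) p.1.proj
  have hpχ := mem_chart_source E4 p.1.proj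
  have h1 := (chartChange_transition hφ hχ hp hpχ).cartanCoord_eq Λ (frameVelocity φ p v)
  rw [frameLift_transition hφ hχ hp hpχ, ← frameVelocity_transition hφ hχ hp hpχ] at h1
  exact h1

theorem cartanForm_mem (Λ : ℝ) (v : TangentSpace (𝓡 10) p) :
    cartanForm T o Λ p v ∈ lieAlgebraOf (modelGroup Λ) := by
  have hχ := IsManifold.chart_mem_maximalAtlas (I := 𝓡 4) (n := ∞) p.1.proj
  have hpχ := mem_chart_source E4 p.1.proj
  rw [cartanForm_eq Λ hχ hpχ]
  exact mem_lieAlgebraOf_modelGroup.2 ⟨_, _, connCoord_frameVelocity_mem hχ hpχ v, rfl⟩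

theorem cartanForm_injective (Λ : ℝ) : Function.Injective (cartanForm T o Λ p) := by
  have hχ := IsManifold.chart_mem_maximalAtlas (I := 𝓡 4) (n := ∞) p.1.proj
  have hpχ := mem_chart_source E4 p.1.proj
  intro v w e
  rw [cartanForm_eq Λ hχ hpχ, cartanForm_eq Λ hχ hpχ] at e
  exact frameVelocity_injective hχ hpχ (cartanCoord_injective Λ X.sqCoord_homogeneous
    (smoothNear_sqCoord_frameCoord hχ hpχ) (det_metricCoef_ne_zero hχ hpχ)
    (det_frameMatrix_ne_zero hχ hpχ) e)

theorem bijOn_cartanForm (Λ : ℝ) (p : observerFrames T o) :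
    BijOn (cartanForm T o Λ p) univ (lieAlgebraOf (modelGroup Λ)) := by
  have : FiniteDimensional ℝ (TangentSpace (𝓡 10) p) :=
    inferInstanceAs (FiniteDimensional ℝ (EuclideanSpace ℝ (Fin 10)))
  have h : Module.finrank ℝ (TangentSpace (𝓡 10) p) = 10 :=
    finrank_euclideanSpace_fin (𝕜 := ℝ) (n := 10)
  exact bijOn_lieAlgebraOf h (cartanForm T o Λ p).toLinearMap (cartanForm_injective Λ)
    (cartanForm_mem Λ)

/-- The fundamental vector fields. -/
theorem exists_cartanForm_eq (Λ : ℝ) (hφ : φ ∈ IsManifold.maximalAtlas (𝓡 4) ∞ M)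
    (hp : p.1.proj ∈ φ.source) {h : Matrix (Fin 4) (Fin 4) ℝ} (z : Fin 4 → ℝ)
    (hh : hᵀ * eta + eta * h = 0) : ∃ v : TangentSpace (𝓡 10) p,
      cartanForm T o Λ p v = algElem Λ h z ∧
      frameVelocity φ p v = fundamentalCoord (X.sqCoord φ) (frameCoord φ p.1) h z := by
  -- The vector is obtained from the bijectivity of `A`. Its coordinates are then identified by the
  -- injectivity of `cartanCoord` on arbitrary velocities, so the tangency of the explicit vector
  -- field to `P` is a consequence.
  obtain ⟨v, -, hv⟩ := (bijOn_cartanForm Λ p).surjOn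
    (mem_lieAlgebraOf_modelGroup.2 ⟨h, z, hh, rfl⟩)
  refine ⟨v, hv, ?_⟩
  rw [cartanForm_eq Λ hφ hp] at hv
  refine cartanCoord_injective Λ X.sqCoord_homogeneous (smoothNear_sqCoord_frameCoord hφ hp)
    (det_metricCoef_ne_zero hφ hp) (det_frameMatrix_ne_zero hφ hp) (hv.trans ?_)
  exact (cartanCoord_fundamentalCoord Λ X.sqCoord_homogeneous
    (smoothNear_sqCoord_frameCoord hφ hp) (det_metricCoef_ne_zero hφ hp)
    (det_frameMatrix_ne_zero hφ hp) h z).symm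

/-- With the chart at the base point of `v₀` kept fixed, the form is a smooth function of the
coordinates of the frame and of its velocity, and these are smooth on the tangent bundle of `P`. -/
theorem contMDiff_cartanForm (Λ : ℝ) (i j : Fin 4 ⊕ Fin 1) :
    ContMDiff (𝓡 10).tangent 𝓘(ℝ, ℝ) ∞
      (fun v : TangentBundle (𝓡 10) (observerFrames T o) => cartanForm T o Λ v.proj v.2 i j) := by
  intro v₀
  have hφ := IsManifold.chart_mem_maximalAtlas (I := 𝓡 4) (n := ∞) v₀.proj.1.proj
  have hp := mem_chart_source E4 v₀.proj.1.proj
  set φ := chartAt E4 v₀.proj.1.proj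
  let U : Set (observerFrames T o) := {q | q.1.proj ∈ φ.source}
  have hU : IsOpen U := isOpen_frameDomain T o φ
  have hc := contMDiffOn_frameCoord_val T o hφ
  have h1 := hc.contMDiffOn_tangentMapWithin (m := ∞) (by simp) hU.uniqueMDiffOn
  have h2 : ContMDiffOn (𝓡 10).tangent 𝓘(ℝ, FrameCoord × FrameCoord) ∞
      (fun v : TangentBundle (𝓡 10) (observerFrames T o) =>
        (frameCoord φ v.proj.1, frameVelocity φ v.proj v.2)) (TotalSpace.proj ⁻¹' U) := by
    have h3 : ContMDiffOn (𝓡 10).tangent 𝓘(ℝ, FrameCoord × FrameCoord) ∞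
        (fun v : TangentBundle (𝓡 10) (observerFrames T o) => (frameCoord φ v.proj.1,
          (tangentMapWithin (𝓡 10) 𝓘(ℝ, FrameCoord)
            (fun q : observerFrames T o => frameCoord φ q.1) U v).2)) (TotalSpace.proj ⁻¹' U) :=
      (hc.comp (contMDiff_proj (TangentSpace (𝓡 10))).contMDiffOn fun v hv => hv).prodMk_space
        (contMDiff_snd_tangentBundle_modelSpace FrameCoord 𝓘(ℝ, FrameCoord)
          |>.comp_contMDiffOn h1)
    refine h3.congr fun v hv => ?_
    simp only [frameVelocity, tangentMapWithin]
    rw [mfderivWithin_of_isOpen hU hv]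
  have hV : TotalSpace.proj ⁻¹' U ∈ 𝓝 v₀ :=
    (hU.preimage (FiberBundle.continuous_proj (EuclideanSpace ℝ (Fin 10))
      (TangentSpace (𝓡 10) : observerFrames T o → Type _))).mem_nhds hp
  have h3 := contDiffAt_cartanCoord Λ (smoothNear_sqCoord_frameCoord hφ hp)
    (det_metricCoef_ne_zero hφ hp) (det_frameMatrix_ne_zero hφ hp)
    (frameVelocity φ v₀.proj v₀.2) i j
  have h4 := h3.contMDiffAt.comp (x := v₀) (h2.contMDiffAt hV)
  refine h4.congr_of_eventuallyEq ?_
  filter_upwards [hV] with v hv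
  rw [cartanForm_eq Λ hφ hv]
  rfl

theorem frameCoord_frameAction (p : observerFrames T o) (k : SO3) :
    frameCoord φ (frameAction T o p k).1 = rotateCoord k (frameCoord φ p.1) :=
  Prod.ext rfl (funext fun i => (frameCoord_rotateFrame p.1 k i).trans
    (rotateCoord_snd k _ i).symm)

/-- In coordinates the right translation is the linear map `rotateCoord k`. It therefore acts on
velocities by the same formula, and the coordinate identity `cartanCoord_rotateCoord` applies. -/
theorem cartanForm_equivariant (Λ : ℝ) (k : SO3) (p : observerFrames T o)
    (v : TangentSpace (𝓡 10) p) :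
    cartanForm T o Λ (frameAction T o p k)
        (mfderiv (𝓡 10) (𝓡 10) (fun q => frameAction T o q k) p v) =
      inclK k⁻¹ * cartanForm T o Λ p v * inclK k := by
  have hφ := IsManifold.chart_mem_maximalAtlas (I := 𝓡 4) (n := ∞) p.1.proj
  have hp := mem_chart_source E4 p.1.proj
  set φ := chartAt E4 p.1.proj
  have hp' : (frameAction T o p k).1.proj ∈ φ.source := hp
  have h1 : MDifferentiableAt (𝓡 10) (𝓡 10) (fun q => frameAction T o q k) p :=
    (contMDiff_frameAction.comp (contMDiff_id.prodMk contMDiff_const)).mdifferentiableAt (by simp)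
  have h2 : frameVelocity φ (frameAction T o p k)
      (mfderiv (𝓡 10) (𝓡 10) (fun q => frameAction T o q k) p v) =
      rotateCoord k (frameVelocity φ p v) := by
    have h3 := mfderiv_comp p (mdifferentiableAt_frameCoord_val hφ hp') h1
    have h4 := mfderiv_comp p (rotateCoord k).differentiableAt.mdifferentiableAt
      (mdifferentiableAt_frameCoord_val hφ hp)
    have h5 : ((fun q : observerFrames T o => frameCoord φ q.1) ∘ fun q => frameAction T o q k) =
        rotateCoord k ∘ fun q : observerFrames T o => frameCoord φ q.1 :=
      funext fun q => frameCoord_frameAction q k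
    rw [h5] at h3
    have h6 := DFunLike.congr_fun (h3.symm.trans h4) v
    rw [mfderiv_eq_fderiv, ContinuousLinearMap.fderiv] at h6
    exact h6
  rw [cartanForm_eq Λ hφ hp', cartanForm_eq Λ hφ hp, h2, frameCoord_frameAction,
    cartanCoord_rotateCoord]

theorem cartanForm_vertical (Λ : ℝ) (p : observerFrames T o) (Y : TangentSpace (𝓡 3) (1 : SO3))
    (i j : Fin 4 ⊕ Fin 1) :
    cartanForm T o Λ (frameAction T o p 1) (mfderiv (𝓡 3) (𝓡 10) (frameAction T o p) 1 Y) i j =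
      mfderiv (𝓡 3) 𝓘(ℝ, ℝ) (fun k => inclK k i j) 1 Y := by
  have hφ := IsManifold.chart_mem_maximalAtlas (I := 𝓡 4) (n := ∞) p.1.proj
  have hp := mem_chart_source E4 p.1.proj
  set φ := chartAt E4 p.1.proj
  have hp' : (frameAction T o p 1).1.proj ∈ φ.source := hp
  have h1 : MDifferentiableAt (𝓡 3) (𝓡 10) (frameAction T o p) 1 :=
    (contMDiff_frameAction.comp (contMDiff_const.prodMk contMDiff_id)).mdifferentiableAt (by simp)
  let κ : Matrix (Fin 4) (Fin 4) ℝ := Matrix.of fun a i =>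
    mfderiv (𝓡 3) 𝓘(ℝ, ℝ) (fun k : SO3 => spatial k.1 a i) 1 Y
  set s := frameCoord φ p.1 with hs
  have h2 : frameVelocity φ (frameAction T o p 1)
      (mfderiv (𝓡 3) (𝓡 10) (frameAction T o p) 1 Y) = (0, fun i => ∑ a, κ a i • s.2 a) := by
    have h3 := mfderiv_comp (1 : SO3) (mdifferentiableAt_frameCoord_val hφ hp') h1
    -- The coordinates of `p · k` depend affinely on the entries of `spatial k`, with linear part
    -- `L`. The velocity of the orbit is therefore `L` applied to the derivative `κ` of these
    -- entries.
    let L : (Fin 4 → Fin 4 → ℝ) →L[ℝ] FrameCoord := LinearMap.toContinuousLinearMap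
      { toFun := fun m => (0, fun i => ∑ a, m a i • s.2 a)
        map_add' := fun m m' => Prod.ext (by simp) (funext fun i => by
          simp [add_smul, Finset.sum_add_distrib])
        map_smul' := fun c m => Prod.ext (by simp) (funext fun i => by
          simp [Finset.smul_sum, smul_smul]) }
    let σ : SO3 → Fin 4 → Fin 4 → ℝ := fun k a i => spatial k.1 a i
    have hσ : MDifferentiableAt (𝓡 3) 𝓘(ℝ, Fin 4 → Fin 4 → ℝ) σ 1 :=
      (contMDiff_pi_space.2 fun a => contMDiff_pi_space.2 fun i =>
        contMDiff_spatial_entry a i).mdifferentiableAt (by simp)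
    have hL : HasFDerivAt (fun m => (s.1, 0) + L m) L (σ 1) := L.hasFDerivAt.const_add _
    have h4 := mfderiv_comp (1 : SO3) hL.differentiableAt.mdifferentiableAt hσ
    have h5 : ((fun q : observerFrames T o => frameCoord φ q.1) ∘ frameAction T o p) =
        (fun m => (s.1, 0) + L m) ∘ σ := by
      funext k
      refine (frameCoord_frameAction p k).trans (Prod.ext ?_ (funext fun i => ?_))
      · exact (add_zero _).symm
      · exact (rotateCoord_snd k _ i).trans (zero_add _).symm
    rw [h5] at h3
    have h6 := DFunLike.congr_fun (h3.symm.trans h4) Y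
    rw [mfderiv_eq_fderiv, hL.fderiv] at h6
    refine h6.trans (Prod.ext rfl (funext fun i => ?_))
    change ∑ a, (mfderiv (𝓡 3) 𝓘(ℝ, Fin 4 → Fin 4 → ℝ) σ 1 Y : Fin 4 → Fin 4 → ℝ) a i • s.2 a =
      ∑ a, κ a i • s.2 a
    refine Finset.sum_congr rfl fun a _ => congrArg (· • s.2 a) ?_
    let e : (Fin 4 → Fin 4 → ℝ) →L[ℝ] ℝ :=
      (ContinuousLinearMap.proj (R := ℝ) (φ := fun _ : Fin 4 => ℝ) i).comp
        (ContinuousLinearMap.proj (R := ℝ) (φ := fun _ : Fin 4 => Fin 4 → ℝ) a)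
    have h7 := DFunLike.congr_fun
      (mfderiv_comp (1 : SO3) e.differentiableAt.mdifferentiableAt hσ) Y
    rw [mfderiv_eq_fderiv, e.fderiv] at h7
    exact h7.symm
  have h3 : ∀ a, κ a 0 = 0 := by
    intro a
    have : (fun k : SO3 => spatial k.1 a 0) = fun _ => (1 : Matrix (Fin 4) (Fin 4) ℝ) a 0 := by
      funext k
      refine Fin.cases rfl (fun α => ?_) a
      rw [spatial_succ_zero]; simp
    change mfderiv (𝓡 3) 𝓘(ℝ, ℝ) (fun k : SO3 => spatial k.1 a 0) 1 Y = 0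
    rw [this, mfderiv_const]; rfl
  have h4 : frameCoord φ (frameAction T o p 1).1 = s := by
    rw [hs]; exact congrArg (frameCoord φ) (rotateFrame_one p.1)
  rw [cartanForm_eq Λ hφ hp', h2, h4, cartanCoord_vertical Λ (det_frameMatrix_ne_zero hφ hp) h3]
  rcases i with i | i <;> rcases j with j | j
  · rfl
  · have : (fun k : SO3 => inclK k (Sum.inl i) (Sum.inr j)) = fun _ => 0 := rfl
    rw [this, mfderiv_const]; rfl
  · have : (fun k : SO3 => inclK k (Sum.inr i) (Sum.inl j)) = fun _ => 0 := rfl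
    rw [this, mfderiv_const]
    change algElem Λ κ 0 (Sum.inr i) (Sum.inl j) = 0
    simp [algElem]
  · have : (fun k : SO3 => inclK k (Sum.inr i) (Sum.inr j)) =
      fun _ => (1 : Matrix (Fin 1) (Fin 1) ℝ) i j := rfl
    rw [this, mfderiv_const]; rfl

theorem isCartanConnection_cartanForm (T : TimeOrientation X) (o : ManifoldOrientation M) (Λ : ℝ) :
    IsCartanConnection (𝓡 3) (𝓡 10) (modelGroup Λ) inclK (frameAction T o)
      (cartanForm T o Λ) where
  map_mem := inclK_mem_modelGroup Λ
  isClosedEmbedding := isClosedEmbedding_inclK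
  contMDiff := contMDiff_cartanForm Λ
  bijOn := bijOn_cartanForm Λ
  equivariant := cartanForm_equivariant Λ
  maurerCartan := cartanForm_vertical Λ

end CartanForm

end FinslerCartan

end

theorem mainTheorem1 {M : Type*} [TopologicalSpace M] [T2Space M] [ParacompactSpace M]
    [ConnectedSpace M] [ChartedSpace FinslerCartan.E4 M] [IsManifold (𝓡 4) ∞ M]
    (X : FinslerCartan.FinslerSpacetime M) (T : FinslerCartan.TimeOrientation X)
    (o : FinslerCartan.ManifoldOrientation M) (Λ : ℝ) :
    -- smooth structures on `O`, `P` and `K`, of dimensions 7, 10 and 3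
    ∃ (_ : ChartedSpace (EuclideanSpace ℝ (Fin 7)) (FinslerCartan.observerSpace T))
      (_ : IsManifold (𝓡 7) ∞ (FinslerCartan.observerSpace T))
      (_ : ChartedSpace (EuclideanSpace ℝ (Fin 10)) (FinslerCartan.observerFrames T o))
      (_ : IsManifold (𝓡 10) ∞ (FinslerCartan.observerFrames T o))
      (_ : ChartedSpace (EuclideanSpace ℝ (Fin 3)) FinslerCartan.SO3)
      (_ : LieGroup (𝓡 3) ∞ FinslerCartan.SO3)
      -- the right action of `K` on `P` and the form `A`
      (act : FinslerCartan.observerFrames T o → FinslerCartan.SO3 →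
        FinslerCartan.observerFrames T o)
      (A : ∀ p : FinslerCartan.observerFrames T o,
        TangentSpace (𝓡 10) p →L[ℝ] FinslerCartan.ModelMat),
      -- `O`, `P` and `K` are embedded submanifolds
      IsSmoothEmbedding (𝓡 7) (𝓡 4).tangent ∞
        (Subtype.val : FinslerCartan.observerSpace T → TangentBundle (𝓡 4) M) ∧
      IsSmoothEmbedding (𝓡 10) FinslerCartan.frameModel ∞
        (Subtype.val : FinslerCartan.observerFrames T o → FinslerCartan.FrameSpace M) ∧
      IsSmoothEmbedding (𝓡 3) 𝓘(ℝ, Fin 3 → Fin 3 → ℝ) ∞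
        (fun (k : FinslerCartan.SO3) (i j : Fin 3) => k.1 i j) ∧
      -- `K` acts by spatial rotations of the frames, and `P` is a principal bundle over `O`
      (∀ p k, (act p k : FinslerCartan.FrameSpace M) = FinslerCartan.rotateFrame p.1 k) ∧
      FinslerCartan.IsPrincipalBundle (𝓡 3) (𝓡 10) (𝓡 7) (FinslerCartan.toObserver T o) act ∧
      -- `A = ω + e` in all induced coordinates
      (∀ φ ∈ IsManifold.maximalAtlas (𝓡 4) ∞ M, ∀ p : FinslerCartan.observerFrames T o,
        p.1.proj ∈ φ.source → ∀ v : TangentSpace (𝓡 10) p,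
        A p v = FinslerCartan.cartanCoord Λ (X.sqCoord φ) (FinslerCartan.frameCoord φ p.1)
          (FinslerCartan.frameVelocity φ p v)) ∧
      -- `A` is a Cartan connection modeled on `G/K`
      FinslerCartan.IsCartanConnection (𝓡 3) (𝓡 10) (FinslerCartan.modelGroup Λ)
        FinslerCartan.inclK act A ∧
      -- the fundamental vector fields
      (∀ φ ∈ IsManifold.maximalAtlas (𝓡 4) ∞ M, ∀ p : FinslerCartan.observerFrames T o,
        p.1.proj ∈ φ.source → ∀ (h : Matrix (Fin 4) (Fin 4) ℝ) (z : Fin 4 → ℝ),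
        hᵀ * FinslerCartan.eta + FinslerCartan.eta * h = 0 →
        ∃ v : TangentSpace (𝓡 10) p, A p v = FinslerCartan.algElem Λ h z ∧
          FinslerCartan.frameVelocity φ p v = FinslerCartan.fundamentalCoord (X.sqCoord φ)
            (FinslerCartan.frameCoord φ p.1) h z) := by
  exact ⟨FinslerCartan.observerChartedSpace T, FinslerCartan.observerIsManifold T,
    FinslerCartan.framesChartedSpace T o, FinslerCartan.framesIsManifold T o,
    FinslerCartan.SO3.chartedSpace, FinslerCartan.SO3.lieGroup,
    FinslerCartan.frameAction T o, FinslerCartan.cartanForm T o Λ,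
    FinslerCartan.isSmoothEmbedding_observerSpace T,
    FinslerCartan.isSmoothEmbedding_observerFrames T o,
    FinslerCartan.SO3.isSmoothEmbedding_entries, fun _ _ => rfl,
    FinslerCartan.isPrincipalBundle_frames T o,
    fun _ hφ _ hp v => FinslerCartan.cartanForm_eq Λ hφ hp v,
    FinslerCartan.isCartanConnection_cartanForm T o Λ,
    fun _ hφ _ hp _ z hh => FinslerCartan.exists_cartanForm_eq Λ hφ hp z hh⟩
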